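/- **Setting.** Consider three systems: continuous Hahn (cH), Wilson (W) and Askey–Wilson (AW, with $0<q<1$). Put $\gamma=1$ (cH, W), $\gamma=\log q$ (AW); $\eta(x)=x,\ x^2,\ \cos x$ respectively. The parameters are $\lambda=(\lambda_1,\dots,\lambda_4)\in\mathbb C^4$, with $a_k=\lambda_k$ (cH, W) or $a_k=q^{\lambda_k}$ (AW). Let $P_n(\eta(x);\lambda)$ be the continuous Hahn polynomial $p_n(x;a_1,a_2,a_3,a_4)$, the Wilson polynomial $W_n(x^2;a_1,a_2,a_3,a_4)$, or the Askey–Wilson polynomial $p_n(\cos x;a_1,a_2,a_3,a_4|q)$, in the usual normalization (polynomial in the parameters, up to powers of $a_1$). Let $$V(x;\lambda)=(a_1+ix)(a_2+ix),\quad \frac{\prod_{k=1}^4(a_k+ix)}{2ix(2ix+1)},\quad \frac{\prod_{k=1}^4(1-a_ke^{ix})}{(1-e^{2ix})(1-qe^{2ix})}$$ and $V^*(x;\lambda)=(a_3-ix)(a_4-ix)$ (cH), $V^*(x;\lambda)=V(-x;\lambda)$ (W, AW). (When $\lambda_3=\overline{\lambda_1},\lambda_4=\overline{\lambda_2}$ for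 cH, or $\{\lambda_k\}$ is closed under conjugation for W, AW, $V^*$ is $V$ with conjugated coefficients; this is not needed.) The twists are $\mathfrak t^{\mathrm I}(\lambda)=(1-\lambda_3,\lambda_2,1-\lambda_1,\lambda_4)$, $\mathfrak t^{\mathrm{II}}(\lambda)=(\lambda_1,1-\lambda_4,\lambda_3,1-\lambda_2)$ for cH and $\mathfrak t^{\mathrm I}(\lambda)=(1-\lambda_1,1-\lambda_2,\lambda_3,\lambda_4)$, $\mathfrak t^{\mathrm{II}}(\lambda)=(\lambda_1,\lambda_2,1-\lambda_3,1-\lambda_4)$ for W, AW. Let $\tilde\delta^{\mathrm I}=(-\frac12,\frac12,-\frac12,\frac12)$ (cH), $(-\frac12,-\frac12,\frac12,\frac12)$ (W, AW), and $\tilde\delta^{\mathrm{II}}=-\tilde\delta^{\mathrm I}$. The type $T$ seed function of degree $v$ is $\xi^T_v(x)/\nu^T(x)$ with $\xi^T_v(x)=P_v(\eta(x);\mathfrak t^T(\lambda))$. Here $\nu^T$ is the ratio $\phi_0(x;\lambda)/\phi_0(x;\mathfrak t^T(\lambda))$ of ground state wavefunctions; only its values at shifted points, up to a common factor, matter. They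 are given, on nodes $x_j=x+i(\frac{L+1}2-j)\gamma$ ($1\le j\le L$), by $$\nu^T_j(x)=f_j\prod_{k\in T_+}\bigl(a_k-\tfrac{L-1}2+ix\bigr)_{j-1}\prod_{k\in T_-}\bigl(a_k-\tfrac{L-1}2-ix\bigr)_{L-j},$$ where $f_j=(-1)^{j-1}$ (cH), $1$ (W), $e^{ix(L+1-2j)}q^{(j-1)(L-j)}$ (AW), $(\mathrm I_+,\mathrm I_-,\mathrm{II}_+,\mathrm{II}_-)=(\{1\},\{3\},\{2\},\{4\})$ for cH and $(\{1,2\},\{1,2\},\{3,4\},\{3,4\})$ for W, AW; for AW the factors $(a_k-c\pm ix)_m$ here and below are replaced by $(a_kq^{-c}e^{\pm ix};q)_m$. Let $\mathcal D=\mathcal D^{\mathrm I}\cup\mathcal D^{\mathrm{II}}$ be an index set: finite sets of degrees of type I and type II, $M_{\mathrm I}=|\mathcal D^{\mathrm I}|$, $M_{\mathrm{II}}=|\mathcal D^{\mathrm{II}}|$, $M=M_{\mathrm I}+M_{\mathrm{II}}$, and $$\ell_{\mathcal D}=\sum_{d\in\mathcal D}d-\tfrac12M(M-1)+2M_{\mathrm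 I}M_{\mathrm{II}},\qquad \lambda_{\mathcal D}=\lambda+M_{\mathrm I}\tilde\delta^{\mathrm I}+M_{\mathrm{II}}\tilde\delta^{\mathrm{II}} .$$ The denominator polynomial $\Xi_{\mathcal D}(\eta)$ and the case-(1) multi-indexed polynomials $P_{\mathcal D,n}(\eta)$ are the polynomial parts of the Casoratians of the seed functions, resp. of the seed functions and $P_n$. After multiplying row $j$ by $\nu^{\mathrm I}_j\nu^{\mathrm{II}}_j$, this means: with columns $\nu^{\mathrm{II}}_j\xi^{\mathrm I}_d(x_j)$ ($d\in\mathcal D^{\mathrm I}$), then $\nu^{\mathrm I}_j\xi^{\mathrm{II}}_d(x_j)$ ($d\in\mathcal D^{\mathrm{II}}$), in increasing order of $d$, and for $P_{\mathcal D,n}$ a last column $\nu^{\mathrm I}_j\nu^{\mathrm{II}}_jP_n(\eta(x_j))$, $$i^{M(M-1)/2}\det{}_{L=M}=\Phi_{M,M_{\mathrm I},M_{\mathrm{II}}}(x)\,\Xi_{\mathcal D}(\eta(x)),\qquad i^{M(M+1)/2}\det{}_{L=M+1}=\Phi_{M+1,M_{\mathrm I}+1,M_{\mathrm{II}}+1}(x)\,P_{\mathcal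 D,n}(\eta(x))$$ for all $x\in\mathbb C$, where $$\Phi_{L,m,m'}(x)=\prod_{1\le j<k\le L}(\eta(x_j)-\eta(x_k))\ \prod_{j=0}^{m-1}\ \prod_{k\in\mathrm{II}_+}(a_k-\tfrac{L-1}2+ix)_j\prod_{k\in\mathrm{II}_-}(a_k-\tfrac{L-1}2-ix)_j\ \prod_{j=0}^{m'-1}\ \prod_{k\in\mathrm{I}_+}(a_k-\tfrac{L-1}2+ix)_j\prod_{k\in\mathrm{I}_-}(a_k-\tfrac{L-1}2-ix)_j .$$ (These conditions determine $\Xi_{\mathcal D}$ and $P_{\mathcal D,n}$ uniquely.) Write $\check\Xi_{\mathcal D}(x)=\Xi_{\mathcal D}(\eta(x))$, $\check P_{\mathcal D,n}(x)=P_{\mathcal D,n}(\eta(x))$. Fix an integer $\mathcal N\ge0$, put $\widetilde{\mathcal N}=\ell_{\mathcal D}+\mathcal N$, and let the polynomials $\mathcal P_a$ be the following: (0) $P_{\mathcal D,n}$ for $0\le n<\mathcal N$; (1) $P_{\mathcal D',\mathcal N}$ with $\mathcal D'=(\mathcal D^{\mathrm I}\setminus\{d\})\cup\{\epsilon\}\cup\mathcal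 D^{\mathrm{II}}$ for $d\in\mathcal D^{\mathrm I}$, $0\le\epsilon<d$, $\epsilon\notin\mathcal D^{\mathrm I}$; (2) the same with the roles of the types exchanged; (3) $P_{\mathcal D',\mathcal N}$ with $\mathcal D'=(\mathcal D^{\mathrm I}\setminus\{d\})\cup(\mathcal D^{\mathrm{II}}\setminus\{d'\})$ for $d\in\mathcal D^{\mathrm I}$, $d'\in\mathcal D^{\mathrm{II}}$. Let $$\check F(x)=\frac{-1}{P'_{\mathcal D,\mathcal N}(\eta(x))}\Bigl(\eta(x-i\gamma)V(x;\lambda_{\mathcal D})\frac{\check\Xi_{\mathcal D}(x+i\frac\gamma2)}{\check\Xi_{\mathcal D}(x-i\frac\gamma2)}\check P_{\mathcal D,\mathcal N}(x-i\gamma)+\eta(x+i\gamma)V^*(x;\lambda_{\mathcal D})\frac{\check\Xi_{\mathcal D}(x-i\frac\gamma2)}{\check\Xi_{\mathcal D}(x+i\frac\gamma2)}\check P_{\mathcal D,\mathcal N}(x+i\gamma)\Bigr),$$ and call $x$ regular if $P'_{\mathcal D,\mathcal N}(\eta(x))$, $\check\Xi_{\mathcal D}(x\pm i\frac\gamma2)$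 and the denominators of $V(x;\cdot)$ and $V(-x;\cdot)$ displayed above (for cH there are none) are all nonzero. **Theorem.** The polynomials $\Xi_{\mathcal D}$ and $P_{\mathcal E,n}$ exist for all index sets $\mathcal E$ and all $n\ge0$, $\deg P_{\mathcal E,n}\le\ell_{\mathcal E}+n$, and the number of labels $a$ is $\widetilde{\mathcal N}$. Assume that the parameters are generic in the following sense: $\deg P_{\mathcal D,\mathcal N}=\widetilde{\mathcal N}$; the zeros $\eta_1,\dots,\eta_{\widetilde{\mathcal N}}\in\mathbb C$ of $P_{\mathcal D,\mathcal N}$ are simple; and every $x\in\mathbb C$ with $\check P_{\mathcal D,\mathcal N}(x)=0$ is regular and satisfies $\check F(x)\ne0$. Then there is a rational function $F(\eta)$, without poles at $\eta(x)$ for regular $x$, such that $F(\eta(x))=\check F(x)$ for all regular $x$, and there are constants $k_a\in\mathbb C$ with $$\sum_{j=1}^{\widetilde{\mathcal N}}\frac1{F(\eta_j)}\,\frac{\mathcal P_a(\eta_j)}{P'_{\mathcal D,\mathcal N}(\eta_j)}\,\frac{\mathcal P_b(\eta_j)}{P'_{\mathcal D,\mathcal N}(\eta_j)}=k_a\,\delta_{ab}\qquad\text{for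 all labels }a,b .$$ -/

import Mathlib

namespace MultiIndexed

noncomputable section

/-- The three systems: continuous Hahn, Wilson, and Askey-Wilson with base `0 < q < 1`. -/
inductive System : Type
  | cH : System
  | W : System
  | AW (q : ℝ) (hq0 : 0 < q) (hq1 : q < 1) : System

/-- The two types of virtual states (seed solutions). -/
inductive VType : Type
  | I : VType
  | II : VType

/-- The shift parameter `γ`: `1` (cH, W) or `log q` (AW). -/
def gam : System → ℂ
  | .cH => 1
  | .W => 1
  | .AW q _ _ => ((Real.log q : ℝ) : ℂ)

/-- The sinusoidal coordinate `η(x)`: `x` (cH), `x ^ 2` (W), `cos x` (AW). -/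
def eta : System → ℂ → ℂ
  | .cH, x => x
  | .W, x => x ^ 2
  | .AW _ _ _, x => Complex.cos x

/-- The linear factor `s + i x` (cH, W) or `1 - q ^ s * exp (i x)` (AW). -/
def lin : System → ℂ → ℂ → ℂ
  | .cH, s, x => s + Complex.I * x
  | .W, s, x => s + Complex.I * x
  | .AW q _ _, s, x => 1 - (q : ℂ) ^ s * Complex.exp (Complex.I * x)

/-- The shifted factorial `(s + i x)_n` (cH, W) or `(q ^ s * exp (i x); q)_n` (AW). -/
def poch (S : System) (s x : ℂ) (n : ℕ) : ℂ :=
  ∏ i ∈ Finset.range n, lin S (s + i) x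

/-- The shifted factorial `(s)_n` (cH, W) or `(q ^ s; q)_n` (AW). -/
def poch0 (S : System) (s : ℂ) (n : ℕ) : ℂ := poch S s 0 n

/-- The polynomials `P_n(η(x); λ)`: continuous Hahn `p_n(x; a₁, a₂, a₃, a₄)`, Wilson
`W_n(x ^ 2; a₁, a₂, a₃, a₄)`, Askey-Wilson `p_n(cos x; a₁, a₂, a₃, a₄ | q)`, where `a_k = λ_k`
(cH, W) or `a_k = q ^ λ_k` (AW). These are the terminating `₃F₂`, `₄F₃`, `₄φ₃` in their usual
normalization, e.g. `(a₁ + a₂)_n / (a₁ + a₂)_k` is written `(a₁ + a₂ + k)_(n - k)`. -/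
def basePoly : System → (Fin 4 → ℂ) → ℕ → ℂ → ℂ
  | .cH, l, n, x =>
      Complex.I ^ n / (n.factorial : ℂ) *
        ∑ k ∈ Finset.range (n + 1),
          poch0 .cH (-n) k * poch0 .cH (n + (l 0 + l 1 + l 2 + l 3) - 1) k * poch .cH (l 0) x k *
            poch0 .cH (l 0 + l 2 + k) (n - k) * poch0 .cH (l 0 + l 3 + k) (n - k) /
            (k.factorial : ℂ)
  | .W, l, n, x =>
      ∑ k ∈ Finset.range (n + 1),
        poch0 .W (-n) k * poch0 .W (n + (l 0 + l 1 + l 2 + l 3) - 1) k *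
          poch .W (l 0) x k * poch .W (l 0) (-x) k *
          poch0 .W (l 0 + l 1 + k) (n - k) * poch0 .W (l 0 + l 2 + k) (n - k) *
          poch0 .W (l 0 + l 3 + k) (n - k) / (k.factorial : ℂ)
  | .AW q h0 h1, l, n, x =>
      (q : ℂ) ^ (-(n * l 0)) *
        ∑ k ∈ Finset.range (n + 1),
          poch0 (.AW q h0 h1) (-n) k *
            poch0 (.AW q h0 h1) (n + (l 0 + l 1 + l 2 + l 3) - 1) k *
            poch (.AW q h0 h1) (l 0) x k * poch (.AW q h0 h1) (l 0) (-x) k *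
            poch0 (.AW q h0 h1) (l 0 + l 1 + k) (n - k) *
            poch0 (.AW q h0 h1) (l 0 + l 2 + k) (n - k) *
            poch0 (.AW q h0 h1) (l 0 + l 3 + k) (n - k) * (q : ℂ) ^ k /
            poch0 (.AW q h0 h1) 1 k

/-- The denominator of the potential `V(x)`. -/
def potDen : System → ℂ → ℂ
  | .cH, _ => 1
  | .W, x => 2 * Complex.I * x * (2 * Complex.I * x + 1)
  | .AW q _ _, x =>
      (1 - Complex.exp (2 * Complex.I * x)) * (1 - (q : ℂ) * Complex.exp (2 * Complex.I * x))

/-- The potential function `V(x; λ)`. -/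
def pot : System → (Fin 4 → ℂ) → ℂ → ℂ
  | .cH, l, x => lin .cH (l 0) x * lin .cH (l 1) x
  | S, l, x => (∏ k, lin S (l k) x) / potDen S x

/-- The function `V^*(x; λ)`: `(a₃ - i x)(a₄ - i x)` (cH) or `V(-x; λ)` (W, AW). Under the reality
conditions `λ₃ = conj λ₁`, `λ₄ = conj λ₂` (cH), resp. invariance of the parameter (multi)set under
conjugation (W, AW), this is `V` with complex conjugated coefficients. -/
def potStar : System → (Fin 4 → ℂ) → ℂ → ℂ
  | .cH, l, x => lin .cH (l 2) (-x) * lin .cH (l 3) (-x)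
  | S, l, x => pot S l (-x)

/-- The twist `𝔱` of the parameters which produces the virtual states of either type. -/
def twist : System → VType → (Fin 4 → ℂ) → (Fin 4 → ℂ)
  | .cH, .I, l => ![1 - l 2, l 1, 1 - l 0, l 3]
  | .cH, .II, l => ![l 0, 1 - l 3, l 2, 1 - l 1]
  | _, .I, l => ![1 - l 0, 1 - l 1, l 2, l 3]
  | _, .II, l => ![l 0, l 1, 1 - l 2, 1 - l 3]

/-- Polynomial part `ξ_v(η(x); λ) = P_v(η(x); 𝔱(λ))` of the degree `v` virtual state wavefunction
`φ₀(x; 𝔱(λ)) P_v(η(x); 𝔱(λ))`. -/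
def seedPoly (S : System) (l : Fin 4 → ℂ) (T : VType) (v : ℕ) (x : ℂ) : ℂ :=
  basePoly S (twist S T l) v x

/-- The shift `δ̃` of the parameters caused by one Darboux transformation of either type. -/
def tdelta : System → VType → (Fin 4 → ℂ)
  | .cH, .I => ![-1 / 2, 1 / 2, -1 / 2, 1 / 2]
  | .cH, .II => ![1 / 2, -1 / 2, 1 / 2, -1 / 2]
  | _, .I => ![-1 / 2, -1 / 2, 1 / 2, 1 / 2]
  | _, .II => ![1 / 2, 1 / 2, -1 / 2, -1 / 2]

/-- The shifted parameters `λ_𝒟 = λ + M_I δ̃^I + M_II δ̃^II`. -/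
def lamD (S : System) (l : Fin 4 → ℂ) (DI DII : Finset ℕ) : Fin 4 → ℂ :=
  fun k => l k + (DI.card : ℂ) * tdelta S .I k + (DII.card : ℂ) * tdelta S .II k

/-- The nodes `x_j^{(L)} = x + i ((L + 1) / 2 - j) γ` of an `L`-function Casoratian, with the index
`j` shifted so that it starts at `0`. -/
def node (S : System) (L : ℕ) (x : ℂ) (j : ℕ) : ℂ :=
  x + Complex.I * (((L : ℂ) - 1) / 2 - j) * gam S

/-- Parameters entering a type `T` twist through `+ i x`. -/
def plusPar : System → VType → Finset (Fin 4)
  | .cH, .I => {0}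
  | .cH, .II => {1}
  | _, .I => {0, 1}
  | _, .II => {2, 3}

/-- Parameters entering a type `T` twist through `- i x`. -/
def minusPar : System → VType → Finset (Fin 4)
  | .cH, .I => {2}
  | .cH, .II => {3}
  | _, .I => {0, 1}
  | _, .II => {2, 3}

/-- `∏ (a_k - c + i x)_m * ∏ (a_k - c - i x)_n` (and its `q`-analogue) over the parameters that a
type `T` twist changes. -/
def twistPoch (S : System) (l : Fin 4 → ℂ) (T : VType) (c x : ℂ) (m n : ℕ) : ℂ :=
  (∏ k ∈ plusPar S T, poch S (l k - c) x m) * ∏ k ∈ minusPar S T, poch S (l k - c) (-x) n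

/-- Elementary factor in `nuRow`. -/
def phase : System → ℕ → ℂ → ℕ → ℂ
  | .cH, _, _, j => (-1) ^ j
  | .W, _, _, _ => 1
  | .AW q _ _, L, x, j =>
      Complex.exp (Complex.I * x * ((L : ℂ) - 1 - 2 * j)) * (q : ℂ) ^ (j * (L - 1 - j))

/-- The values at the nodes of `ν(x) = φ₀(x; λ) / φ₀(x; 𝔱(λ))`, with a common factor that does not
depend on the row `j` removed; the ratio of consecutive rows is
`ν(x - i γ) / ν(x) = V(x; λ) / (α V(x; 𝔱(λ)))` at `x = x_j`, where `α = 1` (cH, W) and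
`α = a_k a_m / q` for the two parameters `a_k, a_m` changed by the twist (AW). -/
def nuRow (S : System) (l : Fin 4 → ℂ) (T : VType) (L : ℕ) (x : ℂ) (j : ℕ) : ℂ :=
  phase S L x j * twistPoch S l T (((L : ℂ) - 1) / 2) x j (L - 1 - j)

/-- Column entry, in row `j` of an `L × L` Casoratian whose rows have been multiplied by
`ν^I ν^II`, of the seed function of type `T` and degree `v`, i.e. of `ξ_v / ν^T`. -/
def seedEntry (S : System) (l : Fin 4 → ℂ) (L : ℕ) (x : ℂ) (j : ℕ) : VType → ℕ → ℂ
  | .I, v => nuRow S l .II L x j * seedPoly S l .I v (node S L x j)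
  | .II, v => nuRow S l .I L x j * seedPoly S l .II v (node S L x j)

/-- Column entry, in the same normalization, of the eigenpolynomial `P_n`. -/
def eigenEntry (S : System) (l : Fin 4 → ℂ) (L : ℕ) (x : ℂ) (j n : ℕ) : ℂ :=
  nuRow S l .I L x j * nuRow S l .II L x j * basePoly S l n (node S L x j)

/-- The index set `𝒟` in the standard order: type I degrees increasing, then type II degrees. -/
def seeds (DI DII : Finset ℕ) : List (VType × ℕ) :=
  (DI.sort (· ≤ ·)).map (fun d => (VType.I, d)) ++ (DII.sort (· ≤ ·)).map (fun d => (VType.II, d))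

/-- The Casoratian of the seed functions, up to a common factor of each row. -/
def detXi (S : System) (l : Fin 4 → ℂ) (DI DII : Finset ℕ) (x : ℂ) : ℂ :=
  Complex.I ^ ((seeds DI DII).length * ((seeds DI DII).length - 1) / 2) *
    Matrix.det (Matrix.of fun j k : Fin (seeds DI DII).length =>
      seedEntry S l (seeds DI DII).length x j ((seeds DI DII).get k).1 ((seeds DI DII).get k).2)

/-- The Casoratian of the seed functions followed by `P_n`, up to a common factor of each row. -/
def detP (S : System) (l : Fin 4 → ℂ) (DI DII : Finset ℕ) (n : ℕ) (x : ℂ) : ℂ :=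
  Complex.I ^ (((seeds DI DII).length + 1) * (seeds DI DII).length / 2) *
    Matrix.det (Matrix.of fun j k : Fin ((seeds DI DII).length + 1) =>
      Fin.lastCases (motive := fun _ => ℂ)
        (eigenEntry S l ((seeds DI DII).length + 1) x j n)
        (fun k' : Fin (seeds DI DII).length =>
          seedEntry S l ((seeds DI DII).length + 1) x j
            ((seeds DI DII).get k').1 ((seeds DI DII).get k').2) k)

/-- The non-polynomial prefactor of an `L × L` determinant as above in which `mI` columns carry
`ν^II` and `mII` columns carry `ν^I`: the Vandermonde product of the `η(x_j)` and the factors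
common to the columns. -/
def prefactor (S : System) (l : Fin 4 → ℂ) (L mI mII : ℕ) (x : ℂ) : ℂ :=
  (∏ k ∈ Finset.range L, ∏ j ∈ Finset.range k, (eta S (node S L x j) - eta S (node S L x k))) *
    (∏ j ∈ Finset.range mI, twistPoch S l .II (((L : ℂ) - 1) / 2) x j j) *
    ∏ j ∈ Finset.range mII, twistPoch S l .I (((L : ℂ) - 1) / 2) x j j

/-- `Q` is the polynomial part of the Casoratian of the seed functions. As `η` is onto `ℂ` and the
prefactor does not vanish identically, there is at most one such `Q`. -/
def IsDenominatorPoly (S : System) (l : Fin 4 → ℂ) (DI DII : Finset ℕ) (Q : Polynomial ℂ) :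
    Prop :=
  ∀ x : ℂ, detXi S l DI DII x =
    prefactor S l (DI.card + DII.card) DI.card DII.card x * Q.eval (eta S x)

/-- `Q` is the polynomial part of the Casoratian of the seed functions followed by `P_n`. -/
def IsMultiIndexedPoly (S : System) (l : Fin 4 → ℂ) (DI DII : Finset ℕ) (n : ℕ)
    (Q : Polynomial ℂ) : Prop :=
  ∀ x : ℂ, detP S l DI DII n x =
    prefactor S l (DI.card + DII.card + 1) (DI.card + 1) (DII.card + 1) x * Q.eval (eta S x)

open Classical in
/-- The denominator polynomial `Ξ_𝒟(η; λ)`. -/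
def Xi (S : System) (l : Fin 4 → ℂ) (DI DII : Finset ℕ) : Polynomial ℂ :=
  if h : ∃ Q, IsDenominatorPoly S l DI DII Q then h.choose else 0

open Classical in
/-- The multi-indexed polynomial `P_{𝒟,n}(η; λ)`. -/
def multiP (S : System) (l : Fin 4 → ℂ) (DI DII : Finset ℕ) (n : ℕ) : Polynomial ℂ :=
  if h : ∃ Q, IsMultiIndexedPoly S l DI DII n Q then h.choose else 0

/-- `ℓ_𝒟 = ∑ d_j - M (M - 1) / 2 + 2 M_I M_II` with `M = M_I + M_II` (a natural number). -/
def ell (DI DII : Finset ℕ) : ℤ :=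
  (∑ d ∈ DI, (d : ℤ)) + (∑ d ∈ DII, (d : ℤ)) -
    ((DI.card : ℤ) + DII.card) * ((DI.card : ℤ) + DII.card - 1) / 2 + 2 * DI.card * DII.card

/-- Labels `a` of the polynomials `𝒫_a`: `n < N`; pairs `(d, ε)` with `d ∈ 𝒟^I`,
`ε ∉ 𝒟^I`, `ε < d`; the same for `𝒟^II`; pairs in `𝒟^I × 𝒟^II`. -/
abbrev Label (DI DII : Finset ℕ) (N : ℕ) : Type :=
  Fin N ⊕ {p : ℕ × ℕ // p.1 ∈ DI ∧ p.2 ∉ DI ∧ p.2 < p.1} ⊕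
    {p : ℕ × ℕ // p.1 ∈ DII ∧ p.2 ∉ DII ∧ p.2 < p.1} ⊕ ({d // d ∈ DI} × {d // d ∈ DII})

/-- The polynomials `𝒫_a`: `P_{𝒟,n}` for `n < N`, and `P_{𝒟',N}` for the modified index sets. -/
def calP (S : System) (l : Fin 4 → ℂ) (DI DII : Finset ℕ) (N : ℕ) :
    Label DI DII N → Polynomial ℂ
  | .inl n => multiP S l DI DII n
  | .inr (.inl p) => multiP S l (insert p.1.2 (DI.erase p.1.1)) DII N
  | .inr (.inr (.inl p)) => multiP S l DI (insert p.1.2 (DII.erase p.1.1)) N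
  | .inr (.inr (.inr p)) => multiP S l (DI.erase p.1.1) (DII.erase p.2.1) N

/-- `Ξ̌_𝒟(x) = Ξ_𝒟(η(x))`. -/
def XiC (S : System) (l : Fin 4 → ℂ) (DI DII : Finset ℕ) (x : ℂ) : ℂ :=
  (Xi S l DI DII).eval (eta S x)

/-- `P̌_{𝒟,N}(x) = P_{𝒟,N}(η(x))`. -/
def multiPC (S : System) (l : Fin 4 → ℂ) (DI DII : Finset ℕ) (N : ℕ) (x : ℂ) : ℂ :=
  (multiP S l DI DII N).eval (eta S x)

/-- The function `F̌(x)`. -/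
def FC (S : System) (l : Fin 4 → ℂ) (DI DII : Finset ℕ) (N : ℕ) (x : ℂ) : ℂ :=
  -1 / (multiP S l DI DII N).derivative.eval (eta S x) *
    (eta S (x - Complex.I * gam S) * pot S (lamD S l DI DII) x *
        (XiC S l DI DII (x + Complex.I * gam S / 2) / XiC S l DI DII (x - Complex.I * gam S / 2)) *
        multiPC S l DI DII N (x - Complex.I * gam S) +
      eta S (x + Complex.I * gam S) * potStar S (lamD S l DI DII) x *
        (XiC S l DI DII (x - Complex.I * gam S / 2) / XiC S l DI DII (x + Complex.I * gam S / 2)) *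
        multiPC S l DI DII N (x + Complex.I * gam S))

/-- No denominator in the formula for `F̌(x)` vanishes. -/
def IsRegular (S : System) (l : Fin 4 → ℂ) (DI DII : Finset ℕ) (N : ℕ) (x : ℂ) : Prop :=
  potDen S x ≠ 0 ∧ potDen S (-x) ≠ 0 ∧
    XiC S l DI DII (x + Complex.I * gam S / 2) ≠ 0 ∧
    XiC S l DI DII (x - Complex.I * gam S / 2) ≠ 0 ∧
    (multiP S l DI DII N).derivative.eval (eta S x) ≠ 0

end

end MultiIndexed

namespace MultiIndexed

open Matrix

/-! ### Casoratians and their bilinear identities -/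

/-! Write P for P_{𝒟,𝒩}, and let x_j lie over its zero η_j. After multiplication by suitable gauge
factors, all seed functions and all eigenpolynomials become solutions of one and the same three-term
recurrence along x, x - iγ, x - 2iγ, …, differing only in the energy (`dressed_isSol`).
Determinantal identities for Casoratians of such solutions then give difference equations V
Ξ(x+iγ/2)² Q(x-iγ) + V* Ξ(x-iγ/2)² Q(x+iγ) = (e Ξ(x+iγ/2) Ξ(x-iγ/2) - Δ(x)) Q(x) + R(x), in which Δ
does not depend on Q. For Q = P_{𝒟,n} one has e = E_n and R = 0 (`cas_schrodinger`). If one seed d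
is exchanged for ε, then e = E_ε + E_d - E_𝒩 and R is a multiple of P(x) (`cas_exchange`). If two
seeds d, d' are removed, then e = E_d + E_{d'} - E_𝒩 and again R is a multiple of P(x)
(`cas_remove`). Removal is a disguised exchange: when one seed is replaced by a second solution with
the energy of another seed h, that solution and h drop out of the Casoratian together, because the
recurrence at their common energy annihilates both columns.

At x_j the term R vanishes. Every 𝒫_a has smaller degree than P, so partial fractions express
𝒫_a(η(x_j ∓ iγ)) through y_m = 𝒫_a(η_m)/P'(η_m). The equation of P itself at x_j merges the two
expansions into Σ_m K_jm y_m = (e_a + w_j) y_j / F(η_j) with w_j independent of a, where K_jm is the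
inverse of (η(x_j-iγ) - η_m)(η(x_j+iγ) - η_m) (`kernel_eq`). This kernel is symmetric
(`eta_shift_symm`), so vectors with different e_a are orthogonal for the weight 1/F
(`sum_eq_zero_of_symm`).

The difference equations are derived at points where no factor vanishes and carried to x_j by
density. That Δ has a finite limit there requires some P_{𝒟,n} not to vanish at x_j
(`Generic.exists_multiPC_ne_zero`). This, the distinctness of the e_a and the coprimality used for
the polynomial parts hold for a dense set of parameters. For other parameters the relations follow
by continuity, since the coefficients of the polynomial parts, the simple zeros, and F at them
depend continuously on λ (`exists_limit_polynomial`, `sum_eq_zero`).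

The polynomial parts exist because, in the variable x or exp(ix), the determinant is divisible by
the Vandermonde factor (two rows agree where their values of η agree) and by the common shifted
factorials. Finite differences of the rows bound the degree, and reflection symmetry turns the
quotient into a polynomial in η (`GenericPar.exists_polynomial`). For W and AW, F̌ is likewise
invariant under x ↦ -x, hence a rational function of η; for cH this is immediate since η(x) = x
(`exists_ratFunc`). -/

/-- Append a last element to a finite family. -/
def snoc {α : Type*} {n : ℕ} (f : Fin n → α) (a : α) : Fin (n + 1) → α :=
  fun k => Fin.lastCases (motive := fun _ => α) a f k

@[simp] lemma snoc_castSucc {α : Type*} {n : ℕ} (f : Fin n → α) (a : α) (k : Fin n) :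
    snoc f a k.castSucc = f k := by simp [snoc]

@[simp] lemma snoc_last {α : Type*} {n : ℕ} (f : Fin n → α) (a : α) :
    snoc f a (Fin.last n) = a := by simp [snoc]

/-- The determinant with prescribed columns. -/
noncomputable def colDet {n : ℕ} (v : Fin n → Fin n → ℂ) : ℂ :=
  Matrix.det (Matrix.of fun i k : Fin n => v k i)

lemma colDet_eq {n : ℕ} (v : Fin n → Fin n → ℂ) :
    colDet v = Matrix.detRowAlternating v := by
  rw [colDet, ← Matrix.det_transpose]; rfl

/-- The three-term Plücker relation. -/
lemma plucker {m : ℕ} (B : Fin m → Fin (m + 2) → ℂ) (u v w z : Fin (m + 2) → ℂ) :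
    colDet (snoc (snoc B u) v) * colDet (snoc (snoc B w) z) =
      colDet (snoc (snoc B u) w) * colDet (snoc (snoc B v) z) -
        colDet (snoc (snoc B u) z) * colDet (snoc (snoc B v) w) := by
  have upd1 : ∀ a b c : Fin (m + 2) → ℂ,
      Function.update (snoc (snoc B a) b) (Fin.last _) c = snoc (snoc B a) c := by
    intro a b c; funext k
    induction k using Fin.lastCases with
    | last => simp
    | cast k => simp [Function.update, Fin.ext_iff, k.2.ne]
  have upd2 : ∀ a b c : Fin (m + 2) → ℂ,
      Function.update (snoc (snoc B a) b) (Fin.last m).castSucc c = snoc (snoc B c) b := by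
    intro a b c; funext k
    induction k using Fin.lastCases with
    | last => simp [Function.update, Fin.ext_iff]
    | cast k =>
      induction k using Fin.lastCases with
      | last => simp
      | cast k => simp [Function.update, Fin.ext_iff, k.2.ne]
  -- the linear functional `x ↦ [B, x, z]`
  let φ : (Fin (m + 2) → ℂ) →ₗ[ℂ] ℂ :=
    (Matrix.detRowAlternating (R := ℂ) (n := Fin (m + 2))).toMultilinearMap.toLinearMap
      (snoc (snoc B 0) z) (Fin.last m).castSucc
  have hφ : ∀ x, φ x = colDet (snoc (snoc B x) z) := by
    intro x
    rw [colDet_eq, ← upd2 0 z x]; rfl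
  have hφB : ∀ i, φ (B i) = 0 := by
    intro i
    rw [hφ, colDet_eq]
    refine AlternatingMap.map_eq_zero_of_eq _ _ (i := i.castSucc.castSucc)
      (j := (Fin.last m).castSucc) (by simp) (by simp [Fin.ext_iff, i.2.ne])
  have swap : ∀ a b, colDet (snoc (snoc B a) b) = - colDet (snoc (snoc B b) a) := by
    intro a b
    rw [colDet_eq, colDet_eq]
    have := AlternatingMap.map_swap (Matrix.detRowAlternating (R := ℂ) (n := Fin (m + 2)))
      (snoc (snoc B b) a) (i := (Fin.last m).castSucc) (j := Fin.last _) (by simp [Fin.ext_iff])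
    rw [← this]
    congr 1
    funext k
    induction k using Fin.lastCases with
    | last => simp
    | cast k =>
      induction k using Fin.lastCases with
      | last => simp
      | cast k =>
        simp only [Function.comp]
        rw [Equiv.swap_apply_of_ne_of_ne]
        · simp
        · simp [Fin.ext_iff, k.2.ne]
        · simp only [ne_eq, Fin.ext_iff, Fin.val_castSucc, Fin.val_last]; have := k.2; omega
  set A : Matrix (Fin (m + 2)) (Fin (m + 2)) ℂ :=
    Matrix.of fun i k : Fin (m + 2) => snoc (snoc B u) v k i with hA
  -- Cramer's rule writes `det A • w` as a combination of the columns of B, u and v. The functional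
  -- `φ` kills those of B, and the three surviving terms are the products in the relation.
  have hc := Matrix.mulVec_cramer A w
  have hsum : A *ᵥ A.cramer w = ∑ k, A.cramer w k • (snoc (snoc B u) v k) := by
    funext i
    simp [Matrix.mulVec, dotProduct, hA, mul_comm]
  have hcr : ∀ k, A.cramer w k = colDet (Function.update (snoc (snoc B u) v) k w) := by
    intro k
    rw [Matrix.cramer_apply, colDet]
    congr 1
    ext i j
    by_cases h : j = k
    · subst h; simp
    · simp [h, hA]
  rw [hsum] at hc
  have h2 := congrArg φ hc
  rw [map_sum, Fin.sum_univ_castSucc, Fin.sum_univ_castSucc] at h2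
  simp only [map_smul, snoc_castSucc, snoc_last, hφB, smul_eq_mul, mul_zero,
    Finset.sum_const_zero, zero_add] at h2
  simp only [hcr, upd1, upd2, hφ] at h2
  have h3 : A.det = colDet (snoc (snoc B u) v) := rfl
  rw [h3] at h2
  rw [← h2, swap w v]; ring

/-- The Casoratian of the sequences `u` on the sites `p, p + 1, …`. -/
noncomputable def cas {n : ℕ} (p : ℕ) (u : Fin n → ℕ → ℂ) : ℂ :=
  Matrix.det (Matrix.of fun i k : Fin n => u k (p + i))

/-- The Casoratian with its last row moved to the next site. -/
noncomputable def casR {n : ℕ} (p : ℕ) (u : Fin (n + 1) → ℕ → ℂ) : ℂ :=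
  Matrix.det ((Matrix.of fun i k : Fin (n + 1) => u k (p + i)).updateRow (Fin.last n)
    fun k => u k (p + n + 1))

/-- The Casoratian on the sites `p + 1, p + 2, …` with its first row moved to the site `p`. -/
noncomputable def casL {n : ℕ} (p : ℕ) (u : Fin (n + 1) → ℕ → ℂ) : ℂ :=
  Matrix.det ((Matrix.of fun i k : Fin (n + 1) => u k (p + 1 + i)).updateRow 0
    fun k => u k p)

/-- The trace identity for solutions of a three-term recurrence. -/
lemma casR_casL {n : ℕ} (p : ℕ) (a b c : ℕ → ℂ) (u : Fin (n + 1) → ℕ → ℂ)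
    (E : Fin (n + 1) → ℂ)
    (h : ∀ k, ∀ j ≤ n, a (p + 1 + j) * u k (p + 1 + j + 1) + b (p + 1 + j) * u k (p + j) =
      (c (p + 1 + j) + E k) * u k (p + 1 + j)) :
    a (p + 1 + n) * casR (p + 1) u + b (p + 1) * casL p u =
      (∑ k, E k + ∑ i : Fin (n + 1), c (p + 1 + i)) * cas (p + 1) u := by
  set A : Matrix (Fin (n + 1)) (Fin (n + 1)) ℂ := Matrix.of fun i k => u k (p + 1 + i) with hA
  have hdet : cas (p + 1) u = A.det := rfl
  -- Each determinant is expanded along its modified row. Summing over rows first, `adjugate A * A =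
  -- det A • 1` leaves `det A` for every column, so only the sum of the energies remains.
  have h1 : ∑ i, (A.updateRow i fun k => E k * A i k).det = (∑ k, E k) * A.det := by
    have : ∀ i, (A.updateRow i fun k => E k * A i k).det =
        ∑ k, E k * (A i k * A.adjugate k i) := by
      intro i
      have h2 := Matrix.cramer_transpose_apply A (fun k => E k * A i k) i
      rw [← h2, Matrix.cramer_eq_adjugate_mulVec, ← Matrix.adjugate_transpose]
      simp only [Matrix.mulVec, dotProduct, Matrix.transpose_apply]
      exact Finset.sum_congr rfl fun k _ => by ring
    simp_rw [this]
    rw [Finset.sum_comm, Finset.sum_mul]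
    refine Finset.sum_congr rfl fun k _ => ?_
    rw [← Finset.mul_sum]
    congr 1
    have h3 := congrFun (congrFun (Matrix.adjugate_mul A) k) k
    simp only [Matrix.mul_apply, Matrix.smul_apply, Matrix.one_apply_eq, smul_eq_mul,
      mul_one] at h3
    rw [← h3]
    exact Finset.sum_congr rfl fun _ _ => by ring
  have h2 : ∀ i : Fin (n + 1), (A.updateRow i fun k => E k * A i k).det =
      a (p + 1 + i) * (A.updateRow i fun k => u k (p + 1 + i + 1)).det +
      b (p + 1 + i) * (A.updateRow i fun k => u k (p + i)).det - c (p + 1 + i) * A.det := by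
    intro i
    have e : (fun k => E k * A i k) = a (p + 1 + i) • (fun k => u k (p + 1 + i + 1)) +
        (b (p + 1 + i) • (fun k => u k (p + i)) + (-c (p + 1 + i)) • A i) := by
      funext k
      have := h k i (by omega)
      simp only [hA, Matrix.of_apply, Pi.add_apply, Pi.smul_apply, smul_eq_mul]
      linear_combination -this
    rw [e, Matrix.det_updateRow_add, Matrix.det_updateRow_add, Matrix.det_updateRow_smul,
      Matrix.det_updateRow_smul, Matrix.det_updateRow_smul, Matrix.updateRow_eq_self]
    ring
  simp_rw [h2] at h1
  rw [Finset.sum_sub_distrib, Finset.sum_add_distrib] at h1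
  -- Row i advanced by one site coincides with row i + 1, so only the last row contributes. In the
  -- same way only the first row survives when rows move back.
  have h3 : ∑ i : Fin (n + 1), a (p + 1 + i) *
      (A.updateRow i fun k => u k (p + 1 + i + 1)).det = a (p + 1 + n) * casR (p + 1) u := by
    rw [Fin.sum_univ_castSucc, Finset.sum_eq_zero, zero_add]
    · simp [casR, hA]
    · intro i _
      have : (fun k => u k (p + 1 + (i.castSucc : ℕ) + 1)) = A i.succ := by
        funext k; simp [hA, add_assoc]
      rw [this, Matrix.det_updateRow_eq_zero, mul_zero]
      exact (Fin.castSucc_lt_succ (i := i)).ne'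
  have h4 : ∑ i : Fin (n + 1), b (p + 1 + i) *
      (A.updateRow i fun k => u k (p + i)).det = b (p + 1) * casL p u := by
    rw [Fin.sum_univ_succ, Finset.sum_eq_zero, add_zero]
    · simp [casL, hA]
    · intro i _
      have : (fun k => u k (p + (i.succ : ℕ))) = A i.castSucc := by
        funext k; simp only [hA, Fin.val_succ, Matrix.of_apply, Fin.val_castSucc]; congr 1; ring
      rw [this, Matrix.det_updateRow_eq_zero, mul_zero]
      exact (Fin.castSucc_lt_succ (i := i)).ne
  rw [h3, h4, ← Finset.sum_mul] at h1
  rw [hdet]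
  linear_combination h1

/-- A unit vector in the last column deletes one row. Choosing which site to delete makes
Casoratians on shorter windows, and also `casR` and `casL`, special values of (m + 2)-dimensional
determinants, so that all bilinear identities below become instances of `plucker`. -/
lemma colDet_snoc_single {n : ℕ} (c : Fin n → Fin (n + 1) → ℂ) (i : Fin (n + 1)) :
    colDet (snoc c (Pi.single i 1)) =
      (-1) ^ ((i : ℕ) + n) * colDet fun k r => c k (i.succAbove r) := by
  rw [colDet, Matrix.det_succ_column _ (Fin.last n), Finset.sum_eq_single i]
  · simp only [Matrix.of_apply, snoc_last, Pi.single_eq_same, mul_one, Fin.val_last, colDet]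
    congr 2
    ext a b
    simp
  · intro j _ hj
    simp [hj]
  · simp

lemma single_succAbove {n : ℕ} (i i' : Fin (n + 1)) (r' : Fin n) (h : i.succAbove r' = i') :
    (fun r => (Pi.single i' 1 : Fin (n + 1) → ℂ) (i.succAbove r)) = Pi.single r' 1 := by
  subst h
  funext r
  simp [Pi.single_apply]

/-- The restriction of sequences to `n` consecutive sites. -/
def res {m : ℕ} (n p : ℕ) (B : Fin m → ℕ → ℂ) : Fin m → Fin n → ℂ := fun k i => B k (p + i)

lemma res_snoc {m : ℕ} (n p : ℕ) (B : Fin m → ℕ → ℂ) (u : ℕ → ℂ) :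
    snoc (res n p B) (fun i => u (p + i)) = res n p (snoc B u) := by
  funext k
  induction k using Fin.lastCases <;> (funext i; simp [res])

lemma cas_eq {n : ℕ} (p : ℕ) (u : Fin n → ℕ → ℂ) : cas p u = colDet (res n p u) := rfl

/-! ### Casoratians as determinants on m + 2 sites with unit-vector columns -/

section values

variable {m : ℕ} (p : ℕ) (B : Fin m → ℕ → ℂ) (u : ℕ → ℂ) (x : Fin (m + 2) → ℂ)

lemma minor_snoc (c : Fin m → Fin (m + 2) → ℂ) (i : Fin (m + 2)) :
    (fun k r => snoc c x k (i.succAbove r)) =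
      snoc (fun k r => c k (i.succAbove r)) (fun r => x (i.succAbove r)) := by
  funext k
  induction k using Fin.lastCases <;> simp

lemma res_last : (fun (k : Fin m) (r : Fin (m + 1)) =>
    res (m + 2) p B k ((Fin.last (m + 1)).succAbove r)) = res (m + 1) p B := by
  funext k r; simp [res]

lemma res_zero : (fun (k : Fin m) (r : Fin (m + 1)) =>
    res (m + 2) p B k ((0 : Fin (m + 2)).succAbove r)) = res (m + 1) (p + 1) B := by
  funext k r; simp only [res, Fin.zero_succAbove, Fin.val_succ]; congr 1; ring

lemma val_last : colDet (snoc (snoc (res (m + 2) p B) fun i => u (p + i))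
    (Pi.single (Fin.last (m + 1)) 1)) = cas p (snoc B u) := by
  rw [colDet_snoc_single, res_snoc, Fin.val_last, Even.neg_one_pow ⟨m + 1, rfl⟩, one_mul, cas_eq]
  congr 1; funext k r; simp [res]

lemma val_zero : colDet (snoc (snoc (res (m + 2) p B) fun i => u (p + i))
    (Pi.single 0 1)) = (-1) ^ (m + 1) * cas (p + 1) (snoc B u) := by
  rw [colDet_snoc_single, res_snoc, cas_eq, Fin.val_zero, zero_add]
  congr 2; funext k r; simp only [res, Fin.zero_succAbove, Fin.val_succ]; ring_nf

/-- Without the penultimate of the m + 2 sites, the last row sits one site further than in a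
contiguous window, which is the situation of `casR`. -/
lemma val_pen : colDet (snoc (snoc (res (m + 2) p B) fun i => u (p + i))
    (Pi.single (Fin.last m).castSucc 1)) = - casR p (snoc B u) := by
  have h : (-1 : ℂ) ^ (m + (m + 1)) = -1 := Odd.neg_one_pow ⟨m, by ring⟩
  rw [colDet_snoc_single, res_snoc, Fin.val_castSucc, Fin.val_last, h, neg_one_mul, casR, colDet]
  congr 2
  ext r k
  induction r using Fin.lastCases with
  | last =>
    simp only [res, Matrix.of_apply, Matrix.updateRow_self, Fin.succAbove_castSucc_self,
      Fin.val_succ, Fin.val_last]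
    congr 1
  | cast r =>
    rw [Matrix.updateRow_ne (by simp [Fin.ext_iff, r.2.ne])]
    simp only [res, Matrix.of_apply, Fin.val_castSucc]
    rw [Fin.succAbove_of_castSucc_lt _ _ (by simp [Fin.lt_def])]
    simp

lemma val_one : colDet (snoc (snoc (res (m + 2) p B) fun i => u (p + i))
    (Pi.single 1 1)) = (-1) ^ m * casL p (snoc B u) := by
  rw [colDet_snoc_single, res_snoc, Fin.val_one, casL, colDet]
  congr 1
  · rw [show 1 + (m + 1) = m + 2 by ring, pow_add]; norm_num
  congr 1
  ext r k
  induction r using Fin.cases with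
  | zero => simp [res]
  | succ r =>
    rw [Matrix.updateRow_ne (by simp)]
    simp only [res, Matrix.of_apply, Fin.val_succ]
    rw [Fin.succAbove_of_le_castSucc _ _ (by simp [Fin.le_def])]
    simp only [Fin.val_succ]
    ring_nf

lemma val_pen_last : colDet (snoc (snoc (res (m + 2) p B) (Pi.single (Fin.last m).castSucc 1))
    (Pi.single (Fin.last (m + 1)) 1)) = cas p B := by
  rw [colDet_snoc_single, minor_snoc, res_last, Fin.val_last, Even.neg_one_pow ⟨m + 1, rfl⟩,
    one_mul, single_succAbove _ _ (Fin.last m) (by simp), colDet_snoc_single, Fin.val_last,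
    Even.neg_one_pow ⟨m, rfl⟩, one_mul, cas_eq]
  congr 1; funext k r; simp [res]

lemma val_last_pen : colDet (snoc (snoc (res (m + 2) p B) (Pi.single (Fin.last (m + 1)) 1))
    (Pi.single (Fin.last m).castSucc 1)) = - cas p B := by
  have h : (-1 : ℂ) ^ (m + (m + 1)) = -1 := Odd.neg_one_pow ⟨m, by ring⟩
  rw [colDet_snoc_single, minor_snoc, Fin.val_castSucc, Fin.val_last, h, neg_one_mul,
    single_succAbove _ _ (Fin.last m) (by simp), colDet_snoc_single, Fin.val_last,
    Even.neg_one_pow ⟨m, rfl⟩, one_mul, cas_eq]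
  congr 2; funext k r
  simp only [res, Fin.succAbove_last]
  rw [Fin.succAbove_of_castSucc_lt _ _ (by simp [Fin.lt_def])]
  simp

lemma val_zero_last : colDet (snoc (snoc (res (m + 2) p B) (Pi.single 0 1))
    (Pi.single (Fin.last (m + 1)) 1)) = (-1) ^ m * cas (p + 1) B := by
  rw [colDet_snoc_single, minor_snoc, res_last, Fin.val_last, Even.neg_one_pow ⟨m + 1, rfl⟩,
    one_mul, single_succAbove _ _ 0 (by simp), colDet_snoc_single, Fin.val_zero, zero_add, cas_eq]
  congr 2; funext k r; simp only [res, Fin.zero_succAbove, Fin.val_succ]; congr 1; ring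

lemma val_last_zero : colDet (snoc (snoc (res (m + 2) p B) (Pi.single (Fin.last (m + 1)) 1))
    (Pi.single 0 1)) = (-1) ^ (m + 1) * cas (p + 1) B := by
  rw [colDet_snoc_single, minor_snoc, res_zero, Fin.val_zero, zero_add,
    single_succAbove _ _ (Fin.last m) (by simp), colDet_snoc_single, Fin.val_last,
    Even.neg_one_pow ⟨m, rfl⟩, one_mul, cas_eq]
  congr 2; funext k r; simp [res]

lemma val_zero_one : colDet (snoc (snoc (res (m + 2) p B) (Pi.single 0 1))
    (Pi.single 1 1)) = cas (p + 2) B := by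
  rw [colDet_snoc_single, minor_snoc, Fin.val_one, single_succAbove _ _ 0 (by simp),
    colDet_snoc_single, Fin.val_zero, zero_add, cas_eq, ← mul_assoc, ← pow_add,
    Even.neg_one_pow ⟨m + 1, by ring⟩, one_mul]
  congr 1; funext k r
  simp only [res, Fin.zero_succAbove]
  rw [Fin.succAbove_of_le_castSucc _ _ (by simp [Fin.le_def])]
  simp only [Fin.val_succ]
  congr 1; ring

end values

section bilinear

variable {m : ℕ} (p : ℕ) (B : Fin m → ℕ → ℂ)

/-- The Jacobi identity for Casoratians. -/
lemma cas_jacobi (u v : ℕ → ℂ) : cas p (snoc (snoc B u) v) * cas (p + 1) B =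
    cas p (snoc B u) * cas (p + 1) (snoc B v) - cas (p + 1) (snoc B u) * cas p (snoc B v) := by
  have h := plucker (res (m + 2) p B) (fun i => u (p + i)) (fun i => v (p + i))
    (Pi.single 0 1) (Pi.single (Fin.last (m + 1)) 1)
  rw [val_zero_last, val_zero, val_zero, val_last, val_last, res_snoc, res_snoc, ← cas_eq] at h
  have h2 : ((-1 : ℂ) ^ m) * (-1) ^ m = 1 := by rw [← pow_add]; exact Even.neg_one_pow ⟨m, rfl⟩
  rw [pow_succ] at h
  linear_combination (-1) ^ m * h + (-cas p (snoc (snoc B u) v) * cas (p + 1) B +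
    cas p (snoc B u) * cas (p + 1) (snoc B v) - cas (p + 1) (snoc B u) * cas p (snoc B v)) * h2

/-- The Plücker relation in which the fourth vector is the unit vector at the last site; deleting
that site leaves windows that start at p. The companion `cas_three_right` deletes the first site
instead. -/
lemma cas_three_left (f g e : ℕ → ℂ) :
    cas p (snoc B f) * cas p (snoc (snoc B e) g) =
      cas p (snoc B e) * cas p (snoc (snoc B f) g) -
        cas p (snoc B g) * cas p (snoc (snoc B f) e) := by
  have h := plucker (res (m + 2) p B) (fun i => f (p + i)) (fun i => e (p + i))
    (fun i => g (p + i)) (Pi.single (Fin.last (m + 1)) 1)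
  rw [val_last, val_last, val_last] at h
  simp only [res_snoc, ← cas_eq] at h
  linear_combination h

lemma cas_three_right (f g e : ℕ → ℂ) :
    cas (p + 1) (snoc B f) * cas p (snoc (snoc B e) g) =
      cas (p + 1) (snoc B e) * cas p (snoc (snoc B f) g) -
        cas (p + 1) (snoc B g) * cas p (snoc (snoc B f) e) := by
  have h := plucker (res (m + 2) p B) (fun i => f (p + i)) (fun i => e (p + i))
    (fun i => g (p + i)) (Pi.single 0 1)
  rw [val_zero, val_zero, val_zero] at h
  simp only [res_snoc, ← cas_eq] at h
  have h2 : ((-1 : ℂ) ^ (m + 1)) ≠ 0 := by simp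
  refine mul_left_cancel₀ h2 ?_
  linear_combination h

/-- As functionals of the last column t, the Casoratian with a displaced row and the two contiguous
ones are linearly dependent. The point is that θ is a minor of B alone: this makes the potential
term of the deformed equation independent of the solution it is applied to. -/
lemma casR_mul : ∃ θ : ℂ, ∀ t : ℕ → ℂ, casR p (snoc B t) * cas (p + 1) B =
    cas p B * cas (p + 1) (snoc B t) + θ * cas p (snoc B t) := by
  have h2 : ((-1 : ℂ) ^ m) * (-1) ^ m = 1 := by rw [← pow_add]; exact Even.neg_one_pow ⟨m, rfl⟩
  refine ⟨-(-1) ^ m * colDet (snoc (snoc (res (m + 2) p B) (Pi.single 0 1))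
    (Pi.single (Fin.last m).castSucc 1)), fun t => ?_⟩
  have h := plucker (res (m + 2) p B) (fun i => t (p + i)) (Pi.single (Fin.last (m + 1)) 1)
    (Pi.single 0 1) (Pi.single (Fin.last m).castSucc 1)
  rw [val_last, val_zero, val_last_pen, val_pen, val_last_zero, pow_succ] at h
  linear_combination (-1) ^ m * h + (-casR p (snoc B t) * cas (p + 1) B +
    cas p B * cas (p + 1) (snoc B t)) * h2

lemma casL_mul : ∃ θ : ℂ, ∀ t : ℕ → ℂ, casL p (snoc B t) * cas (p + 1) B =
    cas (p + 2) B * cas p (snoc B t) + θ * cas (p + 1) (snoc B t) := by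
  have h2 : ((-1 : ℂ) ^ m) * (-1) ^ m = 1 := by rw [← pow_add]; exact Even.neg_one_pow ⟨m, rfl⟩
  refine ⟨(-1) ^ m * colDet (snoc (snoc (res (m + 2) p B) (Pi.single (Fin.last (m + 1)) 1))
    (Pi.single 1 1)), fun t => ?_⟩
  have h := plucker (res (m + 2) p B) (fun i => t (p + i)) (Pi.single 0 1)
    (Pi.single (Fin.last (m + 1)) 1) (Pi.single 1 1)
  rw [val_last, val_zero, val_zero_one, val_one, val_zero_last, pow_succ] at h
  linear_combination h - (casL p (snoc B t) * cas (p + 1) B) * h2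

/-- The Plücker relation with the unit vectors at the last two sites. Antisymmetrizing in u and v
removes the displaced row at the price of a Casoratian with one more column; `casL_sub` does the
same at the first two sites. -/
lemma casR_sub (u v : ℕ → ℂ) : casR p (snoc B u) * cas p (snoc B v) -
    cas p (snoc B u) * casR p (snoc B v) = - cas p B * cas p (snoc (snoc B u) v) := by
  have h := plucker (res (m + 2) p B) (fun i => u (p + i)) (fun i => v (p + i))
    (Pi.single (Fin.last m).castSucc 1) (Pi.single (Fin.last (m + 1)) 1)
  rw [val_pen_last, val_pen, val_pen, val_last, val_last, res_snoc, res_snoc, ← cas_eq] at h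
  linear_combination h

lemma casL_sub (u v : ℕ → ℂ) : casL p (snoc B u) * cas (p + 1) (snoc B v) -
    cas (p + 1) (snoc B u) * casL p (snoc B v) = cas (p + 2) B * cas p (snoc (snoc B u) v) := by
  have h2 : ((-1 : ℂ) ^ m) * (-1) ^ m = 1 := by rw [← pow_add]; exact Even.neg_one_pow ⟨m, rfl⟩
  have h := plucker (res (m + 2) p B) (fun i => u (p + i)) (fun i => v (p + i))
    (Pi.single 0 1) (Pi.single 1 1)
  rw [val_zero_one, val_one, val_one, val_zero, val_zero, res_snoc, res_snoc, ← cas_eq,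
    pow_succ] at h
  linear_combination -h + (-casL p (snoc B u) * cas (p + 1) (snoc B v) +
    cas (p + 1) (snoc B u) * casL p (snoc B v)) * h2

end bilinear

/-! ### Difference equations for Casoratians of solutions of a three-term recurrence -/

/-- `u` solves the three-term recurrence with energy `E` at the sites `1, …, n + 1`. -/
def IsSol (a b c : ℕ → ℂ) (n : ℕ) (u : ℕ → ℂ) (E : ℂ) : Prop :=
  ∀ j ≤ n, a (j + 1) * u (j + 2) + b (j + 1) * u j = (c (j + 1) + E) * u (j + 1)

lemma IsSol.mono {a b c : ℕ → ℂ} {n m : ℕ} {u : ℕ → ℂ} {E : ℂ} (h : IsSol a b c n u E)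
    (hm : m ≤ n) : IsSol a b c m u E := fun j hj => h j (hj.trans hm)

lemma IsSol.snoc {a b c : ℕ → ℂ} {n m : ℕ} {B : Fin m → ℕ → ℂ} {E : Fin m → ℂ} {u : ℕ → ℂ}
    {e : ℂ} (hB : ∀ k, IsSol a b c n (B k) (E k)) (hu : IsSol a b c n u e) (k : Fin (m + 1)) :
    IsSol a b c n (MultiIndexed.snoc B u k) (MultiIndexed.snoc E e k) := by
  induction k using Fin.lastCases with
  | last => simpa using hu
  | cast k => simpa using hB k

lemma sum_snoc {m : ℕ} (E : Fin m → ℂ) (e : ℂ) : ∑ k, snoc E e k = ∑ k, E k + e := by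
  simp [Fin.sum_univ_castSucc]

variable {a b c : ℕ → ℂ}

lemma casR_casL_snoc {m : ℕ} {B : Fin m → ℕ → ℂ} {E : Fin m → ℂ} {u : ℕ → ℂ} {e : ℂ}
    (hB : ∀ k, IsSol a b c m (B k) (E k)) (hu : IsSol a b c m u e) :
    a (m + 1) * casR 1 (snoc B u) + b 1 * casL 0 (snoc B u) =
      (∑ k, E k + e + ∑ i : Fin (m + 1), c (0 + 1 + i)) * cas 1 (snoc B u) := by
  have h := casR_casL 0 a b c (snoc B u) (snoc E e) (fun k j hj => by
    have := IsSol.snoc hB hu k j hj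
    rwa [show 0 + 1 + j + 1 = j + 2 by ring, show 0 + 1 + j = j + 1 by ring, zero_add])
  rw [sum_snoc] at h
  rw [← h, show 0 + 1 + m = m + 1 by ring]

/-- The deformed Schrödinger equation. -/
lemma cas_schrodinger {m : ℕ} {D : Fin m → ℕ → ℂ} {E : Fin m → ℂ}
    (hD : ∀ k, IsSol a b c m (D k) (E k)) : ∃ δ : ℂ, ∀ t e, IsSol a b c m t e →
      a (m + 1) * cas 1 D ^ 2 * cas 2 (snoc D t) + b 1 * cas 2 D ^ 2 * cas 0 (snoc D t) =
        (e * cas 1 D * cas 2 D - δ) * cas 1 (snoc D t) := by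
  obtain ⟨θ, hθ⟩ := casR_mul 1 D
  obtain ⟨θ', hθ'⟩ := casL_mul 0 D
  -- The constant gathers the two θ and the trace term of the seeds. It depends on D and the
  -- coefficients of the recurrence, but not on t or e.
  refine ⟨a (m + 1) * cas 1 D * θ + b 1 * cas 2 D * θ' -
    cas 1 D * cas 2 D * (∑ k, E k + ∑ i : Fin (m + 1), c (0 + 1 + i)), fun t e ht => ?_⟩
  have h1 := hθ t
  have h2 := hθ' t
  have h3 := casR_casL_snoc hD ht
  simp only [zero_add, show 1 + 1 = 2 from rfl] at h1 h2 h3 ⊢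
  linear_combination cas 1 D * cas 2 D * h3 - a (m + 1) * cas 1 D * h1 - b 1 * cas 2 D * h2

/-- The bilinear form of the Schrödinger equation. -/
lemma cas_bilinear {m : ℕ} {B : Fin m → ℕ → ℂ} {E : Fin m → ℂ} {u v : ℕ → ℂ} {e e' : ℂ}
    (hB : ∀ k, IsSol a b c m (B k) (E k)) (hu : IsSol a b c m u e) (hv : IsSol a b c m v e') :
    b 1 * cas 2 B * cas 0 (snoc (snoc B u) v) - a (m + 1) * cas 1 B * cas 1 (snoc (snoc B u) v) =
      (e - e') * cas 1 (snoc B u) * cas 1 (snoc B v) := by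
  have h1 := casR_casL_snoc hB hu
  have h2 := casR_casL_snoc hB hv
  have h3 := casR_sub 1 B u v
  have h4 := casL_sub 0 B u v
  simp only [zero_add] at h1 h2 h3 h4
  linear_combination cas 1 (snoc B v) * h1 - cas 1 (snoc B u) * h2 - a (m + 1) * h3 - b 1 * h4

/-- The equation satisfied by the Casoratian in which one seed is exchanged. -/
lemma cas_exchange {m : ℕ} {B : Fin m → ℕ → ℂ} {E : Fin m → ℂ} {f g s : ℕ → ℂ} {ef eg es δ : ℂ}
    (hB : ∀ k, IsSol a b c (m + 1) (B k) (E k)) (hf : IsSol a b c (m + 1) f ef)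
    (hg : IsSol a b c (m + 1) g eg) (hs : IsSol a b c (m + 1) s es)
    (h1 : cas 1 (snoc B f) ≠ 0) (h2 : cas 2 (snoc B f) ≠ 0)
    (hδ : ∀ t e, IsSol a b c (m + 1) t e →
      a (m + 2) * cas 1 (snoc B f) ^ 2 * cas 2 (snoc (snoc B f) t) +
        b 1 * cas 2 (snoc B f) ^ 2 * cas 0 (snoc (snoc B f) t) =
        (e * cas 1 (snoc B f) * cas 2 (snoc B f) - δ) * cas 1 (snoc (snoc B f) t)) :
    a (m + 2) * cas 1 (snoc B f) ^ 2 * cas 2 (snoc (snoc B s) g) +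
        b 1 * cas 2 (snoc B f) ^ 2 * cas 0 (snoc (snoc B s) g) =
      ((es + ef - eg) * cas 1 (snoc B f) * cas 2 (snoc B f) - δ) * cas 1 (snoc (snoc B s) g) +
        cas 1 (snoc (snoc B f) g) * ((eg - es) *
          (cas 1 (snoc B f) * cas 2 (snoc B s) + cas 2 (snoc B f) * cas 1 (snoc B s))) := by
  have hm : m ≤ m + 1 := by omega
  have hB' := fun k => (hB k).mono hm
  have b1 := cas_bilinear hB' (hf.mono hm) (hg.mono hm)
  have b2 := cas_bilinear hB' (hf.mono hm) (hs.mono hm)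
  have l1 := cas_three_left 1 B f g s
  have r1 := cas_three_right 1 B f g s
  have l2 := cas_three_left 2 B f g s
  have r0 := cas_three_right 0 B f g s
  have j1 := cas_jacobi 1 B f s
  have j2 := cas_jacobi 1 B f g
  have d1 := hδ g eg hg
  have d2 := hδ s es hs
  simp only [zero_add, show 1 + 1 = 2 from rfl] at *
  generalize cas 1 (snoc B f) = X1 at *
  generalize cas 2 (snoc B f) = X2 at *
  -- After multiplication by `X1 * X2`, the relations `l2` and `r0` trade the outer Casoratians of
  -- (B, s, g) for those of (B, f, g) and (B, f, s). The equations `d1` and `d2` apply to these, and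
  -- the remaining products are reduced by the bilinear identities `b1`, `b2` and the Jacobi
  -- identities.
  refine mul_left_cancel₀ (mul_ne_zero h1 h2) ?_
  linear_combination a (m + 2) * X1 ^ 3 * l2 + b 1 * X2 ^ 3 * r0 + X1 * cas 2 (snoc B s) * d1 -
    X1 * cas 2 (snoc B g) * d2 + b 1 * X2 ^ 2 * cas 0 (snoc (snoc B f) g) * j1 -
    b 1 * X2 ^ 2 * cas 0 (snoc (snoc B f) s) * j2 - X2 ^ 2 * cas 1 (snoc (snoc B f) s) * b1 +
    X2 ^ 2 * cas 1 (snoc (snoc B f) g) * b2 - X1 * (es * X1 * X2 - δ) * r1 -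
    X2 ^ 2 * X1 * (ef - eg) * l1

/-- A permutation of the columns changes all Casoratians by the same sign. -/
lemma cas_reorder {n n' : ℕ} (hn : n = n') (u : Fin n → ℕ → ℂ) (u' : Fin n' → ℕ → ℂ)
    (σ : Fin n → Fin n') (hσ : Function.Injective σ) (h : ∀ k, u k = u' (σ k)) :
    ∃ ε : ℂ, ε * ε = 1 ∧ ∀ p, cas p u = ε * cas p u' := by
  subst hn
  let τ : Equiv.Perm (Fin n) := Equiv.ofBijective σ (Finite.injective_iff_bijective.1 hσ)
  refine ⟨((Equiv.Perm.sign τ : ℤ) : ℂ), ?_, fun p => ?_⟩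
  · rw [← Int.cast_mul, ← Units.val_mul, Int.units_mul_self]; simp
  · have := Matrix.det_permute' τ (Matrix.of fun i k : Fin n => u' k (p + i))
    rw [cas, cas, ← this]
    congr 1
    ext i k
    simp [h, τ]

/-- Row operations replace every row after the first two by the recurrence operator minus e applied
to the columns. This annihilates h and s and multiplies column i of C by E_i - e, so the matrix
becomes block triangular, with the 2 × 2 Casoratian of h and s in the corner. -/
lemma cas_append_pair {r n : ℕ} {C : Fin r → ℕ → ℂ} {E : Fin r → ℂ} {h s : ℕ → ℂ} {e : ℂ}
    (hC : ∀ k, IsSol a b c n (C k) (E k)) (hh : IsSol a b c n h e) (hs : IsSol a b c n s e)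
    (k : ℕ) (hk : k + r ≤ n + 1) :
    cas k (Fin.append ![h, s] C) * ∏ i ∈ Finset.range r, a (k + 1 + i) =
      (h k * s (k + 1) - h (k + 1) * s k) * (∏ i, (E i - e)) * cas (k + 1) C := by
  set A : Matrix (Fin 2 ⊕ Fin r) (Fin 2 ⊕ Fin r) ℂ :=
    Matrix.of fun i j => Fin.append ![h, s] C (finSumFinEquiv j) (k + finSumFinEquiv i) with hA
  have hdet : cas k (Fin.append ![h, s] C) = A.det := by
    rw [cas, ← Matrix.det_submatrix_equiv_self finSumFinEquiv]; rfl
  -- The coefficient of site k + J in the recurrence with energy e centred at site k + 1 + i. Its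
  -- last nonzero entry, at J = i + 2, is the diagonal entry of the lower block of T, whence the
  -- product of the a's.
  let q : ℕ → ℕ → ℂ := fun i J => (if J = i + 2 then a (k + 1 + i) else 0) +
    (if J = i + 1 then -(c (k + 1 + i) + e) else 0) + (if J = i then b (k + 1 + i) else 0)
  set T : Matrix (Fin 2 ⊕ Fin r) (Fin 2 ⊕ Fin r) ℂ := Matrix.fromBlocks 1 0
    (Matrix.of fun i j => q i j) (Matrix.of fun i j => q i (2 + j)) with hT
  have hTdet : T.det = ∏ i ∈ Finset.range r, a (k + 1 + i) := by
    rw [hT, Matrix.det_fromBlocks_zero₁₂, Matrix.det_one, one_mul, Matrix.det_of_isLowerTriangular]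
    · rw [Finset.prod_range]
      refine Finset.prod_congr rfl fun i _ => ?_
      simp only [q, Matrix.of_apply]
      rw [if_pos (by omega), if_neg (by omega), if_neg (by omega)]
      ring
    · intro i j hij
      have hij' : (i : ℕ) < j := hij
      simp only [q, Matrix.of_apply]
      rw [if_neg (by omega), if_neg (by omega), if_neg (by omega)]
      ring
  have hrow : ∀ (u : ℕ → ℂ) (E' : ℂ), IsSol a b c n u E' → ∀ i : Fin r,
      ∑ j : Fin 2, q i j * u (k + j) + ∑ j : Fin r, q i (2 + j) * u (k + (2 + j)) =
        (E' - e) * u (k + 1 + i) := by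
    intro u E' hu i
    have h1 : ∑ j : Fin 2, q i j * u (k + j) + ∑ j : Fin r, q i (2 + j) * u (k + (2 + j)) =
        ∑ J ∈ Finset.range (2 + r), q i J * u (k + J) := by
      rw [Finset.sum_range_add, Finset.sum_range, Finset.sum_range]
    rw [h1]
    simp only [q, add_mul, ite_mul, zero_mul, Finset.sum_add_distrib, Finset.sum_ite_eq',
      Finset.mem_range]
    rw [if_pos (by omega), if_pos (by omega), if_pos (by omega)]
    have h2 := hu (k + i) (by omega)
    rw [show k + 1 + (i : ℕ) = k + i + 1 by ring, show k + ((i : ℕ) + 1) = k + i + 1 by ring,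
      show k + ((i : ℕ) + 2) = k + i + 2 by ring]
    linear_combination h2
  have hTA : T * A = Matrix.fromBlocks !![h k, s k; h (k + 1), s (k + 1)]
      (Matrix.of fun (i : Fin 2) j => C j (k + i)) 0
      (Matrix.of fun (i : Fin r) j => (E j - e) * C j (k + 1 + i)) := by
    ext i j
    rw [Matrix.mul_apply, Fintype.sum_sum_type]
    rcases i with i | i
    · simp only [hT, Matrix.fromBlocks_apply₁₁, Matrix.fromBlocks_apply₁₂, Matrix.zero_apply,
        zero_mul, Finset.sum_const_zero, add_zero, Matrix.one_apply, ite_mul, one_mul,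
        Finset.sum_ite_eq, Finset.mem_univ, if_true]
      rcases j with j | j
      · simp only [hA, Matrix.of_apply, finSumFinEquiv_apply_left, Fin.append_left,
          Matrix.fromBlocks_apply₁₁]
        fin_cases i <;> fin_cases j <;> simp
      · simp [hA]
    · simp only [hT, Matrix.fromBlocks_apply₂₁, Matrix.fromBlocks_apply₂₂, Matrix.of_apply]
      rcases j with j | j
      · simp only [hA, Matrix.of_apply, finSumFinEquiv_apply_left, finSumFinEquiv_apply_right,
          Fin.append_left, Fin.val_castAdd, Fin.val_natAdd, Matrix.fromBlocks_apply₂₁,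
          Matrix.zero_apply]
        have hj : IsSol a b c n ((![h, s] : Fin 2 → ℕ → ℂ) j) e := by fin_cases j <;> simpa
        simpa using hrow _ _ hj i
      · simp only [hA, Matrix.of_apply, finSumFinEquiv_apply_left, finSumFinEquiv_apply_right,
          Fin.append_right, Fin.val_castAdd, Fin.val_natAdd, Matrix.fromBlocks_apply₂₂]
        exact hrow _ _ (hC j) i
  have h2 := congrArg Matrix.det hTA
  rw [Matrix.det_mul, hTdet, Matrix.det_fromBlocks_zero₂₁, Matrix.det_fin_two_of] at h2
  have h3 : (Matrix.of fun i j : Fin r => (E j - e) * C j (k + 1 + i)).det =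
      (∏ i, (E i - e)) * cas (k + 1) C := by
    rw [cas, ← Matrix.det_mul_row]; rfl
  rw [h3] at h2
  rw [hdet]
  linear_combination h2

/-- A second solution of the recurrence. -/
lemma exists_second_solution (n : ℕ) (e : ℂ) (ha : ∀ j ≤ n, a (j + 1) ≠ 0) (s0 s1 : ℂ) :
    ∃ s : ℕ → ℂ, IsSol a b c n s e ∧ s 0 = s0 ∧ s 1 = s1 := by
  let F : ℕ → ℂ × ℂ := fun j => Nat.rec (s0, s1)
    (fun j q => (q.2, ((c (j + 1) + e) * q.2 - b (j + 1) * q.1) / a (j + 1))) j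
  have hF : ∀ j, F (j + 1) = ((F j).2, ((c (j + 1) + e) * (F j).2 - b (j + 1) * (F j).1) /
    a (j + 1)) := fun j => rfl
  refine ⟨fun j => (F j).1, fun j hj => ?_, rfl, rfl⟩
  have h1 := ha j hj
  simp only [hF]
  field_simp
  ring

lemma cas_col_zero {n : ℕ} (p : ℕ) (u : Fin n → ℕ → ℂ) (k : Fin n)
    (h : ∀ i < n, u k (p + i) = 0) : cas p u = 0 :=
  Matrix.det_eq_zero_of_column_eq_zero k fun i => by simpa using h i i.2

/-- Moving the pair in front of C costs a sign which is the same for all windows, so equations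
between Casoratians on different windows are not affected. -/
lemma cas_pair_snoc {m : ℕ} (C : Fin m → ℕ → ℂ) (h s : ℕ → ℂ) : ∃ ε : ℂ, ε * ε = 1 ∧
    ∀ p, cas p (snoc (snoc C h) s) = ε * cas p (Fin.append ![h, s] C) := by
  refine cas_reorder (by omega) _ _
    (snoc (snoc (fun k => Fin.natAdd 2 k) (Fin.castAdd m 0)) (Fin.castAdd m 1)) ?_ ?_
  · intro i j hij
    induction i using Fin.lastCases with
    | last =>
      induction j using Fin.lastCases with
      | last => rfl
      | cast j =>
        induction j using Fin.lastCases with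
        | last => simp [Fin.ext_iff] at hij
        | cast j => simp [Fin.ext_iff] at hij; omega
    | cast i =>
      induction j using Fin.lastCases with
      | last =>
        induction i using Fin.lastCases with
        | last => simp [Fin.ext_iff] at hij
        | cast j => simp [Fin.ext_iff] at hij; omega
      | cast j =>
        induction i using Fin.lastCases with
        | last =>
          induction j using Fin.lastCases with
          | last => rfl
          | cast j => simp only [snoc_castSucc, snoc_last, Fin.ext_iff, Fin.val_castAdd,
              Fin.val_natAdd, Fin.val_zero] at hij; omega
        | cast i =>
          induction j using Fin.lastCases with
          | last => simp [Fin.ext_iff] at hij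
          | cast j => simpa [Fin.ext_iff] using hij
  · intro k
    induction k using Fin.lastCases with
    | last => simp only [snoc_last, Fin.append_left]; rfl
    | cast k =>
      induction k using Fin.lastCases with
      | last => simp only [snoc_last, snoc_castSucc, Fin.append_left]; rfl
      | cast k => simp only [snoc_castSucc, Fin.append_right]

lemma cas_pair_snoc' {m : ℕ} (C : Fin m → ℕ → ℂ) (h s g : ℕ → ℂ) : ∃ ε : ℂ, ε * ε = 1 ∧
    ∀ p, cas p (snoc (snoc (snoc C h) s) g) =
      ε * cas p (Fin.append ![h, s] (snoc C g)) := by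
  refine cas_reorder (by omega) _ _
    (snoc (snoc (snoc (fun k => Fin.natAdd 2 k.castSucc) (Fin.castAdd (m + 1) 0))
      (Fin.castAdd (m + 1) 1)) (Fin.natAdd 2 (Fin.last m))) ?_ ?_
  · have key : ∀ i : Fin (m + 3), ((snoc (snoc (snoc (fun k => Fin.natAdd 2 k.castSucc)
        (Fin.castAdd (m + 1) 0)) (Fin.castAdd (m + 1) 1)) (Fin.natAdd 2 (Fin.last m)) i :
        Fin (2 + (m + 1))) : ℕ) =
        if (i : ℕ) < m then (i : ℕ) + 2 else if (i : ℕ) = m then 0 else if (i : ℕ) = m + 1 then 1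
        else m + 2 := by
      intro i
      induction i using Fin.lastCases with
      | last => simp; omega
      | cast i =>
        induction i using Fin.lastCases with
        | last => simp
        | cast i =>
          induction i using Fin.lastCases with
          | last => simp
          | cast i => simp; omega
    intro i j hij
    have h1 := key i
    have h2 := key j
    rw [hij, h2] at h1
    have := i.2
    have := j.2
    ext
    split_ifs at h1 <;> omega
  · intro k
    induction k using Fin.lastCases with
    | last => simp only [snoc_last, Fin.append_right]
    | cast k =>
      induction k using Fin.lastCases with
      | last => simp only [snoc_last, snoc_castSucc, Fin.append_left]; rfl
      | cast k =>
        induction k using Fin.lastCases with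
        | last => simp only [snoc_last, snoc_castSucc, Fin.append_left]; rfl
        | cast k => simp only [snoc_castSucc, Fin.append_right]

/-- The equation satisfied by the Casoratian from which two seeds are removed. -/
lemma cas_remove {m : ℕ} {C : Fin m → ℕ → ℂ} {E : Fin m → ℂ} {f g h : ℕ → ℂ} {ef eg eh δ : ℂ}
    (hC : ∀ k, IsSol a b c (m + 2) (C k) (E k)) (hf : IsSol a b c (m + 2) f ef)
    (hg : IsSol a b c (m + 2) g eg) (hh : IsSol a b c (m + 2) h eh)
    (ha : ∀ j ≤ m + 2, a (j + 1) ≠ 0) (hb : ∀ j ≤ m + 2, b (j + 1) ≠ 0)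
    (hE : ∀ k, E k ≠ eh) (hge : eg ≠ eh)
    (h1 : cas 1 (snoc (snoc C h) f) ≠ 0) (h2 : cas 2 (snoc (snoc C h) f) ≠ 0)
    (hδ : ∀ t e, IsSol a b c (m + 2) t e →
      a (m + 3) * cas 1 (snoc (snoc C h) f) ^ 2 * cas 2 (snoc (snoc (snoc C h) f) t) +
        b 1 * cas 2 (snoc (snoc C h) f) ^ 2 * cas 0 (snoc (snoc (snoc C h) f) t) =
        (e * cas 1 (snoc (snoc C h) f) * cas 2 (snoc (snoc C h) f) - δ) *
          cas 1 (snoc (snoc (snoc C h) f) t)) :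
    ∃ ε : ℂ, ε * ε = 1 ∧ b 2 * cas 1 (snoc (snoc C h) f) ^ 2 * cas 3 (snoc C g) +
        a (m + 2) * cas 2 (snoc (snoc C h) f) ^ 2 * cas 1 (snoc C g) =
      ((eh + ef - eg) * cas 1 (snoc (snoc C h) f) * cas 2 (snoc (snoc C h) f) - δ) *
          cas 2 (snoc C g) +
        ε * cas 1 (snoc (snoc (snoc C h) f) g) *
          (cas 1 (snoc (snoc C h) f) * (b 2 * cas 3 C) +
            cas 2 (snoc (snoc C h) f) * (a (m + 2) * cas 2 C)) := by
  -- `h` does not vanish at the first two sites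
  have hh01 : h 0 ≠ 0 ∨ h 1 ≠ 0 := by
    by_contra hcon
    push Not at hcon
    have hz : ∀ j ≤ m + 3, h j = 0 ∧ h (j + 1) = 0 := by
      intro j
      induction j with
      | zero => exact fun _ => hcon
      | succ j ih =>
        intro hj
        obtain ⟨i1, i2⟩ := ih (by omega)
        refine ⟨i2, ?_⟩
        have := hh j (by omega)
        rw [i1, i2] at this
        have h3 := ha j (by omega)
        simpa [h3] using this
    refine h1 (cas_col_zero 1 _ (Fin.last m).castSucc fun i hi => ?_)
    simp only [snoc_castSucc, snoc_last]
    exact (hz (1 + i) (by omega)).1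
  -- The initial values of the second solution are chosen so that its 2 × 2 Casoratian with h is `h
  -- 0` or `- h 1`, whichever is nonzero.
  obtain ⟨s, hs, hw0⟩ : ∃ s, IsSol a b c (m + 2) s eh ∧ h 0 * s 1 - h 1 * s 0 ≠ 0 := by
    rcases hh01 with h0 | h0
    · obtain ⟨s, hs, e0, e1⟩ := exists_second_solution (b := b) (c := c) (m + 2) eh ha 0 1
      exact ⟨s, hs, by rw [e0, e1]; simpa using h0⟩
    · obtain ⟨s, hs, e0, e1⟩ := exists_second_solution (b := b) (c := c) (m + 2) eh ha 1 0
      exact ⟨s, hs, by rw [e0, e1]; simpa using h0⟩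
  set w : ℕ → ℂ := fun k => h k * s (k + 1) - h (k + 1) * s k with hw
  -- Abel's identity: the Casoratian of two solutions with the same energy obeys a first-order
  -- recurrence, hence does not vanish at site 1 either.
  have hwr : ∀ j ≤ m + 2, a (j + 1) * w (j + 1) = b (j + 1) * w j := by
    intro j hj
    have e1 := hh j hj
    have e2 := hs j hj
    simp only [hw]
    linear_combination h (j + 1) * e2 - s (j + 1) * e1
  obtain ⟨ε, hε, hX⟩ := cas_pair_snoc C h s
  obtain ⟨ε', hε', hQ⟩ := cas_pair_snoc' C h s g
  set K : ℂ := ∏ i, (E i - eh) with hK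
  have hK0 : K ≠ 0 := Finset.prod_ne_zero_iff.2 fun i _ => sub_ne_zero.2 (hE i)
  have hCg := IsSol.snoc hC hg
  have hKg : ∏ i, (snoc E eg i - eh) = K * (eg - eh) := by
    rw [Fin.prod_univ_castSucc]; simp [hK]
  have hQ' : ∀ k ≤ 2, cas k (snoc (snoc (snoc C h) s) g) *
      ∏ i ∈ Finset.range (m + 1), a (k + 1 + i) =
        ε' * w k * K * (eg - eh) * cas (k + 1) (snoc C g) := by
    intro k hk
    have := cas_append_pair hCg hh hs k (by omega)
    rw [hKg] at this
    rw [hQ]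
    linear_combination ε' * this
  have hX' : ∀ k ≤ 2, cas k (snoc (snoc C h) s) * ∏ i ∈ Finset.range m, a (k + 1 + i) =
        ε * w k * K * cas (k + 1) C := by
    intro k hk
    have := cas_append_pair hC hh hs k (by omega)
    rw [hX]
    linear_combination ε * this
  -- The seeds are C, h, f, and f is exchanged for s. In the resulting equation h and s occur
  -- together with C in the exchanged Casoratians, so `hQ'` and `hX'` remove both; the effective
  -- energy uses that s has the energy of h.
  have hex := cas_exchange (IsSol.snoc hC hh) hf hg hs h1 h2 hδ
  have q0 := hQ' 0 (by omega)
  have q1 := hQ' 1 (by omega)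
  have q2 := hQ' 2 (by omega)
  have x1 := hX' 1 (by omega)
  have x2 := hX' 2 (by omega)
  have w0 := hwr 0 (by omega)
  have w1 := hwr 1 (by omega)
  have hw1 : w 1 ≠ 0 := by
    intro h0
    rw [h0, mul_zero] at w0
    exact mul_ne_zero (hb 0 (by omega)) hw0 w0.symm
  -- products of the coefficients
  set A : ℂ := ∏ i ∈ Finset.range m, a (3 + i) with hA
  have hA0 : A ≠ 0 := Finset.prod_ne_zero_iff.2 fun i hi => by
    rw [Finset.mem_range] at hi
    rw [show 3 + i = (i + 2) + 1 by ring]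
    exact ha _ (by omega)
  have p2 : ∏ i ∈ Finset.range (m + 1), a (2 + 1 + i) = A * a (m + 3) := by
    rw [Finset.prod_range_succ, show 2 + 1 + m = m + 3 by ring]
  have p1 : ∏ i ∈ Finset.range (m + 1), a (1 + 1 + i) = A * a 2 := by
    rw [Finset.prod_range_succ']
    congr 1
    exact Finset.prod_congr rfl fun i _ => by ring_nf
  have ha2 : a 2 ≠ 0 := ha 1 (by omega)
  have ham2 : a (m + 2) ≠ 0 := ha (m + 1) (by omega)
  have ham3 : a (m + 3) ≠ 0 := ha (m + 2) (by omega)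
  have ha1 : a 1 ≠ 0 := ha 0 (by omega)
  have hb1 : b 1 ≠ 0 := hb 0 (by omega)
  have p0 : (∏ i ∈ Finset.range (m + 1), a (0 + 1 + i)) * a (m + 2) = A * a 1 * a 2 := by
    have e1 : ∏ i ∈ Finset.range (m + 1 + 1), a (1 + i) =
        (∏ i ∈ Finset.range (m + 1), a (0 + 1 + i)) * a (m + 2) := by
      rw [Finset.prod_range_succ]; ring_nf
    rw [← e1, Finset.prod_range_succ', Finset.prod_range_succ']
    have e2 : ∏ i ∈ Finset.range m, a (1 + (i + 1 + 1)) = A :=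
      Finset.prod_congr rfl fun i _ => by ring_nf
    rw [e2]; ring_nf
  have r1 : (∏ i ∈ Finset.range m, a (1 + 1 + i)) * a (m + 2) = A * a 2 := by
    rw [← p1, Finset.prod_range_succ]; ring_nf
  rw [p2] at q2
  rw [p1] at q1
  have hege : eg - eh ≠ 0 := sub_ne_zero.2 hge
  have hε'0 : ε' ≠ 0 := by rintro rfl; simp at hε'
  simp only [zero_add, show 1 + 1 = 2 from rfl, show 2 + 1 = 3 from rfl,
    show m + 1 + 2 = m + 3 from rfl] at *
  -- Once w 0 and w 2 are expressed through w 1 and the products of the a's are cancelled, the two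
  -- recurrence coefficients trade places: the term with `b 1` now carries `a (m + 2)`, and the term
  -- with `a (m + 3)` carries `b 2`.
  have y0 : b 1 * cas 0 (snoc (snoc (snoc C h) s) g) * (A * a 2) =
      ε' * w 1 * K * (eg - eh) * (a (m + 2) * cas 1 (snoc C g)) := by
    refine mul_left_cancel₀ ha1 ?_
    linear_combination b 1 * a (m + 2) * q0 - b 1 * cas 0 (snoc (snoc (snoc C h) s) g) * p0 -
      ε' * K * (eg - eh) * a (m + 2) * cas 1 (snoc C g) * w0
  have y2 : a (m + 3) * cas 2 (snoc (snoc (snoc C h) s) g) * (A * a 2) =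
      ε' * w 1 * K * (eg - eh) * (b 2 * cas 3 (snoc C g)) := by
    linear_combination a 2 * q2 + ε' * K * (eg - eh) * cas 3 (snoc C g) * w1
  have z1 : cas 1 (snoc (snoc C h) s) * (A * a 2) = ε * w 1 * K * (a (m + 2) * cas 2 C) := by
    linear_combination a (m + 2) * x1 - cas 1 (snoc (snoc C h) s) * r1
  have z2 : cas 2 (snoc (snoc C h) s) * (A * a 2) = ε * w 1 * K * (b 2 * cas 3 C) := by
    linear_combination a 2 * x2 + ε * K * cas 3 C * w1
  refine ⟨ε * ε', by linear_combination ε' * ε' * hε + hε', ?_⟩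
  refine mul_left_cancel₀ (mul_ne_zero (mul_ne_zero (mul_ne_zero hε'0 hw1) hK0) hege) ?_
  linear_combination A * a 2 * hex - cas 1 (snoc (snoc C h) f) ^ 2 * y2 -
    cas 2 (snoc (snoc C h) f) ^ 2 * y0 +
    ((eh + ef - eg) * cas 1 (snoc (snoc C h) f) * cas 2 (snoc (snoc C h) f) - δ) * q1 +
    cas 1 (snoc (snoc (snoc C h) f) g) * (eg - eh) * (cas 1 (snoc (snoc C h) f) * z2 +
      cas 2 (snoc (snoc C h) f) * z1) - (w 1 * K * (eg - eh) * ε *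
        cas 1 (snoc (snoc (snoc C h) f) g) * (cas 1 (snoc (snoc C h) f) * (b 2 * cas 3 C) +
            cas 2 (snoc (snoc C h) f) * (a (m + 2) * cas 2 C))) * hε'

end MultiIndexed

namespace MultiIndexed

open Complex

/-! ### Elementary functions of the three systems -/

lemma q_cpow {q : ℝ} (h0 : 0 < q) (s : ℂ) : (q : ℂ) ^ s = exp (((Real.log q : ℝ) : ℂ) * s) := by
  rw [Complex.cpow_def_of_ne_zero (by exact_mod_cast h0.ne'), Complex.ofReal_log h0.le]

lemma gam_ne_zero (S : System) : gam S ≠ 0 := by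
  cases S with
  | cH => simp [gam]
  | W => simp [gam]
  | AW q h0 h1 =>
    simp only [gam, ne_eq, ofReal_eq_zero]
    exact (Real.log_neg h0 h1).ne

/-- A shift of the parameter is a shift of the argument by a multiple of iγ. This turns shifted
factorials into products over nodes, and half-integer parameter shifts into moves between sites. -/
lemma lin_add (S : System) (s c x : ℂ) : lin S (s + c) x = lin S s (x - I * c * gam S) := by
  cases S with
  | cH => simp only [lin, gam]; linear_combination c * I_mul_I
  | W => simp only [lin, gam]; linear_combination c * I_mul_I
  | AW q h0 h1 =>
    simp only [lin, gam, q_cpow h0, ← exp_add]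
    congr 2
    linear_combination (c * ((Real.log q : ℝ) : ℂ)) * I_mul_I

lemma lin_add_neg (S : System) (s c x : ℂ) :
    lin S (s + c) (-x) = lin S s (-(x + I * c * gam S)) := by
  rw [lin_add]; congr 1; ring

lemma node_eq (S : System) (L : ℕ) (x : ℂ) (j : ℕ) :
    node S L x j = x - I * ((j : ℂ) - ((L : ℂ) - 1) / 2) * gam S := by
  rw [node]; ring

lemma poch_node (S : System) (s x : ℂ) (L j : ℕ) :
    poch S (s - ((L : ℂ) - 1) / 2) x j = ∏ i ∈ Finset.range j, lin S s (node S L x i) := by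
  refine Finset.prod_congr rfl fun i _ => ?_
  rw [node_eq, ← lin_add]; congr 1; ring

lemma poch_node_neg (S : System) (s x : ℂ) (L j : ℕ) (hj : j ≤ L) :
    poch S (s - ((L : ℂ) - 1) / 2) (-x) j =
      ∏ i ∈ Finset.Ico (L - j) L, lin S s (-(node S L x i)) := by
  rw [Finset.prod_Ico_eq_prod_range, ← Finset.prod_range_reflect, poch,
    show L - (L - j) = j by omega]
  refine Finset.prod_congr rfl fun i hi => ?_
  rw [Finset.mem_range] at hi
  rw [show s - ((L : ℂ) - 1) / 2 + i = s + (i - ((L : ℂ) - 1) / 2) by ring, lin_add_neg, node_eq]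
  have : ((L - j + (j - 1 - i) : ℕ) : ℂ) = (L : ℂ) - 1 - i := by
    have h : L - j + (j - 1 - i) + 1 + i = L := by omega
    have := congrArg (Nat.cast : ℕ → ℂ) h
    push_cast at this ⊢
    linear_combination this
  rw [this]
  congr 1; ring

/-- The sign or phase attached to the parameters entering through `+ i y`. -/
noncomputable def phA : System → ℂ → ℂ
  | .cH, _ => -1
  | .W, _ => 1
  | .AW _ _ _, y => exp (-(I * y))

/-- The phase attached to the parameters entering through `- i y`. -/
noncomputable def phB : System → ℂ → ℂ
  | .cH, _ => 1
  | .W, _ => 1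
  | .AW _ _ _, y => exp (I * y)

/-- The factor of `ν^T` contributed by a site above the given one. -/
noncomputable def hA (S : System) (l : Fin 4 → ℂ) (T : VType) (y : ℂ) : ℂ :=
  phA S y * ∏ k ∈ plusPar S T, lin S (l k) y

/-- The factor of `ν^T` contributed by a site below the given one. -/
noncomputable def hB (S : System) (l : Fin 4 → ℂ) (T : VType) (y : ℂ) : ℂ :=
  phB S y * ∏ k ∈ minusPar S T, lin S (l k) (-y)

/-- The constant in the factorization of `nuRow`. -/
noncomputable def nuC : System → ℕ → ℂ
  | .cH, _ => 1
  | .W, _ => 1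
  | .AW q _ _, L => exp (-(((Real.log q : ℝ) : ℂ) * (((L : ℂ) - 1) / 2)))

lemma nuC_ne_zero (S : System) (L : ℕ) : nuC S L ≠ 0 := by
  cases S <;> simp [nuC]

lemma phA_ne_zero (S : System) (y : ℂ) : phA S y ≠ 0 := by
  cases S <;> simp [phA]

lemma phB_ne_zero (S : System) (y : ℂ) : phB S y ≠ 0 := by
  cases S <;> simp [phB]

lemma sum_range_cast (n : ℕ) : ∑ i ∈ Finset.range n, (i : ℂ) = (n : ℂ) * (n - 1) / 2 := by
  induction n with
  | zero => simp
  | succ n ih => rw [Finset.sum_range_succ, ih]; push_cast; ring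

/-- For AW the phases above and below row j multiply to exp(ix(L - 1 - 2j)) times the power of q
collected from the displacements of the nodes. The displacements of all nodes add up to zero, which
leaves j (L - 1 - j) together with the row-independent exponent kept in `nuC`. -/
lemma phase_eq (S : System) (L : ℕ) (x : ℂ) (j : ℕ) (hj : j < L) :
    phase S L x j = nuC S L * (∏ m ∈ Finset.range j, phA S (node S L x m)) *
      ∏ m ∈ Finset.Ico (j + 1) L, phB S (node S L x m) := by
  cases S with
  | cH => simp [phase, nuC, phA, phB]
  | W => simp [phase, nuC, phA, phB]
  | AW q h0 h1 =>
    simp only [phase, nuC, phA, phB, ← exp_sum, ← exp_add]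
    rw [show (q : ℂ) ^ (j * (L - 1 - j)) = exp (((Real.log q : ℝ) : ℂ) * (j * (L - 1 - j) : ℕ)) by
      rw [← q_cpow h0, cpow_natCast], ← exp_add]
    congr 1
    rw [Finset.sum_Ico_eq_sub _ (by omega : j + 1 ≤ L), Finset.sum_neg_distrib]
    simp only [node, gam]
    have hs : ∀ n : ℕ, ∑ i ∈ Finset.range n,
        I * (x + I * (((L : ℂ) - 1) / 2 - i) * ((Real.log q : ℝ) : ℂ)) =
        I * n * x - (n * (((L : ℂ) - 1) / 2) - (n : ℂ) * (n - 1) / 2) *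
          ((Real.log q : ℝ) : ℂ) := by
      intro n
      rw [← sum_range_cast, ← Finset.mul_sum, Finset.sum_add_distrib, ← Finset.sum_mul,
        ← Finset.mul_sum, Finset.sum_sub_distrib]
      simp only [Finset.sum_const, Finset.card_range, nsmul_eq_mul]
      linear_combination ((n * (((L : ℂ) - 1) / 2) - ∑ i ∈ Finset.range n, (i : ℂ)) *
          ((Real.log q : ℝ) : ℂ)) * I_mul_I
    rw [hs, hs, hs]
    have hc : ((j * (L - 1 - j) : ℕ) : ℂ) = j * ((L : ℂ) - 1 - j) := by
      have h : L - 1 - j + 1 + j = L := by omega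
      have := congrArg (Nat.cast : ℕ → ℂ) h
      push_cast at this ⊢
      linear_combination (j : ℂ) * this
    rw [hc]
    push_cast
    ring

/-- The factorization of `nuRow` over the sites. -/
lemma nuRow_eq (S : System) (l : Fin 4 → ℂ) (T : VType) (L : ℕ) (x : ℂ) (j : ℕ) (hj : j < L) :
    nuRow S l T L x j = nuC S L * (∏ m ∈ Finset.range j, hA S l T (node S L x m)) *
      ∏ m ∈ Finset.Ico (j + 1) L, hB S l T (node S L x m) := by
  have h1 : ∏ k ∈ plusPar S T, poch S (l k - ((L : ℂ) - 1) / 2) x j =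
      ∏ m ∈ Finset.range j, ∏ k ∈ plusPar S T, lin S (l k) (node S L x m) := by
    rw [Finset.prod_comm]
    exact Finset.prod_congr rfl fun k _ => poch_node S (l k) x L j
  have h2 : ∏ k ∈ minusPar S T, poch S (l k - ((L : ℂ) - 1) / 2) (-x) (L - 1 - j) =
      ∏ m ∈ Finset.Ico (j + 1) L, ∏ k ∈ minusPar S T, lin S (l k) (-(node S L x m)) := by
    rw [Finset.prod_comm]
    refine Finset.prod_congr rfl fun k _ => ?_
    rw [poch_node_neg S (l k) x L _ (by omega), show L - (L - 1 - j) = j + 1 by omega]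
  simp only [nuRow, twistPoch, hA, hB, Finset.prod_mul_distrib, phase_eq S L x j hj]
  rw [h1, h2]; ring

lemma prod_twistPoch (S : System) (l : Fin 4 → ℂ) (T : VType) (L : ℕ) (x : ℂ) (j : ℕ)
    (hj : j ≤ L) : twistPoch S l T (((L : ℂ) - 1) / 2) x j j =
      (∏ i ∈ Finset.range j, ∏ k ∈ plusPar S T, lin S (l k) (node S L x i)) *
        ∏ i ∈ Finset.Ico (L - j) L, ∏ k ∈ minusPar S T, lin S (l k) (-(node S L x i)) := by
  rw [twistPoch, Finset.prod_comm, Finset.prod_comm (s := Finset.Ico (L - j) L)]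
  congr 1
  · exact Finset.prod_congr rfl fun k _ => poch_node S (l k) x L j
  · exact Finset.prod_congr rfl fun k _ => poch_node_neg S (l k) x L j hj

/-- The constant in the factorization of `twistPoch`. -/
noncomputable def tpC : System → ℕ → ℕ → ℂ
  | .cH, _, j => (-1) ^ j
  | .W, _, _ => 1
  | .AW q _ _, L, j => exp (((Real.log q : ℝ) : ℂ) * (j * ((j : ℂ) - L)))

lemma tpC_ne_zero (S : System) (L j : ℕ) : tpC S L j ≠ 0 := by
  cases S <;> simp [tpC]

lemma twistPoch_eq (S : System) (l : Fin 4 → ℂ) (T : VType) (L : ℕ) (x : ℂ) (j : ℕ)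
    (hj : j ≤ L) : twistPoch S l T (((L : ℂ) - 1) / 2) x j j =
      tpC S L j * ((∏ i ∈ Finset.range j, hA S l T (node S L x i)) *
        ∏ i ∈ Finset.Ico (L - j) L, hB S l T (node S L x i)) := by
  rw [prod_twistPoch S l T L x j hj]
  simp only [hA, hB, Finset.prod_mul_distrib]
  have h : tpC S L j * ((∏ i ∈ Finset.range j, phA S (node S L x i)) *
      ∏ i ∈ Finset.Ico (L - j) L, phB S (node S L x i)) = 1 := by
    cases S with
    | cH => simp [tpC, phA, phB, ← pow_add, ← two_mul]
    | W => simp [tpC, phA, phB]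
    | AW q h0 h1 =>
      simp only [tpC, phA, phB, ← exp_sum, ← exp_add]
      rw [exp_eq_one_iff]
      refine ⟨0, ?_⟩
      rw [Finset.sum_Ico_eq_sub _ (by omega : L - j ≤ L), Finset.sum_neg_distrib]
      simp only [node, gam]
      have hs : ∀ n : ℕ, ∑ i ∈ Finset.range n,
          I * (x + I * (((L : ℂ) - 1) / 2 - i) * ((Real.log q : ℝ) : ℂ)) =
          I * n * x - (n * (((L : ℂ) - 1) / 2) - (n : ℂ) * (n - 1) / 2) *
            ((Real.log q : ℝ) : ℂ) := by
        intro n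
        rw [← sum_range_cast, ← Finset.mul_sum, Finset.sum_add_distrib, ← Finset.sum_mul,
          ← Finset.mul_sum, Finset.sum_sub_distrib]
        simp only [Finset.sum_const, Finset.card_range, nsmul_eq_mul]
        linear_combination ((n * (((L : ℂ) - 1) / 2) - ∑ i ∈ Finset.range n, (i : ℂ)) *
            ((Real.log q : ℝ) : ℂ)) * I_mul_I
      rw [hs, hs, hs, Nat.cast_sub hj]
      push_cast
      ring
  linear_combination (-((∏ i ∈ Finset.range j, ∏ k ∈ plusPar S T, lin S (l k) (node S L x i)) *
    ∏ i ∈ Finset.Ico (L - j) L, ∏ k ∈ minusPar S T, lin S (l k) (-(node S L x i)))) * h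

/-- The difference factor of `η(u) - η(v)`. -/
noncomputable def dl : System → ℂ → ℂ
  | .cH, w => w
  | .W, w => w
  | .AW _ _ _, w => -2 * sin (w / 2)

/-- The sum factor of `η(u) - η(v)`. -/
noncomputable def sg : System → ℂ → ℂ
  | .cH, _ => 1
  | .W, w => w
  | .AW _ _ _, w => sin (w / 2)

/-- The two factors have separate roles. For nodes of one window u - v does not depend on x, so `dl`
contributes only constants to Vandermonde products, while `sg` carries the dependence on x. -/
lemma eta_sub (S : System) (u v : ℂ) : eta S u - eta S v = dl S (u - v) * sg S (u + v) := by
  cases S with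
  | cH => simp [eta, dl, sg]
  | W => simp only [eta, dl, sg]; ring
  | AW q h0 h1 => simp only [eta, dl, sg]; rw [cos_sub_cos]; ring

lemma dl_ne_zero (S : System) (r : ℝ) (hr : r ≠ 0) : dl S (I * r * gam S) ≠ 0 := by
  cases S with
  | cH => simp [dl, gam, hr]
  | W => simp [dl, gam, hr]
  | AW q h0 h1 =>
    have hl := (Real.log_neg h0 h1).ne
    simp only [dl, gam]
    rw [show I * (r : ℂ) * ((Real.log q : ℝ) : ℂ) / 2 = ((r * Real.log q / 2 : ℝ) : ℂ) * I by
      push_cast; ring, sin_mul_I, ← ofReal_sinh]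
    have : Real.sinh (r * Real.log q / 2) ≠ 0 := by
      rw [ne_eq, Real.sinh_eq_zero]
      positivity
    simp only [mul_ne_zero_iff, ne_eq, ofReal_eq_zero]
    exact ⟨by norm_num, this, I_ne_zero⟩

/-! ### The eigenvalue equation of the base polynomials -/

/-- The operator is triangular with one off-diagonal in the basis φ. The condition on the
coefficients makes the error of a partial sum telescope to a multiple of its top term, and the
multiple vanishes at k = n. -/
lemma eigen_of_ladder {n : ℕ} (c e G φ Hφ : ℕ → ℂ) (h0 : Hφ 0 = e 0 * φ 0)
    (hs : ∀ k, Hφ (k + 1) = e (k + 1) * φ (k + 1) - G k * φ k)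
    (hc : ∀ k < n, c (k + 1) * G k = c k * (e k - e n)) :
    ∑ k ∈ Finset.range (n + 1), c k * Hφ k = e n * ∑ k ∈ Finset.range (n + 1), c k * φ k := by
  have key : ∀ m ≤ n, ∑ k ∈ Finset.range (m + 1), c k * Hφ k =
      e n * ∑ k ∈ Finset.range (m + 1), c k * φ k + c m * (e m - e n) * φ m := by
    intro m
    induction m with
    | zero => intro _; simp only [zero_add, Finset.range_one, Finset.sum_singleton, h0]; ring
    | succ m ih =>
      intro hm
      rw [Finset.sum_range_succ, Finset.sum_range_succ _ (m + 1), ih (by omega), hs]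
      linear_combination (-(φ m)) * hc m (by omega)
  rw [key n le_rfl]; ring

/-- The eigenvalues `E_n`. -/
noncomputable def eigE : System → (Fin 4 → ℂ) → ℕ → ℂ
  | .cH, l, n => n * (n + (l 0 + l 1 + l 2 + l 3) - 1)
  | .W, l, n => n * (n + (l 0 + l 1 + l 2 + l 3) - 1)
  | .AW q _ _, l, n =>
      ((q : ℂ) ^ (-(n : ℂ)) - 1) * (1 - (q : ℂ) ^ ((l 0 + l 1 + l 2 + l 3) + n - 1))

lemma poch_zero (S : System) (s x : ℂ) : poch S s x 0 = 1 := by simp [poch]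

lemma poch_succ (S : System) (s x : ℂ) (n : ℕ) :
    poch S s x (n + 1) = poch S s x n * lin S (s + n) x := by simp [poch, Finset.prod_range_succ]

lemma poch_succ' (S : System) (s x : ℂ) (n : ℕ) :
    poch S s x (n + 1) = lin S s x * poch S (s + 1) x n := by
  simp only [poch, Finset.prod_range_succ']
  rw [mul_comm]; congr 1
  · simp
  · refine Finset.prod_congr rfl fun i _ => ?_
    congr 1; push_cast; ring

lemma poch_add (S : System) (s c x : ℂ) (n : ℕ) :
    poch S (s + c) x n = poch S s (x - I * c * gam S) n := by
  refine Finset.prod_congr rfl fun i _ => ?_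
  rw [show s + c + (i : ℂ) = s + i + c by ring, lin_add]

lemma poch_shift_down (S : System) (s x : ℂ) (n : ℕ) :
    poch S s (x - I * gam S) n = poch S (s + 1) x n := by
  rw [poch_add]; congr 2; ring

lemma poch_shift_up (S : System) (s x : ℂ) (n : ℕ) :
    poch S s (x + I * gam S) n = poch S (s - 1) x n := by
  rw [sub_eq_add_neg s 1, poch_add]; congr 2; ring

/-- In the basis of shifted factorials (a₁ + ix)_k the difference operator is a ladder: a shift of x
alters only the end factors of the product. The series coefficients obey exactly the recursion
required by `eigen_of_ladder`. The W and AW cases use (a₁ + ix)_k (a₁ - ix)_k and its q-analogue. -/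
lemma eigen_cH (l : Fin 4 → ℂ) (n : ℕ) (y : ℂ) :
    pot .cH l y * (basePoly .cH l n (y - I * gam .cH) - basePoly .cH l n y) +
      potStar .cH l y * (basePoly .cH l n (y + I * gam .cH) - basePoly .cH l n y) =
    eigE .cH l n * basePoly .cH l n y := by
  have H := eigen_of_ladder (n := n)
    (fun k => poch0 .cH (-n) k * poch0 .cH (n + (l 0 + l 1 + l 2 + l 3) - 1) k *
      poch0 .cH (l 0 + l 2 + k) (n - k) * poch0 .cH (l 0 + l 3 + k) (n - k) / (k.factorial : ℂ))
    (eigE .cH l) (fun k => (k + 1) * (l 0 + l 2 + k) * (l 0 + l 3 + k))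
    (fun k => poch .cH (l 0) y k)
    (fun k => pot .cH l y * (poch .cH (l 0) (y - I * gam .cH) k - poch .cH (l 0) y k) +
      potStar .cH l y * (poch .cH (l 0) (y + I * gam .cH) k - poch .cH (l 0) y k))
    (by simp [poch_zero, eigE]) ?_ ?_
  · simp only [basePoly]
    have e : ∀ z : ℂ, ∑ k ∈ Finset.range (n + 1),
          poch0 .cH (-n) k * poch0 .cH (n + (l 0 + l 1 + l 2 + l 3) - 1) k * poch .cH (l 0) z k *
            poch0 .cH (l 0 + l 2 + k) (n - k) * poch0 .cH (l 0 + l 3 + k) (n - k) /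
            (k.factorial : ℂ) = ∑ k ∈ Finset.range (n + 1), poch0 .cH (-n) k *
            poch0 .cH (n + (l 0 + l 1 + l 2 + l 3) - 1) k *
      poch0 .cH (l 0 + l 2 + k) (n - k) * poch0 .cH (l 0 + l 3 + k) (n - k) / (k.factorial : ℂ) *
        poch .cH (l 0) z k := fun z => Finset.sum_congr rfl fun k _ => by ring
    simp only [e]
    simp only [mul_add, mul_sub, Finset.sum_add_distrib, Finset.sum_sub_distrib] at H
    have m : ∀ (a : ℂ) (f g : ℕ → ℂ), ∑ k ∈ Finset.range (n + 1), f k * (a * g k) =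
      a * ∑ k ∈ Finset.range (n + 1), f k * g k := fun a f g => by
        rw [Finset.mul_sum]; exact Finset.sum_congr rfl fun k _ => by ring
    simp only [m] at H
    linear_combination (I ^ n / (n.factorial : ℂ)) * H
  · intro k
    simp only [poch_shift_down, poch_shift_up]
    rw [poch_succ _ (l 0 + 1), poch_succ' _ (l 0 - 1), sub_add_cancel, poch_succ _ (l 0)]
    have := poch_succ .cH (l 0) y k
    rw [poch_succ' .cH (l 0)] at this
    simp only [pot, potStar, eigE, lin] at *
    push_cast
    linear_combination ((l 1 + I * y) * (l 0 + I * y + k + 1)) * this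
  · intro k hk
    obtain ⟨m, rfl⟩ : ∃ m, n = k + 1 + m := ⟨n - k - 1, by omega⟩
    rw [show k + 1 + m - k = m + 1 by omega, show k + 1 + m - (k + 1) = m by omega]
    simp only [poch0]
    rw [poch_succ' _ (l 0 + l 2 + k), poch_succ' _ (l 0 + l 3 + k), poch_succ _ _ _ k,
      poch_succ _ _ _ k, Nat.factorial_succ]
    have h1 : (k.factorial : ℂ) ≠ 0 := by exact_mod_cast k.factorial_ne_zero
    have h2 : (k : ℂ) + 1 ≠ 0 := by exact_mod_cast k.succ_ne_zero
    simp only [lin, eigE]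
    push_cast
    simp only [← add_assoc]
    field_simp
    ring

lemma eigen_W (l : Fin 4 → ℂ) (n : ℕ) (y : ℂ) (h1 : potDen .W y ≠ 0) (h2 : potDen .W (-y) ≠ 0) :
    pot .W l y * (basePoly .W l n (y - I * gam .W) - basePoly .W l n y) +
      potStar .W l y * (basePoly .W l n (y + I * gam .W) - basePoly .W l n y) =
    eigE .W l n * basePoly .W l n y := by
  have H := eigen_of_ladder (n := n)
    (fun k => poch0 .W (-n) k * poch0 .W (n + (l 0 + l 1 + l 2 + l 3) - 1) k *
      poch0 .W (l 0 + l 1 + k) (n - k) * poch0 .W (l 0 + l 2 + k) (n - k) *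
      poch0 .W (l 0 + l 3 + k) (n - k) / (k.factorial : ℂ))
    (eigE .W l) (fun k => (k + 1) * (l 0 + l 1 + k) * (l 0 + l 2 + k) * (l 0 + l 3 + k))
    (fun k => poch .W (l 0) y k * poch .W (l 0) (-y) k)
    (fun k => pot .W l y * (poch .W (l 0) (y - I * gam .W) k * poch .W (l 0) (-(y - I * gam .W)) k
        - poch .W (l 0) y k * poch .W (l 0) (-y) k) +
      potStar .W l y * (poch .W (l 0) (y + I * gam .W) k * poch .W (l 0) (-(y + I * gam .W)) k
        - poch .W (l 0) y k * poch .W (l 0) (-y) k))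
    (by simp [poch_zero, eigE]) ?_ ?_
  · simp only [basePoly]
    have e : ∀ z : ℂ, ∑ k ∈ Finset.range (n + 1),
        poch0 .W (-n) k * poch0 .W (n + (l 0 + l 1 + l 2 + l 3) - 1) k *
          poch .W (l 0) z k * poch .W (l 0) (-z) k *
          poch0 .W (l 0 + l 1 + k) (n - k) * poch0 .W (l 0 + l 2 + k) (n - k) *
          poch0 .W (l 0 + l 3 + k) (n - k) / (k.factorial : ℂ) = ∑ k ∈ Finset.range (n + 1),
        poch0 .W (-n) k * poch0 .W (n + (l 0 + l 1 + l 2 + l 3) - 1) k *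
        poch0 .W (l 0 + l 1 + k) (n - k) * poch0 .W (l 0 + l 2 + k) (n - k) *
        poch0 .W (l 0 + l 3 + k) (n - k) / (k.factorial : ℂ) *
        (poch .W (l 0) z k * poch .W (l 0) (-z) k) := fun z =>
          Finset.sum_congr rfl fun k _ => by ring
    simp only [e]
    simp only [mul_add, mul_sub, Finset.sum_add_distrib, Finset.sum_sub_distrib] at H
    have m : ∀ (a : ℂ) (f g : ℕ → ℂ), ∑ k ∈ Finset.range (n + 1), f k * (a * g k) =
      a * ∑ k ∈ Finset.range (n + 1), f k * g k := fun a f g => by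
        rw [Finset.mul_sum]; exact Finset.sum_congr rfl fun k _ => by ring
    simp only [m] at H
    linear_combination H
  · intro k
    rw [neg_sub', neg_add', sub_neg_eq_add]
    simp only [poch_shift_down, poch_shift_up]
    have u1 : poch .W (l 0 - 1) y (k + 1) = lin .W (l 0 - 1) y * poch .W (l 0) y k := by
      rw [poch_succ', sub_add_cancel]
    have u2 : poch .W (l 0 - 1) (-y) (k + 1) = lin .W (l 0 - 1) (-y) * poch .W (l 0) (-y) k := by
      rw [poch_succ', sub_add_cancel]
    have v1 : lin .W (l 0) y * poch .W (l 0 + 1) y (k + 1) =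
        poch .W (l 0) y k * lin .W (l 0 + k) y * lin .W (l 0 + (k + 1 : ℕ)) y := by
      rw [← poch_succ', poch_succ, poch_succ]
    have v2 : lin .W (l 0) (-y) * poch .W (l 0 + 1) (-y) (k + 1) =
        poch .W (l 0) (-y) k * lin .W (l 0 + k) (-y) * lin .W (l 0 + (k + 1 : ℕ)) (-y) := by
      rw [← poch_succ', poch_succ, poch_succ]
    rw [u1, u2, poch_succ .W (l 0) y k, poch_succ .W (l 0) (-y) k]
    simp only [potDen] at h1 h2
    simp only [pot, potStar, eigE, Fin.prod_univ_four, potDen]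
    rw [div_mul_eq_mul_div, div_mul_eq_mul_div, div_add_div _ _ h1 h2, div_eq_iff (mul_ne_zero h1 h2)]
    simp only [lin] at *
    push_cast at *
    generalize poch .W (l 0) y k = p1 at *
    generalize poch .W (l 0) (-y) k = p2 at *
    generalize poch .W (l 0 + 1) y (k + 1) = r1 at *
    generalize poch .W (l 0 + 1) (-y) (k + 1) = r2 at *
    -- The substitution X = iy removes the imaginary unit, so that the claim becomes a polynomial
    -- identity in X and the parameters.
    obtain ⟨X, rfl⟩ : ∃ X, y = -(I * X) := ⟨I * y, by linear_combination y * I_mul_I⟩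
    have hX : I * -(I * X) = X := by linear_combination (-X) * I_mul_I
    have hX' : I * -(-(I * X)) = -X := by linear_combination X * I_mul_I
    have hX2 : 2 * I * -(I * X) = 2 * X := by linear_combination (-2 * X) * I_mul_I
    have hX2' : 2 * I * -(-(I * X)) = -2 * X := by linear_combination (2 * X) * I_mul_I
    rw [hX] at v1
    rw [hX'] at v2
    rw [hX, hX', hX2, hX2']
    linear_combination (((l 1 + X) * (l 2 + X) * (l 3 + X)) * ((l 0 - 1 - X) * p2) *
      (-2 * X * (-2 * X + 1))) * v1 + (((l 1 - X) * (l 2 - X) * (l 3 - X)) * ((l 0 - 1 + X) * p1) *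
      (2 * X * (2 * X + 1))) * v2
  · intro k hk
    obtain ⟨m, rfl⟩ : ∃ m, n = k + 1 + m := ⟨n - k - 1, by omega⟩
    rw [show k + 1 + m - k = m + 1 by omega, show k + 1 + m - (k + 1) = m by omega]
    simp only [poch0]
    rw [poch_succ' _ (l 0 + l 1 + k), poch_succ' _ (l 0 + l 2 + k), poch_succ' _ (l 0 + l 3 + k),
      poch_succ _ _ _ k, poch_succ _ _ _ k, Nat.factorial_succ]
    have h1 : (k.factorial : ℂ) ≠ 0 := by exact_mod_cast k.factorial_ne_zero
    have h2 : (k : ℂ) + 1 ≠ 0 := by exact_mod_cast k.succ_ne_zero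
    simp only [lin, eigE]
    push_cast
    simp only [← add_assoc]
    field_simp
    ring

lemma lin_AW {q : ℝ} (h0 : 0 < q) (h1 : q < 1) (s y : ℂ) :
    lin (.AW q h0 h1) s y = 1 - (q : ℂ) ^ s * exp (I * y) := rfl

lemma lin_AW_neg {q : ℝ} (h0 : 0 < q) (h1 : q < 1) (s y : ℂ) :
    lin (.AW q h0 h1) s (-y) = 1 - (q : ℂ) ^ s * (exp (I * y))⁻¹ := by
  rw [lin_AW, ← exp_neg]; congr 3; ring

lemma poch0_AW_one_ne_zero {q : ℝ} (h0 : 0 < q) (h1 : q < 1) (k : ℕ) :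
    poch0 (.AW q h0 h1) 1 k ≠ 0 := by
  rw [poch0, poch, Finset.prod_ne_zero_iff]
  intro i _
  rw [lin_AW, mul_zero, exp_zero, mul_one, sub_ne_zero,
    show (1 : ℂ) + i = ((i + 1 : ℕ) : ℂ) by push_cast; ring, cpow_natCast]
  have : q ^ (i + 1) < 1 := pow_lt_one₀ h0.le h1 (by omega)
  exact_mod_cast this.ne'

lemma eigen_AW {q : ℝ} (h0 : 0 < q) (h1 : q < 1) (l : Fin 4 → ℂ) (n : ℕ) (y : ℂ)
    (hd1 : potDen (.AW q h0 h1) y ≠ 0) (hd2 : potDen (.AW q h0 h1) (-y) ≠ 0) :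
    pot (.AW q h0 h1) l y * (basePoly (.AW q h0 h1) l n (y - I * gam (.AW q h0 h1)) -
        basePoly (.AW q h0 h1) l n y) +
      potStar (.AW q h0 h1) l y * (basePoly (.AW q h0 h1) l n (y + I * gam (.AW q h0 h1)) -
        basePoly (.AW q h0 h1) l n y) =
    eigE (.AW q h0 h1) l n * basePoly (.AW q h0 h1) l n y := by
  have hq : (q : ℂ) ≠ 0 := by exact_mod_cast h0.ne'
  have hz : exp (I * y) ≠ 0 := exp_ne_zero _
  have H := eigen_of_ladder (n := n)
    (fun k => poch0 (.AW q h0 h1) (-n) k *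
            poch0 (.AW q h0 h1) (n + (l 0 + l 1 + l 2 + l 3) - 1) k *
            poch0 (.AW q h0 h1) (l 0 + l 1 + k) (n - k) *
            poch0 (.AW q h0 h1) (l 0 + l 2 + k) (n - k) *
            poch0 (.AW q h0 h1) (l 0 + l 3 + k) (n - k) * (q : ℂ) ^ k /
            poch0 (.AW q h0 h1) 1 k)
    (eigE (.AW q h0 h1) l) (fun k => ((q : ℂ) ^ (k + 1))⁻¹ * lin (.AW q h0 h1) (1 + k) 0 *
      lin (.AW q h0 h1) (l 0 + l 1 + k) 0 * lin (.AW q h0 h1) (l 0 + l 2 + k) 0 *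
      lin (.AW q h0 h1) (l 0 + l 3 + k) 0)
    (fun k => poch (.AW q h0 h1) (l 0) y k * poch (.AW q h0 h1) (l 0) (-y) k)
    (fun k => pot (.AW q h0 h1) l y * (poch (.AW q h0 h1) (l 0) (y - I * gam (.AW q h0 h1)) k *
        poch (.AW q h0 h1) (l 0) (-(y - I * gam (.AW q h0 h1))) k
        - poch (.AW q h0 h1) (l 0) y k * poch (.AW q h0 h1) (l 0) (-y) k) +
      potStar (.AW q h0 h1) l y * (poch (.AW q h0 h1) (l 0) (y + I * gam (.AW q h0 h1)) k *
        poch (.AW q h0 h1) (l 0) (-(y + I * gam (.AW q h0 h1))) k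
        - poch (.AW q h0 h1) (l 0) y k * poch (.AW q h0 h1) (l 0) (-y) k))
    (by simp [poch_zero, eigE]) ?_ ?_
  · simp only [basePoly]
    have e : ∀ z : ℂ, ∑ k ∈ Finset.range (n + 1),
          poch0 (.AW q h0 h1) (-n) k *
            poch0 (.AW q h0 h1) (n + (l 0 + l 1 + l 2 + l 3) - 1) k *
            poch (.AW q h0 h1) (l 0) z k * poch (.AW q h0 h1) (l 0) (-z) k *
            poch0 (.AW q h0 h1) (l 0 + l 1 + k) (n - k) *
            poch0 (.AW q h0 h1) (l 0 + l 2 + k) (n - k) *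
            poch0 (.AW q h0 h1) (l 0 + l 3 + k) (n - k) * (q : ℂ) ^ k /
            poch0 (.AW q h0 h1) 1 k = ∑ k ∈ Finset.range (n + 1),
        poch0 (.AW q h0 h1) (-n) k *
            poch0 (.AW q h0 h1) (n + (l 0 + l 1 + l 2 + l 3) - 1) k *
            poch0 (.AW q h0 h1) (l 0 + l 1 + k) (n - k) *
            poch0 (.AW q h0 h1) (l 0 + l 2 + k) (n - k) *
            poch0 (.AW q h0 h1) (l 0 + l 3 + k) (n - k) * (q : ℂ) ^ k /
            poch0 (.AW q h0 h1) 1 k *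
        (poch (.AW q h0 h1) (l 0) z k * poch (.AW q h0 h1) (l 0) (-z) k) := fun z =>
          Finset.sum_congr rfl fun k _ => by ring
    simp only [e]
    simp only [mul_add, mul_sub, Finset.sum_add_distrib, Finset.sum_sub_distrib] at H
    have m : ∀ (a : ℂ) (f g : ℕ → ℂ), ∑ k ∈ Finset.range (n + 1), f k * (a * g k) =
      a * ∑ k ∈ Finset.range (n + 1), f k * g k := fun a f g => by
        rw [Finset.mul_sum]; exact Finset.sum_congr rfl fun k _ => by ring
    simp only [m] at H
    linear_combination ((q : ℂ) ^ (-(n * l 0))) * H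
  · intro k
    rw [neg_sub', neg_add', sub_neg_eq_add]
    simp only [poch_shift_down, poch_shift_up]
    have u1 : poch (.AW q h0 h1) (l 0 - 1) y (k + 1) =
        lin (.AW q h0 h1) (l 0 - 1) y * poch (.AW q h0 h1) (l 0) y k := by
      rw [poch_succ', sub_add_cancel]
    have u2 : poch (.AW q h0 h1) (l 0 - 1) (-y) (k + 1) =
        lin (.AW q h0 h1) (l 0 - 1) (-y) * poch (.AW q h0 h1) (l 0) (-y) k := by
      rw [poch_succ', sub_add_cancel]
    have v1 : lin (.AW q h0 h1) (l 0) y * poch (.AW q h0 h1) (l 0 + 1) y (k + 1) =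
        poch (.AW q h0 h1) (l 0) y k * lin (.AW q h0 h1) (l 0 + k) y *
          lin (.AW q h0 h1) (l 0 + (k + 1 : ℕ)) y := by
      rw [← poch_succ', poch_succ, poch_succ]
    have v2 : lin (.AW q h0 h1) (l 0) (-y) * poch (.AW q h0 h1) (l 0 + 1) (-y) (k + 1) =
        poch (.AW q h0 h1) (l 0) (-y) k * lin (.AW q h0 h1) (l 0 + k) (-y) *
          lin (.AW q h0 h1) (l 0 + (k + 1 : ℕ)) (-y) := by
      rw [← poch_succ', poch_succ, poch_succ]
    rw [u1, u2, poch_succ (.AW q h0 h1) (l 0) y k, poch_succ (.AW q h0 h1) (l 0) (-y) k]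
    have hz2 : exp (2 * I * y) = exp (I * y) ^ 2 := by rw [← exp_nat_mul]; congr 1; push_cast; ring
    have hz3 : exp (2 * I * (-y)) = (exp (I * y) ^ 2)⁻¹ := by
      rw [← hz2, ← exp_neg]; congr 1; ring
    simp only [potDen, hz2, hz3] at hd1 hd2
    simp only [pot, potStar, eigE, Fin.prod_univ_four, potDen, hz2, hz3]
    rw [div_mul_eq_mul_div, div_mul_eq_mul_div, div_add_div _ _ hd1 hd2,
      div_eq_iff (mul_ne_zero hd1 hd2)]
    simp only [lin_AW_neg] at *
    simp only [lin_AW, mul_zero, exp_zero, mul_one, Nat.cast_add, Nat.cast_one, cpow_neg,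
      cpow_add _ _ hq, cpow_sub _ _ hq, cpow_natCast, cpow_one] at *
    generalize poch (.AW q h0 h1) (l 0) y k = p1 at *
    generalize poch (.AW q h0 h1) (l 0) (-y) k = p2 at *
    generalize poch (.AW q h0 h1) (l 0 + 1) y (k + 1) = r1 at *
    generalize poch (.AW q h0 h1) (l 0 + 1) (-y) (k + 1) = r2 at *
    have ha : ∀ i, (q : ℂ) ^ (l i) ≠ 0 := fun i => by simp [cpow_eq_zero_iff, hq]
    have hk : (q : ℂ) ^ k ≠ 0 := pow_ne_zero _ hq
    clear u1 u2
    generalize exp (I * y) = z at *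
    have ha0 := ha 0
    generalize (q : ℂ) ^ (l 0) = a at *
    generalize (q : ℂ) ^ (l 1) = b at *
    generalize (q : ℂ) ^ (l 2) = c at *
    generalize (q : ℂ) ^ (l 3) = d at *
    rw [pow_succ (q : ℂ) k]
    generalize (q : ℂ) ^ k = t at *
    generalize (q : ℂ) = Q at *
    linear_combination (norm := (field_simp; ring))
      ((1 - b * z) * (1 - c * z) * (1 - d * z) * ((1 - a / Q * z⁻¹) * p2) *
        ((1 - (z ^ 2)⁻¹) * (1 - Q * (z ^ 2)⁻¹))) * v1 +
      ((1 - b * z⁻¹) * (1 - c * z⁻¹) * (1 - d * z⁻¹) * ((1 - a / Q * z) * p1) *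
        ((1 - z ^ 2) * (1 - Q * z ^ 2))) * v2
  · intro k hk
    obtain ⟨m, rfl⟩ : ∃ m, n = k + 1 + m := ⟨n - k - 1, by omega⟩
    rw [show k + 1 + m - k = m + 1 by omega, show k + 1 + m - (k + 1) = m by omega]
    have h1' := poch0_AW_one_ne_zero h0 h1 k
    have h2' := poch0_AW_one_ne_zero h0 h1 (k + 1)
    simp only [poch0] at *
    rw [poch_succ] at h2'
    rw [poch_succ' _ (l 0 + l 1 + k), poch_succ' _ (l 0 + l 2 + k), poch_succ' _ (l 0 + l 3 + k),
      poch_succ _ _ _ k, poch_succ _ _ _ k, poch_succ _ _ _ k]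
    have h3 := (mul_ne_zero_iff.1 h2').2
    simp only [Nat.cast_add, Nat.cast_one, ← add_assoc] at *
    generalize poch (.AW q h0 h1) 1 0 k = p0 at *
    simp only [eigE, lin_AW, mul_zero, exp_zero, mul_one, Nat.cast_add, Nat.cast_one, cpow_neg,
      cpow_add _ _ hq, cpow_sub _ _ hq, cpow_natCast, cpow_one, neg_add] at *
    rw [pow_succ]
    have ht : (q : ℂ) ^ k ≠ 0 := pow_ne_zero _ hq
    have ht' : (q : ℂ) ^ m ≠ 0 := pow_ne_zero _ hq
    generalize (q : ℂ) ^ k = t at *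
    generalize (q : ℂ) ^ m = u at *
    generalize (q : ℂ) ^ (l 0) = a at *
    generalize (q : ℂ) ^ (l 1) = b at *
    generalize (q : ℂ) ^ (l 2) = c at *
    generalize (q : ℂ) ^ (l 3) = d at *
    generalize (q : ℂ) = Q at *
    generalize 1 - Q * t = w at *
    field_simp
    ring

/-- The eigenvalue equation of the base polynomials. -/
lemma eigen_base (S : System) (l : Fin 4 → ℂ) (n : ℕ) (y : ℂ) (h1 : potDen S y ≠ 0)
    (h2 : potDen S (-y) ≠ 0) :
    pot S l y * basePoly S l n (y - I * gam S) + potStar S l y * basePoly S l n (y + I * gam S) =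
      (pot S l y + potStar S l y + eigE S l n) * basePoly S l n y := by
  have : pot S l y * (basePoly S l n (y - I * gam S) - basePoly S l n y) +
      potStar S l y * (basePoly S l n (y + I * gam S) - basePoly S l n y) =
      eigE S l n * basePoly S l n y := by
    cases S with
    | cH => exact eigen_cH l n y
    | W => exact eigen_W l n y h1 h2
    | AW q h0 h1' => exact eigen_AW h0 h1' l n y h1 h2
  linear_combination this

/-! ### Potentials through differences of η, twists and energies -/

/-- The normalization constant of the potentials. -/
noncomputable def kap : System → ℂ
  | .cH => -2
  | .W => 2
  | .AW q _ _ => (1 - q) * (1 - q ^ 2) / (4 * q ^ 2)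

lemma kap_ne_zero (S : System) : kap S ≠ 0 := by
  cases S with
  | cH => simp [kap]
  | W => simp [kap]
  | AW q h0 h1 =>
    have h2 : q ^ 2 < 1 := pow_lt_one₀ h0.le h1 (by omega)
    have : (1 - q) * (1 - q ^ 2) / (4 * q ^ 2) ≠ 0 := by
      have : 0 < 1 - q := by linarith
      have : 0 < 1 - q ^ 2 := by linarith
      positivity
    simp only [kap]
    exact_mod_cast this

/-- Differences of `η` at the site and its neighbours. -/
noncomputable def etaDm (S : System) (y : ℂ) : ℂ :=
  (eta S (y - I * gam S) - eta S y) * (eta S (y - I * gam S) - eta S (y + I * gam S))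

/-- Differences of `η` at the site and its neighbours. -/
noncomputable def etaDp (S : System) (y : ℂ) : ℂ :=
  (eta S (y + I * gam S) - eta S y) * (eta S (y + I * gam S) - eta S (y - I * gam S))

lemma eta_neg_comm (S : System) (hS : S ≠ .cH) (y : ℂ) : eta S (-y) = eta S y := by
  cases S with
  | cH => exact absurd rfl hS
  | W => simp [eta]
  | AW q h0 h1 => simp [eta]

lemma etaDp_eq (S : System) (hS : S ≠ .cH) (y : ℂ) : etaDp S y = etaDm S (-y) := by
  rw [etaDp, etaDm, eta_neg_comm S hS, ← eta_neg_comm S hS (-y + I * gam S),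
    ← eta_neg_comm S hS (-y - I * gam S)]
  congr 3 <;> ring_nf

lemma exp_I_shift {q : ℝ} (h0 : 0 < q) (y : ℂ) :
    exp (I * (y - I * ((Real.log q : ℝ) : ℂ))) = q * exp (I * y) := by
  rw [show I * (y - I * ((Real.log q : ℝ) : ℂ)) = ((Real.log q : ℝ) : ℂ) + I * y by
    linear_combination (-((Real.log q : ℝ) : ℂ)) * I_mul_I, exp_add, ← ofReal_exp, Real.exp_log h0]

lemma exp_I_shift' {q : ℝ} (h0 : 0 < q) (y : ℂ) :
    exp (I * (y + I * ((Real.log q : ℝ) : ℂ))) = (q : ℂ)⁻¹ * exp (I * y) := by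
  rw [show I * (y + I * ((Real.log q : ℝ) : ℂ)) = -((Real.log q : ℝ) : ℂ) + I * y by
    linear_combination ((Real.log q : ℝ) : ℂ) * I_mul_I, exp_add, exp_neg, ← ofReal_exp,
    Real.exp_log h0]

lemma cos_eq_exp (y : ℂ) : cos y = (exp (I * y) + (exp (I * y))⁻¹) / 2 := by
  rw [← exp_neg, Complex.cos]; congr 3 <;> ring_nf

/-- Up to constants and phases, the denominator of V is a product of two differences of η. Written
this way, the potentials combine with the Vandermonde factors when windows of sites are compared. -/
lemma etaDm_eq_potDen (S : System) (y : ℂ) :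
    etaDm S y * phA S y ^ 2 = kap S * potDen S y * phA S y ^ 4 := by
  cases S with
  | cH => simp [etaDm, kap, potDen, phA, eta, gam]; linear_combination (-2) * I_mul_I
  | W =>
    simp only [etaDm, kap, potDen, phA, eta, gam]
    linear_combination (-4 * I * y) * I_mul_I
  | AW q h0 h1 =>
    have hq : (q : ℂ) ≠ 0 := by exact_mod_cast h0.ne'
    have hz : exp (I * y) ≠ 0 := exp_ne_zero _
    have hz2 : exp (2 * I * y) = exp (I * y) ^ 2 := by rw [← exp_nat_mul]; congr 1; push_cast; ring
    simp only [etaDm, kap, potDen, phA, eta, gam, cos_eq_exp, exp_I_shift h0, exp_I_shift' h0, hz2,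
      exp_neg]
    field_simp
    ring

lemma etaDm_ne_zero (S : System) (y : ℂ) (h : potDen S y ≠ 0) : etaDm S y ≠ 0 := by
  intro h0
  have := etaDm_eq_potDen S y
  rw [h0, zero_mul] at this
  exact mul_ne_zero (mul_ne_zero (kap_ne_zero S) h) (pow_ne_zero 4 (phA_ne_zero S y)) this.symm

lemma etaDp_ne_zero (S : System) (y : ℂ) (h : potDen S (-y) ≠ 0) : etaDp S y ≠ 0 := by
  by_cases hS : S = .cH
  · subst hS
    simp only [etaDp, eta, gam]
    ring_nf; simp
  · rw [etaDp_eq S hS]; exact etaDm_ne_zero S _ h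

lemma pot_eq (S : System) (l : Fin 4 → ℂ) (y : ℂ) (h : potDen S y ≠ 0) :
    pot S l y = kap S * (hA S l .I y * hA S l .II y) / etaDm S y := by
  have e := etaDm_eq_potDen S y
  have hD := etaDm_ne_zero S y h
  rw [eq_div_iff hD]
  have hp := phA_ne_zero S y
  have : etaDm S y = kap S * potDen S y * phA S y ^ 2 := by
    apply mul_right_cancel₀ (pow_ne_zero 2 hp)
    linear_combination e
  rw [this]
  cases S with
  | cH => simp [pot, potDen, hA, plusPar]; ring
  | W => simp only [pot, hA, plusPar, Fin.prod_univ_four]; field_simp; simp; ring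
  | AW q h0 h1 => simp only [pot, hA, plusPar, Fin.prod_univ_four]; field_simp; simp; ring

lemma phB_eq (S : System) (hS : S ≠ .cH) (y : ℂ) : phB S y = phA S (-y) := by
  cases S with
  | cH => exact absurd rfl hS
  | W => simp [phA, phB]
  | AW q h0 h1 => simp [phA, phB]

lemma minusPar_eq (S : System) (hS : S ≠ .cH) (T : VType) : minusPar S T = plusPar S T := by
  cases S <;> cases T <;> first | rfl | exact absurd rfl hS

lemma hB_eq (S : System) (hS : S ≠ .cH) (l : Fin 4 → ℂ) (T : VType) (y : ℂ) :
    hB S l T y = hA S l T (-y) := by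
  rw [hA, hB, phB_eq S hS, minusPar_eq S hS]

lemma potStar_eq (S : System) (l : Fin 4 → ℂ) (y : ℂ) (h : potDen S (-y) ≠ 0) :
    potStar S l y = kap S * (hB S l .I y * hB S l .II y) / etaDp S y := by
  by_cases hS : S = .cH
  · subst hS
    rw [eq_div_iff (etaDp_ne_zero _ _ h)]
    simp [potStar, hB, minusPar, kap, phB, etaDp, eta, gam]
    linear_combination (2 * lin .cH (l 2) (-y) * lin .cH (l 3) (-y)) * I_mul_I
  · rw [hB_eq S hS, hB_eq S hS, etaDp_eq S hS, ← pot_eq S l _ h]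
    cases S with
    | cH => exact absurd rfl hS
    | W => rfl
    | AW q h0 h1 => rfl

/-- The factor by which the Hamiltonian with twisted parameters is rescaled. -/
noncomputable def alph : System → (Fin 4 → ℂ) → VType → ℂ
  | .cH, _, _ => 1
  | .W, _, _ => 1
  | .AW q _ _, l, .I => (q : ℂ) ^ (l 0 + l 1 - 1)
  | .AW q _ _, l, .II => (q : ℂ) ^ (l 2 + l 3 - 1)

/-- Replacing a by 1 - a converts a factor in -i(y - iγ) with the old parameter into a factor in +iy
with the new one. Thus a twist interchanges the factors of `hA` and `hB` at neighbouring sites, up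
to the constant `alph`. -/
lemma hB_twist (S : System) (l : Fin 4 → ℂ) (T : VType) (y : ℂ) :
    hB S l T (y - I * gam S) = alph S l T * hA S (twist S T l) T y := by
  cases S with
  | cH =>
    cases T <;> simp [hA, hB, alph, minusPar, plusPar, twist, lin, gam, phA, phB] <;>
      linear_combination I_mul_I
  | W =>
    cases T <;> simp [hA, hB, alph, minusPar, plusPar, twist, lin, gam, phA, phB]
    · linear_combination (l 0 + l 1 - 1 - 2 * I * y + I * I) * I_mul_I
    · linear_combination (l 2 + l 3 - 1 - 2 * I * y + I * I) * I_mul_I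
  | AW q h0 h1 =>
    have hq : (q : ℂ) ≠ 0 := by exact_mod_cast h0.ne'
    have hz : exp (I * y) ≠ 0 := exp_ne_zero _
    have ha : ∀ i, (q : ℂ) ^ (l i) ≠ 0 := fun i => by simp [cpow_eq_zero_iff, hq]
    have ha0 := ha 0
    have ha1 := ha 1
    have ha2 := ha 2
    have ha3 := ha 3
    cases T <;>
    · simp only [hA, hB, lin_AW_neg]
      simp [alph, minusPar, plusPar, twist, gam, phA, phB, lin_AW,
        exp_I_shift h0, cpow_add _ _ hq, cpow_sub _ _ hq, exp_neg]
      field_simp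
      ring

lemma hA_twist (S : System) (l : Fin 4 → ℂ) (T : VType) (y : ℂ) :
    hA S l T (y + I * gam S) = alph S l T * hB S (twist S T l) T y := by
  cases S with
  | cH =>
    cases T <;> simp [hA, hB, alph, minusPar, plusPar, twist, lin, gam, phA, phB] <;>
      linear_combination -I_mul_I
  | W =>
    have := hB_twist .W l T (-y)
    rw [hB_eq _ (by simp)] at this
    rw [hB_eq _ (by simp), ← this]; congr 1; ring
  | AW q h0 h1 =>
    have := hB_twist (.AW q h0 h1) l T (-y)
    rw [hB_eq _ (by simp)] at this
    rw [hB_eq _ (by simp), ← this]; congr 1; ring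

/-- The other type. -/
def VType.other : VType → VType
  | .I => .II
  | .II => .I

lemma hA_twist_other (S : System) (l : Fin 4 → ℂ) (T : VType) (y : ℂ) :
    hA S (twist S T l) T.other y = hA S l T.other y := by
  cases S <;> cases T <;> simp [hA, plusPar, twist, VType.other]

lemma hB_twist_other (S : System) (l : Fin 4 → ℂ) (T : VType) (y : ℂ) :
    hB S (twist S T l) T.other y = hB S l T.other y := by
  cases S <;> cases T <;> simp [hB, minusPar, twist, VType.other]

/-- The sum of the parameters changed by a twist. -/
def parSum : System → VType → (Fin 4 → ℂ) → ℂ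
  | .cH, .I, l => l 0 + l 2
  | .cH, .II, l => l 1 + l 3
  | _, .I, l => l 0 + l 1
  | _, .II, l => l 2 + l 3

/-- The normalized energies of the eigenpolynomials and seed functions. -/
noncomputable def energy : (S : System) → (Fin 4 → ℂ) → Option VType → ℂ → ℂ
  | .AW q h0 h1, l, none, v =>
      (q : ℂ) ^ (-v) + (q : ℂ) ^ (parSum (.AW q h0 h1) .I l + parSum (.AW q h0 h1) .II l + v - 1)
  | .AW q h0 h1, l, some T, v =>
      (q : ℂ) ^ (parSum (.AW q h0 h1) T l - v - 1) + (q : ℂ) ^ (parSum (.AW q h0 h1) T.other l + v)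
  | S, l, none, v => (v + (parSum S .I l + parSum S .II l - 1) / 2) ^ 2
  | S, l, some T, v => (v + (1 - parSum S T l + parSum S T.other l) / 2) ^ 2

/-- The constant relating the two normalizations of the energy. -/
noncomputable def energy0 : (S : System) → (Fin 4 → ℂ) → ℂ
  | .AW q _ _, l => 1 + (q : ℂ) ^ (l 0 + l 1 + l 2 + l 3 - 1)
  | _, l => ((l 0 + l 1 + l 2 + l 3 - 1) / 2) ^ 2

lemma energy_none (S : System) (l : Fin 4 → ℂ) (n : ℕ) :
    energy S l none n = eigE S l n + energy0 S l := by
  cases S with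
  | cH => simp only [energy, eigE, energy0, parSum]; ring
  | W => simp only [energy, eigE, energy0, parSum]; ring
  | AW q h0 h1 =>
    have hq : (q : ℂ) ≠ 0 := by exact_mod_cast h0.ne'
    simp only [energy, eigE, energy0, parSum, cpow_add _ _ hq, cpow_sub _ _ hq, cpow_neg]
    have : (q : ℂ) ^ (n : ℂ) ≠ 0 := by simp [hq]
    field_simp
    ring

/-- The twisted Hamiltonian is rescaled by `alph` in order to share the diagonal coefficient with
the untwisted one. With the offset `energy0` the eigenvalues become perfect squares (cH, W) or
symmetric sums of two powers of q (AW). -/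
lemma energy_some (S : System) (l : Fin 4 → ℂ) (T : VType) (n : ℕ) :
    energy S l (some T) n =
      alph S l T * (eigE S (twist S T l) n + energy0 S (twist S T l)) := by
  cases S with
  | cH => cases T <;> simp [energy, eigE, energy0, parSum, twist, alph, VType.other] <;> ring
  | W => cases T <;> simp [energy, eigE, energy0, parSum, twist, alph, VType.other] <;> ring
  | AW q h0 h1 =>
    have hq : (q : ℂ) ≠ 0 := by exact_mod_cast h0.ne'
    have ha : ∀ i : ℂ, (q : ℂ) ^ i ≠ 0 := fun i => by simp [cpow_eq_zero_iff, hq]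
    have hn : (q : ℂ) ^ n ≠ 0 := pow_ne_zero _ hq
    have ha0 := ha (l 0)
    have ha1 := ha (l 1)
    have ha2 := ha (l 2)
    have ha3 := ha (l 3)
    cases T <;>
    · simp [energy, eigE, energy0, parSum, twist, alph, VType.other, cpow_add _ _ hq,
        cpow_sub _ _ hq, cpow_neg]
      field_simp
      ring

-- The diagonal coefficient is invariant under the twist after rescaling by `alph` and subtraction
-- of `energy0`. This is what allows seed functions of both types and eigenpolynomials to satisfy
-- recurrences with the same diagonal.
set_option maxHeartbeats 1000000 in
lemma pot_twist (S : System) (l : Fin 4 → ℂ) (T : VType) (y : ℂ) (h1 : potDen S y ≠ 0)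
    (h2 : potDen S (-y) ≠ 0) :
    alph S l T * (pot S (twist S T l) y + potStar S (twist S T l) y - energy0 S (twist S T l)) =
      pot S l y + potStar S l y - energy0 S l := by
  cases S with
  | cH =>
    cases T <;> simp [alph, pot, potStar, energy0, twist, lin] <;> ring
  | W =>
    simp only [potDen] at h1 h2
    obtain ⟨X, rfl⟩ : ∃ X, y = -(I * X) := ⟨I * y, by linear_combination y * I_mul_I⟩
    have hX : I * -(I * X) = X := by linear_combination (-X) * I_mul_I
    have hX' : I * -(-(I * X)) = -X := by linear_combination X * I_mul_I
    have hX2 : 2 * I * -(I * X) = 2 * X := by linear_combination (-2 * X) * I_mul_I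
    have hX2' : 2 * I * -(-(I * X)) = -2 * X := by linear_combination (2 * X) * I_mul_I
    rw [hX2] at h1
    rw [hX2'] at h2
    have e0 : X ≠ 0 := by rintro rfl; simp at h1
    have e1 : 2 * X + 1 ≠ 0 := (mul_ne_zero_iff.1 h1).2
    have e2 : 1 - 2 * X ≠ 0 := by
      have := (mul_ne_zero_iff.1 h2).2
      intro h; apply this; linear_combination h
    have f2 : -2 * X * (-2 * X + 1) = -(2 * X * (1 - 2 * X)) := by ring
    simp only [alph, pot, potStar, energy0, Fin.prod_univ_four, lin, potDen, hX, hX', hX2, hX2', f2,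
      div_neg]
    generalize hu : 2 * X + 1 = u at *
    generalize hw : 1 - 2 * X = w at *
    cases T <;>
    · simp only [twist, Matrix.cons_val]
      field_simp
      rw [← hu, ← hw]
      ring
  | AW q h0 h1' =>
    have hq : (q : ℂ) ≠ 0 := by exact_mod_cast h0.ne'
    have hz : exp (I * y) ≠ 0 := exp_ne_zero _
    have ha : ∀ i : ℂ, (q : ℂ) ^ i ≠ 0 := fun i => by simp [cpow_eq_zero_iff, hq]
    have ha0 := ha (l 0)
    have ha1 := ha (l 1)
    have ha2 := ha (l 2)
    have ha3 := ha (l 3)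
    have hz2 : exp (2 * I * y) = exp (I * y) ^ 2 := by rw [← exp_nat_mul]; congr 1; push_cast; ring
    have hz3 : exp (2 * I * (-y)) = (exp (I * y) ^ 2)⁻¹ := by
      rw [← hz2, ← exp_neg]; congr 1; ring
    simp only [potDen, hz2, hz3] at h1 h2
    simp only [alph, pot, potStar, energy0, Fin.prod_univ_four, lin_AW_neg]
    simp only [lin_AW, potDen, hz2, hz3]
    have e0 : 1 - exp (I * y) ^ 2 ≠ 0 := (mul_ne_zero_iff.1 h1).1
    have e1 : 1 - q * exp (I * y) ^ 2 ≠ 0 := (mul_ne_zero_iff.1 h1).2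
    have e2 : exp (I * y) ^ 2 - q ≠ 0 := by
      have := (mul_ne_zero_iff.1 h2).2
      intro h; apply this
      field_simp; linear_combination h
    have f2 : (1 - (exp (I * y) ^ 2)⁻¹) * (1 - (q : ℂ) * (exp (I * y) ^ 2)⁻¹) =
        -((1 - exp (I * y) ^ 2) * (exp (I * y) ^ 2 - q)) / exp (I * y) ^ 4 := by
      field_simp; ring
    rw [f2]
    cases T <;>
    · simp [twist, cpow_add _ _ hq, cpow_sub _ _ hq]
      generalize exp (I * y) = z at *
      generalize (q : ℂ) ^ (l 0) = a at *
      generalize (q : ℂ) ^ (l 1) = b at *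
      generalize (q : ℂ) ^ (l 2) = c at *
      generalize (q : ℂ) ^ (l 3) = d at *
      generalize (q : ℂ) = Q at *
      generalize hu : 1 - z ^ 2 = u at *
      generalize hv : 1 - Q * z ^ 2 = v at *
      generalize hw : z ^ 2 - Q = w at *
      field_simp
      rw [← hu, ← hv, ← hw]
      ring

/-! ### One recurrence for eigenpolynomials and seed functions -/

/-- The polynomial part of an eigenfunction (`none`) or of a seed function (`some T`). -/
noncomputable def colPoly (S : System) (l : Fin 4 → ℂ) : Option VType → ℕ → ℂ → ℂ
  | none, n, y => basePoly S l n y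
  | some T, n, y => seedPoly S l T n y

/-- The normalized diagonal coefficient. -/
noncomputable def diagC (S : System) (l : Fin 4 → ℂ) (y : ℂ) : ℂ :=
  pot S l y + potStar S l y - energy0 S l

lemma recurrence_none (S : System) (l : Fin 4 → ℂ) (n : ℕ) (y : ℂ) (h1 : potDen S y ≠ 0)
    (h2 : potDen S (-y) ≠ 0) :
    kap S * (hA S l .I y * hA S l .II y) / etaDm S y * colPoly S l none n (y - I * gam S) +
      kap S * (hB S l .I y * hB S l .II y) / etaDp S y * colPoly S l none n (y + I * gam S) =
      (diagC S l y + energy S l none n) * colPoly S l none n y := by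
  rw [← pot_eq S l y h1, ← potStar_eq S l y h2, energy_none]
  have := eigen_base S l n y h1 h2
  simp only [colPoly, diagC]
  linear_combination this

/-- This is the eigenvalue equation with twisted parameters, times `alph`. The factors of type T are
rewritten by `hA_twist` and `hB_twist` as untwisted factors at the neighbouring sites; those of the
other type are untouched by the twist. -/
lemma recurrence_some (S : System) (l : Fin 4 → ℂ) (T : VType) (n : ℕ) (y : ℂ)
    (h1 : potDen S y ≠ 0) (h2 : potDen S (-y) ≠ 0) :
    kap S * (hB S l T (y - I * gam S) * hA S l T.other y) / etaDm S y *
        colPoly S l (some T) n (y - I * gam S) +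
      kap S * (hA S l T (y + I * gam S) * hB S l T.other y) / etaDp S y *
        colPoly S l (some T) n (y + I * gam S) =
      (diagC S l y + energy S l (some T) n) * colPoly S l (some T) n y := by
  have e := eigen_base S (twist S T l) n y h1 h2
  have hp := pot_eq S (twist S T l) y h1
  have hs := potStar_eq S (twist S T l) y h2
  have hA' : hA S (twist S T l) .I y * hA S (twist S T l) .II y =
      hA S (twist S T l) T y * hA S l T.other y := by
    rw [← hA_twist_other]; cases T <;> simp [VType.other, mul_comm]
  have hB' : hB S (twist S T l) .I y * hB S (twist S T l) .II y =
      hB S (twist S T l) T y * hB S l T.other y := by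
    rw [← hB_twist_other]; cases T <;> simp [VType.other, mul_comm]
  rw [hA'] at hp
  rw [hB'] at hs
  rw [hB_twist, hA_twist, energy_some, diagC, ← pot_twist S l T y h1 h2]
  simp only [colPoly, seedPoly]
  linear_combination (alph S l T) * e - alph S l T * basePoly S (twist S T l) n (y - I * gam S) * hp
    - alph S l T * basePoly S (twist S T l) n (y + I * gam S) * hs

/-- The gauge factor `∏_{m<k} hA(y_m) / ∏_{m≤k} hB(y_m)`. -/
noncomputable def gauge (S : System) (l : Fin 4 → ℂ) (T : VType) (y : ℕ → ℂ) (k : ℕ) : ℂ :=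
  (∏ m ∈ Finset.range k, hA S l T (y m)) / ∏ m ∈ Finset.range (k + 1), hB S l T (y m)

lemma gauge_succ (S : System) (l : Fin 4 → ℂ) (T : VType) (y : ℕ → ℂ) (k : ℕ) :
    gauge S l T y (k + 1) = gauge S l T y k * (hA S l T (y k) / hB S l T (y (k + 1))) := by
  rw [gauge, gauge, Finset.prod_range_succ, Finset.prod_range_succ _ (k + 1)]
  rw [mul_div_mul_comm]

/-- The part of the gauge factor that a column carries. -/
noncomputable def colGauge (S : System) (l : Fin 4 → ℂ) (y : ℕ → ℂ) : Option VType → ℕ → ℂ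
  | none, k => gauge S l .I y k * gauge S l .II y k
  | some T, k => gauge S l T.other y k

/-- A dressed column. -/
noncomputable def dressed (S : System) (l : Fin 4 → ℂ) (y : ℕ → ℂ) (c : Option VType × ℕ)
    (k : ℕ) : ℂ :=
  colGauge S l y c.1 k * colPoly S l c.1 c.2 (y k)

/-- The coefficient of the lower neighbour in the dressed recurrence. -/
noncomputable def recA (S : System) (l : Fin 4 → ℂ) (y : ℂ) : ℂ :=
  kap S * (hB S l .I (y - I * gam S) * hB S l .II (y - I * gam S)) / etaDm S y

/-- The coefficient of the upper neighbour in the dressed recurrence. -/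
noncomputable def recB (S : System) (l : Fin 4 → ℂ) (y : ℂ) : ℂ :=
  kap S * (hA S l .I (y + I * gam S) * hA S l .II (y + I * gam S)) / etaDp S y

/-- The ratio of consecutive gauge factors is hA(y_k) / hB(y_{k+1}). Multiplying by them turns the
factor hA at a site into hB at the next one, and hB into hA at the previous one. Seeds of type T
have this form already for the type T, so they need only the gauge factor of the other type; then
all columns share the coefficients `recA` and `recB`. -/
lemma dressed_isSol (S : System) (l : Fin 4 → ℂ) (y : ℕ → ℂ) (n : ℕ)
    (hy : ∀ k, y (k + 1) = y k - I * gam S)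
    (hB0 : ∀ T, ∀ k ≤ n + 2, hB S l T (y k) ≠ 0)
    (h1 : ∀ k ≤ n, potDen S (y (k + 1)) ≠ 0) (h2 : ∀ k ≤ n, potDen S (-(y (k + 1))) ≠ 0)
    (c : Option VType × ℕ) :
    IsSol (fun j => recA S l (y j)) (fun j => recB S l (y j)) (fun j => diagC S l (y j)) n
      (dressed S l y c) (energy S l c.1 c.2) := by
  intro j hj
  have hm : y (j + 1) - I * gam S = y (j + 2) := (hy _).symm
  have hp : y (j + 1) + I * gam S = y j := by rw [hy]; ring
  have b1 := hB0 .I (j + 1) (by omega)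
  have b2 := hB0 .II (j + 1) (by omega)
  have b1' := hB0 .I (j + 2) (by omega)
  have b2' := hB0 .II (j + 2) (by omega)
  have d1 := etaDm_ne_zero S _ (h1 j hj)
  have d2 := etaDp_ne_zero S _ (h2 j hj)
  obtain ⟨o, v⟩ := c
  cases o with
  | none =>
    have e := recurrence_none S l v (y (j + 1)) (h1 j hj) (h2 j hj)
    rw [hm, hp] at e
    simp only [recA, recB, dressed, colGauge, hm, hp, gauge_succ _ _ _ _ (j + 1),
      gauge_succ _ _ _ _ j, show j + 1 + 1 = j + 2 from rfl]
    linear_combination (norm := (field_simp; ring)) (gauge S l .I y j *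
      (hA S l .I (y j) / hB S l .I (y (j + 1))) * (gauge S l .II y j *
      (hA S l .II (y j) / hB S l .II (y (j + 1))))) * e
  | some T =>
    have e := recurrence_some S l T v (y (j + 1)) (h1 j hj) (h2 j hj)
    rw [hm, hp] at e
    simp only [recA, recB, dressed, colGauge, hm, hp, gauge_succ _ _ _ _ (j + 1),
      gauge_succ _ _ _ _ j, show j + 1 + 1 = j + 2 from rfl]
    cases T <;> simp only [VType.other] at e ⊢
    · linear_combination (norm := (field_simp; ring)) (gauge S l .II y j *
        (hA S l .II (y j) / hB S l .II (y (j + 1)))) * e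
    · linear_combination (norm := (field_simp; ring)) (gauge S l .I y j *
        (hA S l .I (y j) / hB S l .I (y (j + 1)))) * e

end MultiIndexed

namespace MultiIndexed

open Polynomial

/-! ### Divisibility and degree of determinants of polynomials -/

/-- All coefficients above the integer `D` vanish. -/
def DegLE (p : ℂ[X]) (D : ℤ) : Prop := ∀ k : ℕ, D < k → p.coeff k = 0

lemma DegLE.mono {p : ℂ[X]} {D D' : ℤ} (h : DegLE p D) (hD : D ≤ D') : DegLE p D' :=
  fun k hk => h k (by omega)

lemma DegLE.add {p p' : ℂ[X]} {D : ℤ} (h : DegLE p D) (h' : DegLE p' D) : DegLE (p + p') D :=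
  fun k hk => by rw [coeff_add, h k hk, h' k hk, add_zero]

lemma DegLE.zero (D : ℤ) : DegLE 0 D := fun _ _ => by simp

lemma DegLE.sum {ι : Type*} {s : Finset ι} {p : ι → ℂ[X]} {D : ℤ} (h : ∀ i ∈ s, DegLE (p i) D) :
    DegLE (∑ i ∈ s, p i) D := fun k hk => by
  rw [finsetSum_coeff]; exact Finset.sum_eq_zero fun i hi => h i hi k hk

lemma DegLE.mul {p p' : ℂ[X]} {D D' : ℤ} (h : DegLE p D) (h' : DegLE p' D') :
    DegLE (p * p') (D + D') := fun k hk => by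
  rw [coeff_mul]
  refine Finset.sum_eq_zero fun x hx => ?_
  have := Finset.HasAntidiagonal.mem_antidiagonal.1 hx
  by_cases h1 : D < x.1
  · rw [h _ h1, zero_mul]
  · rw [h' x.2 (by omega), mul_zero]

lemma DegLE.of_natDegree {p : ℂ[X]} {n : ℕ} (h : p.natDegree ≤ n) : DegLE p n := fun k hk =>
  coeff_eq_zero_of_natDegree_lt (by omega)

lemma DegLE.C (c : ℂ) : DegLE (C c) 0 :=
  DegLE.of_natDegree (n := 0) (by simp)

lemma DegLE.X : DegLE X 1 := DegLE.of_natDegree (n := 1) (by simp)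

lemma DegLE.neg {p : ℂ[X]} {D : ℤ} (h : DegLE p D) : DegLE (-p) D :=
  fun k hk => by rw [coeff_neg, h k hk, neg_zero]

lemma DegLE.prod {ι : Type*} {s : Finset ι} {p : ι → ℂ[X]} {D : ι → ℤ}
    (h : ∀ i ∈ s, DegLE (p i) (D i)) : DegLE (∏ i ∈ s, p i) (∑ i ∈ s, D i) := by
  classical
  induction s using Finset.induction_on with
  | empty => simpa using DegLE.C 1
  | insert a s ha ih =>
    rw [Finset.prod_insert ha, Finset.sum_insert ha]
    exact (h a (Finset.mem_insert_self _ _)).mul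
      (ih fun i hi => h i (Finset.mem_insert_of_mem hi))

lemma DegLE.pow {p : ℂ[X]} {D : ℤ} (h : DegLE p D) (n : ℕ) : DegLE (p ^ n) (n * D) := by
  have := DegLE.prod (s := Finset.range n) (p := fun _ => p) (D := fun _ => D) fun _ _ => h
  simpa using this

lemma DegLE.of_mul {p p' : ℂ[X]} {D : ℤ} (h : DegLE (p * p') D) (hp : p ≠ 0) :
    DegLE p' (D - p.natDegree) := by
  by_cases h0 : p' = 0
  · rw [h0]; exact DegLE.zero _
  have h1 : ((p * p').natDegree : ℤ) ≤ D := by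
    by_contra hc
    exact leadingCoeff_ne_zero.2 (mul_ne_zero hp h0) (h (p * p').natDegree (by omega))
  rw [natDegree_mul hp h0] at h1
  exact (DegLE.of_natDegree le_rfl).mono (by push_cast at h1; omega)

lemma DegLE.natDegree_le {p : ℂ[X]} {n : ℕ} (h : DegLE p n) : p.natDegree ≤ n :=
  natDegree_le_iff_coeff_eq_zero.2 fun k hk => h k (by exact_mod_cast hk)

lemma DegLE.det {L : ℕ} {M : Fin L → Fin L → ℂ[X]} {r s : Fin L → ℤ}
    (h : ∀ i j, DegLE (M i j) (r i + s j)) :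
    DegLE (Matrix.det (Matrix.of M)) (∑ i, r i + ∑ i, s i) := by
  rw [Matrix.det_apply]
  refine DegLE.sum fun σ _ => ?_
  have : DegLE (∏ i, M (σ i) i) (∑ i, (r (σ i) + s i)) := DegLE.prod fun i _ => h _ _
  rw [Finset.sum_add_distrib, Equiv.sum_comp σ r] at this
  intro k hk
  have := this k hk
  rcases Int.units_eq_one_or (Equiv.Perm.sign σ) with e | e <;> simp [e, this]

/-- Products of initial members of a divisibility chain divide products over arbitrary sets. -/
lemma prod_chain_dvd {R : Type*} [CommRing R] (f : ℕ → R) (hf : ∀ i, f i ∣ f (i + 1))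
    (s : Finset ℕ) : ∏ i ∈ Finset.range s.card, f i ∣ ∏ i ∈ s, f i := by
  have hmono : ∀ i j, i ≤ j → f i ∣ f j := fun i j h => by
    induction j, h using Nat.le_induction with
    | base => exact dvd_rfl
    | succ j _ ih => exact ih.trans (hf j)
  induction s using Finset.induction_on_max with
  | empty => simp
  | insert a s ha ih =>
    have hn : a ∉ s := fun h => lt_irrefl _ (ha a h)
    rw [Finset.card_insert_of_notMem hn, Finset.prod_range_succ, Finset.prod_insert hn, mul_comm]
    refine mul_dvd_mul (hmono _ _ ?_) ih
    have : s ⊆ Finset.range a := fun x hx => Finset.mem_range.2 (ha x hx)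
    simpa using Finset.card_le_card this

lemma prod_chain_dvd' {R ι : Type*} [CommRing R] (f : ℕ → R) (hf : ∀ i, f i ∣ f (i + 1))
    (s : Finset ι) (e : ι → ℕ) (he : Set.InjOn e s) :
    ∏ i ∈ Finset.range s.card, f i ∣ ∏ i ∈ s, f (e i) := by
  have := prod_chain_dvd f hf (s.image e)
  rwa [Finset.card_image_of_injOn he, Finset.prod_image he] at this

/-- Rows that agree in pairs modulo `w` produce powers of `w` in the determinant. -/
lemma pow_dvd_det {R : Type*} [CommRing R] {n : Type*} [Fintype n] [DecidableEq n]
    (M : Matrix n n R) (w : R) (J : Finset n) (τ : n → n) (hτ : ∀ j ∈ J, τ j ∉ J)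
    (h : ∀ j ∈ J, ∀ k, w ∣ M j k - M (τ j) k) : w ^ J.card ∣ M.det := by
  classical
  -- Multiplication by 1 - E subtracts row τ j from row j for all j in J at once. Because τ leads
  -- out of J, E squares to zero and 1 + E is the inverse. Every row in J of the product is
  -- divisible by w.
  let E : Matrix n n R := Matrix.of fun j i => if j ∈ J ∧ i = τ j then 1 else 0
  have hE : E * E = 0 := by
    ext j i
    rw [Matrix.mul_apply, Matrix.zero_apply]
    refine Finset.sum_eq_zero fun a _ => ?_
    simp only [E, Matrix.of_apply]
    by_cases h1 : j ∈ J ∧ a = τ j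
    · have : ¬(a ∈ J ∧ i = τ a) := by
        rintro ⟨h2, -⟩
        exact hτ j h1.1 (h1.2 ▸ h2)
      rw [if_neg this, mul_zero]
    · rw [if_neg h1, zero_mul]
  have hinv : (1 + E) * (1 - E) = 1 := by
    rw [mul_sub, mul_one, add_mul, one_mul, hE, add_zero, add_sub_cancel_right]
  have hdet : (1 + E).det * ((1 - E) * M).det = M.det := by
    rw [← Matrix.det_mul, ← mul_assoc, hinv, one_mul]
  rw [← hdet]
  apply Dvd.dvd.mul_left
  have hEM : ∀ j k, (E * M) j k = if j ∈ J then M (τ j) k else 0 := by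
    intro j k
    rw [Matrix.mul_apply]
    by_cases hj : j ∈ J <;> simp [E, hj]
  choose! q hq using h
  have : (1 - E) * M = Matrix.of fun j k => (if j ∈ J then w else 1) *
      (if j ∈ J then q j k else M j k) := by
    ext j k
    rw [sub_mul, one_mul, Matrix.sub_apply, hEM, Matrix.of_apply]
    by_cases hj : j ∈ J
    · simp only [hj, if_true]; exact hq j hj k
    · simp [hj]
  have hd := Matrix.det_mul_column (fun j => if j ∈ J then w else 1)
    (Matrix.of fun j k => if j ∈ J then q j k else M j k)
  simp only [Matrix.of_apply] at hd
  rw [this, hd]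
  apply Dvd.dvd.mul_right
  simp

/-- A separable polynomial divides every polynomial that vanishes at its roots. -/
lemma dvd_of_separable {w f : ℂ[X]} (hw : ∀ r, w.eval r = 0 → w.derivative.eval r ≠ 0)
    (hw0 : w ≠ 0) (h : ∀ r, w.eval r = 0 → f.eval r = 0) : w ∣ f := by
  by_cases hf : f = 0
  · simp [hf]
  refine (IsAlgClosed.splits w).dvd_of_roots_le_roots hw0 ?_
  have hnd : w.roots.Nodup := by
    rw [Multiset.nodup_iff_count_le_one]
    intro r
    rw [count_roots]
    by_contra hc
    have := (one_lt_rootMultiplicity_iff_isRoot hw0).1 (not_le.1 hc)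
    exact hw r this.1 this.2
  rw [Multiset.le_iff_subset hnd]
  intro r hr
  rw [mem_roots hw0] at hr
  rw [mem_roots hf]
  exact h r hr

lemma isCoprime_of_no_common_root {p p' : ℂ[X]} (h : ∀ r, p.eval r = 0 → p'.eval r ≠ 0) :
    IsCoprime p p' := by
  rw [isCoprime_iff_aeval_ne_zero_of_isAlgClosed ℂ ℂ]
  intro a
  by_cases ha : p.eval a = 0
  · right; simpa using h a ha
  · left; simpa using ha

/-! ### Finite differences -/

/-- Iterated differences of the rows are obtained by a unitriangular matrix of signed binomial
coefficients, which leaves the determinant unchanged. -/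
lemma det_fwdDiff (L : ℕ) (f : Fin L → ℕ → ℂ[X]) :
    Matrix.det (Matrix.of fun i j : Fin L => ((fwdDiff 1)^[(i : ℕ)] (f j) 0)) =
      Matrix.det (Matrix.of fun i j : Fin L => f j i) := by
  let T : Matrix (Fin L) (Fin L) ℂ[X] := Matrix.of fun i k =>
    if (k : ℕ) ≤ i then (((-1 : ℤ) ^ ((i : ℕ) - k) * (i : ℕ).choose k : ℤ) : ℂ[X]) else 0
  have hT : T.det = 1 := by
    rw [Matrix.det_of_isLowerTriangular T]
    · simp [T]
    · intro i j hij
      have : ¬ ((j : ℕ) ≤ i) := by simpa using hij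
      simp only [T, Matrix.of_apply, if_neg this]
  have : (Matrix.of fun i j : Fin L => ((fwdDiff 1)^[(i : ℕ)] (f j) 0)) =
      T * Matrix.of fun i j : Fin L => f j i := by
    ext1 i j
    rw [Matrix.mul_apply, Matrix.of_apply, fwdDiff_iter_eq_sum_shift]
    simp only [T, Matrix.of_apply, zero_add, smul_eq_mul, mul_one, zsmul_eq_mul, ite_mul, zero_mul]
    rw [Fin.sum_univ_eq_sum_range (fun k => if k ≤ (i : ℕ) then
      (((-1 : ℤ) ^ ((i : ℕ) - k) * (i : ℕ).choose k : ℤ) : ℂ[X]) * f j k else 0) L,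
      ← Finset.sum_filter]
    refine Finset.sum_congr ?_ fun _ _ => rfl
    ext k
    simp only [Finset.mem_range, Finset.mem_filter]
    have := i.2
    omega
  rw [this, Matrix.det_mul, hT, one_mul]

/-- The `i`-th differences of the first `n + 1` terms have degree at most `D - i`. -/
def Filt : ℕ → ℤ → (ℕ → ℂ[X]) → Prop
  | 0, D, f => DegLE (f 0) D
  | n + 1, D, f => (∀ j ≤ n + 1, DegLE (f j) D) ∧ Filt n (D - 1) (fun j => f (j + 1) - f j)

lemma Filt.degLE {n : ℕ} {D : ℤ} {f : ℕ → ℂ[X]} (h : Filt n D f) (j : ℕ) (hj : j ≤ n) :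
    DegLE (f j) D := by
  cases n with
  | zero => obtain rfl : j = 0 := by omega
            exact h
  | succ n => exact h.1 j hj

lemma Filt.congr {n : ℕ} {D : ℤ} {f g : ℕ → ℂ[X]} (h : Filt n D f) (hfg : ∀ j ≤ n, f j = g j) :
    Filt n D g := by
  induction n generalizing D f g with
  | zero => rw [Filt, ← hfg 0 le_rfl]; exact h
  | succ n ih =>
    refine ⟨fun j hj => hfg j hj ▸ h.1 j hj, ih h.2 fun j hj => ?_⟩
    rw [hfg j (by omega), hfg (j + 1) (by omega)]

lemma Filt.mono {n : ℕ} {D D' : ℤ} {f : ℕ → ℂ[X]} (h : Filt n D f) (hD : D ≤ D') :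
    Filt n D' f := by
  induction n generalizing D D' f with
  | zero => exact DegLE.mono h hD
  | succ n ih => exact ⟨fun j hj => (h.1 j hj).mono hD, ih h.2 (by omega)⟩

lemma Filt.add {n : ℕ} {D : ℤ} {f g : ℕ → ℂ[X]} (h : Filt n D f) (h' : Filt n D g) :
    Filt n D (fun j => f j + g j) := by
  induction n generalizing D f g with
  | zero => exact DegLE.add h h'
  | succ n ih =>
    refine ⟨fun j hj => (h.1 j hj).add (h'.1 j hj), (ih h.2 h'.2).congr fun j _ => by ring⟩

lemma Filt.neg {n : ℕ} {D : ℤ} {f : ℕ → ℂ[X]} (h : Filt n D f) :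
    Filt n D (fun j => -f j) := by
  induction n generalizing D f with
  | zero => exact DegLE.neg h
  | succ n ih =>
    refine ⟨fun j hj => (h.1 j hj).neg, (ih h.2).congr fun j _ => by ring⟩

lemma Filt.sub {n : ℕ} {D : ℤ} {f g : ℕ → ℂ[X]} (h : Filt n D f) (h' : Filt n D g) :
    Filt n D (fun j => f j - g j) := by
  simpa [sub_eq_add_neg] using h.add h'.neg

lemma Filt.zero (n : ℕ) (D : ℤ) : Filt n D (fun _ => 0) := by
  induction n generalizing D with
  | zero => exact DegLE.zero _
  | succ n ih => exact ⟨fun _ _ => DegLE.zero _, by simpa using ih (D - 1)⟩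

lemma Filt.const {n : ℕ} {D : ℤ} {p : ℂ[X]} (h : DegLE p D) : Filt n D (fun _ => p) := by
  cases n with
  | zero => exact h
  | succ n => exact ⟨fun _ _ => h, by simpa using Filt.zero n _⟩

lemma Filt.shift {n : ℕ} {D : ℤ} {f : ℕ → ℂ[X]} (h : Filt (n + 1) D f) :
    Filt n D (fun j => f (j + 1)) := by
  induction n generalizing D f with
  | zero => exact h.1 1 le_rfl
  | succ n ih => exact ⟨fun j hj => h.1 _ (by omega), ih h.2⟩

lemma Filt.pred {n : ℕ} {D : ℤ} {f : ℕ → ℂ[X]} (h : Filt (n + 1) D f) : Filt n D f := by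
  induction n generalizing D f with
  | zero => exact h.1 0 (by omega)
  | succ n ih => exact ⟨fun j hj => h.1 _ (by omega), ih h.2⟩

/-- The discrete Leibniz rule Δ(fg) = Δf · g(· + 1) + f · Δg; in either term the filtration drops by
one. -/
lemma Filt.mul {n : ℕ} {D D' : ℤ} {f g : ℕ → ℂ[X]} (h : Filt n D f) (h' : Filt n D' g) :
    Filt n (D + D') (fun j => f j * g j) := by
  induction n generalizing D D' f g with
  | zero => exact DegLE.mul h h'
  | succ n ih =>
    refine ⟨fun j hj => (h.1 j hj).mul (h'.1 j hj), ?_⟩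
    have h1 := (ih h.2 h'.shift).mono (show D - 1 + D' ≤ D + D' - 1 by omega)
    have h2 := (ih h.pred h'.2).mono (show D + (D' - 1) ≤ D + D' - 1 by omega)
    exact (h1.add h2).congr fun j _ => by ring

lemma Filt.sum {ι : Type*} {s : Finset ι} {n : ℕ} {D : ℤ} {f : ι → ℕ → ℂ[X]}
    (h : ∀ i ∈ s, Filt n D (f i)) : Filt n D (fun j => ∑ i ∈ s, f i j) := by
  classical
  induction s using Finset.induction_on with
  | empty => simpa using Filt.zero n D
  | insert a s ha ih =>
    refine ((h a (Finset.mem_insert_self _ _)).add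
      (ih fun i hi => h i (Finset.mem_insert_of_mem hi))).congr fun j _ => ?_
    rw [Finset.sum_insert ha]

lemma Filt.pow {n : ℕ} {D : ℤ} {f : ℕ → ℂ[X]} (h : Filt n D f) (k : ℕ) :
    Filt n (k * D) (fun j => f j ^ k) := by
  induction k with
  | zero => simpa using Filt.const (n := n) (DegLE.C 1)
  | succ k ih =>
    refine ((ih.mul h).mono (by push_cast; ring_nf; rfl)).congr fun j _ => by ring

lemma Filt.fwdDiff {n : ℕ} {D : ℤ} {f : ℕ → ℂ[X]} (h : Filt n D f) (i : ℕ) (hi : i ≤ n) :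
    DegLE ((fwdDiff 1)^[i] f 0) (D - i) := by
  induction i generalizing n D f with
  | zero => simpa using h.degLE 0 (by omega)
  | succ i ih =>
    obtain ⟨m, rfl⟩ : ∃ m, n = m + 1 := ⟨n - 1, by omega⟩
    have := ih h.2 (by omega)
    rw [Function.iterate_succ_apply]
    exact this.mono (by push_cast; omega)

/-- Products of factors `A` above and `B` below a row. -/
noncomputable def nuSeq (n : ℕ) (A B : ℕ → ℂ[X]) (j : ℕ) : ℂ[X] :=
  (∏ m ∈ Finset.range j, A m) * ∏ m ∈ Finset.Ico (j + 1) (n + 1), B m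

/-- Passing from row j to row j + 1 replaces the factor B_{j+1} by A_j. Their difference has degree
one less, since A_j - B_j and B_{j+1} - B_j both do; what remains is a product of the same kind with
one factor fewer and B shifted, so induction applies. -/
lemma Filt.nuSeq {n : ℕ} {e : ℕ} {A B : ℕ → ℂ[X]} (hA : ∀ N, Filt N e A) (hB : ∀ N, Filt N e B)
    (hAB : ∀ N, Filt N (e - 1) (fun j => A j - B j)) :
    Filt n (e * n) (nuSeq n A B) := by
  have hdeg : ∀ (n : ℕ) (B : ℕ → ℂ[X]), (∀ N, Filt N e B) → ∀ j ≤ n,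
      DegLE (MultiIndexed.nuSeq n A B j) (e * n) := by
    intro n B hB j hj
    have h1 := DegLE.prod (s := Finset.range j) (p := A) (D := fun _ => (e : ℤ))
      fun i _ => (hA i).degLE i le_rfl
    have h2 := DegLE.prod (s := Finset.Ico (j + 1) (n + 1)) (p := B) (D := fun _ => (e : ℤ))
      fun i _ => (hB i).degLE i le_rfl
    refine (h1.mul h2).mono ?_
    simp only [Finset.sum_const, Finset.card_range, Nat.card_Ico, nsmul_eq_mul]
    rw [← add_mul, mul_comm]
    refine mul_le_mul_of_nonneg_left ?_ (by positivity)
    omega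
  induction n generalizing B with
  | zero => exact hdeg 0 B hB 0 le_rfl
  | succ n ih =>
    refine ⟨hdeg (n + 1) B hB, ?_⟩
    have hs : ∀ N, Filt N e (fun j => B (j + 1)) := fun N => (hB (N + 1)).shift
    have hC : ∀ N, Filt N (e - 1) (fun j => A j - B (j + 1)) := fun N =>
      ((hAB N).sub (hB (N + 1)).2).congr fun j _ => by ring
    have := (ih hs hC).mul (hC n)
    refine (this.mono (by push_cast; ring_nf; rfl)).congr fun j hj => ?_
    rw [MultiIndexed.nuSeq, MultiIndexed.nuSeq, MultiIndexed.nuSeq, Finset.prod_range_succ,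
      Finset.prod_eq_prod_Ico_succ_bot (show j + 1 < n + 1 + 1 by omega),
      Finset.prod_Ico_add' B (j + 1) (n + 1) 1]
    ring

/-- The degree of a determinant drops by finite differencing of its rows. -/
lemma degLE_det_of_filt {L : ℕ} {f : Fin L → ℕ → ℂ[X]} {D : Fin L → ℤ}
    (h : ∀ k, Filt (L - 1) (D k) (f k)) :
    DegLE (Matrix.det (Matrix.of fun j k : Fin L => f k j)) (∑ k, D k - ∑ k : Fin L, (k : ℤ)) := by
  rw [← det_fwdDiff]
  have := DegLE.det (M := fun i j : Fin L => ((fwdDiff 1)^[(i : ℕ)] (f j) 0))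
    (r := fun i => -(i : ℤ)) (s := D) fun i j => ((h j).fwdDiff i (by omega)).mono (by omega)
  refine this.mono ?_
  rw [Finset.sum_neg_distrib]
  omega

end MultiIndexed

namespace MultiIndexed

open Complex Polynomial

/-! ### Polynomial models of the elementary functions -/

/-- The variable in which all entries are (Laurent) polynomials. -/
noncomputable def zeta : System → ℂ → ℂ
  | .cH, x => x
  | .W, x => x
  | .AW _ _ _, x => exp (I * x)

/-- The weight used to clear negative powers of `zeta`. -/
noncomputable def om : System → ℂ → ℂ
  | .cH, _ => 1
  | .W, _ => 1
  | .AW _ _ _, x => exp (I * x)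

/-- The polynomial model of the weight. -/
noncomputable def omP : System → ℂ[X]
  | .cH => 1
  | .W => 1
  | .AW _ _ _ => X

lemma om_ne_zero (S : System) (x : ℂ) : om S x ≠ 0 := by
  cases S <;> simp [om]

lemma eval_omP (S : System) (x : ℂ) : (omP S).eval (zeta S x) = om S x := by
  cases S <;> simp [om, omP, zeta]

/-- The polynomial model of `lin S s (x + c)`. -/
noncomputable def linP : System → ℂ → ℂ → ℂ[X]
  | .cH, s, c => C I * X + C (s + I * c)
  | .W, s, c => C I * X + C (s + I * c)
  | .AW q _ _, s, c => C (-((q : ℂ) ^ s * exp (I * c))) * X + C 1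

/-- The polynomial model of `lin S s (-(x + c))`. -/
noncomputable def linN : System → ℂ → ℂ → ℂ[X]
  | .cH, s, c => C (-I) * X + C (s - I * c)
  | .W, s, c => C (-I) * X + C (s - I * c)
  | .AW q _ _, s, c => C 1 * X + C (-((q : ℂ) ^ s * exp (-(I * c))))

lemma eval_linP (S : System) (s c x : ℂ) : (linP S s c).eval (zeta S x) = lin S s (x + c) := by
  cases S with
  | cH => simp [linP, zeta, lin]; ring
  | W => simp [linP, zeta, lin]; ring
  | AW q h0 h1 => simp [linP, zeta, lin, mul_add, exp_add]; ring

lemma eval_linN (S : System) (s c x : ℂ) :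
    (linN S s c).eval (zeta S x) = lin S s (-(x + c)) * om S x := by
  cases S with
  | cH => simp [linN, zeta, lin, om]; ring
  | W => simp [linN, zeta, lin, om]; ring
  | AW q h0 h1 =>
    have hz : exp (I * x) ≠ 0 := exp_ne_zero _
    simp only [linN, zeta, om, lin_AW_neg]
    simp [mul_add, exp_add, exp_neg]
    field_simp
    ring

lemma linP_lead_ne_zero (S : System) (s c : ℂ) :
    linP S s c ≠ 0 ∧ (linP S s c).natDegree = 1 := by
  have : ∀ a b : ℂ, a ≠ 0 → C a * X + C b ≠ 0 ∧ (C a * X + C b : ℂ[X]).natDegree = 1 := by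
    intro a b ha
    have h := natDegree_linear (b := b) ha
    exact ⟨fun h0 => by rw [h0] at h; simp at h, h⟩
  cases S with
  | cH => exact this _ _ I_ne_zero
  | W => exact this _ _ I_ne_zero
  | AW q h0 h1 =>
    refine this _ _ (neg_ne_zero.2 (mul_ne_zero ?_ (exp_ne_zero _)))
    rw [q_cpow h0]; exact exp_ne_zero _

lemma linN_lead_ne_zero (S : System) (s c : ℂ) :
    linN S s c ≠ 0 ∧ (linN S s c).natDegree = 1 := by
  have : ∀ a b : ℂ, a ≠ 0 → C a * X + C b ≠ 0 ∧ (C a * X + C b : ℂ[X]).natDegree = 1 := by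
    intro a b ha
    have h := natDegree_linear (b := b) ha
    exact ⟨fun h0 => by rw [h0] at h; simp at h, h⟩
  cases S with
  | cH => exact this _ _ (neg_ne_zero.2 I_ne_zero)
  | W => exact this _ _ (neg_ne_zero.2 I_ne_zero)
  | AW q h0 h1 => exact this _ _ one_ne_zero

/-- The number of linear factors of `hA` and `hB`. -/
def parDeg : System → ℕ
  | .cH => 1
  | .W => 2
  | .AW _ _ _ => 2

lemma card_plusPar (S : System) (T : VType) : (plusPar S T).card = parDeg S := by
  cases S <;> cases T <;> rfl

lemma card_minusPar (S : System) (T : VType) : (minusPar S T).card = parDeg S := by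
  cases S <;> cases T <;> rfl

/-- The polynomial model of `hA S l T (x + c)`. -/
noncomputable def pA (S : System) (l : Fin 4 → ℂ) (T : VType) (c : ℂ) : ℂ[X] :=
  C (phA S c) * ∏ k ∈ plusPar S T, linP S (l k) c

/-- The polynomial model of `hB S l T (x + c)`. -/
noncomputable def pB (S : System) (l : Fin 4 → ℂ) (T : VType) (c : ℂ) : ℂ[X] :=
  C (phB S c) * ∏ k ∈ minusPar S T, linN S (l k) c

/-- For AW the phases in `hA` and `hB` are balanced so that both become polynomials after
multiplication by exactly one power of the weight. The power needed for `nuRow` is therefore the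
same in every row. -/
lemma eval_pA (S : System) (l : Fin 4 → ℂ) (T : VType) (c x : ℂ) :
    (pA S l T c).eval (zeta S x) = hA S l T (x + c) * om S x := by
  simp only [pA, hA, eval_mul, eval_C, eval_prod, eval_linP]
  have : phA S c = phA S (x + c) * om S x := by
    cases S with
    | cH => simp [phA, om]
    | W => simp [phA, om]
    | AW q h0 h1 => simp only [phA, om, ← exp_add]; congr 1; ring
  rw [this]; ring

lemma eval_pB (S : System) (l : Fin 4 → ℂ) (T : VType) (c x : ℂ) :
    (pB S l T c).eval (zeta S x) = hB S l T (x + c) * om S x := by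
  simp only [pB, hB, eval_mul, eval_C, eval_prod, eval_linN, Finset.prod_mul_distrib,
    Finset.prod_const, card_minusPar]
  have : phB S c * om S x ^ parDeg S = phB S (x + c) * om S x := by
    cases S with
    | cH => simp [phB, om]
    | W => simp [phB, om]
    | AW q h0 h1 =>
      simp only [phB, om, parDeg, ← exp_add, ← exp_nat_mul]; congr 1; push_cast; ring
  linear_combination (∏ k ∈ minusPar S T, lin S (l k) (-(x + c))) * this

lemma pA_ne_zero (S : System) (l : Fin 4 → ℂ) (T : VType) (c : ℂ) : pA S l T c ≠ 0 :=
  mul_ne_zero (C_ne_zero.2 (phA_ne_zero S c))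
    (Finset.prod_ne_zero_iff.2 fun _ _ => (linP_lead_ne_zero S _ _).1)

lemma pB_ne_zero (S : System) (l : Fin 4 → ℂ) (T : VType) (c : ℂ) : pB S l T c ≠ 0 :=
  mul_ne_zero (C_ne_zero.2 (phB_ne_zero S c))
    (Finset.prod_ne_zero_iff.2 fun _ _ => (linN_lead_ne_zero S _ _).1)

lemma natDegree_pA (S : System) (l : Fin 4 → ℂ) (T : VType) (c : ℂ) :
    (pA S l T c).natDegree = parDeg S := by
  rw [pA, natDegree_C_mul (phA_ne_zero S c),
    natDegree_prod _ _ fun _ _ => (linP_lead_ne_zero S _ _).1, ← card_plusPar S T]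
  simp [(linP_lead_ne_zero S _ _).2]

lemma natDegree_pB (S : System) (l : Fin 4 → ℂ) (T : VType) (c : ℂ) :
    (pB S l T c).natDegree = parDeg S := by
  rw [pB, natDegree_C_mul (phB_ne_zero S c),
    natDegree_prod _ _ fun _ _ => (linN_lead_ne_zero S _ _).1, ← card_minusPar S T]
  simp [(linN_lead_ne_zero S _ _).2]

/-- The polynomial model of `η(x + c)`. -/
noncomputable def pE : System → ℂ → ℂ[X]
  | .cH, c => X + C c
  | .W, c => (X + C c) ^ 2
  | .AW _ _ _, c => C (exp (I * c) / 2) * X ^ 2 + C (exp (-(I * c)) / 2)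

lemma eval_pE (S : System) (c x : ℂ) :
    (pE S c).eval (zeta S x) = eta S (x + c) * om S x := by
  cases S with
  | cH => simp [pE, zeta, eta, om]
  | W => simp [pE, zeta, eta, om]
  | AW q h0 h1 =>
    have hz : exp (I * x) ≠ 0 := exp_ne_zero _
    simp [pE, zeta, eta, om, cos_eq_exp, mul_add, exp_add, exp_neg]
    field_simp

/-- The polynomial model of `p(η(x + c))`. -/
noncomputable def pcol (S : System) (d : ℕ) (p : ℂ[X]) (c : ℂ) : ℂ[X] :=
  ∑ i ∈ Finset.range (d + 1), C (p.coeff i) * pE S c ^ i * omP S ^ (d - i)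

lemma eval_pcol (S : System) (d : ℕ) (p : ℂ[X]) (hp : p.natDegree ≤ d) (c x : ℂ) :
    (pcol S d p c).eval (zeta S x) = p.eval (eta S (x + c)) * om S x ^ d := by
  rw [eval_eq_sum_range' (Nat.lt_succ_of_le hp), pcol, eval_finsetSum, Finset.sum_mul]
  refine Finset.sum_congr rfl fun i hi => ?_
  have : om S x ^ d = om S x ^ i * om S x ^ (d - i) := by
    rw [← pow_add]; congr 1; have := Finset.mem_range.1 hi; omega
  simp only [eval_mul, eval_C, eval_pow, eval_pE, eval_omP]
  rw [this]; ring

/-- The polynomial model of `sg S (2 * x + c)`. -/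
noncomputable def wP : System → ℂ → ℂ[X]
  | .cH, _ => C 1
  | .W, c => C 2 * X + C c
  | .AW _ _ _, c => C (exp (I * (c / 2)) / (2 * I)) * X ^ 2 + C (-exp (-(I * (c / 2))) / (2 * I))

/-- The degree of `wP`. -/
def wDeg : System → ℕ
  | .cH => 0
  | .W => 1
  | .AW _ _ _ => 2

lemma eval_wP (S : System) (c x : ℂ) :
    (wP S c).eval (zeta S x) = sg S (2 * x + c) * om S x := by
  cases S with
  | cH => simp [wP, sg, om]
  | W => simp [wP, zeta, sg, om]
  | AW q h0 h1 =>
    have hz : exp (I * x) ≠ 0 := exp_ne_zero _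
    have hc : exp (I * (c / 2)) ≠ 0 := exp_ne_zero _
    have e1 : exp (-((2 * x + c) / 2) * I) = (exp (I * x) * exp (I * (c / 2)))⁻¹ := by
      rw [← exp_add, ← exp_neg]; congr 1; ring
    have e2 : exp ((2 * x + c) / 2 * I) = exp (I * x) * exp (I * (c / 2)) := by
      rw [← exp_add]; congr 1; ring
    simp only [wP, zeta, sg, om, Complex.sin, e1, e2, exp_neg]
    simp
    clear e1 e2
    generalize exp (I * (c / 2)) = k at *
    generalize exp (I * x) = z at *
    field_simp
    linear_combination (z ^ 2 * k ^ 2 - 1) * I_sq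

lemma wP_ne_zero_natDegree (S : System) (c : ℂ) : wP S c ≠ 0 ∧ (wP S c).natDegree = wDeg S := by
  cases S with
  | cH => simp [wP, wDeg]
  | W =>
    have h := natDegree_linear (a := (2 : ℂ)) (b := c) two_ne_zero
    exact ⟨fun h0 => by rw [wP] at h0; rw [h0] at h; simp at h, h⟩
  | AW q h0 h1 =>
    have ha : exp (I * (c / 2)) / (2 * I) ≠ 0 := by simp [I_ne_zero]
    have h := natDegree_quadratic (b := 0) (c := -exp (-(I * (c / 2))) / (2 * I)) ha
    rw [C_0, zero_mul, add_zero] at h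
    exact ⟨fun h0 => by rw [wP] at h0; rw [h0] at h; simp at h, h⟩

lemma wP_separable (S : System) (c r : ℂ) (h : (wP S c).eval r = 0) :
    (wP S c).derivative.eval r ≠ 0 := by
  cases S with
  | cH => simp [wP] at h
  | W => simp [wP]
  | AW q h0 h1 =>
    have hr : r ≠ 0 := by
      rintro rfl
      simp [wP, I_ne_zero] at h
    simp [wP, I_ne_zero, hr]

lemma exists_zeta_of_root (S : System) (c r : ℂ) (h : (wP S c).eval r = 0) :
    ∃ x, zeta S x = r ∧ sg S (2 * x + c) = 0 := by
  have : ∃ x, zeta S x = r := by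
    cases S with
    | cH => exact ⟨r, rfl⟩
    | W => exact ⟨r, rfl⟩
    | AW q h0 h1 =>
      have hr : r ≠ 0 := by
        rintro rfl
        simp [wP, I_ne_zero] at h
      refine ⟨-I * log r, ?_⟩
      simp only [zeta]
      rw [show I * (-I * log r) = log r by linear_combination (-log r) * I_mul_I, exp_log hr]
  obtain ⟨x, rfl⟩ := this
  rw [eval_wP] at h
  exact ⟨x, rfl, (mul_eq_zero.1 h).resolve_right (om_ne_zero S x)⟩

/-! ### Zeros of `sg` -/

lemma sg_eq_zero_imp (S : System) (w : ℂ) (h : sg S w = 0) :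
    S ≠ .cH ∧ ∃ n : ℤ, w = 2 * Real.pi * n ∧ (S = .W → n = 0) := by
  cases S with
  | cH => simp [sg] at h
  | W => exact ⟨by simp, 0, by simpa [sg] using h, fun _ => rfl⟩
  | AW q h0 h1 =>
    simp only [sg, Complex.sin_eq_zero_iff] at h
    obtain ⟨n, hn⟩ := h
    exact ⟨by simp, n, by linear_combination 2 * hn, by simp⟩

/-- A zero of `sg (u + v)` means that v equals -u up to a period of the system; for cH there is no
such zero. -/
lemma lin_of_sg (S : System) (s u v : ℂ) (h : sg S (u + v) = 0) : lin S s (-u) = lin S s v := by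
  obtain ⟨hS, n, hn, h0⟩ := sg_eq_zero_imp S _ h
  obtain rfl : v = -u + n * (2 * Real.pi) := by linear_combination hn
  cases S with
  | cH => exact absurd rfl hS
  | W => simp [h0 rfl]
  | AW q hq0 hq1 =>
    simp only [lin]
    rw [show I * (-u + n * (2 * Real.pi)) = I * (-u) + n * (2 * Real.pi * I) by ring,
      exp_add, exp_int_mul_two_pi_mul_I, mul_one]

lemma hB_of_sg (S : System) (l : Fin 4 → ℂ) (T : VType) (u v : ℂ) (h : sg S (u + v) = 0) :
    hB S l T u = hA S l T v := by
  obtain ⟨hS, n, hn, h0⟩ := sg_eq_zero_imp S _ h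
  have : phB S u = phA S v := by
    obtain rfl : v = -u + n * (2 * Real.pi) := by linear_combination hn
    cases S with
    | cH => exact absurd rfl hS
    | W => rfl
    | AW q hq0 hq1 =>
      simp only [phA, phB]
      rw [show -(I * (-u + n * (2 * Real.pi))) = I * u + (-n : ℤ) * (2 * Real.pi * I) by
        push_cast; ring, exp_add, exp_int_mul_two_pi_mul_I, mul_one]
  rw [hA, hB, this, minusPar_eq S hS]
  congr 1
  exact Finset.prod_congr rfl fun k _ => lin_of_sg S _ _ _ h

lemma eta_of_sg (S : System) (u v : ℂ) (h : sg S (u + v) = 0) : eta S u = eta S v := by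
  have := eta_sub S u v
  rw [h, mul_zero] at this
  exact sub_eq_zero.1 this

/-- The zeros of `sg` are real, whereas the shift is purely imaginary and nonzero unless r = 0. This
is what separates Vandermonde factors belonging to different sums of indices. -/
lemma sg_shift_unique (S : System) (w : ℂ) (r : ℤ) (h : sg S w = 0)
    (h' : sg S (w + I * r * gam S) = 0) : r = 0 := by
  obtain ⟨hS, n, hn, h0⟩ := sg_eq_zero_imp S _ h
  obtain ⟨-, n', hn', h0'⟩ := sg_eq_zero_imp S _ h'
  have e : I * r * gam S = ((2 * Real.pi * (n' - n) : ℝ) : ℂ) := by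
    push_cast; linear_combination hn' - hn
  have hg : ∃ g : ℝ, g ≠ 0 ∧ gam S = g := by
    cases S with
    | cH => exact ⟨1, one_ne_zero, by simp [gam]⟩
    | W => exact ⟨1, one_ne_zero, by simp [gam]⟩
    | AW q hq0 hq1 => exact ⟨Real.log q, (Real.log_neg hq0 hq1).ne, rfl⟩
  obtain ⟨g, hg0, hg⟩ := hg
  rw [hg] at e
  have := congrArg Complex.im e
  rw [ofReal_im, show I * (r : ℂ) * (g : ℂ) = ((r * g : ℝ) : ℂ) * I by push_cast; ring,
    im_ofReal_mul, I_im, mul_one] at this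
  have := (mul_eq_zero.1 this).resolve_right hg0
  exact_mod_cast this

/-! ### Generic parameters -/

/-- No sum of two parameters is an integer, modulo the period. -/
def GenericPar (S : System) (l : Fin 4 → ℂ) : Prop :=
  ∀ k k' : Fin 4, ∀ n m : ℤ, gam S * (l k + l k') ≠ gam S * n + 2 * Real.pi * I * m

lemma lin_eq_zero_imp (S : System) (s u : ℂ) (h : lin S s u = 0) :
    ∃ m : ℤ, gam S * s + I * u = 2 * Real.pi * I * m := by
  cases S with
  | cH => exact ⟨0, by simpa [gam, lin] using h⟩
  | W => exact ⟨0, by simpa [gam, lin] using h⟩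
  | AW q h0 h1 =>
    simp only [lin, q_cpow h0, ← exp_add] at h
    obtain ⟨n, hn⟩ := exp_eq_one_iff.1 (sub_eq_zero.1 h).symm
    exact ⟨n, by simp only [gam]; linear_combination hn⟩

/-- A zero of `hA` at u and one of `hB` at v fix a parameter each. Adding the two conditions cancels
u and v up to an integer multiple of γ and produces a sum of two parameters excluded by genericity.
-/
lemma GenericPar.hB_ne_zero {S : System} {l : Fin 4 → ℂ} (hl : GenericPar S l) (T T' : VType)
    (u v : ℂ) (r : ℤ) (huv : u - v = I * r * gam S) (h : hA S l T u = 0) : hB S l T' v ≠ 0 := by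
  intro h'
  have h1 := (mul_eq_zero.1 h).resolve_left (phA_ne_zero S u)
  have h2 := (mul_eq_zero.1 h').resolve_left (phB_ne_zero S v)
  obtain ⟨k, -, hk⟩ := Finset.prod_eq_zero_iff.1 h1
  obtain ⟨k', -, hk'⟩ := Finset.prod_eq_zero_iff.1 h2
  obtain ⟨m, hm⟩ := lin_eq_zero_imp S _ _ hk
  obtain ⟨m', hm'⟩ := lin_eq_zero_imp S _ _ hk'
  refine hl k k' r (m + m') ?_
  push_cast
  linear_combination hm + hm' - I * huv - r * gam S * I_mul_I

/-- The shift of a node. -/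
noncomputable def nc (S : System) (L : ℕ) (j : ℕ) : ℂ := I * (((L : ℂ) - 1) / 2 - j) * gam S

lemma node_eq_add (S : System) (L : ℕ) (x : ℂ) (j : ℕ) : node S L x j = x + nc S L j := rfl

/-- The shift of the sum of two nodes. -/
noncomputable def nc2 (S : System) (L : ℕ) (σ : ℕ) : ℂ := I * ((L : ℂ) - 1 - σ) * gam S

lemma nc_add (S : System) (L : ℕ) (j k : ℕ) : nc S L j + nc S L k = nc2 S L (j + k) := by
  simp only [nc, nc2]; push_cast; ring

/-- Where the Vandermonde factor of index sum σ vanishes, reflection maps nodes to nodes modulo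
periods and multiples of iγ. A zero of `hA` at a node would thus be a zero of `hB` at a point
differing by an integer multiple of iγ, contrary to the preceding lemma. -/
lemma GenericPar.hA_ne_zero_of_sg {S : System} {l : Fin 4 → ℂ} (hl : GenericPar S l) (T : VType)
    (L σ t : ℕ) (x : ℂ) (h : sg S (2 * x + nc2 S L σ) = 0) : hA S l T (x + nc S L t) ≠ 0 := by
  intro h0
  have hs : sg S ((2 * x + nc2 S L σ - (x + nc S L t)) + (x + nc S L t)) = 0 := by
    rw [sub_add_cancel]; exact h
  refine hl.hB_ne_zero T T (x + nc S L t) _ ((σ : ℤ) - 2 * t) ?_ h0 ((hB_of_sg S l T _ _ hs).trans h0)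
  simp only [nc, nc2]; push_cast; ring

lemma GenericPar.hB_ne_zero_of_sg {S : System} {l : Fin 4 → ℂ} (hl : GenericPar S l) (T : VType)
    (L σ t : ℕ) (x : ℂ) (h : sg S (2 * x + nc2 S L σ) = 0) : hB S l T (x + nc S L t) ≠ 0 := by
  intro h0
  have hs : sg S ((x + nc S L t) + (2 * x + nc2 S L σ - (x + nc S L t))) = 0 := by
    rw [add_sub_cancel]; exact h
  refine hl.hB_ne_zero T T _ (x + nc S L t) (2 * t - (σ : ℤ)) ?_
    ((hB_of_sg S l T _ _ hs).symm.trans h0) h0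
  simp only [nc, nc2]; push_cast; ring

/-! ### Casoratians of general columns -/

/-- Whether a column of the given kind carries the factor `ν^T`. -/
def carr : Option VType → VType → ℕ
  | some .I, .I => 0
  | some .II, .II => 0
  | _, _ => 1

lemma carr_le_one (o : Option VType) (T : VType) : carr o T ≤ 1 := by
  rcases o with _ | (_ | _) <;> cases T <;> simp [carr]

/-- A column entry with an arbitrary polynomial. -/
noncomputable def rawEntry (S : System) (l : Fin 4 → ℂ) (L : ℕ) (x : ℂ) (j : ℕ) (o : Option VType)
    (p : ℂ[X]) : ℂ :=
  nuRow S l .I L x j ^ carr o .I * nuRow S l .II L x j ^ carr o .II * p.eval (eta S (node S L x j))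

/-- The determinant of general columns. -/
noncomputable def rawDet (S : System) (l : Fin 4 → ℂ) {L : ℕ} (o : Fin L → Option VType)
    (p : Fin L → ℂ[X]) (x : ℂ) : ℂ :=
  Matrix.det (Matrix.of fun j k : Fin L => rawEntry S l L x j (o k) (p k))

/-- The polynomial model of `nuRow`. -/
noncomputable def pNu (S : System) (l : Fin 4 → ℂ) (T : VType) (L : ℕ) (j : ℕ) : ℂ[X] :=
  (∏ m ∈ Finset.range j, pA S l T (nc S L m)) * ∏ m ∈ Finset.Ico (j + 1) L, pB S l T (nc S L m)

lemma eval_pNu (S : System) (l : Fin 4 → ℂ) (T : VType) (L j : ℕ) (hj : j < L) (x : ℂ) :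
    nuC S L * (pNu S l T L j).eval (zeta S x) = nuRow S l T L x j * om S x ^ (L - 1) := by
  rw [nuRow_eq S l T L x j hj, pNu]
  simp only [eval_mul, eval_prod, eval_pA, eval_pB, Finset.prod_mul_distrib, Finset.prod_const,
    Finset.card_range, Nat.card_Ico, node_eq_add]
  have : om S x ^ (L - 1) = om S x ^ j * om S x ^ (L - (j + 1)) := by
    rw [← pow_add]; congr 1; omega
  rw [this]; ring

/-- The polynomial model of a column entry. -/
noncomputable def pEnt (S : System) (l : Fin 4 → ℂ) (L : ℕ) (j : ℕ) (o : Option VType)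
    (d : ℕ) (p : ℂ[X]) : ℂ[X] :=
  pNu S l .I L j ^ carr o .I * pNu S l .II L j ^ carr o .II * pcol S d p (nc S L j)

/-- The exponent of the weight in a column. -/
def colWt (L : ℕ) (o : Option VType) (d : ℕ) : ℕ := (L - 1) * (carr o .I + carr o .II) + d

lemma eval_pEnt (S : System) (l : Fin 4 → ℂ) (L j : ℕ) (hj : j < L) (o : Option VType)
    (d : ℕ) (p : ℂ[X]) (hp : p.natDegree ≤ d) (x : ℂ) :
    (nuC S L ^ (carr o .I + carr o .II)) * (pEnt S l L j o d p).eval (zeta S x) =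
      rawEntry S l L x j o p * om S x ^ colWt L o d := by
  simp only [pEnt, eval_mul, eval_pow, eval_pcol S d p hp, rawEntry, colWt, node_eq_add]
  have h1 := eval_pNu S l .I L j hj x
  have h2 := eval_pNu S l .II L j hj x
  rw [pow_add, pow_add, pow_mul, pow_add]
  calc _ = (nuC S L * (pNu S l .I L j).eval (zeta S x)) ^ carr o .I *
      (nuC S L * (pNu S l .II L j).eval (zeta S x)) ^ carr o .II *
      (eval (eta S (x + nc S L j)) p * om S x ^ d) := by rw [mul_pow, mul_pow]; ring
    _ = _ := by rw [h1, h2, mul_pow, mul_pow]; ring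

/-- The polynomial model of the determinant. -/
noncomputable def pDet (S : System) (l : Fin 4 → ℂ) {L : ℕ} (o : Fin L → Option VType)
    (d : Fin L → ℕ) (p : Fin L → ℂ[X]) : ℂ[X] :=
  Matrix.det (Matrix.of fun j k : Fin L => pEnt S l L j (o k) (d k) (p k))

lemma eval_pDet (S : System) (l : Fin 4 → ℂ) {L : ℕ} (o : Fin L → Option VType)
    (d : Fin L → ℕ) (p : Fin L → ℂ[X]) (hp : ∀ k, (p k).natDegree ≤ d k) (x : ℂ) :
    (∏ k, nuC S L ^ (carr (o k) .I + carr (o k) .II)) * (pDet S l o d p).eval (zeta S x) =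
      rawDet S l o p x * om S x ^ ∑ k, colWt L (o k) (d k) := by
  have e : (pDet S l o d p).eval (zeta S x) = Matrix.det (Matrix.of fun j k : Fin L =>
      (pEnt S l L j (o k) (d k) (p k)).eval (zeta S x)) := by
    rw [pDet, ← coe_evalRingHom, RingHom.map_det]; rfl
  rw [e, ← Finset.prod_pow_eq_pow_sum, mul_comm (rawDet S l o p x), rawDet]
  have h1 := Matrix.det_mul_row (fun k : Fin L => nuC S L ^ (carr (o k) .I + carr (o k) .II))
    (Matrix.of fun j k : Fin L => (pEnt S l L j (o k) (d k) (p k)).eval (zeta S x))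
  have h2 := Matrix.det_mul_row (fun k : Fin L => om S x ^ colWt L (o k) (d k))
    (Matrix.of fun j k : Fin L => rawEntry S l L x j (o k) (p k))
  rw [← h1, ← h2]
  congr 1
  ext j k
  simp only [Matrix.of_apply]
  rw [eval_pEnt S l L j j.2 _ _ _ (hp k), mul_comm]

/-- The number of columns carrying `ν^T`. -/
def mcount {L : ℕ} (o : Fin L → Option VType) (T : VType) : ℕ := ∑ k, carr (o k) T

lemma mcount_le {L : ℕ} (o : Fin L → Option VType) (T : VType) : mcount o T ≤ L := by
  have := Finset.sum_le_sum fun k (_ : k ∈ Finset.univ) => carr_le_one (o k) T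
  simpa [mcount] using this

lemma mcount_eq_card {L : ℕ} (o : Fin L → Option VType) (T : VType) :
    mcount o T = (Finset.univ.filter fun k => carr (o k) T = 1).card := by
  rw [Finset.card_filter]
  refine Finset.sum_congr rfl fun k _ => ?_
  have := carr_le_one (o k) T
  split_ifs <;> omega

/-- The polynomial model of `∏_{j<m} twistPoch j j`. -/
noncomputable def pPi (S : System) (l : Fin 4 → ℂ) (T : VType) (L m : ℕ) : ℂ[X] :=
  ∏ i ∈ Finset.range m, ((∏ t ∈ Finset.range i, pA S l T (nc S L t)) *
    ∏ t ∈ Finset.Ico (L - i) L, pB S l T (nc S L t))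

lemma eval_pPi (S : System) (l : Fin 4 → ℂ) (T : VType) (L m : ℕ) (hm : m ≤ L) (x : ℂ) :
    (∏ i ∈ Finset.range m, tpC S L i) * (pPi S l T L m).eval (zeta S x) =
      (∏ i ∈ Finset.range m, twistPoch S l T (((L : ℂ) - 1) / 2) x i i) *
        om S x ^ ∑ i ∈ Finset.range m, 2 * i := by
  rw [pPi, eval_prod, ← Finset.prod_mul_distrib, ← Finset.prod_pow_eq_pow_sum,
    ← Finset.prod_mul_distrib]
  refine Finset.prod_congr rfl fun i hi => ?_
  have hi' := Finset.mem_range.1 hi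
  rw [twistPoch_eq S l T L x i (by omega)]
  simp only [eval_mul, eval_prod, eval_pA, eval_pB, Finset.prod_mul_distrib, Finset.prod_const,
    Finset.card_range, Nat.card_Ico, node_eq_add]
  rw [show L - (L - i) = i by omega, two_mul, pow_add]
  ring

lemma pPi_ne_zero (S : System) (l : Fin 4 → ℂ) (T : VType) (L m : ℕ) : pPi S l T L m ≠ 0 :=
  Finset.prod_ne_zero_iff.2 fun _ _ => mul_ne_zero
    (Finset.prod_ne_zero_iff.2 fun _ _ => pA_ne_zero _ _ _ _)
    (Finset.prod_ne_zero_iff.2 fun _ _ => pB_ne_zero _ _ _ _)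

lemma natDegree_pPi (S : System) (l : Fin 4 → ℂ) (T : VType) (L m : ℕ) (hm : m ≤ L) :
    (pPi S l T L m).natDegree = parDeg S * ∑ i ∈ Finset.range m, 2 * i := by
  rw [pPi, natDegree_prod, Finset.mul_sum]
  · refine Finset.sum_congr rfl fun i hi => ?_
    have hi' := Finset.mem_range.1 hi
    have h1 : ∏ t ∈ Finset.range i, pA S l T (nc S L t) ≠ 0 :=
      Finset.prod_ne_zero_iff.2 fun _ _ => pA_ne_zero _ _ _ _
    have h2 : ∏ t ∈ Finset.Ico (L - i) L, pB S l T (nc S L t) ≠ 0 :=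
      Finset.prod_ne_zero_iff.2 fun _ _ => pB_ne_zero _ _ _ _
    rw [natDegree_mul h1 h2, natDegree_prod _ _ fun _ _ => pA_ne_zero _ _ _ _,
      natDegree_prod _ _ fun _ _ => pB_ne_zero _ _ _ _]
    simp only [natDegree_pA, natDegree_pB, Finset.sum_const, Finset.card_range, Nat.card_Ico,
      smul_eq_mul]
    rw [show L - (L - i) = i by omega]
    ring
  · exact fun _ _ => mul_ne_zero
      (Finset.prod_ne_zero_iff.2 fun _ _ => pA_ne_zero _ _ _ _)
      (Finset.prod_ne_zero_iff.2 fun _ _ => pB_ne_zero _ _ _ _)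

/-- In a term of the Leibniz expansion the columns carrying ν^T lie in distinct rows. The products
of factors above a row form a divisibility chain, and so do those below it. Hence a product over m
distinct rows is divisible by the product of the m smallest members of either chain. -/
lemma pPi_dvd_prod_pNu (S : System) (l : Fin 4 → ℂ) (T : VType) {L : ℕ}
    (o : Fin L → Option VType) (σ : Equiv.Perm (Fin L)) :
    pPi S l T L (mcount o T) ∣ ∏ k, pNu S l T L (σ k) ^ carr (o k) T := by
  have e : ∏ k, pNu S l T L (σ k) ^ carr (o k) T =
      ∏ k ∈ Finset.univ.filter fun k => carr (o k) T = 1, pNu S l T L (σ k) := by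
    rw [Finset.prod_filter]
    refine Finset.prod_congr rfl fun k _ => ?_
    have := carr_le_one (o k) T
    split_ifs with h
    · rw [h, pow_one]
    · rw [show carr (o k) T = 0 by omega, pow_zero]
  rw [e, pPi, mcount_eq_card]
  simp only [pNu, Finset.prod_mul_distrib]
  refine mul_dvd_mul ?_ ?_
  · refine prod_chain_dvd' (fun i => ∏ t ∈ Finset.range i, pA S l T (nc S L t)) (fun i => ?_) _
      (fun k => (σ k : ℕ)) fun a _ b _ h => σ.injective (Fin.ext h)
    rw [Finset.prod_range_succ]; exact dvd_mul_right _ _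
  · have := prod_chain_dvd' (fun i => ∏ t ∈ Finset.Ico (L - i) L, pB S l T (nc S L t))
      (fun i => ?_) (Finset.univ.filter fun k => carr (o k) T = 1)
      (fun k => L - ((σ k : ℕ) + 1)) fun a _ b _ h => ?_
    · refine this.trans (dvd_of_eq (Finset.prod_congr rfl fun k _ => ?_))
      have := (σ k).2
      rw [show L - (L - ((σ k : ℕ) + 1)) = (σ k : ℕ) + 1 by omega]
    · apply Finset.prod_dvd_prod_of_subset
      apply Finset.Ico_subset_Ico <;> omega
    · apply σ.injective
      apply Fin.ext
      have h1 := (σ a).2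
      have h2 := (σ b).2
      simp only at h
      omega

lemma pPi_dvd_pDet (S : System) (l : Fin 4 → ℂ) {L : ℕ} (o : Fin L → Option VType)
    (d : Fin L → ℕ) (p : Fin L → ℂ[X]) :
    pPi S l .I L (mcount o .I) * pPi S l .II L (mcount o .II) ∣ pDet S l o d p := by
  rw [pDet, Matrix.det_apply]
  refine Finset.dvd_sum fun σ _ => ?_
  have : pPi S l .I L (mcount o .I) * pPi S l .II L (mcount o .II) ∣
      ∏ k, pEnt S l L (σ k) (o k) (d k) (p k) := by
    simp only [pEnt, Finset.prod_mul_distrib]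
    exact Dvd.dvd.mul_right (mul_dvd_mul (pPi_dvd_prod_pNu S l .I o σ)
      (pPi_dvd_prod_pNu S l .II o σ)) _
  rw [Units.smul_def, zsmul_eq_mul]
  exact Dvd.dvd.mul_left this _

/-! ### The Vandermonde factor -/

/-- The polynomial model of the Vandermonde product. -/
noncomputable def pV (S : System) (L : ℕ) : ℂ[X] :=
  ∏ k ∈ Finset.range L, ∏ j ∈ Finset.range k, wP S (nc2 S L (j + k))

/-- The constant in the Vandermonde product. -/
noncomputable def vC (S : System) (L : ℕ) : ℂ :=
  ∏ k ∈ Finset.range L, ∏ j ∈ Finset.range k, dl S (nc S L j - nc S L k)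

lemma vC_ne_zero (S : System) (L : ℕ) : vC S L ≠ 0 := by
  refine Finset.prod_ne_zero_iff.2 fun k _ => Finset.prod_ne_zero_iff.2 fun j hj => ?_
  have hj' := Finset.mem_range.1 hj
  have := dl_ne_zero S ((k : ℝ) - j) (by
    rw [sub_ne_zero]; exact_mod_cast hj'.ne')
  have e : nc S L j - nc S L k = I * (((k : ℝ) - j : ℝ) : ℂ) * gam S := by
    simp only [nc]; push_cast; ring
  rwa [e]

lemma eval_pV (S : System) (L : ℕ) (x : ℂ) :
    vC S L * (pV S L).eval (zeta S x) =
      (∏ k ∈ Finset.range L, ∏ j ∈ Finset.range k, (eta S (node S L x j) - eta S (node S L x k))) *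
        om S x ^ ∑ k ∈ Finset.range L, k := by
  rw [vC, pV, eval_prod, ← Finset.prod_mul_distrib, ← Finset.prod_pow_eq_pow_sum,
    ← Finset.prod_mul_distrib]
  refine Finset.prod_congr rfl fun k _ => ?_
  rw [eval_prod, ← Finset.prod_mul_distrib]
  have : om S x ^ k = ∏ j ∈ Finset.range k, om S x := by simp
  rw [this, ← Finset.prod_mul_distrib]
  refine Finset.prod_congr rfl fun j _ => ?_
  rw [eval_wP, eta_sub, node_eq_add, node_eq_add, ← nc_add,
    show x + nc S L j - (x + nc S L k) = nc S L j - nc S L k by ring,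
    show x + nc S L j + (x + nc S L k) = 2 * x + (nc S L j + nc S L k) by ring]
  ring

lemma pV_ne_zero (S : System) (L : ℕ) : pV S L ≠ 0 :=
  Finset.prod_ne_zero_iff.2 fun _ _ => Finset.prod_ne_zero_iff.2 fun _ _ =>
    (wP_ne_zero_natDegree S _).1

lemma natDegree_pV (S : System) (L : ℕ) :
    (pV S L).natDegree = wDeg S * ∑ k ∈ Finset.range L, k := by
  rw [pV, natDegree_prod _ _ fun _ _ => Finset.prod_ne_zero_iff.2 fun _ _ =>
    (wP_ne_zero_natDegree S _).1, Finset.mul_sum]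
  refine Finset.sum_congr rfl fun k _ => ?_
  rw [natDegree_prod _ _ fun _ _ => (wP_ne_zero_natDegree S _).1]
  simp [(wP_ne_zero_natDegree S _).2, mul_comm]

lemma isCoprime_wP (S : System) (L σ σ' : ℕ) (h : σ ≠ σ') :
    IsCoprime (wP S (nc2 S L σ)) (wP S (nc2 S L σ')) := by
  refine isCoprime_of_no_common_root fun r hr hr' => ?_
  obtain ⟨x, rfl, hx⟩ := exists_zeta_of_root S _ _ hr
  rw [eval_wP] at hr'
  have hx' := (mul_eq_zero.1 hr').resolve_right (om_ne_zero S x)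
  have e : 2 * x + nc2 S L σ' = 2 * x + nc2 S L σ + I * ((σ - σ' : ℤ) : ℂ) * gam S := by
    simp only [nc2]; push_cast; ring
  rw [e] at hx'
  have := sg_shift_unique S _ _ hx hx'
  omega

lemma GenericPar.isCoprime_pPi {S : System} {l : Fin 4 → ℂ} (hl : GenericPar S l) (T : VType)
    (L m σ : ℕ) : IsCoprime (wP S (nc2 S L σ)) (pPi S l T L m) := by
  refine isCoprime_of_no_common_root fun r hr => ?_
  obtain ⟨x, rfl, hx⟩ := exists_zeta_of_root S _ _ hr
  rw [pPi, eval_prod, Finset.prod_ne_zero_iff]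
  intro i _
  rw [eval_mul, eval_prod, eval_prod]
  refine mul_ne_zero (Finset.prod_ne_zero_iff.2 fun t _ => ?_)
    (Finset.prod_ne_zero_iff.2 fun t _ => ?_)
  · rw [eval_pA]
    exact mul_ne_zero (hl.hA_ne_zero_of_sg T L σ t x hx) (om_ne_zero S x)
  · rw [eval_pB]
    exact mul_ne_zero (hl.hB_ne_zero_of_sg T L σ t x hx) (om_ne_zero S x)

/-- The rows j and σ - j have the same factors except for the nodes between them. There row j has
B's and row σ - j has A's, and reflection identifies the B at node t with the A at node σ - t. -/
lemma eval_pNu_of_sg (S : System) (l : Fin 4 → ℂ) (T : VType) (L σ j : ℕ) (x : ℂ)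
    (hx : sg S (2 * x + nc2 S L σ) = 0) (hj : 2 * j < σ) (hL : σ - j < L) :
    (pNu S l T L j).eval (zeta S x) = (pNu S l T L (σ - j)).eval (zeta S x) := by
  have hAB : ∀ t, t ≤ σ → (pB S l T (nc S L t)).eval (zeta S x) =
      (pA S l T (nc S L (σ - t))).eval (zeta S x) := by
    intro t ht
    rw [eval_pA, eval_pB, hB_of_sg S l T _ (x + nc S L (σ - t))]
    rw [show x + nc S L t + (x + nc S L (σ - t)) = 2 * x + (nc S L t + nc S L (σ - t)) by ring,
      nc_add, Nat.add_sub_cancel' ht]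
    exact hx
  simp only [pNu, eval_mul, eval_prod]
  rw [← Finset.prod_range_mul_prod_Ico _ (show j ≤ σ - j by omega),
    ← Finset.prod_Ico_consecutive _ (show j + 1 ≤ σ - j + 1 by omega) (show σ - j + 1 ≤ L by omega)]
  have : ∏ t ∈ Finset.Ico (j + 1) (σ - j + 1), (pB S l T (nc S L t)).eval (zeta S x) =
      ∏ t ∈ Finset.Ico j (σ - j), (pA S l T (nc S L t)).eval (zeta S x) := by
    have e := Finset.prod_Ico_reflect (fun t => (pA S l T (nc S L t)).eval (zeta S x)) (j + 1)
      (show σ - j + 1 ≤ σ + 1 by omega)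
    rw [show σ + 1 - (σ - j + 1) = j by omega, show σ + 1 - (j + 1) = σ - j by omega] at e
    rw [← e]
    refine Finset.prod_congr rfl fun t ht => ?_
    have := Finset.mem_Ico.1 ht
    rw [hAB t (by omega)]
  rw [this]; ring

lemma eval_pEnt_of_sg (S : System) (l : Fin 4 → ℂ) (L σ j : ℕ) (x : ℂ)
    (hx : sg S (2 * x + nc2 S L σ) = 0) (hj : 2 * j < σ) (hL : σ - j < L) (o : Option VType)
    (d : ℕ) (p : ℂ[X]) (hp : p.natDegree ≤ d) :
    (pEnt S l L j o d p).eval (zeta S x) = (pEnt S l L (σ - j) o d p).eval (zeta S x) := by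
  simp only [pEnt, eval_mul, eval_pow, eval_pcol S d p hp, eval_pNu_of_sg S l _ L σ j x hx hj hL]
  rw [eta_of_sg S (x + nc S L j) (x + nc S L (σ - j))]
  rw [show x + nc S L j + (x + nc S L (σ - j)) = 2 * x + (nc S L j + nc S L (σ - j)) by ring,
      nc_add, Nat.add_sub_cancel' (by omega)]
  exact hx

/-- At the roots of the factor with index sum σ, row j equals row σ - j for every admissible j.
Since the factor is separable, this agreement at roots is a congruence of entries, and every pair of
rows contributes one power. -/
lemma pow_wP_dvd_pDet (S : System) (l : Fin 4 → ℂ) {L : ℕ} (o : Fin L → Option VType)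
    (d : Fin L → ℕ) (p : Fin L → ℂ[X]) (hp : ∀ k, (p k).natDegree ≤ d k) (σ : ℕ) :
    wP S (nc2 S L σ) ^ (Finset.univ.filter fun j : Fin L => 2 * (j : ℕ) < σ ∧ σ - j < L).card ∣
      pDet S l o d p := by
  refine pow_dvd_det _ _ _ (fun j => if h : σ - j < L then ⟨σ - j, h⟩ else j) ?_ ?_
  · intro j hj
    simp only [Finset.mem_filter, Finset.mem_univ, true_and] at hj ⊢
    rw [dif_pos hj.2]
    simp only
    omega
  · intro j hj k
    simp only [Finset.mem_filter, Finset.mem_univ, true_and] at hj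
    rw [dif_pos hj.2]
    refine dvd_of_separable (wP_separable S _) (wP_ne_zero_natDegree S _).1 fun r hr => ?_
    obtain ⟨x, rfl, hx⟩ := exists_zeta_of_root S _ _ hr
    simp only [Matrix.of_apply, eval_sub]
    rw [eval_pEnt_of_sg S l L σ j x hx hj.1 hj.2 _ _ _ (hp k), sub_self]

/-- The Vandermonde factors are grouped by the sum σ of the two indices. Different groups are
coprime, and within one group the number of pairs equals the exponent supplied by `pow_wP_dvd_pDet`.
-/
lemma pV_dvd_pDet (S : System) (l : Fin 4 → ℂ) {L : ℕ} (o : Fin L → Option VType)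
    (d : Fin L → ℕ) (p : Fin L → ℂ[X]) (hp : ∀ k, (p k).natDegree ≤ d k) :
    pV S L ∣ pDet S l o d p := by
  classical
  rw [pV, Finset.prod_sigma']
  rw [← Finset.prod_fiberwise_of_maps_to (s := (Finset.range L).sigma fun k => Finset.range k)
    (t := Finset.range (2 * L)) (g := fun a => a.2 + a.1)]
  · refine Finset.prod_dvd_of_coprime ?_ ?_
    · intro σ _ σ' _ h
      refine IsCoprime.prod_left fun a ha => IsCoprime.prod_right fun b hb => ?_
      rw [(Finset.mem_filter.1 ha).2, (Finset.mem_filter.1 hb).2]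
      exact isCoprime_wP S L σ σ' h
    · intro σ _
      have e : ∏ a ∈ ((Finset.range L).sigma fun k => Finset.range k).filter
          (fun a => a.2 + a.1 = σ), wP S (nc2 S L (a.2 + a.1)) =
          wP S (nc2 S L σ) ^ (((Finset.range L).sigma fun k => Finset.range k).filter
          (fun a => a.2 + a.1 = σ)).card := by
        rw [← Finset.prod_const]
        exact Finset.prod_congr rfl fun a ha => by rw [(Finset.mem_filter.1 ha).2]
      rw [e]
      refine (pow_dvd_pow _ ?_).trans (pow_wP_dvd_pDet S l o d p hp σ)
      refine Finset.card_le_card_of_surjOn (fun j : Fin L => ⟨σ - j, j⟩) fun a ha => ?_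
      simp only [Finset.coe_filter, Finset.mem_sigma, Finset.mem_range, Set.mem_ofPred_eq] at ha
      refine ⟨⟨a.2, by omega⟩, ?_, ?_⟩
      · simp only [Finset.coe_filter, Finset.mem_univ, true_and, Set.mem_ofPred_eq]
        omega
      · obtain ⟨k, j⟩ := a
        simp only at ha ⊢
        rw [show σ - j = k by omega]
  · intro a ha
    simp only [Finset.mem_sigma, Finset.mem_range] at ha ⊢
    omega

/-! ### Degrees -/

/-- The expected degree of the polynomial part. -/
def expDeg {L : ℕ} (o : Fin L → Option VType) (d : Fin L → ℕ) : ℤ :=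
  (∑ k, colWt L (o k) (d k) : ℕ) - ((∑ k ∈ Finset.range L, k : ℕ) : ℤ) -
    (∑ i ∈ Finset.range (mcount o .I), 2 * i : ℕ) - (∑ i ∈ Finset.range (mcount o .II), 2 * i : ℕ)

lemma filt_affine (N : ℕ) (a b c : ℂ) : Filt N 1 (fun j => C a * X + C (b + c * j)) := by
  have h : ∀ j : ℕ, DegLE (C a * X + C (b + c * j)) 1 := fun j =>
    DegLE.of_natDegree (n := 1) natDegree_linear_le
  cases N with
  | zero => exact h 0
  | succ n =>
    refine ⟨fun j _ => h j, (Filt.const (DegLE.C c)).congr fun j _ => ?_⟩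
    simp only [C_add, C_mul]; push_cast; simp only [C_add, mul_add, C_1]; ring

lemma filt_linP (S : System) (hS : ∀ q h0 h1, S ≠ .AW q h0 h1) (s : ℂ) (L N : ℕ) :
    Filt N 1 (fun j => linP S s (nc S L j)) := by
  refine (filt_affine N I (s + I * (I * (((L : ℂ) - 1) / 2) * gam S)) (-(I * I * gam S))).congr
    fun j _ => ?_
  cases S with
  | cH => simp only [linP, nc]; congr 2; ring
  | W => simp only [linP, nc]; congr 2; ring
  | AW q h0 h1 => exact absurd rfl (hS q h0 h1)

lemma filt_linN (S : System) (hS : ∀ q h0 h1, S ≠ .AW q h0 h1) (s : ℂ) (L N : ℕ) :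
    Filt N 1 (fun j => linN S s (nc S L j)) := by
  refine (filt_affine N (-I) (s - I * (I * (((L : ℂ) - 1) / 2) * gam S)) (I * I * gam S)).congr
    fun j _ => ?_
  cases S with
  | cH => simp only [linN, nc]; congr 2; ring
  | W => simp only [linN, nc]; congr 2; ring
  | AW q h0 h1 => exact absurd rfl (hS q h0 h1)

lemma filt_pA (S : System) (hS : ∀ q h0 h1, S ≠ .AW q h0 h1) (l : Fin 4 → ℂ) (T : VType)
    (L N : ℕ) : Filt N (parDeg S) (fun j => pA S l T (nc S L j)) := by
  have h := fun s => filt_linP S hS s L N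
  cases S with
  | cH =>
    cases T with
    | I =>
      refine ((Filt.const (DegLE.C (-1))).mul (h (l 0))).congr fun j _ => ?_
      simp [pA, plusPar, phA]
    | II =>
      refine ((Filt.const (DegLE.C (-1))).mul (h (l 1))).congr fun j _ => ?_
      simp [pA, plusPar, phA]
  | W =>
    cases T with
    | I =>
      refine ((h (l 0)).mul (h (l 1))).congr fun j _ => ?_
      simp [pA, plusPar, phA]
    | II =>
      refine ((h (l 2)).mul (h (l 3))).congr fun j _ => ?_
      simp [pA, plusPar, phA]
  | AW q h0 h1 => exact absurd rfl (hS q h0 h1)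

lemma filt_pB (S : System) (hS : ∀ q h0 h1, S ≠ .AW q h0 h1) (l : Fin 4 → ℂ) (T : VType)
    (L N : ℕ) : Filt N (parDeg S) (fun j => pB S l T (nc S L j)) := by
  have h := fun s => filt_linN S hS s L N
  cases S with
  | cH =>
    cases T with
    | I =>
      refine (h (l 2)).congr fun j _ => ?_
      simp [pB, minusPar, phB]
    | II =>
      refine (h (l 3)).congr fun j _ => ?_
      simp [pB, minusPar, phB]
  | W =>
    cases T with
    | I =>
      refine ((h (l 0)).mul (h (l 1))).congr fun j _ => ?_
      simp [pB, minusPar, phB]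
    | II =>
      refine ((h (l 2)).mul (h (l 3))).congr fun j _ => ?_
      simp [pB, minusPar, phB]
  | AW q h0 h1 => exact absurd rfl (hS q h0 h1)

/-- The leading terms agree: for cH the sign -1 in `phA` matches the sign of -ix, and for W the
products of two factors have the same square term. This cancellation is what makes differences of
`nuRow` drop in degree. -/
lemma filt_pA_sub_pB (S : System) (hS : ∀ q h0 h1, S ≠ .AW q h0 h1) (l : Fin 4 → ℂ) (T : VType)
    (L N : ℕ) :
    Filt N (parDeg S - 1) (fun j => pA S l T (nc S L j) - pB S l T (nc S L j)) := by
  cases S with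
  | cH =>
    have h : ∀ s : ℂ, Filt N 0 (fun _ => C s) := fun s => Filt.const (DegLE.C s)
    cases T with
    | I =>
      refine (h (-(l 0 + l 2))).congr fun j _ => ?_
      simp [pA, pB, minusPar, plusPar, phA, phB, linP, linN]; ring
    | II =>
      refine (h (-(l 1 + l 3))).congr fun j _ => ?_
      simp [pA, pB, minusPar, plusPar, phA, phB, linP, linN]; ring
  | W =>
    have h : ∀ s : ℂ, Filt N 1 (fun j => C s * linP .W 0 (nc .W L j)) := fun s =>
      ((Filt.const (DegLE.C s)).mul (filt_linP _ hS 0 L N)).mono (by simp)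
    cases T with
    | I =>
      refine (h (l 0 + l 1 + (l 0 + l 1))).congr fun j _ => ?_
      simp [pA, pB, minusPar, plusPar, phA, phB, linP, linN]; ring
    | II =>
      refine (h (l 2 + l 3 + (l 2 + l 3))).congr fun j _ => ?_
      simp [pA, pB, minusPar, plusPar, phA, phB, linP, linN]; ring
  | AW q h0 h1 => exact absurd rfl (hS q h0 h1)

lemma degLE_omP (S : System) : DegLE (omP S) (parDeg S) := by
  cases S with
  | cH => exact (DegLE.C 1).mono (by simp [parDeg])
  | W => exact (DegLE.C 1).mono (by simp [parDeg])
  | AW q h0 h1 => exact DegLE.X.mono (by simp [parDeg])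

lemma degLE_pE (S : System) (c : ℂ) : DegLE (pE S c) (parDeg S) := by
  cases S with
  | cH => exact DegLE.of_natDegree (n := 1) (by simp [pE])
  | W => exact DegLE.of_natDegree (n := 2) (by simp [pE])
  | AW q h0 h1 =>
    have := natDegree_quadratic_le (a := exp (I * c) / 2) (b := 0) (c := exp (-(I * c)) / 2)
    rw [C_0, zero_mul, add_zero] at this
    exact DegLE.of_natDegree (n := 2) this

lemma degLE_pcol (S : System) (d : ℕ) (p : ℂ[X]) (c : ℂ) :
    DegLE (pcol S d p c) (parDeg S * d) := by
  refine DegLE.sum fun i hi => ?_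
  have hi' := Finset.mem_range.1 hi
  refine (((DegLE.C _).mul ((degLE_pE S c).pow i)).mul ((degLE_omP S).pow (d - i))).mono ?_
  rw [zero_add, ← add_mul, ← Nat.cast_add, Nat.add_sub_cancel' (by omega), mul_comm]

lemma filt_pcol (S : System) (hS : ∀ q h0 h1, S ≠ .AW q h0 h1) (d : ℕ) (p : ℂ[X]) (L N : ℕ) :
    Filt N (parDeg S * d) (fun j => pcol S d p (nc S L j)) := by
  have hE : Filt N (parDeg S) (fun j => pE S (nc S L j)) := by
    cases S with
    | cH =>
      refine (filt_affine N 1 (I * (((L : ℂ) - 1) / 2) * gam .cH) (-(I * gam .cH))).congr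
        fun j _ => ?_
      simp only [pE, nc, C_1, one_mul]; congr 2; ring
    | W =>
      refine ((filt_affine N 1 (I * (((L : ℂ) - 1) / 2) * gam .W) (-(I * gam .W))).pow 2).congr
        fun j _ => ?_
      simp only [pE, nc, C_1, one_mul]; congr 3; ring
    | AW q h0 h1 => exact absurd rfl (hS q h0 h1)
  refine Filt.sum fun i hi => ?_
  have hi' := Finset.mem_range.1 hi
  refine (((Filt.const (DegLE.C (p.coeff i))).mul (hE.pow i)).mul
    ((Filt.const (degLE_omP S)).pow (d - i))).mono ?_
  rw [zero_add, ← add_mul, ← Nat.cast_add, Nat.add_sub_cancel' (by omega), mul_comm]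

lemma degLE_pNu (S : System) (l : Fin 4 → ℂ) (T : VType) (L j : ℕ) (hj : j < L) :
    DegLE (pNu S l T L j) (parDeg S * (L - 1 : ℕ)) := by
  have h1 := DegLE.prod (s := Finset.range j) (p := fun m => pA S l T (nc S L m))
    (D := fun _ => (parDeg S : ℤ)) fun i _ => DegLE.of_natDegree (natDegree_pA S l T _).le
  have h2 := DegLE.prod (s := Finset.Ico (j + 1) L) (p := fun m => pB S l T (nc S L m))
    (D := fun _ => (parDeg S : ℤ)) fun i _ => DegLE.of_natDegree (natDegree_pB S l T _).le
  refine (h1.mul h2).mono ?_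
  simp only [Finset.sum_const, Finset.card_range, Nat.card_Ico, nsmul_eq_mul]
  rw [← add_mul, ← Nat.cast_add, show j + (L - (j + 1)) = L - 1 by omega, mul_comm]

/-- For cH and W, differencing the rows lowers the degree by L(L - 1)/2. For AW no gain is available
and none is needed, because the Vandermonde factors already have degree `parDeg`. The coefficient
`parDeg S - wDeg S` is 1 in the first two cases and 0 in the last. -/
lemma degLE_pDet (S : System) (l : Fin 4 → ℂ) {L : ℕ} (o : Fin L → Option VType)
    (d : Fin L → ℕ) (p : Fin L → ℂ[X]) :
    DegLE (pDet S l o d p) (parDeg S * (∑ k, colWt L (o k) (d k) : ℕ) -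
      (parDeg S - wDeg S) * ((∑ k ∈ Finset.range L, k : ℕ) : ℤ)) := by
  by_cases hS : ∀ q h0 h1, S ≠ .AW q h0 h1
  · have hw : (parDeg S - wDeg S : ℤ) = 1 := by
      cases S with
      | cH => rfl
      | W => rfl
      | AW q h0 h1 => exact absurd rfl (hS q h0 h1)
    rw [hw, one_mul]
    have hν : ∀ T, Filt (L - 1) (parDeg S * (L - 1 : ℕ)) (fun j => pNu S l T L j) := fun T => by
      refine (Filt.nuSeq (n := L - 1) (filt_pA S hS l T L) (filt_pB S hS l T L)
        (filt_pA_sub_pB S hS l T L)).congr fun j hj => ?_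
      cases L with
      | zero =>
        obtain rfl : j = 0 := by omega
        simp [nuSeq, pNu]
      | succ n => rfl
    have := degLE_det_of_filt (L := L) (f := fun k j => pEnt S l L j (o k) (d k) (p k))
      (D := fun k => parDeg S * (colWt L (o k) (d k) : ℕ)) fun k => by
        refine ((((hν .I).pow (carr (o k) .I)).mul ((hν .II).pow (carr (o k) .II))).mul
          (filt_pcol S hS (d k) (p k) L (L - 1))).mono ?_
        simp only [colWt]; push_cast; ring_nf; rfl
    rw [pDet]
    refine this.mono (le_of_eq ?_)
    rw [← Finset.mul_sum, Fin.sum_univ_eq_sum_range (fun k => (k : ℤ)) L]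
    push_cast; rfl
  · push Not at hS
    obtain ⟨q, h0, h1, rfl⟩ := hS
    rw [pDet]
    have := DegLE.det (M := fun j k : Fin L => pEnt (.AW q h0 h1) l L j (o k) (d k) (p k))
      (r := fun _ => 0) (s := fun k => parDeg (.AW q h0 h1) * (colWt L (o k) (d k) : ℕ))
      fun j k => by
        refine (((((degLE_pNu _ l .I L j j.2).pow (carr (o k) .I)).mul
          ((degLE_pNu _ l .II L j j.2).pow (carr (o k) .II))).mul
          (degLE_pcol _ (d k) (p k) _))).mono ?_
        simp only [colWt]; push_cast; ring_nf; rfl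
    refine this.mono (le_of_eq ?_)
    rw [← Finset.mul_sum]
    simp [parDeg, wDeg]

/-- The quotient of the determinant by its prefactor, as polynomials. -/
lemma GenericPar.exists_quotient {S : System} {l : Fin 4 → ℂ} (hl : GenericPar S l) {L : ℕ}
    (o : Fin L → Option VType) (d : Fin L → ℕ) (p : Fin L → ℂ[X])
    (hp : ∀ k, (p k).natDegree ≤ d k) :
    ∃ g, pDet S l o d p = pV S L * (pPi S l .I L (mcount o .I) * pPi S l .II L (mcount o .II)) * g ∧
      DegLE g (parDeg S * expDeg o d) := by
  have hcop : IsCoprime (pV S L) (pPi S l .I L (mcount o .I) * pPi S l .II L (mcount o .II)) := by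
    refine IsCoprime.prod_left fun k _ => IsCoprime.prod_left fun j _ => ?_
    exact (hl.isCoprime_pPi .I L _ _).mul_right (hl.isCoprime_pPi .II L _ _)
  obtain ⟨g, hg⟩ := hcop.mul_dvd (pV_dvd_pDet S l o d p hp) (pPi_dvd_pDet S l o d p)
  refine ⟨g, hg, ?_⟩
  have hD := degLE_pDet S l o d p
  have h1 := pPi_ne_zero S l .I L (mcount o .I)
  have h2 := pPi_ne_zero S l .II L (mcount o .II)
  have h3 := pV_ne_zero S L
  rw [hg] at hD
  refine (hD.of_mul (mul_ne_zero h3 (mul_ne_zero h1 h2))).mono (le_of_eq ?_)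
  rw [natDegree_mul h3 (mul_ne_zero h1 h2), natDegree_mul h1 h2, natDegree_pV,
    natDegree_pPi _ _ _ _ _ (mcount_le o _), natDegree_pPi _ _ _ _ _ (mcount_le o _), expDeg]
  push_cast
  ring

/-! ### Reflection symmetry -/

lemma node_neg (S : System) (L : ℕ) (x : ℂ) (j : ℕ) (hj : j < L) :
    node S L (-x) j = -node S L x (L - 1 - j) := by
  have h : L - 1 - j + 1 + j = L := by omega
  have := congrArg (Nat.cast : ℕ → ℂ) h
  push_cast at this
  simp only [node]
  linear_combination (-(I * gam S)) * this

lemma nuRow_neg (S : System) (hS : S ≠ .cH) (l : Fin 4 → ℂ) (T : VType) (L : ℕ) (x : ℂ) (j : ℕ)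
    (hj : j < L) : nuRow S l T L (-x) j = nuRow S l T L x (L - 1 - j) := by
  rw [nuRow_eq S l T L _ j hj, nuRow_eq S l T L _ _ (by omega : L - 1 - j < L)]
  have h1 : ∏ m ∈ Finset.range j, hA S l T (node S L (-x) m) =
      ∏ m ∈ Finset.Ico (L - 1 - j + 1) L, hB S l T (node S L x m) := by
    have e := Finset.prod_Ico_reflect (fun m => hB S l T (node S L x m)) 0
      (show j ≤ (L - 1) + 1 by omega)
    rw [show L - 1 + 1 - j = L - 1 - j + 1 by omega, show L - 1 + 1 - 0 = L by omega] at e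
    rw [← e, Finset.range_eq_Ico]
    refine Finset.prod_congr rfl fun m hm => ?_
    have := Finset.mem_Ico.1 hm
    rw [node_neg S L x m (by omega), hB_eq S hS]
  have h2 : ∏ m ∈ Finset.Ico (j + 1) L, hB S l T (node S L (-x) m) =
      ∏ m ∈ Finset.range (L - 1 - j), hA S l T (node S L x m) := by
    have e := Finset.prod_Ico_reflect (fun m => hA S l T (node S L x m)) (j + 1)
      (show L ≤ (L - 1) + 1 by omega)
    rw [show L - 1 + 1 - L = 0 by omega, show L - 1 + 1 - (j + 1) = L - 1 - j by omega] at e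
    rw [Finset.range_eq_Ico, ← e]
    refine Finset.prod_congr rfl fun m hm => ?_
    have := Finset.mem_Ico.1 hm
    rw [node_neg S L x m (by omega), hB_eq S hS, neg_neg]
  rw [h1, h2]; ring

/-- Reflection of x reverses the order of the nodes and hence of the rows, so the determinant
changes by the sign of the reversal. The prefactor changes by the same sign (`prefactor_neg`), and
the quotient is even. -/
lemma rawDet_neg (S : System) (hS : S ≠ .cH) (l : Fin 4 → ℂ) {L : ℕ} (o : Fin L → Option VType)
    (p : Fin L → ℂ[X]) (x : ℂ) :
    rawDet S l o p (-x) = ((Equiv.Perm.sign (Fin.revPerm : Equiv.Perm (Fin L)) : ℤ) : ℂ) *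
      rawDet S l o p x := by
  rw [rawDet, rawDet, ← Matrix.det_permute]
  congr 1
  ext j k
  have hj := j.2
  have e : L - 1 - (j : ℕ) = L - (j + 1) := by omega
  simp only [Matrix.of_apply, rawEntry, Matrix.submatrix_apply, id, Fin.revPerm_apply, Fin.val_rev]
  rw [nuRow_neg S hS l _ L x j hj, nuRow_neg S hS l _ L x j hj, node_neg S L x j hj,
    eta_neg_comm S hS, e]

lemma vandermonde_eq_det (L : ℕ) (v : ℕ → ℂ) :
    ∏ k ∈ Finset.range L, ∏ j ∈ Finset.range k, (v j - v k) =
      (∏ k ∈ Finset.range L, ∏ _j ∈ Finset.range k, (-1)) *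
        Matrix.det (Matrix.vandermonde fun i : Fin L => v i) := by
  rw [Matrix.det_vandermonde, Finset.prod_comm' (s := Finset.univ)
    (t := fun i : Fin L => Finset.Ioi i) (t' := Finset.univ)
    (s' := fun j : Fin L => Finset.Iio j) (by simp)]
  have : ∀ j : Fin L, ∏ i ∈ Finset.Iio j, (v j - v i) = ∏ i ∈ Finset.range j, (v j - v i) := by
    intro j
    have e := Finset.prod_map (Finset.Iio j) Fin.valEmbedding (fun i => v j - v i)
    rw [Fin.map_valEmbedding_Iio] at e
    rw [← Nat.Iio_eq_range, e]; rfl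
  simp only [this]
  rw [Fin.prod_univ_eq_prod_range (fun j => ∏ i ∈ Finset.range j, (v j - v i)) L,
    ← Finset.prod_mul_distrib]
  refine Finset.prod_congr rfl fun k _ => ?_
  rw [← Finset.prod_mul_distrib]
  exact Finset.prod_congr rfl fun j _ => by ring

lemma prefactor_neg (S : System) (hS : S ≠ .cH) (l : Fin 4 → ℂ) (L m m' : ℕ) (x : ℂ) :
    prefactor S l L m m' (-x) =
      ((Equiv.Perm.sign (Fin.revPerm : Equiv.Perm (Fin L)) : ℤ) : ℂ) * prefactor S l L m m' x := by
  have ht : ∀ T j, twistPoch S l T (((L : ℂ) - 1) / 2) (-x) j j =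
      twistPoch S l T (((L : ℂ) - 1) / 2) x j j := by
    intro T j
    rw [twistPoch, twistPoch, minusPar_eq S hS, neg_neg, mul_comm]
  simp only [prefactor, ht]
  rw [vandermonde_eq_det L (fun j => eta S (node S L (-x) j)),
    vandermonde_eq_det L (fun j => eta S (node S L x j))]
  have : Matrix.det (Matrix.vandermonde fun i : Fin L => eta S (node S L (-x) i)) =
      ((Equiv.Perm.sign (Fin.revPerm : Equiv.Perm (Fin L)) : ℤ) : ℂ) *
        Matrix.det (Matrix.vandermonde fun i : Fin L => eta S (node S L x i)) := by
    rw [← Matrix.det_permute]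
    congr 1
    ext j k
    have hj := j.2
    have e : L - 1 - (j : ℕ) = L - (j + 1) := by omega
    simp only [Matrix.vandermonde_apply, Matrix.submatrix_apply, id, Fin.revPerm_apply, Fin.val_rev]
    rw [node_neg S L x j hj, eta_neg_comm S hS, e]
  rw [this]; ring

/-- Symmetrization of a polynomial in `zeta` gives a polynomial in `η`. -/
lemma exists_eta_poly (S : System) (hS : S ≠ .cH) (g : ℂ[X]) (N N' : ℕ) (D : ℤ)
    (hD : D = N - N') (hg : DegLE g (parDeg S * D)) :
    ∃ Q : ℂ[X], DegLE Q D ∧ ∀ x, Q.eval (eta S x) =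
      (om S x ^ N' / om S x ^ N * g.eval (zeta S x) +
        om S (-x) ^ N' / om S (-x) ^ N * g.eval (zeta S (-x))) / 2 := by
  cases S with
  | cH => exact absurd rfl hS
  | W =>
    -- Symmetrization in x cancels the odd powers, and the even ones are powers of η = x².
    refine ⟨∑ k ∈ Finset.range (g.natDegree + 1), if Even k then C (g.coeff k) * X ^ (k / 2) else 0,
      DegLE.sum fun k _ => ?_, fun x => ?_⟩
    · split_ifs with hk
      · by_cases h : 2 * D < k
        · rw [hg k h]; simpa using DegLE.zero _
        · refine ((DegLE.C _).mul (DegLE.X.pow _)).mono ?_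
          omega
      · exact DegLE.zero _
    · simp only [om, zeta, one_pow, div_one, one_mul, eval_finsetSum, eval_eq_sum_range (p := g),
        ← Finset.sum_add_distrib, Finset.sum_div]
      refine Finset.sum_congr rfl fun k _ => ?_
      rcases Nat.even_or_odd k with hk | hk
      · obtain ⟨m, rfl⟩ := hk
        rw [if_pos ⟨m, rfl⟩, ← two_mul, Nat.mul_div_cancel_left _ two_pos]
        simp only [eval_mul, eval_C, eval_pow, eval_X, eta, pow_mul, neg_sq]
        ring
      · rw [if_neg (Nat.not_even_iff_odd.2 hk), eval_zero, hk.neg_pow]; ring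
  | AW q h0 h1 =>
    -- With the weight included, the k-th monomial is exp(i(k - D)x), whose symmetrization is cos((k
    -- - D)x), a Chebyshev polynomial of possibly negative index in cos x. Since 0 ≤ k ≤ 2D, its
    -- degree is at most D.
    refine ⟨∑ k ∈ Finset.range (g.natDegree + 1), C (g.coeff k) * Chebyshev.T ℂ (k - D),
      DegLE.sum fun k _ => ?_, fun x => ?_⟩
    · by_cases h : 2 * D < k
      · rw [hg k h]; simpa using DegLE.zero _
      · refine ((DegLE.C _).mul (DegLE.of_natDegree (Chebyshev.natDegree_T ℂ _).le)).mono ?_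
        omega
    · simp only [eval_finsetSum, eval_eq_sum_range (p := g), Finset.mul_sum,
        ← Finset.sum_add_distrib, Finset.sum_div]
      refine Finset.sum_congr rfl fun k _ => ?_
      simp only [eval_mul, eval_C, eta, Chebyshev.T_complex_cos, om, zeta]
      have e : ∀ y : ℂ, exp (I * y) ^ N' / exp (I * y) ^ N * (g.coeff k * exp (I * y) ^ k) =
          g.coeff k * exp (I * ((k - D : ℤ) * y)) := by
        intro y
        have : I * ((k - D : ℤ) * y) = (N' : ℕ) * (I * y) - (N : ℕ) * (I * y) + (k : ℕ) * (I * y) := by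
          rw [hD]; push_cast; ring
        rw [this, exp_add, exp_sub, exp_nat_mul, exp_nat_mul, exp_nat_mul]
        ring
      rw [e, e, Complex.cos]
      rw [show I * ((k - D : ℤ) * -x) = -((k - D : ℤ) * x) * I by ring,
        show I * ((k - D : ℤ) * x) = ((k - D : ℤ) * x) * I by ring]
      ring

/-- Existence of the polynomial part for generic parameters. -/
theorem GenericPar.exists_polynomial {S : System} {l : Fin 4 → ℂ} (hl : GenericPar S l) {L : ℕ}
    (o : Fin L → Option VType) (d : Fin L → ℕ) (p : Fin L → ℂ[X])
    (hp : ∀ k, (p k).natDegree ≤ d k) :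
    ∃ Q : ℂ[X], DegLE Q (expDeg o d) ∧ ∀ x, rawDet S l o p x =
      prefactor S l L (mcount o .II) (mcount o .I) x * Q.eval (eta S x) := by
  obtain ⟨g, hg, hgD⟩ := hl.exists_quotient o d p hp
  set N := ∑ k, colWt L (o k) (d k) with hN
  set N1 := ∑ k ∈ Finset.range L, k with hN1
  set N2 := ∑ i ∈ Finset.range (mcount o .I), 2 * i with hN2
  set N3 := ∑ i ∈ Finset.range (mcount o .II), 2 * i with hN3
  set cD := ∏ k, nuC S L ^ (carr (o k) .I + carr (o k) .II) with hcD
  set t1 := ∏ i ∈ Finset.range (mcount o .I), tpC S L i with ht1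
  set t2 := ∏ i ∈ Finset.range (mcount o .II), tpC S L i with ht2
  have hv := vC_ne_zero S L
  have ht1' : t1 ≠ 0 := Finset.prod_ne_zero_iff.2 fun _ _ => tpC_ne_zero _ _ _
  have ht2' : t2 ≠ 0 := Finset.prod_ne_zero_iff.2 fun _ _ => tpC_ne_zero _ _ _
  -- The polynomial quotient g equals the quotient of the determinant by its prefactor, up to a
  -- constant and a power of the weight. For W and AW it remains to average this identity over x and
  -- -x.
  have key : ∀ x, rawDet S l o p x = prefactor S l L (mcount o .II) (mcount o .I) x *
      (om S x ^ (N1 + N2 + N3) / om S x ^ N * (C (cD / (vC S L * t1 * t2)) * g).eval (zeta S x)) := by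
    intro x
    have e1 := eval_pDet S l o d p hp x
    have e2 := eval_pV S L x
    have e3 := eval_pPi S l .I L _ (mcount_le o .I) x
    have e4 := eval_pPi S l .II L _ (mcount_le o .II) x
    rw [← hN2, ← ht1] at e3
    rw [← hN3, ← ht2] at e4
    rw [← hN1] at e2
    rw [hg, eval_mul, eval_mul, eval_mul, ← hN, ← hcD] at e1
    have ho : om S x ^ N ≠ 0 := pow_ne_zero _ (om_ne_zero S x)
    apply mul_right_cancel₀ ho
    rw [← e1, prefactor, eval_mul, eval_C]
    field_simp
    rw [pow_add, pow_add]
    generalize eval (zeta S x) (pV S L) = v1 at *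
    generalize eval (zeta S x) (pPi S l .I L (mcount o .I)) = v2 at *
    generalize eval (zeta S x) (pPi S l .II L (mcount o .II)) = v3 at *
    generalize (∏ k ∈ Finset.range L, ∏ j ∈ Finset.range k,
      (eta S (node S L x j) - eta S (node S L x k))) = V at *
    generalize (∏ i ∈ Finset.range (mcount o .I),
      twistPoch S l .I (((L : ℂ) - 1) / 2) x i i) = T1 at *
    generalize (∏ i ∈ Finset.range (mcount o .II),
      twistPoch S l .II (((L : ℂ) - 1) / 2) x i i) = T2 at *
    linear_combination cD * eval (zeta S x) g * ((t1 * v2) * (t2 * v3) * e2 +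
      V * om S x ^ N1 * (t2 * v3) * e3 + V * om S x ^ N1 * (T1 * om S x ^ N2) * e4)
  by_cases hS : S = .cH
  · subst hS
    refine ⟨C (cD / (vC .cH L * t1 * t2)) * g, ?_, fun x => ?_⟩
    · exact ((DegLE.C _).mul hgD).mono (by simp [parDeg])
    · rw [key x]; simp [om, zeta, eta]
  · obtain ⟨Q, hQ, hQe⟩ := exists_eta_poly S hS (C (cD / (vC S L * t1 * t2)) * g) N (N1 + N2 + N3)
      (expDeg o d) (by rw [expDeg, ← hN, ← hN1, ← hN2, ← hN3]; push_cast; ring) (((DegLE.C _).mul hgD).mono (by rw [zero_add]))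
    refine ⟨Q, hQ, fun x => ?_⟩
    rw [hQe]
    have k1 := key x
    have k2 := key (-x)
    rw [rawDet_neg S hS, prefactor_neg S hS] at k2
    have hs : (((Equiv.Perm.sign (Fin.revPerm : Equiv.Perm (Fin L)) : ℤ) : ℂ)) ^ 2 = 1 := by
      rcases Int.units_eq_one_or (Equiv.Perm.sign (Fin.revPerm : Equiv.Perm (Fin L))) with e | e <;>
        simp [e]
    generalize (((Equiv.Perm.sign (Fin.revPerm : Equiv.Perm (Fin L)) : ℤ) : ℂ)) = s at *
    linear_combination k1 / 2 + s / 2 * k2 - (rawDet S l o p x - prefactor S l L (mcount o .II)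
      (mcount o .I) x * (om S (-x) ^ (N1 + N2 + N3) / om S (-x) ^ N *
        (C (cD / (vC S L * t1 * t2)) * g).eval (zeta S (-x)))) / 2 * hs

/-! ### The base polynomials as polynomials in `η` -/

/-- The linear polynomial in `η` underlying the basis of shifted factorials. -/
noncomputable def phiLin : System → ℂ → ℂ[X]
  | .cH, s => C I * X + C s
  | .W, s => C 1 * X + C (s ^ 2)
  | .AW q _ _, s => C (-2 * (q : ℂ) ^ s) * X + C (1 + (q : ℂ) ^ s * (q : ℂ) ^ s)

/-- The basis of shifted factorials. -/
noncomputable def phiP (S : System) (s : ℂ) (k : ℕ) : ℂ[X] :=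
  ∏ i ∈ Finset.range k, phiLin S (s + i)

/-- The coefficients of the base polynomials in the basis of shifted factorials. -/
noncomputable def baseCoeff : System → (Fin 4 → ℂ) → ℕ → ℕ → ℂ
  | .cH, l, n, k =>
      Complex.I ^ n / (n.factorial : ℂ) *
          (poch0 .cH (-n) k * poch0 .cH (n + (l 0 + l 1 + l 2 + l 3) - 1) k *
            poch0 .cH (l 0 + l 2 + k) (n - k) * poch0 .cH (l 0 + l 3 + k) (n - k) /
            (k.factorial : ℂ))
  | .W, l, n, k =>
        poch0 .W (-n) k * poch0 .W (n + (l 0 + l 1 + l 2 + l 3) - 1) k *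
          poch0 .W (l 0 + l 1 + k) (n - k) * poch0 .W (l 0 + l 2 + k) (n - k) *
          poch0 .W (l 0 + l 3 + k) (n - k) / (k.factorial : ℂ)
  | .AW q h0 h1, l, n, k =>
      (q : ℂ) ^ (-(n * l 0)) *
          (poch0 (.AW q h0 h1) (-n) k *
            poch0 (.AW q h0 h1) (n + (l 0 + l 1 + l 2 + l 3) - 1) k *
            poch0 (.AW q h0 h1) (l 0 + l 1 + k) (n - k) *
            poch0 (.AW q h0 h1) (l 0 + l 2 + k) (n - k) *
            poch0 (.AW q h0 h1) (l 0 + l 3 + k) (n - k) * (q : ℂ) ^ k /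
            poch0 (.AW q h0 h1) 1 k)

/-- The base polynomial as a polynomial in `η`. -/
noncomputable def baseP (S : System) (l : Fin 4 → ℂ) (n : ℕ) : ℂ[X] :=
  ∑ k ∈ Finset.range (n + 1), C (baseCoeff S l n k) * phiP S (l 0) k

lemma natDegree_phiLin (S : System) (s : ℂ) : phiLin S s ≠ 0 ∧ (phiLin S s).natDegree = 1 := by
  have : ∀ a b : ℂ, a ≠ 0 → C a * X + C b ≠ 0 ∧ (C a * X + C b : ℂ[X]).natDegree = 1 := by
    intro a b ha
    have h := natDegree_linear (b := b) ha
    exact ⟨fun h0 => by rw [h0] at h; simp at h, h⟩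
  cases S with
  | cH => exact this _ _ I_ne_zero
  | W => exact this _ _ one_ne_zero
  | AW q h0 h1 =>
    refine this _ _ (mul_ne_zero (by norm_num) ?_)
    rw [q_cpow h0]; exact exp_ne_zero _

lemma phiP_ne_zero (S : System) (s : ℂ) (k : ℕ) : phiP S s k ≠ 0 :=
  Finset.prod_ne_zero_iff.2 fun _ _ => (natDegree_phiLin S _).1

lemma natDegree_phiP (S : System) (s : ℂ) (k : ℕ) : (phiP S s k).natDegree = k := by
  rw [phiP, natDegree_prod _ _ fun _ _ => (natDegree_phiLin S _).1]
  simp [(natDegree_phiLin S _).2]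

lemma eval_baseP (S : System) (l : Fin 4 → ℂ) (n : ℕ) (x : ℂ) :
    (baseP S l n).eval (eta S x) = basePoly S l n x := by
  rw [baseP, eval_finsetSum]
  cases S with
  | cH =>
    rw [basePoly, Finset.mul_sum]
    refine Finset.sum_congr rfl fun k _ => ?_
    have : (phiP .cH (l 0) k).eval (eta .cH x) = poch .cH (l 0) x k := by
      rw [phiP, eval_prod, poch]
      exact Finset.prod_congr rfl fun i _ => by simp [phiLin, lin, eta]; ring
    rw [eval_mul, eval_C, this, baseCoeff]; ring
  | W =>
    rw [basePoly]
    refine Finset.sum_congr rfl fun k _ => ?_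
    have : (phiP .W (l 0) k).eval (eta .W x) = poch .W (l 0) x k * poch .W (l 0) (-x) k := by
      rw [phiP, eval_prod, poch, poch, ← Finset.prod_mul_distrib]
      refine Finset.prod_congr rfl fun i _ => ?_
      simp [phiLin, lin, eta]; linear_combination x ^ 2 * I_sq
    rw [eval_mul, eval_C, this, baseCoeff]; ring
  | AW q h0 h1 =>
    rw [basePoly, Finset.mul_sum]
    refine Finset.sum_congr rfl fun k _ => ?_
    have : (phiP (.AW q h0 h1) (l 0) k).eval (eta (.AW q h0 h1) x) =
        poch (.AW q h0 h1) (l 0) x k * poch (.AW q h0 h1) (l 0) (-x) k := by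
      rw [phiP, eval_prod, poch, poch, ← Finset.prod_mul_distrib]
      refine Finset.prod_congr rfl fun i _ => ?_
      have hz : exp (I * x) ≠ 0 := exp_ne_zero _
      rw [lin_AW_neg, lin_AW]
      simp [phiLin, eta, cos_eq_exp]
      field_simp
      ring
    rw [eval_mul, eval_C, this, baseCoeff]; ring

lemma natDegree_baseP_le (S : System) (l : Fin 4 → ℂ) (n : ℕ) : (baseP S l n).natDegree ≤ n :=
  natDegree_sum_le_of_forall_le _ _ fun k hk =>
    (natDegree_C_mul_le _ _).trans (by
      rw [natDegree_phiP]; exact Nat.lt_succ_iff.1 (Finset.mem_range.1 hk))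

/-- The leading coefficient contains (-n)_n and (n + λ₁ + … + λ₄ - 1)_n. The first is never zero, so
the degree can only drop through the second. -/
lemma natDegree_baseP (S : System) (l : Fin 4 → ℂ) (n : ℕ)
    (h : poch0 S (n + (l 0 + l 1 + l 2 + l 3) - 1) n ≠ 0) :
    baseP S l n ≠ 0 ∧ (baseP S l n).natDegree = n := by
  have h1 : ∀ k ≤ n, poch0 S (-n) k ≠ 0 := by
    intro k hk
    rw [poch0, poch, Finset.prod_ne_zero_iff]
    intro i hi h0
    have hi' := Finset.mem_range.1 hi
    obtain ⟨m, hm⟩ := lin_eq_zero_imp S _ _ h0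
    have hg : ∃ g : ℝ, g ≠ 0 ∧ gam S = g := by
      cases S with
      | cH => exact ⟨1, one_ne_zero, by simp [gam]⟩
      | W => exact ⟨1, one_ne_zero, by simp [gam]⟩
      | AW q hq0 hq1 => exact ⟨Real.log q, (Real.log_neg hq0 hq1).ne, rfl⟩
    obtain ⟨g, hg0, hg⟩ := hg
    rw [hg] at hm
    have := congrArg Complex.re hm
    rw [mul_zero, add_zero, show (g : ℂ) * (-n + i) = ((g * (-n + i) : ℝ) : ℂ) by push_cast; ring,
      show 2 * (Real.pi : ℂ) * I * m = ((2 * Real.pi * m : ℝ) : ℂ) * I by push_cast; ring,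
      ofReal_re, re_ofReal_mul, I_re, mul_zero] at this
    have := (mul_eq_zero.1 this).resolve_left hg0
    have : (i : ℝ) = n := by linarith
    have : i = n := by exact_mod_cast this
    omega
  have hc : baseCoeff S l n n ≠ 0 := by
    cases S with
    | cH =>
      have := h1 n le_rfl
      simp only [baseCoeff, Nat.sub_self, poch0, poch_zero] at *
      simp [Nat.factorial_ne_zero, I_ne_zero, this, h]
    | W =>
      have := h1 n le_rfl
      simp only [baseCoeff, Nat.sub_self, poch0, poch_zero] at *
      simp [Nat.factorial_ne_zero, this, h]
    | AW q h0 h1' =>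
      have := h1 n le_rfl
      have h3 := poch0_AW_one_ne_zero h0 h1' n
      have hq : (q : ℂ) ≠ 0 := by exact_mod_cast h0.ne'
      simp only [baseCoeff, Nat.sub_self, poch0, poch_zero] at *
      simp [this, h, h3, hq, cpow_eq_zero_iff]
  have hco : (baseP S l n).coeff n = baseCoeff S l n n * (phiP S (l 0) n).leadingCoeff := by
    rw [baseP, finsetSum_coeff, Finset.sum_range_succ, Finset.sum_eq_zero, zero_add, coeff_C_mul,
      leadingCoeff, natDegree_phiP]
    intro k hk
    rw [coeff_C_mul, coeff_eq_zero_of_natDegree_lt, mul_zero]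
    rw [natDegree_phiP]; exact Finset.mem_range.1 hk
  have hne : (baseP S l n).coeff n ≠ 0 := by
    rw [hco]; exact mul_ne_zero hc (leadingCoeff_ne_zero.2 (phiP_ne_zero _ _ _))
  exact ⟨fun h0 => hne (by rw [h0, coeff_zero]), le_antisymm (natDegree_baseP_le S l n)
    (le_natDegree_of_ne_zero hne)⟩

/-- The polynomial of a column in the variable `η`. -/
noncomputable def colP (S : System) (l : Fin 4 → ℂ) (c : Option VType × ℕ) : ℂ[X] :=
  match c.1 with
  | none => baseP S l c.2
  | some T => baseP S (twist S T l) c.2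

lemma eval_colP (S : System) (l : Fin 4 → ℂ) (c : Option VType × ℕ) (x : ℂ) :
    (colP S l c).eval (eta S x) = colPoly S l c.1 c.2 x := by
  obtain ⟨o, n⟩ := c
  cases o with
  | none => exact eval_baseP S l n x
  | some T => exact eval_baseP S _ n x

lemma natDegree_colP_le (S : System) (l : Fin 4 → ℂ) (c : Option VType × ℕ) :
    (colP S l c).natDegree ≤ c.2 := by
  obtain ⟨o, n⟩ := c
  cases o with
  | none => exact natDegree_baseP_le S l n
  | some T => exact natDegree_baseP_le S _ n

/-- The Casoratian determinant of columns given by kinds and degrees. -/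
noncomputable def colsDet (S : System) (l : Fin 4 → ℂ) {L : ℕ} (c : Fin L → Option VType × ℕ)
    (x : ℂ) : ℂ :=
  rawDet S l (fun k => (c k).1) (fun k => colP S l (c k)) x

/-- The columns of the seed functions. -/
def seedCols (DI DII : Finset ℕ) : Fin (seeds DI DII).length → Option VType × ℕ :=
  fun k => (some ((seeds DI DII).get k).1, ((seeds DI DII).get k).2)

lemma seedEntry_eq (S : System) (l : Fin 4 → ℂ) (L : ℕ) (x : ℂ) (j : ℕ) (T : VType) (v : ℕ) :
    seedEntry S l L x j T v = rawEntry S l L x j (some T) (colP S l (some T, v)) := by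
  rw [rawEntry, eval_colP]
  cases T <;> simp [seedEntry, carr, colPoly]

lemma eigenEntry_eq (S : System) (l : Fin 4 → ℂ) (L : ℕ) (x : ℂ) (j n : ℕ) :
    eigenEntry S l L x j n = rawEntry S l L x j none (colP S l (none, n)) := by
  rw [rawEntry, eval_colP]
  simp [eigenEntry, carr, colPoly]

lemma detXi_eq (S : System) (l : Fin 4 → ℂ) (DI DII : Finset ℕ) (x : ℂ) :
    detXi S l DI DII x =
      I ^ ((seeds DI DII).length * ((seeds DI DII).length - 1) / 2) *
        colsDet S l (seedCols DI DII) x := by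
  rw [detXi, colsDet, rawDet]
  congr 2
  ext j k
  simp only [Matrix.of_apply, seedEntry_eq]
  rfl

lemma detP_eq (S : System) (l : Fin 4 → ℂ) (DI DII : Finset ℕ) (n : ℕ) (x : ℂ) :
    detP S l DI DII n x =
      I ^ (((seeds DI DII).length + 1) * (seeds DI DII).length / 2) *
        colsDet S l (snoc (seedCols DI DII) (none, n)) x := by
  rw [detP, colsDet, rawDet]
  congr 2
  ext j k
  simp only [Matrix.of_apply, seedEntry_eq, eigenEntry_eq]
  induction k using Fin.lastCases with
  | last => simp
  | cast k => simp; rfl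

lemma length_seeds (DI DII : Finset ℕ) : (seeds DI DII).length = DI.card + DII.card := by
  simp [seeds]

lemma sum_seedCols {β : Type*} [AddCommMonoid β] (DI DII : Finset ℕ)
    (f : Option VType × ℕ → β) : ∑ k, f (seedCols DI DII k) =
      ∑ d ∈ DI, f (some .I, d) + ∑ d ∈ DII, f (some .II, d) := by
  have h : ∀ (s : Finset ℕ) (g : ℕ → β), ((s.sort (· ≤ ·)).map g).sum = ∑ d ∈ s, g d := by
    intro s g
    conv_rhs => rw [Finset.sum_eq_multiset_sum, ← Finset.sort_eq s (· ≤ ·)]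
    rw [Multiset.map_coe, Multiset.sum_coe]
  have := Fin.sum_univ_fun_getElem (seeds DI DII) (fun c => f (some c.1, c.2))
  rw [show ∑ k, f (seedCols DI DII k) = ∑ i : Fin (seeds DI DII).length,
    f (some ((seeds DI DII)[i.1]).1, ((seeds DI DII)[i.1]).2) from rfl, this, seeds,
    List.map_append, List.sum_append, List.map_map, List.map_map]
  congr 1
  · exact h DI fun d => f (some .I, d)
  · exact h DII fun d => f (some .II, d)

lemma mcount_seedCols (DI DII : Finset ℕ) (T : VType) :
    mcount (fun k => (seedCols DI DII k).1) T =
      (match T with | .I => DII.card | .II => DI.card) := by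
  rw [mcount, sum_seedCols DI DII (fun c => carr c.1 T)]
  cases T <;> simp [carr]

lemma mcount_snoc {L : ℕ} (c : Fin L → Option VType × ℕ) (a : Option VType × ℕ) (T : VType) :
    mcount (fun k => (snoc c a k).1) T = mcount (fun k => (c k).1) T + carr a.1 T := by
  simp [mcount, Fin.sum_univ_castSucc]

/-- The expected degree for columns given by kinds and degrees. -/
def expDegC {L : ℕ} (c : Fin L → Option VType × ℕ) : ℤ :=
  expDeg (fun k => (c k).1) (fun k => (c k).2)

lemma sum_range_int (m : ℕ) : 2 * ((∑ i ∈ Finset.range m, i : ℕ) : ℤ) = m * (m - 1) := by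
  have := Finset.sum_range_id_mul_two m
  cases m with
  | zero => simp
  | succ m =>
    rw [Nat.add_sub_cancel] at this
    push_cast
    linarith [congrArg (Nat.cast : ℕ → ℤ) (Finset.sum_range_id_mul_two (m + 1))]

/-- Among M + 1 columns every seed contributes M plus its degree, and the eigenpolynomial 2M + n.
Subtracting the degrees of the Vandermonde product and of the two products of shifted factorials
leaves ℓ + n. -/
lemma expDegC_snoc (DI DII : Finset ℕ) (n : ℕ) :
    expDegC (snoc (seedCols DI DII) (none, n)) = ell DI DII + n := by
  have hL := length_seeds DI DII
  have hI := mcount_seedCols DI DII .I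
  have hII := mcount_seedCols DI DII .II
  simp only at hI hII
  have hw : ∑ k, colWt ((seeds DI DII).length + 1) (snoc (seedCols DI DII) (none, n) k).1
      (snoc (seedCols DI DII) (none, n) k).2 =
      (∑ d ∈ DI, ((DI.card + DII.card) + d) + ∑ d ∈ DII, ((DI.card + DII.card) + d)) +
        ((DI.card + DII.card) * 2 + n) := by
    rw [Fin.sum_univ_castSucc]
    simp only [snoc_castSucc, snoc_last]
    rw [sum_seedCols DI DII (fun c => colWt ((seeds DI DII).length + 1) c.1 c.2)]
    simp [colWt, carr, hL]
  rw [expDegC, expDeg, hw, mcount_snoc, mcount_snoc, hI, hII, hL]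
  simp only [carr]
  have e1 := sum_range_int (DI.card + DII.card + 1)
  have e2 := sum_range_int (DI.card + 1)
  have e3 := sum_range_int (DII.card + 1)
  rw [← Finset.mul_sum, ← Finset.mul_sum]
  have e4 : 2 * (((DI.card : ℤ) + DII.card) * ((DI.card : ℤ) + DII.card - 1) / 2) =
      ((DI.card : ℤ) + DII.card) * ((DI.card : ℤ) + DII.card - 1) :=
    Int.mul_ediv_cancel' (Int.even_mul_pred_self _).two_dvd
  rw [ell]
  push_cast at *
  simp only [Finset.sum_add_distrib, Finset.sum_const, nsmul_eq_mul]
  nlinarith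

end MultiIndexed

namespace MultiIndexed

open Complex Polynomial Filter Topology

/-! ### Dependence on the parameters -/

lemma differentiable_lin (S : System) (x : ℂ) : Differentiable ℂ fun s => lin S s x := by
  cases S with
  | cH => simp only [lin]; fun_prop
  | W => simp only [lin]; fun_prop
  | AW q h0 h1 => simp only [lin, q_cpow h0]; fun_prop

lemma continuous_lin (S : System) {X : Type*} [TopologicalSpace X] {s x : X → ℂ}
    (hs : Continuous s) (hx : Continuous x) : Continuous fun t => lin S (s t) (x t) := by
  cases S with
  | cH => simp only [lin]; fun_prop
  | W => simp only [lin]; fun_prop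
  | AW q h0 h1 => simp only [lin, q_cpow h0]; fun_prop

lemma continuous_poch (S : System) {X : Type*} [TopologicalSpace X] {s x : X → ℂ}
    (hs : Continuous s) (hx : Continuous x) (n : ℕ) : Continuous fun t => poch S (s t) (x t) n :=
  continuous_finsetProd _ fun _ _ => continuous_lin S (by fun_prop) hx

lemma continuous_twist (S : System) (T : VType) : Continuous (twist S T) := by
  refine continuous_pi fun k => ?_
  cases S <;> cases T <;> fin_cases k <;> simp [twist] <;> fun_prop

lemma continuous_basePoly (S : System) (n : ℕ) (x : ℂ) :
    Continuous fun l : Fin 4 → ℂ => basePoly S l n x := by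
  have hp : ∀ (S : System) (s : (Fin 4 → ℂ) → ℂ) (hs : Continuous s) (x : ℂ) (n : ℕ),
      Continuous fun l => poch S (s l) x n := fun S s hs x n =>
    continuous_poch S hs continuous_const n
  cases S with
  | cH =>
    simp only [basePoly, poch0]
    refine continuous_const.mul (continuous_finsetSum _ fun k _ => Continuous.div_const ?_ _)
    refine (((Continuous.mul ?_ ?_).mul ?_).mul ?_).mul ?_ <;> apply hp <;> fun_prop
  | W =>
    simp only [basePoly, poch0]
    refine continuous_finsetSum _ fun k _ => Continuous.div_const ?_ _
    refine ((((((Continuous.mul ?_ ?_).mul ?_).mul ?_).mul ?_).mul ?_).mul ?_) <;>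
      apply hp <;> fun_prop
  | AW q h0 h1 =>
    simp only [basePoly, poch0]
    refine Continuous.mul (by simp only [q_cpow h0]; fun_prop)
      (continuous_finsetSum _ fun k _ => Continuous.div_const (Continuous.mul ?_
        continuous_const) _)
    refine ((((((Continuous.mul ?_ ?_).mul ?_).mul ?_).mul ?_).mul ?_).mul ?_) <;>
      apply hp <;> fun_prop

lemma continuous_twistPoch (S : System) (T : VType) (c x : ℂ) (m n : ℕ) :
    Continuous fun l : Fin 4 → ℂ => twistPoch S l T c x m n :=
  (continuous_finsetProd _ fun _ _ => continuous_poch S (by fun_prop) continuous_const m).mul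
    (continuous_finsetProd _ fun _ _ => continuous_poch S (by fun_prop) continuous_const n)

lemma continuous_nuRow (S : System) (T : VType) (L : ℕ) (x : ℂ) (j : ℕ) :
    Continuous fun l : Fin 4 → ℂ => nuRow S l T L x j :=
  continuous_const.mul (continuous_twistPoch S T _ x _ _)

lemma continuous_prefactor (S : System) (L m m' : ℕ) (x : ℂ) :
    Continuous fun l : Fin 4 → ℂ => prefactor S l L m m' x :=
  (continuous_const.mul (continuous_finsetProd _ fun _ _ => continuous_twistPoch S _ _ x _ _)).mul
    (continuous_finsetProd _ fun _ _ => continuous_twistPoch S _ _ x _ _)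

lemma continuous_colsDet (S : System) {L : ℕ} (c : Fin L → Option VType × ℕ) (x : ℂ) :
    Continuous fun l : Fin 4 → ℂ => colsDet S l c x := by
  refine Continuous.matrix_det (continuous_matrix fun j k => ?_)
  refine (((continuous_nuRow S _ _ _ _).pow _).mul ((continuous_nuRow S _ _ _ _).pow _)).mul ?_
  simp only [eval_colP]
  obtain ⟨o, n⟩ := c k
  cases o with
  | none => exact continuous_basePoly S _ _
  | some T => exact (continuous_basePoly S _ _).comp (continuous_twist S T)

/-! ### Points at which the prefactor does not vanish -/

/-- A sequence of points with different values of `η`. -/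
noncomputable def etaPt : System → ℕ → ℂ
  | .AW _ _ _, n => (((n : ℝ) + 1)⁻¹ : ℝ)
  | _, n => n

lemma eta_etaPt_injective (S : System) : Function.Injective fun n => eta S (etaPt S n) := by
  cases S with
  | cH =>
    intro a b h
    simp only [eta, etaPt] at h
    exact_mod_cast h
  | W =>
    intro a b h
    simp only [eta, etaPt] at h
    have : a ^ 2 = b ^ 2 := by exact_mod_cast h
    exact (pow_left_inj₀ (Nat.zero_le a) (Nat.zero_le b) two_ne_zero).1 this
  | AW q h0 h1 =>
    intro a b h
    simp only [eta, etaPt] at h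
    rw [← ofReal_cos, ← ofReal_cos] at h
    have h' := ofReal_injective h
    have hm : ∀ n : ℕ, ((n : ℝ) + 1)⁻¹ ∈ Set.Icc 0 Real.pi := fun n => by
      refine ⟨by positivity, le_trans (inv_le_one_of_one_le₀ ?_) ?_⟩
      · have : (0 : ℝ) ≤ n := Nat.cast_nonneg n
        linarith
      · linarith [Real.pi_gt_three]
    have := inv_injective (Real.injOn_cos (hm a) (hm b) h')
    have : (a : ℝ) = b := by linarith
    exact_mod_cast this

lemma eta_eq_of_zeta (S : System) (x y : ℂ) (h : zeta S x = zeta S y) : eta S x = eta S y := by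
  cases S with
  | cH => exact h
  | W => simp only [zeta] at h; rw [h]
  | AW q h0 h1 => simp only [zeta, eta, cos_eq_exp] at *; rw [h]

lemma exists_prefactor_poly (S : System) (l : Fin 4 → ℂ) (L m m' : ℕ) (hm : m ≤ L)
    (hm' : m' ≤ L) : ∃ p : ℂ[X], p ≠ 0 ∧
      ∀ x, p.eval (zeta S x) ≠ 0 → prefactor S l L m m' x ≠ 0 := by
  refine ⟨pV S L * (pPi S l .II L m * pPi S l .I L m'), mul_ne_zero (pV_ne_zero _ _)
    (mul_ne_zero (pPi_ne_zero _ _ _ _ _) (pPi_ne_zero _ _ _ _ _)), fun x hx h0 => hx ?_⟩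
  have e1 := eval_pV S L x
  have e2 := eval_pPi S l .II L m hm x
  have e3 := eval_pPi S l .I L m' hm' x
  have c1 := vC_ne_zero S L
  have c2 : ∀ m, (∏ i ∈ Finset.range m, tpC S L i) ≠ 0 := fun m =>
    Finset.prod_ne_zero_iff.2 fun _ _ => tpC_ne_zero _ _ _
  rw [prefactor] at h0
  simp only [eval_mul]
  refine (mul_eq_zero.1 (?_ : vC S L * ((∏ i ∈ Finset.range m, tpC S L i) *
    ∏ i ∈ Finset.range m', tpC S L i) * _ = 0)).resolve_left
    (mul_ne_zero c1 (mul_ne_zero (c2 m) (c2 m')))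
  calc _ = (vC S L * (pV S L).eval (zeta S x)) *
        ((∏ i ∈ Finset.range m, tpC S L i) * (pPi S l .II L m).eval (zeta S x)) *
        ((∏ i ∈ Finset.range m', tpC S L i) * (pPi S l .I L m').eval (zeta S x)) := by ring
    _ = 0 := by
      rw [e1, e2, e3]
      linear_combination (om S x ^ (∑ k ∈ Finset.range L, k) *
        om S x ^ (∑ i ∈ Finset.range m, 2 * i) * om S x ^ (∑ i ∈ Finset.range m', 2 * i)) * h0

lemma infinite_prefactor_ne_zero (S : System) (l : Fin 4 → ℂ) (L m m' : ℕ) (hm : m ≤ L)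
    (hm' : m' ≤ L) : {n : ℕ | prefactor S l L m m' (etaPt S n) ≠ 0}.Infinite := by
  obtain ⟨p, hp0, hp⟩ := exists_prefactor_poly S l L m m' hm hm'
  have hinj : Function.Injective fun n => zeta S (etaPt S n) := fun a b h =>
    eta_etaPt_injective S (eta_eq_of_zeta S _ _ h)
  have hfin : {n : ℕ | p.eval (zeta S (etaPt S n)) = 0}.Finite := by
    refine Set.Finite.of_injOn (t := (p.roots.toFinset : Set ℂ)) (fun n hn => ?_)
      hinj.injOn (Finset.finite_toSet _)
    simpa [hp0] using hn
  exact hfin.infinite_compl.mono fun n hn => hp _ hn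

lemma eq_of_prefactor_mul (S : System) (l : Fin 4 → ℂ) (L m m' : ℕ) (hm : m ≤ L)
    (hm' : m' ≤ L) (Q Q' : ℂ[X])
    (h : ∀ x, prefactor S l L m m' x * Q.eval (eta S x) =
      prefactor S l L m m' x * Q'.eval (eta S x)) : Q = Q' := by
  refine eq_of_infinite_eval_eq Q Q' (((infinite_prefactor_ne_zero S l L m m' hm hm').image
    (f := fun n => eta S (etaPt S n)) (eta_etaPt_injective S).injOn).mono ?_)
  rintro _ ⟨n, hn, rfl⟩
  exact mul_left_cancel₀ hn (h _)

/-- Limits of polynomial parts. -/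
lemma exists_limit_polynomial (S : System) (L m m' : ℕ) (hm : m ≤ L) (hm' : m' ≤ L)
    (D : (Fin 4 → ℂ) → ℂ → ℂ) (hD : ∀ x, Continuous fun l => D l x) (l : ℕ → Fin 4 → ℂ)
    (l0 : Fin 4 → ℂ) (hl : Tendsto l atTop (𝓝 l0)) (Q : ℕ → ℂ[X]) (d : ℕ)
    (hd : ∀ k, (Q k).natDegree ≤ d)
    (hQ : ∀ k x, D (l k) x = prefactor S (l k) L m m' x * (Q k).eval (eta S x)) :
    ∃ Q0 : ℂ[X], Q0.natDegree ≤ d ∧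
      (∀ x, D l0 x = prefactor S l0 L m m' x * Q0.eval (eta S x)) ∧
      ∀ i, Tendsto (fun k => (Q k).coeff i) atTop (𝓝 (Q0.coeff i)) := by
  -- At d + 1 points where the limiting prefactor is nonzero, the values of the polynomials
  -- converge. Lagrange interpolation at these fixed points recovers the coefficients, which
  -- therefore converge as well.
  obtain ⟨s, hs, hcard⟩ :=
    (infinite_prefactor_ne_zero S l0 L m m' hm hm').exists_subset_card_eq (d + 1)
  set v : ℕ → ℂ := fun n => eta S (etaPt S n) with hv
  have hvs : Set.InjOn v s := (eta_etaPt_injective S).injOn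
  set r : (Fin 4 → ℂ) → ℕ → ℂ := fun l n => D l (etaPt S n) / prefactor S l L m m' (etaPt S n)
    with hr
  have hcont : ∀ x, Tendsto (fun k => prefactor S (l k) L m m' x) atTop
      (𝓝 (prefactor S l0 L m m' x)) := fun x =>
    ((continuous_prefactor S L m m' x).tendsto l0).comp hl
  have hcontD : ∀ x, Tendsto (fun k => D (l k) x) atTop (𝓝 (D l0 x)) := fun x =>
    ((hD x).tendsto l0).comp hl
  have hrt : ∀ n ∈ s, Tendsto (fun k => r (l k) n) atTop (𝓝 (r l0 n)) := fun n hn =>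
    (hcontD _).div (hcont _) (hs hn)
  have hev : ∀ᶠ k in atTop, ∀ n ∈ s, prefactor S (l k) L m m' (etaPt S n) ≠ 0 :=
    (Finset.eventually_all s).2 fun n hn => (hcont _).eventually_ne (hs hn)
  have hQi : ∀ᶠ k in atTop, Q k = Lagrange.interpolate s v (r (l k)) := by
    filter_upwards [hev] with k hk
    refine Lagrange.eq_interpolate_of_eval_eq _ hvs ?_ fun n hn => ?_
    · rw [hcard]
      exact lt_of_le_of_lt degree_le_natDegree (by exact_mod_cast Nat.lt_succ_of_le (hd k))
    · rw [hr]
      simp only [hQ]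
      rw [mul_div_cancel_left₀ _ (hk n hn)]
  have hcoeff : ∀ i, Tendsto (fun k => (Q k).coeff i) atTop
      (𝓝 ((Lagrange.interpolate s v (r l0)).coeff i)) := by
    intro i
    have : Tendsto (fun k => (Lagrange.interpolate s v (r (l k))).coeff i) atTop
        (𝓝 ((Lagrange.interpolate s v (r l0)).coeff i)) := by
      simp only [Lagrange.interpolate_apply, finsetSum_coeff, coeff_C_mul]
      exact tendsto_finsetSum _ fun n hn => (hrt n hn).mul tendsto_const_nhds
    exact this.congr' (by filter_upwards [hQi] with k hk; rw [hk])
  have hdeg : (Lagrange.interpolate s v (r l0)).natDegree ≤ d := by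
    have := Lagrange.degree_interpolate_lt (r l0) hvs
    rw [hcard] at this
    by_cases h0 : Lagrange.interpolate s v (r l0) = 0
    · rw [h0]; simp
    · exact Nat.lt_succ_iff.1 ((natDegree_lt_iff_degree_lt h0).2 this)
  refine ⟨_, hdeg, fun x => ?_, hcoeff⟩
  have he : Tendsto (fun k => (Q k).eval (eta S x)) atTop
      (𝓝 ((Lagrange.interpolate s v (r l0)).eval (eta S x))) := by
    rw [eval_eq_sum_range' (Nat.lt_succ_of_le hdeg)]
    have : ∀ k, (Q k).eval (eta S x) =
        ∑ i ∈ Finset.range (d + 1), (Q k).coeff i * eta S x ^ i := fun k =>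
      eval_eq_sum_range' (Nat.lt_succ_of_le (hd k)) _
    simp only [this]
    exact tendsto_finsetSum _ fun i _ => (hcoeff i).mul tendsto_const_nhds
  refine tendsto_nhds_unique (hcontD x) ?_
  simp only [hQ]
  exact (hcont x).mul he

/-! ### Generic parameters -/

/-- The energies of the seed functions of both types, as one family indexed by the integers. -/
noncomputable def seedE (S : System) (l : Fin 4 → ℂ) (k : ℤ) : ℂ := energy S l (some .I) k

lemma energy_I (S : System) (l : Fin 4 → ℂ) (v : ℕ) : energy S l (some .I) v = seedE S l v := by
  simp [seedE]

/-- A type II seed of degree v has the energy of a type I seed of formal degree -v - 1. Both types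
thus share one sequence indexed by the integers, type II occupying the negative ones. -/
lemma energy_II (S : System) (l : Fin 4 → ℂ) (v : ℕ) :
    energy S l (some .II) v = seedE S l (-v - 1) := by
  cases S with
  | cH => simp only [seedE, energy, VType.other]; push_cast; ring
  | W => simp only [seedE, energy, VType.other]; push_cast; ring
  | AW q h0 h1 =>
    simp only [seedE, energy, VType.other]; push_cast
    rw [add_comm]
    congr 2 <;> ring

/-- The conditions on the parameters under which all arguments work without exceptions. -/
structure Generic (S : System) (l : Fin 4 → ℂ) : Prop where
  par : GenericPar S l
  lead : ∀ n : ℕ, poch0 S (n + (l 0 + l 1 + l 2 + l 3) - 1) n ≠ 0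
  none_ne : ∀ n n' : ℕ, n ≠ n' → energy S l none n - energy S l none n' ≠ 0
  none_seed : ∀ n n' : ℕ, ∀ k k' : ℤ,
    energy S l none n + energy S l none n' - (seedE S l k + seedE S l k') ≠ 0
  seed_seed : ∀ k k' m m' : ℤ, ¬ ((k = m ∧ k' = m') ∨ (k = m' ∧ k' = m)) →
    seedE S l k + seedE S l k' - (seedE S l m + seedE S l m') ≠ 0

/-- Parameters with given values of `parSum`. -/
noncomputable def parWith : System → ℂ → ℂ → Fin 4 → ℂ
  | .cH, a, b => ![a / 2, b / 2, a / 2, b / 2]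
  | _, a, b => ![a / 2, a / 2, b / 2, b / 2]

lemma parSum_parWith (S : System) (a b : ℂ) (T : VType) :
    parSum S T (parWith S a b) = (match T with | .I => a | .II => b) := by
  cases S <;> cases T <;> simp [parSum, parWith]

lemma System.ne_AW_or_eq (S : System) :
    (∀ q h0 h1, S ≠ .AW q h0 h1) ∨ ∃ q h0 h1, S = .AW q h0 h1 := by
  cases S with
  | cH => simp
  | W => simp
  | AW q h0 h1 => exact Or.inr ⟨q, h0, h1, rfl⟩

/-- Two free constants in the energies; special choices of u and w show that no genericity condition
fails identically for cH and W. -/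
lemma exists_energies_quadratic (S : System) (hS : ∀ q h0 h1, S ≠ .AW q h0 h1) (u w : ℂ) :
    ∃ l : Fin 4 → ℂ, (∀ n : ℕ, energy S l none n = (n + w) ^ 2) ∧
      ∀ k : ℤ, seedE S l k = (k + u) ^ 2 := by
  refine ⟨parWith S (w + 1 - u) (w + u), fun n => ?_, fun k => ?_⟩
  · cases S with
    | cH => simp only [energy, parSum_parWith]; ring
    | W => simp only [energy, parSum_parWith]; ring
    | AW q h0 h1 => exact absurd rfl (hS q h0 h1)
  · cases S with
    | cH => simp only [seedE, energy, parSum_parWith, VType.other]; ring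
    | W => simp only [seedE, energy, parSum_parWith, VType.other]; ring
    | AW q h0 h1 => exact absurd rfl (hS q h0 h1)

/-- The phase is placed so that real and imaginary parts of the energies isolate the powers of q and
their inverses, which serves the same purpose for AW. -/
lemma exists_energies_AW (q : ℝ) (h0 : 0 < q) (h1 : q < 1) (b : ℝ) (hb : 0 < b) :
    ∃ l : Fin 4 → ℂ,
      (∀ n : ℕ, energy (.AW q h0 h1) l none n = ((q ^ n)⁻¹ : ℝ) + (b * q ^ n : ℝ) * I) ∧
      ∀ k : ℤ, seedE (.AW q h0 h1) l k = (b * q ^ k : ℝ) + ((q ^ k)⁻¹ : ℝ) * I := by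
  have hq : (q : ℂ) ≠ 0 := by exact_mod_cast h0.ne'
  have hlog : ((Real.log q : ℝ) : ℂ) ≠ 0 := by exact_mod_cast (Real.log_neg h0 h1).ne
  have hs : ∀ z : ℂ, z ≠ 0 → ∃ s : ℂ, (q : ℂ) ^ s = z := fun z hz =>
    ⟨log z / ((Real.log q : ℝ) : ℂ), by rw [q_cpow h0, mul_div_cancel₀ _ hlog, exp_log hz]⟩
  obtain ⟨a, ha⟩ := hs (I * q) (mul_ne_zero I_ne_zero hq)
  obtain ⟨c, hc⟩ := hs b (by exact_mod_cast hb.ne')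
  refine ⟨parWith (.AW q h0 h1) a c, fun n => ?_, fun k => ?_⟩
  · simp only [energy, parSum_parWith]
    rw [cpow_sub _ _ hq, cpow_add _ _ hq, cpow_add _ _ hq, ha, hc, cpow_neg, cpow_natCast,
      cpow_one]
    push_cast
    field_simp
  · simp only [seedE, energy, parSum_parWith, VType.other]
    rw [cpow_sub _ _ hq, cpow_sub _ _ hq, cpow_add _ _ hq, ha, hc, cpow_intCast, cpow_one]
    have := zpow_ne_zero k hq
    push_cast
    field_simp
    ring

lemma exists_none_ne (S : System) : ∃ l : Fin 4 → ℂ, ∀ n n' : ℕ, n ≠ n' →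
    energy S l none n - energy S l none n' ≠ 0 := by
  rcases S.ne_AW_or_eq with hS | ⟨q, h0, h1, rfl⟩
  · obtain ⟨l, hl, -⟩ := exists_energies_quadratic S hS 0 0
    refine ⟨l, fun n n' hn h => hn ?_⟩
    rw [hl, hl, sub_eq_zero, add_zero, add_zero] at h
    have : n ^ 2 = n' ^ 2 := by exact_mod_cast h
    exact (pow_left_inj₀ (Nat.zero_le _) (Nat.zero_le _) two_ne_zero).1 this
  · obtain ⟨l, hl, -⟩ := exists_energies_AW q h0 h1 1 one_pos
    refine ⟨l, fun n n' hn h => hn ?_⟩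
    rw [hl, hl, sub_eq_zero] at h
    have := congrArg re h
    simp only [add_re, ofReal_re, re_ofReal_mul, I_re, mul_zero, add_zero] at this
    exact (pow_right_injective₀ h0 h1.ne) (inv_injective this)

lemma exists_none_seed (S : System) (n n' : ℕ) (k k' : ℤ) : ∃ l : Fin 4 → ℂ,
    energy S l none n + energy S l none n' - (seedE S l k + seedE S l k') ≠ 0 := by
  rcases S.ne_AW_or_eq with hS | ⟨q, h0, h1, rfl⟩
  -- With t = k² + k'² the seed energies have real part t - 2 in total, while those of the
  -- eigenpolynomials contribute at least 2t². Since 2t² - t + 2 is positive, the two sides differ.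
  · obtain ⟨l, hl, hl'⟩ := exists_energies_quadratic S hS I (((k ^ 2 + k' ^ 2 : ℤ) : ℝ) : ℂ)
    refine ⟨l, fun h => ?_⟩
    rw [hl, hl, hl', hl'] at h
    set t : ℤ := k ^ 2 + k' ^ 2 with ht
    have h' : (((n + t : ℝ) ^ 2 + (n' + t : ℝ) ^ 2 - (t - 2) : ℝ) : ℂ) -
        ((2 * (k + k') : ℝ) : ℂ) * I = 0 := by
      rw [← h, ht]; push_cast; linear_combination 2 * I_sq
    have := congrArg re h'
    simp only [sub_re, ofReal_re, re_ofReal_mul, I_re, mul_zero, sub_zero, zero_re] at this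
    have h3 : (n + t : ℤ) ^ 2 + (n' + t) ^ 2 - (t - 2) = 0 := by exact_mod_cast this
    have ht0 : 0 ≤ t := by positivity
    have hn : (0 : ℤ) ≤ n := Int.natCast_nonneg n
    nlinarith [sq_nonneg ((n' : ℤ) + t), mul_nonneg hn ht0, sq_nonneg ((n : ℤ)), sq_nonneg (t - 1)]
  · have hk : ∀ k : ℤ, 0 < q ^ k := fun k => zpow_pos h0 k
    -- This b normalizes the real part of the sum of the two seed energies to 1, while q^(-n) +
    -- q^(-n') is at least 2.
    obtain ⟨l, hl, hl'⟩ := exists_energies_AW q h0 h1 ((q ^ k + q ^ k')⁻¹)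
      (inv_pos.2 (add_pos (hk k) (hk k')))
    refine ⟨l, fun h => ?_⟩
    rw [hl, hl, hl', hl'] at h
    have := congrArg re h
    simp only [sub_re, add_re, ofReal_re, re_ofReal_mul, I_re, mul_zero, add_zero, zero_re] at this
    rw [← mul_add, inv_mul_cancel₀ (add_pos (hk k) (hk k')).ne'] at this
    have hi : ∀ n : ℕ, 1 ≤ (q ^ n)⁻¹ := fun n =>
      one_le_inv_iff₀.2 ⟨pow_pos h0 n, pow_le_one₀ h0.le h1.le⟩
    linarith [hi n, hi n']

lemma exists_seed_seed (S : System) : ∃ l : Fin 4 → ℂ, ∀ k k' m m' : ℤ,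
    ¬ ((k = m ∧ k' = m') ∨ (k = m' ∧ k' = m)) →
    seedE S l k + seedE S l k' - (seedE S l m + seedE S l m') ≠ 0 := by
  rcases S.ne_AW_or_eq with hS | ⟨q, h0, h1, rfl⟩
  -- With u = i, equality of the energy sums forces equal sums of indices (imaginary part) and equal
  -- sums of squares (real part), so the two unordered pairs coincide. For AW the sum of the powers
  -- of q and the sum of their inverses play these roles.
  · obtain ⟨l, -, hl⟩ := exists_energies_quadratic S hS I 0
    refine ⟨l, fun k k' m m' hne h => hne ?_⟩
    rw [hl, hl, hl, hl] at h
    have h' : (((k : ℝ) ^ 2 + (k' : ℝ) ^ 2 - (m ^ 2 + m' ^ 2) : ℝ) : ℂ) +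
        ((2 * (k + k' - (m + m')) : ℝ) : ℂ) * I = 0 := by
      rw [← h]; push_cast; ring
    have e1 := congrArg re h'
    have e2 := congrArg im h'
    simp only [add_re, ofReal_re, re_ofReal_mul, I_re, mul_zero, add_zero, zero_re] at e1
    simp only [add_im, ofReal_im, im_ofReal_mul, I_im, mul_one, zero_add, zero_im] at e2
    have e1' : k ^ 2 + k' ^ 2 - (m ^ 2 + m' ^ 2) = 0 := by exact_mod_cast e1
    have e2' : 2 * (k + k' - (m + m')) = 0 := by exact_mod_cast e2
    have hk : k' = m + m' - k := by omega
    subst hk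
    have : (k - m) * (k - m') = 0 := by linarith
    rcases mul_eq_zero.1 this with h | h
    · left; omega
    · right; omega
  · obtain ⟨l, -, hl⟩ := exists_energies_AW q h0 h1 1 one_pos
    refine ⟨l, fun k k' m m' hne h => hne ?_⟩
    rw [hl, hl, hl, hl] at h
    have e1 := congrArg re h
    have e2 := congrArg im h
    simp only [sub_re, add_re, ofReal_re, re_ofReal_mul, I_re, mul_zero, add_zero, zero_re,
      one_mul] at e1
    simp only [sub_im, add_im, ofReal_im, im_ofReal_mul, I_im, mul_one, zero_add, zero_im] at e2
    have hq : ∀ k : ℤ, q ^ k ≠ 0 := fun k => zpow_ne_zero k h0.ne'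
    have hp : ∀ k : ℤ, 0 < q ^ k := fun k => zpow_pos h0 k
    have hinj := zpow_right_injective₀ h0 h1.ne
    have h3 : q ^ k * q ^ k' = q ^ m * q ^ m' := by
      have a := hq k
      have b := hq k'
      have c := hq m
      have d := hq m'
      have hs : q ^ k + q ^ k' = q ^ m + q ^ m' := by linarith
      have hs0 : q ^ k + q ^ k' ≠ 0 := (add_pos (hp k) (hp k')).ne'
      field_simp at e2
      have : (q ^ k + q ^ k') * (q ^ m * q ^ m' - q ^ k * q ^ k') = 0 := by
        linear_combination e2 - q ^ k * q ^ k' * hs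
      exact (sub_eq_zero.1 ((mul_eq_zero.1 this).resolve_left hs0)).symm
    have h4 : (q ^ k - q ^ m) * (q ^ k - q ^ m') = 0 := by
      linear_combination q ^ k * e1 - h3
    rcases mul_eq_zero.1 h4 with h | h
    · left
      have : k = m := hinj (sub_eq_zero.1 h)
      subst this
      exact ⟨rfl, hinj (by simp only; linarith)⟩
    · right
      have : k = m' := hinj (sub_eq_zero.1 h)
      subst this
      exact ⟨rfl, hinj (by simp only; linarith)⟩

/-- A nonzero entire function of the parameters is nonzero for most parameters. -/
lemma eventually_residual_ne_zero (f : (Fin 4 → ℂ) → ℂ) (hf : Differentiable ℂ f)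
    (h : ∃ l, f l ≠ 0) : ∀ᶠ l in residual (Fin 4 → ℂ), f l ≠ 0 := by
  obtain ⟨l1, h1⟩ := h
  refine residual_of_dense_open (isOpen_ne_fun hf.continuous continuous_const) ?_
  intro l0
  rw [mem_closure_iff_frequently]
  -- Restriction to the complex line through an arbitrary l0 and a point where f is nonzero. By the
  -- identity theorem g cannot vanish near t = 0, so l0 is a limit of points where f is nonzero.
  set g : ℂ → ℂ := fun t => f (l0 + t • (l1 - l0)) with hg
  have hgd : Differentiable ℂ g := hf.comp (by fun_prop)
  have hfr : ∃ᶠ t in 𝓝 (0 : ℂ), g t ≠ 0 := by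
    by_contra hn
    have hz : ∀ᶠ t in 𝓝 (0 : ℂ), g t = 0 := by simpa [Filter.not_frequently] using hn
    have := AnalyticOnNhd.eqOn_zero_of_preconnected_of_eventuallyEq_zero
      (fun z _ => hgd.analyticAt z) isPreconnected_univ (Set.mem_univ (0 : ℂ)) hz
      (Set.mem_univ (1 : ℂ))
    simp only [hg, one_smul, add_sub_cancel, Pi.zero_apply] at this
    exact h1 this
  have ht : Tendsto (fun t : ℂ => l0 + t • (l1 - l0)) (𝓝 0) (𝓝 l0) := by
    have : Continuous fun t : ℂ => l0 + t • (l1 - l0) := by fun_prop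
    simpa using this.tendsto 0
  exact ht.frequently hfr

lemma differentiable_energy (S : System) (o : Option VType) (v : ℂ) :
    Differentiable ℂ fun l => energy S l o v := by
  cases S with
  | cH => rcases o with _ | (_ | _) <;> simp only [energy, parSum, VType.other] <;> fun_prop
  | W => rcases o with _ | (_ | _) <;> simp only [energy, parSum, VType.other] <;> fun_prop
  | AW q h0 h1 =>
    rcases o with _ | (_ | _) <;> simp only [energy, parSum, VType.other, q_cpow h0] <;> fun_prop

/-- Genericity consists of countably many conditions f(λ) ≠ 0 with f entire and not identically
zero. Each holds on a dense open set, so Baire's theorem gives density of all of them together. -/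
lemma dense_generic (S : System) : Dense {l | Generic S l} := by
  refine dense_of_mem_residual ?_
  have hE : ∀ o v, Differentiable ℂ fun l => energy S l o v := differentiable_energy S
  have p1 : ∀ᶠ l in residual (Fin 4 → ℂ), ∀ k k' : Fin 4, ∀ n m : ℤ,
      gam S * (l k + l k') - (gam S * n + 2 * Real.pi * I * m) ≠ 0 := by
    simp only [eventually_countable_forall]
    intro k k' n m
    have hg : gam S ≠ 0 := gam_ne_zero S
    refine eventually_residual_ne_zero _ (by fun_prop)
      ⟨fun _ => (gam S * n + 2 * Real.pi * I * m + 1) / (2 * gam S), ?_⟩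
    have : gam S * ((gam S * n + 2 * Real.pi * I * m + 1) / (2 * gam S) +
        (gam S * n + 2 * Real.pi * I * m + 1) / (2 * gam S)) -
        (gam S * n + 2 * Real.pi * I * m) = 1 := by
      field_simp; ring
    rw [this]; exact one_ne_zero
  have p2 : ∀ᶠ l in residual (Fin 4 → ℂ), ∀ n : ℕ,
      poch0 S (n + (l 0 + l 1 + l 2 + l 3) - 1) n ≠ 0 := by
    rw [eventually_countable_forall]
    intro n
    refine eventually_residual_ne_zero
      (fun l => poch0 S (n + (l 0 + l 1 + l 2 + l 3) - 1) n) ?_ ?_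
    · unfold poch0 poch
      have hl : ∀ i : ℕ, Differentiable ℂ fun l : Fin 4 → ℂ =>
          lin S (n + (l 0 + l 1 + l 2 + l 3) - 1 + i) 0 := fun i =>
        (differentiable_lin S 0).comp
          (f := fun l : Fin 4 → ℂ => n + (l 0 + l 1 + l 2 + l 3) - 1 + i) (by fun_prop)
      induction Finset.range n using Finset.induction_on with
      | empty => simp
      | insert i s hi ih => simp only [Finset.prod_insert hi]; exact (hl i).fun_mul ih
    · refine ⟨fun _ => 1 / 2, ?_⟩
      rw [poch0, poch, Finset.prod_ne_zero_iff]
      intro i hi h0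
      obtain ⟨m, hm⟩ := lin_eq_zero_imp S _ _ h0
      have hgr : ∃ g : ℝ, g ≠ 0 ∧ gam S = g := by
        cases S with
        | cH => exact ⟨1, one_ne_zero, by simp [gam]⟩
        | W => exact ⟨1, one_ne_zero, by simp [gam]⟩
        | AW q hq0 hq1 => exact ⟨Real.log q, (Real.log_neg hq0 hq1).ne, rfl⟩
      obtain ⟨g, hg0, hg⟩ := hgr
      rw [hg] at hm
      have := congrArg Complex.re hm
      rw [mul_zero, add_zero, show (g : ℂ) * (n + (1 / 2 + 1 / 2 + 1 / 2 + 1 / 2) - 1 + i) =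
          ((g * (n + 1 + i) : ℝ) : ℂ) by push_cast; ring,
        show 2 * (Real.pi : ℂ) * I * m = ((2 * Real.pi * m : ℝ) : ℂ) * I by push_cast; ring,
        ofReal_re, re_ofReal_mul, I_re, mul_zero] at this
      have := (mul_eq_zero.1 this).resolve_left hg0
      have hn : (0 : ℝ) ≤ n := Nat.cast_nonneg n
      have hi : (0 : ℝ) ≤ i := Nat.cast_nonneg i
      linarith
  have p3 : ∀ᶠ l in residual (Fin 4 → ℂ), ∀ n n' : ℕ, n ≠ n' →
      energy S l none n - energy S l none n' ≠ 0 := by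
    obtain ⟨l1, h1⟩ := exists_none_ne S
    simp only [eventually_countable_forall]
    intro n n' hn
    have := hE none n
    have := hE none n'
    exact eventually_residual_ne_zero _ (by fun_prop) ⟨l1, h1 n n' hn⟩
  have p4 : ∀ᶠ l in residual (Fin 4 → ℂ), ∀ n n' : ℕ, ∀ k k' : ℤ,
      energy S l none n + energy S l none n' - (seedE S l k + seedE S l k') ≠ 0 := by
    simp only [eventually_countable_forall]
    intro n n' k k'
    have := hE none n
    have := hE none n'
    have : Differentiable ℂ fun l => seedE S l k := hE _ _
    have : Differentiable ℂ fun l => seedE S l k' := hE _ _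
    exact eventually_residual_ne_zero _ (by fun_prop) (exists_none_seed S n n' k k')
  have p5 : ∀ᶠ l in residual (Fin 4 → ℂ), ∀ k k' m m' : ℤ,
      ¬ ((k = m ∧ k' = m') ∨ (k = m' ∧ k' = m)) →
      seedE S l k + seedE S l k' - (seedE S l m + seedE S l m') ≠ 0 := by
    obtain ⟨l1, h1⟩ := exists_seed_seed S
    simp only [eventually_countable_forall]
    intro k k' m m' hne
    have : ∀ k, Differentiable ℂ fun l => seedE S l k := fun k => hE _ _
    have a := this k
    have b := this k'
    have c := this m
    have d := this m'
    exact eventually_residual_ne_zero _ (by fun_prop) ⟨l1, h1 k k' m m' hne⟩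
  filter_upwards [p1, p2, p3, p4, p5] with l h1 h2 h3 h4 h5
  exact ⟨fun k k' n m => sub_ne_zero.1 (h1 k k' n m), h2, h3, h4, h5⟩

lemma exists_seq_generic (S : System) (l0 : Fin 4 → ℂ) :
    ∃ l : ℕ → Fin 4 → ℂ, (∀ k, Generic S (l k)) ∧ Tendsto l atTop (𝓝 l0) :=
  mem_closure_iff_seq_limit.1 (dense_generic S l0)

/-! ### Counting -/

/-- Below an element d of D that exceeds exactly i others lie d - i gaps; summing over i < |D| gives
the correction |D|(|D| - 1)/2. The induction adds the largest element, which leaves the gaps below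
the others unchanged. -/
lemma sum_card_gaps (D : Finset ℕ) :
    2 * ∑ d ∈ D, ((Finset.range d \ D).card : ℤ) + D.card * (D.card - 1) = 2 * ∑ d ∈ D, (d : ℤ) := by
  induction D using Finset.induction_on_max with
  | empty => simp
  | insert a s hs ih =>
    have ha : a ∉ s := fun h => lt_irrefl _ (hs a h)
    have h1 : ∀ d ∈ s, Finset.range d \ insert a s = Finset.range d \ s := by
      intro d hd
      ext x
      have := hs d hd
      simp only [Finset.mem_sdiff, Finset.mem_range, Finset.mem_insert]
      constructor
      · rintro ⟨h, h'⟩; exact ⟨h, fun h2 => h' (Or.inr h2)⟩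
      · rintro ⟨h, h'⟩; exact ⟨h, by rintro (rfl | h2); exacts [by omega, h' h2]⟩
    have h2 : ((Finset.range a \ insert a s).card : ℤ) = a - s.card := by
      have hsub : s ⊆ Finset.range a := fun x hx => Finset.mem_range.2 (hs x hx)
      have : Finset.range a \ insert a s = Finset.range a \ s := by
        ext x
        simp only [Finset.mem_sdiff, Finset.mem_range, Finset.mem_insert]
        constructor
        · rintro ⟨h, h'⟩; exact ⟨h, fun h2 => h' (Or.inr h2)⟩
        · rintro ⟨h, h'⟩; exact ⟨h, by rintro (rfl | h2); exacts [by omega, h' h2]⟩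
      rw [this, Finset.card_sdiff_of_subset hsub, Finset.card_range,
        Nat.cast_sub (by simpa using Finset.card_le_card hsub)]
    rw [Finset.sum_insert ha, Finset.sum_insert ha, h2, Finset.card_insert_of_notMem ha,
      Finset.sum_congr rfl fun d hd => by rw [h1 d hd]]
    push_cast
    linarith

lemma card_gaps (D : Finset ℕ) :
    (Nat.card {p : ℕ × ℕ // p.1 ∈ D ∧ p.2 ∉ D ∧ p.2 < p.1} : ℤ) =
      ∑ d ∈ D, ((Finset.range d \ D).card : ℤ) := by
  have e : {p : ℕ × ℕ // p.1 ∈ D ∧ p.2 ∉ D ∧ p.2 < p.1} ≃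
      {p : (_ : ℕ) × ℕ // p ∈ D.sigma fun d => Finset.range d \ D} :=
    (Equiv.sigmaEquivProd ℕ ℕ).symm.subtypeEquiv fun p => by
      simp [and_comm]
  rw [Nat.card_congr e, Nat.card_eq_fintype_card, Fintype.card_coe, Finset.card_sigma]
  push_cast
  rfl

lemma two_mul_ell (DI DII : Finset ℕ) :
    2 * ell DI DII = 2 * ∑ d ∈ DI, (d : ℤ) + 2 * ∑ d ∈ DII, (d : ℤ) -
      ((DI.card : ℤ) + DII.card) * ((DI.card : ℤ) + DII.card - 1) +
        4 * DI.card * DII.card := by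
  have : 2 * (((DI.card : ℤ) + DII.card) * ((DI.card : ℤ) + DII.card - 1) / 2) =
      ((DI.card : ℤ) + DII.card) * ((DI.card : ℤ) + DII.card - 1) :=
    Int.mul_ediv_cancel' (Int.even_mul_pred_self _).two_dvd
  rw [ell]
  linarith

lemma finite_gaps (D : Finset ℕ) : Finite {p : ℕ × ℕ // p.1 ∈ D ∧ p.2 ∉ D ∧ p.2 < p.1} := by
  refine Set.Finite.to_subtype ((Finset.finite_toSet
    (D ×ˢ (D.biUnion fun d => Finset.range d))).subset ?_)
  rintro ⟨a, b⟩ ⟨h1, h2, h3⟩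
  simp only [Finset.coe_product, Set.mem_prod, Finset.mem_coe, Finset.mem_biUnion,
    Finset.mem_range]
  exact ⟨h1, a, h1, h3⟩

lemma card_label (DI DII : Finset ℕ) (N : ℕ) :
    (Nat.card (Label DI DII N) : ℤ) = ell DI DII + N := by
  have := finite_gaps DI
  have := finite_gaps DII
  have h1 := sum_card_gaps DI
  have h2 := sum_card_gaps DII
  have h3 := two_mul_ell DI DII
  rw [Label, Nat.card_sum, Nat.card_sum, Nat.card_sum, Nat.card_prod]
  push_cast
  rw [card_gaps, card_gaps]
  simp only [Nat.card_eq_fintype_card, Fintype.card_fin, Fintype.card_coe]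
  linarith

/-- For 𝒩 = 0 this integer counts labels. -/
lemma ell_nonneg (DI DII : Finset ℕ) : 0 ≤ ell DI DII := by
  have := card_label DI DII 0
  have h : (0 : ℤ) ≤ Nat.card (Label DI DII 0) := Int.natCast_nonneg _
  push_cast at this
  linarith

/-! ### Existence of the polynomial parts -/

lemma mcount_snoc_seedCols (DI DII : Finset ℕ) (n : ℕ) :
    mcount (fun k => (snoc (seedCols DI DII) (none, n) k).1) .I = DII.card + 1 ∧
      mcount (fun k => (snoc (seedCols DI DII) (none, n) k).1) .II = DI.card + 1 :=
  ⟨by rw [mcount_snoc, mcount_seedCols]; rfl, by rw [mcount_snoc, mcount_seedCols]; rfl⟩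

lemma Generic.exists_multiP {S : System} {l : Fin 4 → ℂ} (hl : Generic S l) (DI DII : Finset ℕ)
    (n : ℕ) : ∃ Q : ℂ[X], (Q.natDegree : ℤ) ≤ ell DI DII + n ∧
      IsMultiIndexedPoly S l DI DII n Q := by
  obtain ⟨Q, hQd, hQ⟩ := hl.par.exists_polynomial
    (fun k => (snoc (seedCols DI DII) (none, n) k).1)
    (fun k => (snoc (seedCols DI DII) (none, n) k).2)
    (fun k => colP S l (snoc (seedCols DI DII) (none, n) k)) (fun k => natDegree_colP_le S l _)
  have hd : DegLE Q (ell DI DII + n) := by rw [← expDegC_snoc]; exact hQd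
  refine ⟨C (I ^ (((seeds DI DII).length + 1) * (seeds DI DII).length / 2)) * Q, ?_, fun x => ?_⟩
  · have h1 : (Q.natDegree : ℤ) ≤ ell DI DII + n := by
      have h0 := ell_nonneg DI DII
      have := (hd.mono (Int.self_le_toNat _)).natDegree_le
      omega
    have h2 : ((C (I ^ (((seeds DI DII).length + 1) * (seeds DI DII).length / 2)) * Q).natDegree : ℤ)
      ≤ Q.natDegree := by exact_mod_cast natDegree_C_mul_le _ _
    exact h2.trans h1
  · have := hQ x
    rw [(mcount_snoc_seedCols DI DII n).1, (mcount_snoc_seedCols DI DII n).2] at this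
    rw [detP_eq, colsDet, this, length_seeds, eval_mul, eval_C]
    ring

lemma Generic.exists_Xi {S : System} {l : Fin 4 → ℂ} (hl : Generic S l) (DI DII : Finset ℕ) :
    ∃ Q : ℂ[X], Q.natDegree ≤ (expDegC (seedCols DI DII)).toNat ∧
      IsDenominatorPoly S l DI DII Q := by
  obtain ⟨Q, hd, hQ⟩ := hl.par.exists_polynomial
    (fun k => (seedCols DI DII k).1) (fun k => (seedCols DI DII k).2)
    (fun k => colP S l (seedCols DI DII k)) (fun k => natDegree_colP_le S l _)
  have h1 : Q.natDegree ≤ (expDegC (seedCols DI DII)).toNat :=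
     (hd.mono (Int.self_le_toNat _)).natDegree_le
  refine ⟨C (I ^ ((seeds DI DII).length * ((seeds DI DII).length - 1) / 2)) * Q,
    (natDegree_C_mul_le _ _).trans h1, fun x => ?_⟩
  have := hQ x
  rw [mcount_seedCols, mcount_seedCols] at this
  rw [detXi_eq, colsDet, this, length_seeds, eval_mul, eval_C]
  ring

lemma continuous_detP (S : System) (DI DII : Finset ℕ) (n : ℕ) (x : ℂ) :
    Continuous fun l => detP S l DI DII n x := by
  simp only [detP_eq]
  exact continuous_const.mul (continuous_colsDet S _ x)

lemma continuous_detXi (S : System) (DI DII : Finset ℕ) (x : ℂ) :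
    Continuous fun l => detXi S l DI DII x := by
  simp only [detXi_eq]
  exact continuous_const.mul (continuous_colsDet S _ x)

/-- Approximation by generic parameters: the degree bound is uniform along the sequence, so a limit
of the polynomial parts exists and satisfies the defining relation. -/
lemma exists_multiP (S : System) (l : Fin 4 → ℂ) (DI DII : Finset ℕ) (n : ℕ) :
    ∃ Q : ℂ[X], Q.natDegree ≤ (ell DI DII + n).toNat ∧ IsMultiIndexedPoly S l DI DII n Q := by
  obtain ⟨ls, hls, ht⟩ := exists_seq_generic S l
  choose Q hQd hQ using fun k => (hls k).exists_multiP DI DII n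
  obtain ⟨Q0, h0, h1, -⟩ := exists_limit_polynomial S _ _ _
    (by omega : DI.card + 1 ≤ DI.card + DII.card + 1) (by omega)
    (fun l x => detP S l DI DII n x) (continuous_detP S DI DII n) ls l ht Q
    (ell DI DII + n).toNat (fun k => by have := hQd k; omega) hQ
  exact ⟨Q0, h0, h1⟩

lemma exists_Xi (S : System) (l : Fin 4 → ℂ) (DI DII : Finset ℕ) :
    ∃ Q : ℂ[X], Q.natDegree ≤ (expDegC (seedCols DI DII)).toNat ∧
      IsDenominatorPoly S l DI DII Q := by
  obtain ⟨ls, hls, ht⟩ := exists_seq_generic S l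
  choose Q hQd hQ using fun k => (hls k).exists_Xi DI DII
  obtain ⟨Q0, h0, h1, -⟩ := exists_limit_polynomial S _ _ _
    (by omega : DI.card ≤ DI.card + DII.card) (by omega)
    (fun l x => detXi S l DI DII x) (continuous_detXi S DI DII) ls l ht Q _ hQd hQ
  exact ⟨Q0, h0, h1⟩

lemma isMultiIndexedPoly_multiP (S : System) (l : Fin 4 → ℂ) (DI DII : Finset ℕ) (n : ℕ) :
    IsMultiIndexedPoly S l DI DII n (multiP S l DI DII n) := by
  have h : ∃ Q, IsMultiIndexedPoly S l DI DII n Q :=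
    (exists_multiP S l DI DII n).imp fun _ h => h.2
  rw [multiP, dif_pos h]
  exact h.choose_spec

lemma isDenominatorPoly_Xi (S : System) (l : Fin 4 → ℂ) (DI DII : Finset ℕ) :
    IsDenominatorPoly S l DI DII (Xi S l DI DII) := by
  have h : ∃ Q, IsDenominatorPoly S l DI DII Q := (exists_Xi S l DI DII).imp fun _ h => h.2
  rw [Xi, dif_pos h]
  exact h.choose_spec

lemma IsMultiIndexedPoly.eq_multiP {S : System} {l : Fin 4 → ℂ} {DI DII : Finset ℕ} {n : ℕ}
    {Q : ℂ[X]} (h : IsMultiIndexedPoly S l DI DII n Q) : Q = multiP S l DI DII n :=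
  eq_of_prefactor_mul S l _ _ _ (by omega) (by omega) _ _ fun x =>
    (h x).symm.trans (isMultiIndexedPoly_multiP S l DI DII n x)

lemma IsDenominatorPoly.eq_Xi {S : System} {l : Fin 4 → ℂ} {DI DII : Finset ℕ}
    {Q : ℂ[X]} (h : IsDenominatorPoly S l DI DII Q) : Q = Xi S l DI DII :=
  eq_of_prefactor_mul S l _ _ _ (by omega) (by omega) _ _ fun x =>
    (h x).symm.trans (isDenominatorPoly_Xi S l DI DII x)

lemma natDegree_multiP_le (S : System) (l : Fin 4 → ℂ) (DI DII : Finset ℕ) (n : ℕ) :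
    ((multiP S l DI DII n).natDegree : ℤ) ≤ ell DI DII + n := by
  obtain ⟨Q, hd, hQ⟩ := exists_multiP S l DI DII n
  rw [← hQ.eq_multiP]
  have := ell_nonneg DI DII
  omega

lemma natDegree_Xi_le (S : System) (l : Fin 4 → ℂ) (DI DII : Finset ℕ) :
    (Xi S l DI DII).natDegree ≤ (expDegC (seedCols DI DII)).toNat := by
  obtain ⟨Q, hd, hQ⟩ := exists_Xi S l DI DII
  rw [← hQ.eq_Xi]
  exact hd

/-! ### Continuity of the polynomial parts in the parameters -/

lemma tendsto_coeff_multiP (S : System) (DI DII : Finset ℕ) (n : ℕ) {ls : ℕ → Fin 4 → ℂ}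
    {l : Fin 4 → ℂ} (ht : Tendsto ls atTop (𝓝 l)) (i : ℕ) :
    Tendsto (fun k => (multiP S (ls k) DI DII n).coeff i) atTop
      (𝓝 ((multiP S l DI DII n).coeff i)) := by
  obtain ⟨Q0, -, h1, h2⟩ := exists_limit_polynomial S _ _ _
    (by omega : DI.card + 1 ≤ DI.card + DII.card + 1) (by omega)
    (fun l x => detP S l DI DII n x) (continuous_detP S DI DII n) ls l ht
    (fun k => multiP S (ls k) DI DII n) (ell DI DII + n).toNat
    (fun k => by have := natDegree_multiP_le S (ls k) DI DII n; omega)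
    fun k => isMultiIndexedPoly_multiP S (ls k) DI DII n
  rw [← IsMultiIndexedPoly.eq_multiP h1]
  exact h2 i

lemma tendsto_coeff_Xi (S : System) (DI DII : Finset ℕ) {ls : ℕ → Fin 4 → ℂ}
    {l : Fin 4 → ℂ} (ht : Tendsto ls atTop (𝓝 l)) (i : ℕ) :
    Tendsto (fun k => (Xi S (ls k) DI DII).coeff i) atTop (𝓝 ((Xi S l DI DII).coeff i)) := by
  obtain ⟨Q0, -, h1, h2⟩ := exists_limit_polynomial S _ _ _
    (by omega : DI.card ≤ DI.card + DII.card) (by omega)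
    (fun l x => detXi S l DI DII x) (continuous_detXi S DI DII) ls l ht
    (fun k => Xi S (ls k) DI DII) _ (fun k => natDegree_Xi_le S (ls k) DI DII)
    fun k => isDenominatorPoly_Xi S (ls k) DI DII
  rw [← IsDenominatorPoly.eq_Xi h1]
  exact h2 i

end MultiIndexed

namespace MultiIndexed

/-! ### Products over windows of sites -/

section Windows

variable {α β : ℕ → ℂ}

/-- The product of the gauge factors of one type over a window of sites. -/
noncomputable def ph (α β : ℕ → ℂ) (L p m : ℕ) : ℂ :=
  ∏ j ∈ Finset.range m, α (p + j) / β (p + L - j)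

lemma ph_ne_zero (hα : ∀ k, α k ≠ 0) (hβ : ∀ k, β k ≠ 0) (L p m : ℕ) : ph α β L p m ≠ 0 :=
  Finset.prod_ne_zero_iff.2 fun _ _ => div_ne_zero (hα _) (hβ _)

lemma ph_shift (hα : ∀ k, α k ≠ 0) (hβ : ∀ k, β k ≠ 0) (L p m : ℕ) (hm : m ≤ L) :
    ph α β L (p + 1) m =
      ph α β L p m * (α (p + m) / α p) * (β (p + L + 1 - m) / β (p + L + 1)) := by
  induction m with
  | zero =>
    have := hα p
    have := hβ (p + L + 1)
    simp [ph]; field_simp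
  | succ m ih =>
    have e := ih (by omega)
    rw [ph] at e ⊢
    rw [Finset.prod_range_succ, e, ph, ph, Finset.prod_range_succ,
      show p + 1 + m = p + (m + 1) by ring, show p + 1 + L - m = p + L + 1 - m by omega,
      show p + L + 1 - (m + 1) = p + L - m by omega]
    have := hα p
    have := hα (p + m)
    have := hβ (p + L + 1)
    have := hβ (p + L + 1 - m)
    have := hβ (p + L - m)
    field_simp

/-- A window of L + 1 sites contains two windows of L sites. This lemma reduces to the one starting
at p + 1, the next one to the one starting at p; comparing both gives the ratios needed for moving
windows. -/
lemma ph_peel (hβ : ∀ k, β k ≠ 0) (L p m : ℕ) (hm : m ≤ L) :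
    ph α β (L + 1) p (m + 1) = α p / β (p + L + 1 - m) * ph α β L (p + 1) m := by
  induction m with
  | zero => simp [ph, add_assoc]
  | succ m ih =>
    have e := ih (by omega)
    rw [ph, Finset.prod_range_succ, ← ph, e, ph, ph, Finset.prod_range_succ,
      show p + 1 + m = p + (m + 1) by ring, show p + 1 + L - m = p + L + 1 - m by omega,
      show p + (L + 1) - (m + 1) = p + L + 1 - (m + 1) by omega]
    have := hβ (p + L + 1 - (m + 1))
    have := hβ (p + L + 1 - m)
    field_simp

lemma ph_peel' (hβ : ∀ k, β k ≠ 0) (L p m : ℕ) (hm : m ≤ L) :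
    ph α β (L + 1) p (m + 1) = α (p + m) / β (p + L + 1) * ph α β L p m := by
  induction m with
  | zero => simp [ph, add_assoc]
  | succ m ih =>
    have e := ih (by omega)
    rw [ph, Finset.prod_range_succ, ← ph, e, ph, ph, Finset.prod_range_succ,
      show p + (L + 1) - (m + 1) = p + L - m by omega]
    have := hβ (p + L - m)
    have := hβ (p + L + 1)
    field_simp

/-- The Vandermonde product over a window of sites. -/
noncomputable def vd (e : ℕ → ℂ) (L p : ℕ) : ℂ :=
  ∏ k ∈ Finset.range L, ∏ j ∈ Finset.range k, (e (p + j) - e (p + k))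

lemma vd_succ (e : ℕ → ℂ) (L p : ℕ) :
    vd e (L + 1) p = vd e L p * ∏ j ∈ Finset.range L, (e (p + j) - e (p + L)) := by
  rw [vd, Finset.prod_range_succ, ← vd]

lemma vd_succ' (e : ℕ → ℂ) (L p : ℕ) :
    vd e (L + 1) p = vd e L (p + 1) * ∏ k ∈ Finset.range L, (e p - e (p + 1 + k)) := by
  induction L with
  | zero => simp [vd]
  | succ L ih =>
    rw [vd_succ, ih, vd_succ, Finset.prod_range_succ' _ L, Finset.prod_range_succ _ L,
      show p + (L + 1) = p + 1 + L by ring]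
    have : ∏ k ∈ Finset.range L, (e (p + (k + 1)) - e (p + 1 + L)) =
        ∏ j ∈ Finset.range L, (e (p + 1 + j) - e (p + 1 + L)) :=
      Finset.prod_congr rfl fun j _ => by rw [show p + (j + 1) = p + 1 + j by ring]
    rw [this, add_zero]
    ring

/-- A product of values at consecutive indices. -/
noncomputable def runProd (σ : ℕ → ℂ) (a L : ℕ) : ℂ := ∏ i ∈ Finset.range L, σ (a + i)

lemma runProd_shift (σ : ℕ → ℂ) (a L : ℕ) :
    runProd σ a L * (σ (a + L) * σ (a + L + 1)) = σ a * σ (a + 1) * runProd σ (a + 2) L := by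
  induction L with
  | zero => simp [runProd]
  | succ L ih =>
    have h1 : runProd σ a (L + 1) = runProd σ a L * σ (a + L) := Finset.prod_range_succ _ _
    have h2 : runProd σ (a + 2) (L + 1) = runProd σ (a + 2) L * σ (a + 2 + L) :=
      Finset.prod_range_succ _ _
    rw [h1, h2, show a + (L + 1) = a + L + 1 by ring, show a + 2 + L = a + L + 1 + 1 by ring]
    linear_combination σ (a + L + 1 + 1) * ih

variable {e d σ : ℕ → ℂ}

/-- The index sums of the last site with the others are consecutive integers, and so are the index
differences. Both factors are therefore products over runs, in which moving the window cancels all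
but the boundary terms. -/
lemma prod_last (h : ∀ j k, e j - e (j + k + 1) = d (k + 1) * σ (2 * j + k + 1)) (L p : ℕ) :
    ∏ j ∈ Finset.range L, (e (p + j) - e (p + L)) =
      runProd d 1 L * runProd σ (2 * p + L) L := by
  rw [runProd, runProd, ← Finset.prod_range_reflect (fun i => d (1 + i)), ← Finset.prod_mul_distrib]
  refine Finset.prod_congr rfl fun j hj => ?_
  have hj := Finset.mem_range.1 hj
  have := h (p + j) (L - 1 - j)
  rw [show p + j + (L - 1 - j) + 1 = p + L by omega,
    show 2 * (p + j) + (L - 1 - j) + 1 = 2 * p + L + j by omega] at this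
  rw [this, show L - 1 - j + 1 = 1 + (L - 1 - j) by ring]

lemma prod_first (h : ∀ j k, e j - e (j + k + 1) = d (k + 1) * σ (2 * j + k + 1)) (L p : ℕ) :
    ∏ k ∈ Finset.range L, (e p - e (p + 1 + k)) = runProd d 1 L * runProd σ (2 * p + 1) L := by
  rw [runProd, runProd, ← Finset.prod_mul_distrib]
  refine Finset.prod_congr rfl fun k hk => ?_
  have := h p k
  rw [show p + k + 1 = p + 1 + k by ring, show 2 * p + k + 1 = 2 * p + 1 + k by ring] at this
  rw [this, add_comm k 1]

lemma vd_ne_zero (h : ∀ j k, e j - e (j + k + 1) = d (k + 1) * σ (2 * j + k + 1))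
    (hd : ∀ k, d (k + 1) ≠ 0) (hσ : ∀ k, σ k ≠ 0) (L p : ℕ) : vd e L p ≠ 0 := by
  refine Finset.prod_ne_zero_iff.2 fun k _ => Finset.prod_ne_zero_iff.2 fun j hj => ?_
  have := h (p + j) (k - 1 - j)
  rw [show p + j + (k - 1 - j) + 1 = p + k by have := Finset.mem_range.1 hj; omega] at this
  rw [this]
  exact mul_ne_zero (hd _) (hσ _)

end Windows

/-! ### Ratios of window factors -/

/-- The common factor of the Casoratians on a window of sites. -/
noncomputable def winFactor (e α β α' β' : ℕ → ℂ) (L p m m' : ℕ) : ℂ :=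
  vd e L p * (ph α β L p m * ph α' β' L p m')

/-- The hypotheses on the data at the sites. -/
structure SiteData (e d σ α β α' β' : ℕ → ℂ) : Prop where
  diff : ∀ j k, e j - e (j + k + 1) = d (k + 1) * σ (2 * j + k + 1)
  d_ne : ∀ k, d (k + 1) ≠ 0
  σ_ne : ∀ k, σ k ≠ 0
  α_ne : ∀ k, α k ≠ 0
  β_ne : ∀ k, β k ≠ 0
  α'_ne : ∀ k, α' k ≠ 0
  β'_ne : ∀ k, β' k ≠ 0

namespace SiteData

variable {e d σ α β α' β' : ℕ → ℂ} (h : SiteData e d σ α β α' β')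

include h

lemma runProd_d_ne (L : ℕ) : runProd d 1 L ≠ 0 :=
  Finset.prod_ne_zero_iff.2 fun i _ => by rw [add_comm]; exact h.d_ne i

lemma winFactor_ne_zero (L p m m' : ℕ) : winFactor e α β α' β' L p m m' ≠ 0 :=
  mul_ne_zero (vd_ne_zero h.diff h.d_ne h.σ_ne L p)
    (mul_ne_zero (ph_ne_zero h.α_ne h.β_ne _ _ _) (ph_ne_zero h.α'_ne h.β'_ne _ _ _))

/-- Moving the window down, with a column more. -/
lemma ratio_down (M s r : ℕ) (hs : s ≤ M) (hr : r ≤ M) :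
    winFactor e α β α' β' M 1 s r * winFactor e α β α' β' (M + 1) 2 (s + 1) (r + 1) *
        (σ (M + 2) * σ (M + 3)) =
      winFactor e α β α' β' M 2 s r * winFactor e α β α' β' (M + 1) 1 (s + 1) (r + 1) *
        (σ (2 * M + 2) * σ (2 * M + 3)) *
        (α (s + 2) / α (s + 1) * (β (M + 2) / β (M + 3))) *
        (α' (r + 2) / α' (r + 1) * (β' (M + 2) / β' (M + 3))) := by
  have key : ∀ {α β : ℕ → ℂ} (hα : ∀ k, α k ≠ 0) (hβ : ∀ k, β k ≠ 0) (s : ℕ) (hs : s ≤ M),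
      ph α β M 1 s * ph α β (M + 1) 2 (s + 1) = ph α β M 2 s * ph α β (M + 1) 1 (s + 1) *
        (α (s + 2) / α (s + 1) * (β (M + 2) / β (M + 3))) := by
    intro α β hα hβ s hs
    rw [ph_peel' hβ M 2 s hs, ph_peel' hβ M 1 s hs, show 2 + s = s + 2 by ring,
      show 1 + s = s + 1 by ring, show 2 + M + 1 = M + 3 by ring, show 1 + M + 1 = M + 2 by ring]
    have := hα (s + 1)
    have := hβ (M + 2)
    have := hβ (M + 3)
    field_simp
  have k1 := key h.α_ne h.β_ne s hs
  have k2 := key h.α'_ne h.β'_ne r hr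
  have v1 := runProd_shift σ (M + 2) M
  rw [show M + 2 + M = 2 * M + 2 by ring, show 2 * M + 2 + 1 = 2 * M + 3 by ring] at v1
  simp only [winFactor]
  rw [vd_succ e M 2, vd_succ e M 1, prod_last h.diff, prod_last h.diff,
    show 2 * 2 + M = M + 2 + 2 by ring, show 2 * 1 + M = M + 2 by ring]
  calc _ = vd e M 1 * vd e M 2 * runProd d 1 M * (σ (M + 2) * σ (M + 2 + 1) *
        runProd σ (M + 2 + 2) M) * (ph α β M 1 s * ph α β (M + 1) 2 (s + 1)) *
        (ph α' β' M 1 r * ph α' β' (M + 1) 2 (r + 1)) := by ring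
    _ = _ := by rw [← v1, k1, k2]; ring

/-- Moving the window up, with a column more. -/
lemma ratio_up (M s r : ℕ) (hs : s ≤ M) (hr : r ≤ M) :
    winFactor e α β α' β' M 2 s r * winFactor e α β α' β' (M + 1) 0 (s + 1) (r + 1) *
        (σ (M + 1) * σ (M + 2)) =
      winFactor e α β α' β' M 1 s r * winFactor e α β α' β' (M + 1) 1 (s + 1) (r + 1) *
        (σ 1 * σ 2) * (α 0 / α 1 * (β (M + 2 - s) / β (M + 1 - s))) *
        (α' 0 / α' 1 * (β' (M + 2 - r) / β' (M + 1 - r))) := by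
  have key : ∀ {α β : ℕ → ℂ} (hα : ∀ k, α k ≠ 0) (hβ : ∀ k, β k ≠ 0) (s : ℕ) (hs : s ≤ M),
      ph α β M 2 s * ph α β (M + 1) 0 (s + 1) = ph α β M 1 s * ph α β (M + 1) 1 (s + 1) *
        (α 0 / α 1 * (β (M + 2 - s) / β (M + 1 - s))) := by
    intro α β hα hβ s hs
    rw [ph_peel hβ M 0 s hs, ph_peel hβ M 1 s hs, show 0 + M + 1 - s = M + 1 - s by omega,
      show 1 + M + 1 - s = M + 2 - s by omega, zero_add, show 1 + 1 = 2 from rfl]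
    have := hα 1
    have := hβ (M + 2 - s)
    have := hβ (M + 1 - s)
    field_simp
  have k1 := key h.α_ne h.β_ne s hs
  have k2 := key h.α'_ne h.β'_ne r hr
  have v1 := runProd_shift σ 1 M
  rw [show 1 + M = M + 1 by ring, show M + 1 + 1 = M + 2 by ring, show 1 + 1 = 2 from rfl,
    show 1 + 2 = 3 from rfl] at v1
  simp only [winFactor]
  rw [vd_succ' e M 0, vd_succ' e M 1, prod_first h.diff, prod_first h.diff,
    show 2 * 0 + 1 = 1 from rfl, show 2 * 1 + 1 = 3 from rfl, show 1 + 1 = 2 from rfl]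
  calc _ = vd e M 1 * vd e M 2 * runProd d 1 M * (runProd σ 1 M * (σ (M + 1) * σ (M + 2))) *
        (ph α β M 2 s * ph α β (M + 1) 0 (s + 1)) *
        (ph α' β' M 2 r * ph α' β' (M + 1) 0 (r + 1)) := by ring
    _ = _ := by rw [v1, k1, k2]; ring

/-- Moving the window down, with a column less. -/
lemma ratio_down_remove (m s r : ℕ) (hs : s ≤ m + 1) (hr : r ≤ m + 1) :
    winFactor e α β α' β' (m + 2) 1 s r * winFactor e α β α' β' (m + 1) 3 s r *
        (σ (m + 4) * σ (m + 5)) =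
      winFactor e α β α' β' (m + 2) 2 s r * winFactor e α β α' β' (m + 1) 2 s r *
        (σ 3 * σ 4) * (α 1 / α 2 * (α (s + 2) / α (s + 1))) *
        (α' 1 / α' 2 * (α' (r + 2) / α' (r + 1))) := by
  have key : ∀ {α β : ℕ → ℂ} (hα : ∀ k, α k ≠ 0) (hβ : ∀ k, β k ≠ 0) (s : ℕ) (hs : s ≤ m + 1),
      ph α β (m + 2) 1 s * ph α β (m + 1) 3 s = ph α β (m + 2) 2 s * ph α β (m + 1) 2 s *
        (α 1 / α 2 * (α (s + 2) / α (s + 1))) := by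
    intro α β hα hβ s hs
    rw [ph_shift hα hβ (m + 1) 2 s hs, ph_shift hα hβ (m + 2) 1 s (by omega),
      show 2 + (m + 1) + 1 - s = 1 + (m + 2) + 1 - s by omega,
      show 2 + (m + 1) + 1 = 1 + (m + 2) + 1 by omega, show 2 + s = s + 2 by ring,
      show 1 + s = s + 1 by ring]
    have := hα 1
    have := hα 2
    have := hα (s + 1)
    have := hβ (1 + (m + 2) + 1)
    have := hβ (1 + (m + 2) + 1 - s)
    field_simp
  have k1 := key h.α_ne h.β_ne s hs
  have k2 := key h.α'_ne h.β'_ne r hr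
  have v1 := runProd_shift σ 3 (m + 1)
  rw [show 3 + (m + 1) = m + 4 by ring, show m + 4 + 1 = m + 5 by ring,
    show 3 + 1 = 4 from rfl, show 3 + 2 = 5 from rfl] at v1
  simp only [winFactor]
  rw [vd_succ' e (m + 1) 1, vd_succ' e (m + 1) 2, prod_first h.diff, prod_first h.diff,
    show 2 * 1 + 1 = 3 from rfl, show 2 * 2 + 1 = 5 from rfl, show 1 + 1 = 2 from rfl]
  calc _ = vd e (m + 1) 2 * vd e (m + 1) 3 * runProd d 1 (m + 1) *
        (runProd σ 3 (m + 1) * (σ (m + 4) * σ (m + 5))) *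
        (ph α β (m + 2) 1 s * ph α β (m + 1) 3 s) *
        (ph α' β' (m + 2) 1 r * ph α' β' (m + 1) 3 r) := by ring
    _ = _ := by rw [v1, k1, k2]; ring

/-- Moving the window up, with a column less. -/
lemma ratio_up_remove (m s r : ℕ) (hs : s ≤ m + 1) (hr : r ≤ m + 1) :
    winFactor e α β α' β' (m + 2) 2 s r * winFactor e α β α' β' (m + 1) 1 s r *
        (σ (m + 3) * σ (m + 4)) =
      winFactor e α β α' β' (m + 2) 1 s r * winFactor e α β α' β' (m + 1) 2 s r *
        (σ (2 * m + 4) * σ (2 * m + 5)) *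
        (β (m + 4 - s) / β (m + 3 - s) * (β (m + 3) / β (m + 4))) *
        (β' (m + 4 - r) / β' (m + 3 - r) * (β' (m + 3) / β' (m + 4))) := by
  have key : ∀ {α β : ℕ → ℂ} (hα : ∀ k, α k ≠ 0) (hβ : ∀ k, β k ≠ 0) (s : ℕ) (hs : s ≤ m + 1),
      ph α β (m + 2) 2 s * ph α β (m + 1) 1 s = ph α β (m + 2) 1 s * ph α β (m + 1) 2 s *
        (β (m + 4 - s) / β (m + 3 - s) * (β (m + 3) / β (m + 4))) := by
    intro α β hα hβ s hs
    rw [ph_shift hα hβ (m + 1) 1 s hs, ph_shift hα hβ (m + 2) 1 s (by omega),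
      show 1 + (m + 1) + 1 - s = m + 3 - s by omega, show 1 + (m + 2) + 1 - s = m + 4 - s by omega,
      show 1 + (m + 1) + 1 = m + 3 by omega, show 1 + (m + 2) + 1 = m + 4 by omega]
    have := hβ (m + 3)
    have := hβ (m + 4)
    have := hβ (m + 3 - s)
    have := hβ (m + 4 - s)
    field_simp
  have k1 := key h.α_ne h.β_ne s hs
  have k2 := key h.α'_ne h.β'_ne r hr
  have v1 := runProd_shift σ (m + 3) (m + 1)
  rw [show m + 3 + (m + 1) = 2 * m + 4 by ring, show 2 * m + 4 + 1 = 2 * m + 5 by ring,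
    show m + 3 + 1 = m + 4 from rfl, show m + 3 + 2 = m + 5 from rfl] at v1
  simp only [winFactor]
  rw [vd_succ e (m + 1) 2, vd_succ e (m + 1) 1, prod_last h.diff, prod_last h.diff,
    show 2 * 2 + (m + 1) = m + 5 by ring, show 2 * 1 + (m + 1) = m + 3 by ring]
  calc _ = vd e (m + 1) 2 * vd e (m + 1) 1 * runProd d 1 (m + 1) *
        (σ (m + 3) * σ (m + 4) * runProd σ (m + 5) (m + 1)) *
        (ph α β (m + 2) 2 s * ph α β (m + 1) 1 s) *
        (ph α' β' (m + 2) 2 r * ph α' β' (m + 1) 1 r) := by ring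
    _ = _ := by rw [← v1, k1, k2]; ring

/-- The remainder below. -/
lemma ratio_rest_down (m s r : ℕ) (hs : s ≤ m) (hr : r ≤ m) :
    winFactor e α β α' β' (m + 3) 1 (s + 2) (r + 2) * winFactor e α β α' β' m 3 s r *
        runProd d 1 m =
      winFactor e α β α' β' (m + 2) 2 (s + 1) (r + 1) *
        winFactor e α β α' β' (m + 1) 2 (s + 1) (r + 1) *
        runProd d 1 (m + 2) * (σ 3 * σ 4) * (α 1 / α 2) * (α' 1 / α' 2) := by
  have key : ∀ {α β : ℕ → ℂ} (hα : ∀ k, α k ≠ 0) (hβ : ∀ k, β k ≠ 0) (s : ℕ) (hs : s ≤ m),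
      ph α β (m + 3) 1 (s + 2) * ph α β m 3 s =
        ph α β (m + 2) 2 (s + 1) * ph α β (m + 1) 2 (s + 1) * (α 1 / α 2) := by
    intro α β hα hβ s hs
    rw [ph_peel hβ (m + 2) 1 (s + 1) (by omega), ph_peel hβ m 2 s hs,
      show 1 + (m + 2) + 1 - (s + 1) = 2 + m + 1 - s by omega, show 1 + 1 = 2 from rfl,
      show 2 + 1 = 3 from rfl]
    have := hα 2
    have := hβ (2 + m + 1 - s)
    field_simp
  have k1 := key h.α_ne h.β_ne s hs
  have k2 := key h.α'_ne h.β'_ne r hr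
  have v1 : runProd σ 3 (m + 2) = σ 3 * σ 4 * runProd σ 5 m := by
    rw [← runProd_shift σ 3 m, runProd, Finset.prod_range_succ, Finset.prod_range_succ, ← runProd]
    rw [show 3 + (m + 1) = 3 + m + 1 by ring]; ring
  simp only [winFactor]
  rw [vd_succ' e (m + 2) 1, vd_succ' e m 2, prod_first h.diff, prod_first h.diff,
    show 2 * 1 + 1 = 3 from rfl, show 2 * 2 + 1 = 5 from rfl, show 1 + 1 = 2 from rfl, v1]
  calc _ = vd e (m + 2) 2 * vd e m 3 * runProd d 1 (m + 2) * runProd d 1 m *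
        (σ 3 * σ 4 * runProd σ 5 m) *
        (ph α β (m + 3) 1 (s + 2) * ph α β m 3 s) *
        (ph α' β' (m + 3) 1 (r + 2) * ph α' β' m 3 r) := by ring
    _ = _ := by rw [k1, k2]; ring

/-- The remainder above. -/
lemma ratio_rest_up (m s r : ℕ) (hs : s ≤ m) (hr : r ≤ m) :
    winFactor e α β α' β' (m + 3) 1 (s + 2) (r + 2) * winFactor e α β α' β' m 2 s r *
        runProd d 1 m =
      winFactor e α β α' β' (m + 2) 1 (s + 1) (r + 1) *
        winFactor e α β α' β' (m + 1) 2 (s + 1) (r + 1) *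
        runProd d 1 (m + 2) * (σ (2 * m + 4) * σ (2 * m + 5)) *
        (β (m + 3) / β (m + 4)) * (β' (m + 3) / β' (m + 4)) := by
  have key : ∀ {α β : ℕ → ℂ} (hα : ∀ k, α k ≠ 0) (hβ : ∀ k, β k ≠ 0) (s : ℕ) (hs : s ≤ m),
      ph α β (m + 3) 1 (s + 2) * ph α β m 2 s =
        ph α β (m + 2) 1 (s + 1) * ph α β (m + 1) 2 (s + 1) * (β (m + 3) / β (m + 4)) := by
    intro α β hα hβ s hs
    rw [ph_peel' hβ (m + 2) 1 (s + 1) (by omega), ph_peel' hβ m 2 s hs,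
      show 1 + (s + 1) = 2 + s by ring, show 1 + (m + 2) + 1 = m + 4 by ring,
      show 2 + m + 1 = m + 3 by ring]
    have := hβ (m + 3)
    have := hβ (m + 4)
    field_simp
  have k1 := key h.α_ne h.β_ne s hs
  have k2 := key h.α'_ne h.β'_ne r hr
  have v1 : runProd σ (m + 4) (m + 2) * 1 =
      runProd σ (m + 4) m * (σ (2 * m + 4) * σ (2 * m + 5)) := by
    rw [runProd, Finset.prod_range_succ, Finset.prod_range_succ, ← runProd,
      show m + 4 + m = 2 * m + 4 by ring, show m + 4 + (m + 1) = 2 * m + 5 by ring]; ring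
  simp only [winFactor]
  rw [vd_succ e (m + 2) 1, vd_succ e m 2, prod_last h.diff, prod_last h.diff,
    show 2 * 1 + (m + 2) = m + 4 by ring, show 2 * 2 + m = m + 4 by ring]
  calc _ = vd e (m + 2) 1 * vd e m 2 * runProd d 1 (m + 2) * runProd d 1 m *
        (runProd σ (m + 4) (m + 2) * 1) *
        (ph α β (m + 3) 1 (s + 2) * ph α β m 2 s) *
        (ph α' β' (m + 3) 1 (r + 2) * ph α' β' m 2 r) := by ring
    _ = _ := by rw [k1, k2, v1]; ring

end SiteData

end MultiIndexed

namespace MultiIndexed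

open Complex Polynomial Filter Topology

/-! ### Sites around a point -/

/-- The sites around `x`; the site `M / 2 + 1` is `x`. -/
noncomputable def site (S : System) (M : ℕ) (x : ℂ) (k : ℕ) : ℂ :=
  x + I * ((M : ℂ) / 2 + 1 - k) * gam S

lemma site_succ (S : System) (M : ℕ) (x : ℂ) (k : ℕ) :
    site S M x (k + 1) = site S M x k - I * gam S := by
  simp only [site]; push_cast; ring

lemma node_site (S : System) (M L p : ℕ) (x : ℂ) (j : ℕ) :
    node S L (x + I * ((M : ℂ) / 2 + 1 - p - ((L : ℂ) - 1) / 2) * gam S) j =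
      site S M x (p + j) := by
  simp only [site, node]; push_cast; ring

/-- Points around which no factor vanishes. -/
structure GoodPt (S : System) (l : Fin 4 → ℂ) (M : ℕ) (x : ℂ) : Prop where
  hA_ne : ∀ T k, hA S l T (site S M x k) ≠ 0
  hB_ne : ∀ T k, hB S l T (site S M x k) ≠ 0
  sg_ne : ∀ t : ℤ, sg S (2 * x + I * t * gam S) ≠ 0

lemma countable_zeta (S : System) (p : ℂ[X]) (hp : p ≠ 0) :
    {x | p.eval (zeta S x) = 0}.Countable := by
  have hfin : ({z | p.eval z = 0} : Set ℂ).Countable := by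
    refine ((Finset.finite_toSet p.roots.toFinset).subset fun z hz => ?_).countable
    simpa [hp] using hz
  cases S with
  | cH => exact hfin
  | W => exact hfin
  | AW q h0 h1 => exact hfin.preimage_cexp.preimage (mul_right_injective₀ I_ne_zero)

/-- Each of the countably many conditions excludes the zeros of a nonzero polynomial in x or
exp(ix), a countable set. -/
lemma dense_goodPt (S : System) (l : Fin 4 → ℂ) (M : ℕ) : Dense {x | GoodPt S l M x} := by
  have h1 : ∀ T k, {x | hA S l T (site S M x k) = 0}.Countable := fun T k =>
    (countable_zeta S _ (pA_ne_zero S l T (I * ((M : ℂ) / 2 + 1 - k) * gam S))).mono fun x hx => by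
      rw [Set.mem_ofPred_eq, eval_pA]
      exact mul_eq_zero_of_left hx _
  have h2 : ∀ T k, {x | hB S l T (site S M x k) = 0}.Countable := fun T k =>
    (countable_zeta S _ (pB_ne_zero S l T (I * ((M : ℂ) / 2 + 1 - k) * gam S))).mono fun x hx => by
      rw [Set.mem_ofPred_eq, eval_pB]
      exact mul_eq_zero_of_left hx _
  have h3 : ∀ t : ℤ, {x | sg S (2 * x + I * t * gam S) = 0}.Countable := fun t =>
    (countable_zeta S _ (wP_ne_zero_natDegree S (I * t * gam S)).1).mono fun x hx => by
      rw [Set.mem_ofPred_eq, eval_wP]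
      exact mul_eq_zero_of_left hx _
  have hc : ((⋃ k, {x | hA S l .I (site S M x k) = 0}) ∪ (⋃ k, {x | hA S l .II (site S M x k) = 0}) ∪
      ((⋃ k, {x | hB S l .I (site S M x k) = 0}) ∪ ⋃ k, {x | hB S l .II (site S M x k) = 0}) ∪
      ⋃ t : ℤ, {x | sg S (2 * x + I * t * gam S) = 0}).Countable :=
    (((Set.countable_iUnion (h1 .I)).union (Set.countable_iUnion (h1 .II))).union
      ((Set.countable_iUnion (h2 .I)).union (Set.countable_iUnion (h2 .II)))).union
      (Set.countable_iUnion h3)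
  refine (hc.dense_compl ℂ).mono fun x hx => ?_
  simp only [Set.mem_compl_iff, Set.mem_union, Set.mem_iUnion, Set.mem_ofPred_eq, not_or,
    not_exists] at hx
  obtain ⟨⟨⟨a1, a2⟩, b1, b2⟩, c⟩ := hx
  exact ⟨fun T k => by cases T; exacts [a1 k, a2 k], fun T k => by cases T; exacts [b1 k, b2 k], c⟩

lemma dl_neg (S : System) (w : ℂ) : dl S (-w) = -dl S w := by
  cases S with
  | cH => rfl
  | W => rfl
  | AW q h0 h1 => simp only [dl]; rw [neg_div, sin_neg]; ring

lemma etaDm_eq_sg (S : System) (y : ℂ) : etaDm S y =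
    dl S (I * gam S) * dl S (2 * I * gam S) * (sg S (2 * y) * sg S (2 * y - I * gam S)) := by
  rw [etaDm, eta_sub, eta_sub, show y - I * gam S - y = -(I * gam S) by ring,
    show y - I * gam S - (y + I * gam S) = -(2 * I * gam S) by ring, dl_neg, dl_neg,
    show y - I * gam S + y = 2 * y - I * gam S by ring,
    show y - I * gam S + (y + I * gam S) = 2 * y by ring]
  ring

lemma etaDp_eq_sg (S : System) (y : ℂ) : etaDp S y =
    dl S (I * gam S) * dl S (2 * I * gam S) * (sg S (2 * y + I * gam S) * sg S (2 * y)) := by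
  rw [etaDp, eta_sub, eta_sub, show y + I * gam S - y = I * gam S by ring,
    show y + I * gam S - (y - I * gam S) = 2 * I * gam S by ring,
    show y + I * gam S + y = 2 * y + I * gam S by ring,
    show y + I * gam S + (y - I * gam S) = 2 * y by ring]
  ring

lemma dl_nat_ne_zero (S : System) (k : ℕ) : dl S (I * ((k : ℂ) + 1) * gam S) ≠ 0 := by
  have := dl_ne_zero S ((k : ℝ) + 1) (by positivity)
  push_cast at this
  exact this

lemma dl_one_ne_zero (S : System) : dl S (I * gam S) ≠ 0 := by
  simpa using dl_nat_ne_zero S 0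

lemma dl_two_ne_zero (S : System) : dl S (2 * I * gam S) ≠ 0 := by
  have := dl_nat_ne_zero S 1
  push_cast at this
  rwa [show I * (1 + 1) * gam S = 2 * I * gam S by ring] at this

lemma potDen_ne_zero_of_etaDm (S : System) (y : ℂ) (h : etaDm S y ≠ 0) : potDen S y ≠ 0 := by
  intro h0
  have e := etaDm_eq_potDen S y
  rw [h0, mul_zero, zero_mul] at e
  have hp := phA_ne_zero S y
  simp [h, hp] at e

lemma GoodPt.potDen_ne {S : System} {l : Fin 4 → ℂ} {M : ℕ} {x : ℂ} (hx : GoodPt S l M x) (y : ℂ)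
    (t : ℤ) (hy : 2 * y = 2 * x + I * t * gam S) : potDen S y ≠ 0 ∧ potDen S (-y) ≠ 0 := by
  have d1 := dl_one_ne_zero S
  have d2 := dl_two_ne_zero S
  have s0 := hx.sg_ne t
  have s1 := hx.sg_ne (t - 1)
  have s2 := hx.sg_ne (t + 1)
  constructor
  · apply potDen_ne_zero_of_etaDm
    rw [etaDm_eq_sg, hy, show 2 * x + I * t * gam S - I * gam S =
      2 * x + I * ((t - 1 : ℤ) : ℂ) * gam S by push_cast; ring]
    exact mul_ne_zero (mul_ne_zero d1 d2) (mul_ne_zero s0 s1)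
  · by_cases hS : S = .cH
    · subst hS; simp [potDen]
    · apply potDen_ne_zero_of_etaDm
      rw [← etaDp_eq S hS, etaDp_eq_sg, hy, show 2 * x + I * t * gam S + I * gam S =
        2 * x + I * ((t + 1 : ℤ) : ℂ) * gam S by push_cast; ring]
      exact mul_ne_zero (mul_ne_zero d1 d2) (mul_ne_zero s2 s0)

lemma GoodPt.potDen_site {S : System} {l : Fin 4 → ℂ} {M : ℕ} {x : ℂ} (hx : GoodPt S l M x)
    (k : ℕ) : potDen S (site S M x k) ≠ 0 ∧ potDen S (-(site S M x k)) ≠ 0 :=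
  hx.potDen_ne _ (M + 2 - 2 * k) (by simp only [site]; push_cast; ring)

lemma GoodPt.potDen_self {S : System} {l : Fin 4 → ℂ} {M : ℕ} {x : ℂ} (hx : GoodPt S l M x) :
    potDen S x ≠ 0 ∧ potDen S (-x) ≠ 0 :=
  hx.potDen_ne _ 0 (by simp)

/-- The product of the factors `hA` above a site. -/
noncomputable def apr (S : System) (l : Fin 4 → ℂ) (T : VType) (y : ℕ → ℂ) (k : ℕ) : ℂ :=
  ∏ m ∈ Finset.range k, hA S l T (y m)

/-- The product of the factors `hB` above a site. -/
noncomputable def bpr (S : System) (l : Fin 4 → ℂ) (T : VType) (y : ℕ → ℂ) (k : ℕ) : ℂ :=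
  ∏ m ∈ Finset.range k, hB S l T (y m)

/-- The sum factor at two sites with sum of indices `k`. -/
noncomputable def sgS (S : System) (M : ℕ) (x : ℂ) (k : ℕ) : ℂ :=
  sg S (2 * x + I * ((M : ℂ) + 2 - k) * gam S)

/-- The difference factor of two sites. -/
noncomputable def dlS (S : System) (k : ℕ) : ℂ := dl S (I * k * gam S)

lemma GoodPt.siteData {S : System} {l : Fin 4 → ℂ} {M : ℕ} {x : ℂ} (hx : GoodPt S l M x) :
    SiteData (fun k => eta S (site S M x k)) (dlS S) (sgS S M x)
      (apr S l .I (site S M x)) (bpr S l .I (site S M x))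
      (apr S l .II (site S M x)) (bpr S l .II (site S M x)) where
  diff j k := by
    rw [eta_sub, dlS, sgS]
    congr 2 <;> · simp only [site]; push_cast; ring
  d_ne k := by
    have := dl_nat_ne_zero S k
    rw [dlS]; push_cast; exact this
  σ_ne k := by
    have := hx.sg_ne (M + 2 - k)
    rw [sgS]; push_cast at this; exact this
  α_ne k := Finset.prod_ne_zero_iff.2 fun _ _ => hx.hA_ne _ _
  β_ne k := Finset.prod_ne_zero_iff.2 fun _ _ => hx.hB_ne _ _
  α'_ne k := Finset.prod_ne_zero_iff.2 fun _ _ => hx.hA_ne _ _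
  β'_ne k := Finset.prod_ne_zero_iff.2 fun _ _ => hx.hB_ne _ _

/-- The common factor of the Casoratian of dressed columns on a window of sites. -/
noncomputable def winF (S : System) (l : Fin 4 → ℂ) (M : ℕ) (x : ℂ) (L p m m' : ℕ) : ℂ :=
  winFactor (fun k => eta S (site S M x k))
    (apr S l .I (site S M x)) (bpr S l .I (site S M x))
    (apr S l .II (site S M x)) (bpr S l .II (site S M x)) L p m m'

lemma GoodPt.winF_ne_zero {S : System} {l : Fin 4 → ℂ} {M : ℕ} {x : ℂ} (hx : GoodPt S l M x)
    (L p m m' : ℕ) : winF S l M x L p m m' ≠ 0 := hx.siteData.winFactor_ne_zero L p m m'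

/-! ### Casoratians of dressed columns -/

/-- The constant in the Casoratian of dressed columns. -/
noncomputable def casConst (S : System) (L m m' : ℕ) : ℂ :=
  ((nuC S L)⁻¹ ^ m * ∏ j ∈ Finset.range m, tpC S L j) *
    ((nuC S L)⁻¹ ^ m' * ∏ j ∈ Finset.range m', tpC S L j)

lemma casConst_ne_zero (S : System) (L m m' : ℕ) : casConst S L m m' ≠ 0 :=
  mul_ne_zero (mul_ne_zero (pow_ne_zero _ (inv_ne_zero (nuC_ne_zero S L)))
      (Finset.prod_ne_zero_iff.2 fun _ _ => tpC_ne_zero _ _ _))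
    (mul_ne_zero (pow_ne_zero _ (inv_ne_zero (nuC_ne_zero S L)))
      (Finset.prod_ne_zero_iff.2 fun _ _ => tpC_ne_zero _ _ _))

/-- The gauge factor is accumulated from site 0, `nuRow` from the edges of the window. Their
quotient involves only complete products up to these edges, so it is the same in every row. -/
lemma gauge_eq_nuRow (S : System) (l : Fin 4 → ℂ) (T : VType) (M L p j : ℕ) (x : ℂ) (hj : j < L)
    (hB0 : ∀ k, hB S l T (site S M x k) ≠ 0) :
    gauge S l T (site S M x) (p + j) =
      (apr S l T (site S M x) p / bpr S l T (site S M x) (p + L) / nuC S L) *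
        nuRow S l T L (x + I * ((M : ℂ) / 2 + 1 - p - ((L : ℂ) - 1) / 2) * gam S) j := by
  have h1 := nuC_ne_zero S L
  rw [nuRow_eq S l T L _ j hj, gauge]
  simp only [node_site]
  have e1 : ∏ m ∈ Finset.range (p + j), hA S l T (site S M x m) =
      apr S l T (site S M x) p * ∏ m ∈ Finset.range j, hA S l T (site S M x (p + m)) :=
    Finset.prod_range_add _ _ _
  have e2 : bpr S l T (site S M x) (p + L) =
      (∏ m ∈ Finset.range (p + j + 1), hB S l T (site S M x m)) *
        ∏ m ∈ Finset.Ico (j + 1) L, hB S l T (site S M x (p + m)) := by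
    rw [Finset.prod_Ico_add (fun m => hB S l T (site S M x m)), bpr, Finset.range_eq_Ico,
      Finset.range_eq_Ico, show p + j + 1 = j + 1 + p by ring, add_comm p L,
      Finset.prod_Ico_consecutive _ (by omega) (by omega)]
  rw [e1, e2]
  have h2 : (∏ m ∈ Finset.range (p + j + 1), hB S l T (site S M x m)) ≠ 0 :=
    Finset.prod_ne_zero_iff.2 fun _ _ => hB0 _
  have h3 : (∏ m ∈ Finset.Ico (j + 1) L, hB S l T (site S M x (p + m))) ≠ 0 :=
    Finset.prod_ne_zero_iff.2 fun _ _ => hB0 _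
  field_simp

lemma twistPoch_site (S : System) (l : Fin 4 → ℂ) (T : VType) (M L p m : ℕ) (x : ℂ) (hm : m ≤ L)
    (hB0 : ∀ k, hB S l T (site S M x k) ≠ 0) :
    (apr S l T (site S M x) p / bpr S l T (site S M x) (p + L) / nuC S L) ^ m *
      ∏ j ∈ Finset.range m, twistPoch S l T (((L : ℂ) - 1) / 2)
        (x + I * ((M : ℂ) / 2 + 1 - p - ((L : ℂ) - 1) / 2) * gam S) j j =
      ((nuC S L)⁻¹ ^ m * ∏ j ∈ Finset.range m, tpC S L j) *
        ph (apr S l T (site S M x)) (bpr S l T (site S M x)) L p m := by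
  have h1 := nuC_ne_zero S L
  have hb : ∀ k, bpr S l T (site S M x) k ≠ 0 := fun k =>
    Finset.prod_ne_zero_iff.2 fun _ _ => hB0 _
  rw [ph, ← Finset.card_range m, ← Finset.prod_const, ← Finset.prod_const, Finset.card_range,
    ← Finset.prod_mul_distrib, ← Finset.prod_mul_distrib, ← Finset.prod_mul_distrib]
  refine Finset.prod_congr rfl fun j hj => ?_
  have hj := Finset.mem_range.1 hj
  rw [twistPoch_eq S l T L _ j (by omega)]
  simp only [node_site]
  have e1 : apr S l T (site S M x) (p + j) =
      apr S l T (site S M x) p * ∏ m ∈ Finset.range j, hA S l T (site S M x (p + m)) :=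
    Finset.prod_range_add _ _ _
  have e2 : bpr S l T (site S M x) (p + L) = bpr S l T (site S M x) (p + L - j) *
        ∏ m ∈ Finset.Ico (L - j) L, hB S l T (site S M x (p + m)) := by
    rw [Finset.prod_Ico_add (fun m => hB S l T (site S M x m)), bpr, bpr, Finset.range_eq_Ico,
      Finset.range_eq_Ico, show p + L - j = L - j + p by omega, add_comm p L,
      Finset.prod_Ico_consecutive _ (by omega) (by omega)]
  have h3 := hb (p + L)
  have h4 := hb (p + L - j)
  have h5 : (∏ m ∈ Finset.Ico (L - j) L, hB S l T (site S M x (p + m))) ≠ 0 :=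
    Finset.prod_ne_zero_iff.2 fun _ _ => hB0 _
  rw [e1, e2]
  field_simp

/-- A column with an arbitrary polynomial, dressed with the gauge factors of its kind. -/
noncomputable def rawDressed (S : System) (l : Fin 4 → ℂ) (y : ℕ → ℂ) (o : Option VType)
    (p : ℂ[X]) (k : ℕ) : ℂ :=
  colGauge S l y o k * p.eval (eta S (y k))

lemma dressed_eq_rawDressed (S : System) (l : Fin 4 → ℂ) (y : ℕ → ℂ) (c : Option VType × ℕ) :
    dressed S l y c = rawDressed S l y c.1 (colP S l c) := by
  funext k
  rw [dressed, rawDressed, eval_colP]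

/-- The row-independent quotient of gauge factor and `nuRow` can be pulled out of each column that
carries ν^T. Together with the products of shifted factorials in the prefactor it forms the factors
`ph` of the window, up to constants. -/
lemma GoodPt.cas_rawDressed {S : System} {l : Fin 4 → ℂ} {M : ℕ} {x : ℂ} (hx : GoodPt S l M x)
    {L : ℕ} (p : ℕ) (o : Fin L → Option VType) (q : Fin L → ℂ[X]) (z : ℂ)
    (hz : z = x + I * ((M : ℂ) / 2 + 1 - p - ((L : ℂ) - 1) / 2) * gam S) (c : ℂ)
    (hc : rawDet S l o q z = prefactor S l L (mcount o .II) (mcount o .I) z * c) :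
    cas p (fun k => rawDressed S l (site S M x) (o k) (q k)) =
      casConst S L (mcount o .I) (mcount o .II) *
        winF S l M x L p (mcount o .I) (mcount o .II) * c := by
  set g : VType → ℂ := fun T =>
    apr S l T (site S M x) p / bpr S l T (site S M x) (p + L) / nuC S L with hg
  have hent : ∀ (j : Fin L) k, rawDressed S l (site S M x) (o k) (q k) (p + j) =
      (g .I ^ carr (o k) .I * g .II ^ carr (o k) .II) * rawEntry S l L z j (o k) (q k) := by
    intro j k
    have hI := gauge_eq_nuRow S l .I M L p j x j.2 (hx.hB_ne .I)
    have hII := gauge_eq_nuRow S l .II M L p j x j.2 (hx.hB_ne .II)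
    rw [← hz] at hI hII
    rw [rawDressed, rawEntry, hz, node_site, ← hz]
    rcases o k with _ | (_ | _)
    · simp only [colGauge, carr, hI, hII, hg]; ring
    · simp only [colGauge, carr, VType.other, hII, hg]; ring
    · simp only [colGauge, carr, VType.other, hI, hg]; ring
  have hdet : cas p (fun k => rawDressed S l (site S M x) (o k) (q k)) =
      (g .I ^ mcount o .I * g .II ^ mcount o .II) * rawDet S l o q z := by
    rw [cas, rawDet, mcount, mcount, ← Finset.prod_pow_eq_pow_sum, ← Finset.prod_pow_eq_pow_sum,
      ← Finset.prod_mul_distrib, ← Matrix.det_mul_row]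
    congr 1
    ext j k
    exact hent j k
  have t1 := twistPoch_site S l .I M L p (mcount o .I) x (mcount_le o .I) (hx.hB_ne .I)
  have t2 := twistPoch_site S l .II M L p (mcount o .II) x (mcount_le o .II) (hx.hB_ne .II)
  rw [← hz] at t1 t2
  have hv : (∏ k ∈ Finset.range L, ∏ j ∈ Finset.range k,
      (eta S (node S L z j) - eta S (node S L z k))) =
      vd (fun k => eta S (site S M x k)) L p := by
    rw [hz]; simp only [node_site]; rfl
  rw [hdet, hc, prefactor, hv, winF, winFactor, casConst]
  calc _ = vd (fun k => eta S (site S M x k)) L p *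
        (g .I ^ mcount o .I * ∏ j ∈ Finset.range (mcount o .I),
          twistPoch S l .I (((L : ℂ) - 1) / 2) z j j) *
        (g .II ^ mcount o .II * ∏ j ∈ Finset.range (mcount o .II),
          twistPoch S l .II (((L : ℂ) - 1) / 2) z j j) * c := by ring
    _ = _ := by rw [t1, t2]; ring

/-! ### The potentials at the shifted parameters -/

lemma lamD_eq (S : System) (l : Fin 4 → ℂ) (DI DII : Finset ℕ) (k : Fin 4) :
    (k ∈ plusPar S .I ∪ minusPar S .I →
      lamD S l DI DII k = l k + ((DII.card : ℂ) - DI.card) / 2) ∧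
    (k ∈ plusPar S .II ∪ minusPar S .II →
      lamD S l DI DII k = l k + ((DI.card : ℂ) - DII.card) / 2) := by
  cases S <;> fin_cases k <;> simp [plusPar, minusPar, lamD, tdelta] <;> ring

lemma prod_plus_lamD (S : System) (l : Fin 4 → ℂ) (T : VType) (l' : Fin 4 → ℂ) (c x : ℂ)
    (h : ∀ k ∈ plusPar S T ∪ minusPar S T, l' k = l k + c) :
    ∏ k ∈ plusPar S T, lin S (l' k) x = ∏ k ∈ plusPar S T, lin S (l k) (x - I * c * gam S) :=
  Finset.prod_congr rfl fun k hk => by rw [h k (Finset.mem_union_left _ hk), lin_add]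

lemma prod_minus_lamD (S : System) (l : Fin 4 → ℂ) (T : VType) (l' : Fin 4 → ℂ) (c x : ℂ)
    (h : ∀ k ∈ plusPar S T ∪ minusPar S T, l' k = l k + c) :
    ∏ k ∈ minusPar S T, lin S (l' k) (-x) =
      ∏ k ∈ minusPar S T, lin S (l k) (-(x + I * c * gam S)) :=
  Finset.prod_congr rfl fun k hk => by rw [h k (Finset.mem_union_right _ hk), lin_add_neg]

lemma phA_mul (S : System) (u v x : ℂ) (h : u + v = 2 * x) :
    phA S x * phA S x = phA S u * phA S v := by
  cases S with
  | cH => rfl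
  | W => rfl
  | AW q h0 h1 =>
    simp only [phA, ← exp_add]; congr 1; linear_combination I * h

lemma phB_mul (S : System) (u v x : ℂ) (h : u + v = 2 * x) :
    phB S x * phB S x = phB S u * phB S v := by
  cases S with
  | cH => rfl
  | W => rfl
  | AW q h0 h1 =>
    simp only [phB, ← exp_add]; congr 1; linear_combination -I * h

/-- The parameters attached to type I are shifted by (M_II - M_I)/2 and those attached to type II by
the opposite amount. By `lin_add` this moves the argument from x, at the formal site M/2 + 1, to the
sites M_II + 1 and M_I + 1. The phases agree because these two sites are symmetric about x. -/
lemma hA_lamD (S : System) (l : Fin 4 → ℂ) (DI DII : Finset ℕ) (x : ℂ) :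
    hA S (lamD S l DI DII) .I x * hA S (lamD S l DI DII) .II x =
      hA S l .I (site S (DI.card + DII.card) x (DII.card + 1)) *
        hA S l .II (site S (DI.card + DII.card) x (DI.card + 1)) := by
  have e1 : site S (DI.card + DII.card) x (DII.card + 1) =
      x - I * (((DII.card : ℂ) - DI.card) / 2) * gam S := by
    simp only [site]; push_cast; ring
  have e2 : site S (DI.card + DII.card) x (DI.card + 1) =
      x - I * (((DI.card : ℂ) - DII.card) / 2) * gam S := by
    simp only [site]; push_cast; ring
  have e3 := phA_mul S (site S (DI.card + DII.card) x (DII.card + 1))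
    (site S (DI.card + DII.card) x (DI.card + 1)) x (by rw [e1, e2]; ring)
  simp only [hA]
  rw [prod_plus_lamD S l .I _ _ x fun k => (lamD_eq S l DI DII k).1,
    prod_plus_lamD S l .II _ _ x fun k => (lamD_eq S l DI DII k).2, ← e1, ← e2]
  linear_combination (∏ k ∈ plusPar S .I, lin S (l k) (site S (DI.card + DII.card) x (DII.card + 1)))
    * (∏ k ∈ plusPar S .II, lin S (l k) (site S (DI.card + DII.card) x (DI.card + 1))) * e3

lemma hB_lamD (S : System) (l : Fin 4 → ℂ) (DI DII : Finset ℕ) (x : ℂ) :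
    hB S (lamD S l DI DII) .I x * hB S (lamD S l DI DII) .II x =
      hB S l .I (site S (DI.card + DII.card) x (DI.card + 1)) *
        hB S l .II (site S (DI.card + DII.card) x (DII.card + 1)) := by
  have e1 : site S (DI.card + DII.card) x (DI.card + 1) =
      x + I * (((DII.card : ℂ) - DI.card) / 2) * gam S := by
    simp only [site]; push_cast; ring
  have e2 : site S (DI.card + DII.card) x (DII.card + 1) =
      x + I * (((DI.card : ℂ) - DII.card) / 2) * gam S := by
    simp only [site]; push_cast; ring
  have e3 := phB_mul S (site S (DI.card + DII.card) x (DI.card + 1))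
    (site S (DI.card + DII.card) x (DII.card + 1)) x (by rw [e1, e2]; ring)
  simp only [hB]
  rw [prod_minus_lamD S l .I _ _ x fun k => (lamD_eq S l DI DII k).1,
    prod_minus_lamD S l .II _ _ x fun k => (lamD_eq S l DI DII k).2, ← e1, ← e2]
  linear_combination
    (∏ k ∈ minusPar S .I, lin S (l k) (-(site S (DI.card + DII.card) x (DI.card + 1))))
    * (∏ k ∈ minusPar S .II, lin S (l k) (-(site S (DI.card + DII.card) x (DII.card + 1)))) * e3

/-! ### Gauge factors of the difference equations -/

lemma etaDm_site (S : System) (M : ℕ) (x : ℂ) (k : ℕ) : etaDm S (site S M x k) =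
    dl S (I * gam S) * dl S (2 * I * gam S) * (sgS S M x (2 * k) * sgS S M x (2 * k + 1)) := by
  rw [etaDm_eq_sg, sgS, sgS]
  congr 3 <;> · simp only [site]; push_cast; ring

lemma etaDp_site (S : System) (M : ℕ) (x : ℂ) (k : ℕ) : etaDp S (site S M x (k + 1)) =
    dl S (I * gam S) * dl S (2 * I * gam S) *
      (sgS S M x (2 * k + 1) * sgS S M x (2 * k + 2)) := by
  rw [etaDp_eq_sg, sgS, sgS]
  congr 3 <;> · simp only [site]; push_cast; ring

lemma etaDm_self (S : System) (M : ℕ) (x : ℂ) : etaDm S x =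
    dl S (I * gam S) * dl S (2 * I * gam S) * (sgS S M x (M + 2) * sgS S M x (M + 3)) := by
  rw [etaDm_eq_sg, sgS, sgS]
  congr 3 <;> · push_cast; ring

lemma etaDp_self (S : System) (M : ℕ) (x : ℂ) : etaDp S x =
    dl S (I * gam S) * dl S (2 * I * gam S) * (sgS S M x (M + 1) * sgS S M x (M + 2)) := by
  rw [etaDp_eq_sg, sgS, sgS]
  congr 3 <;> · push_cast; ring

lemma gauge_cancel {k d u v X Y a a' b b' : ℂ} (hd : d ≠ 0) (hu : u ≠ 0) (hv : v ≠ 0)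
    (hb : b ≠ 0) (hb' : b' ≠ 0) (h : X * v = Y * u * (a / b) * (a' / b')) :
    k * (b * b') / (d * u) * X = k * (a * a') / (d * v) * Y := by
  field_simp at h ⊢
  linear_combination k * h

lemma apr_succ_div {S : System} {l : Fin 4 → ℂ} {T : VType} {y : ℕ → ℂ}
    (h : ∀ k, hA S l T (y k) ≠ 0) (k : ℕ) :
    apr S l T y (k + 1) / apr S l T y k = hA S l T (y k) := by
  have : apr S l T y k ≠ 0 := Finset.prod_ne_zero_iff.2 fun _ _ => h _
  rw [apr, Finset.prod_range_succ, ← apr]; field_simp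

lemma bpr_succ_div {S : System} {l : Fin 4 → ℂ} {T : VType} {y : ℕ → ℂ}
    (h : ∀ k, hB S l T (y k) ≠ 0) (k : ℕ) :
    bpr S l T y (k + 1) / bpr S l T y k = hB S l T (y k) := by
  have : bpr S l T y k ≠ 0 := Finset.prod_ne_zero_iff.2 fun _ _ => h _
  rw [bpr, Finset.prod_range_succ, ← bpr]; field_simp

section

variable {S : System} {l : Fin 4 → ℂ} {x : ℂ} {DI DII : Finset ℕ}

lemma GoodPt.pot_lamD {M : ℕ} (hx : GoodPt S l M x) (hM : M = DI.card + DII.card) :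
    pot S (lamD S l DI DII) x = kap S * (hA S l .I (site S M x (DII.card + 1)) *
      hA S l .II (site S M x (DI.card + 1))) / etaDm S x := by
  subst hM
  rw [pot_eq S _ x hx.potDen_self.1, hA_lamD]

lemma GoodPt.potStar_lamD {M : ℕ} (hx : GoodPt S l M x) (hM : M = DI.card + DII.card) :
    potStar S (lamD S l DI DII) x = kap S * (hB S l .I (site S M x (DI.card + 1)) *
      hB S l .II (site S M x (DII.card + 1))) / etaDp S x := by
  subst hM
  rw [potStar_eq S _ x hx.potDen_self.2, hB_lamD]

lemma dl_mul_ne_zero (S : System) : dl S (I * gam S) * dl S (2 * I * gam S) ≠ 0 :=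
  mul_ne_zero (dl_one_ne_zero S) (dl_two_ne_zero S)

lemma recA_site (S : System) (l : Fin 4 → ℂ) (M : ℕ) (x : ℂ) (k : ℕ) :
    recA S l (site S M x k) = kap S * (hB S l .I (site S M x (k + 1)) *
      hB S l .II (site S M x (k + 1))) / (dl S (I * gam S) * dl S (2 * I * gam S) *
        (sgS S M x (2 * k) * sgS S M x (2 * k + 1))) := by
  rw [recA, etaDm_site, site_succ]

lemma recB_site (S : System) (l : Fin 4 → ℂ) (M : ℕ) (x : ℂ) (k : ℕ) :
    recB S l (site S M x (k + 1)) = kap S * (hA S l .I (site S M x k) *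
      hA S l .II (site S M x k)) / (dl S (I * gam S) * dl S (2 * I * gam S) *
        (sgS S M x (2 * k + 1) * sgS S M x (2 * k + 2))) := by
  rw [recB, etaDp_site, site_succ, sub_add_cancel]

lemma GoodPt.sgS_mul_ne {M : ℕ} (hx : GoodPt S l M x) (i j : ℕ) :
    sgS S M x i * sgS S M x j ≠ 0 :=
  mul_ne_zero (hx.siteData.σ_ne i) (hx.siteData.σ_ne j)

/-- The recurrence coefficient belongs to an end of the window, the potential V(x; λ_𝒟) to its
centre. The ratio of the window factors exchanges the factors of `hB` for those of `hA` at the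
shifted sites and moves the differences of η from site M + 1 to x. -/
lemma GoodPt.gauge_down {M s r : ℕ} (hx : GoodPt S l M x) (hM : M = DI.card + DII.card)
    (hs : s = DII.card) (hr : r = DI.card) :
    recA S l (site S M x (M + 1)) *
        (winF S l M x M 1 s r * winF S l M x (M + 1) 2 (s + 1) (r + 1)) =
      pot S (lamD S l DI DII) x *
        (winF S l M x M 2 s r * winF S l M x (M + 1) 1 (s + 1) (r + 1)) := by
  rw [hx.pot_lamD hM, ← hs, ← hr, recA_site, etaDm_self S M x]
  have h := hx.siteData.ratio_down M s r (by omega) (by omega)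
  have bne : ∀ T, hB S l T (site S M x (M + 2)) ≠ 0 := fun T => hx.hB_ne T _
  refine gauge_cancel (dl_mul_ne_zero S) (hx.sgS_mul_ne _ _) (hx.sgS_mul_ne _ _) (bne .I) (bne .II)
    (h.trans ?_)
  rw [apr_succ_div (hx.hA_ne _), apr_succ_div (hx.hA_ne _),
    ← inv_div (bpr S l .I (site S M x) (M + 3)), ← inv_div (bpr S l .II (site S M x) (M + 3)),
    bpr_succ_div (hx.hB_ne _), bpr_succ_div (hx.hB_ne _)]
  simp only [winF, div_eq_mul_inv, show 2 * (M + 1) = 2 * M + 2 by ring,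
    show 2 * M + 2 + 1 = 2 * M + 3 by ring]

lemma GoodPt.gauge_up {M s r : ℕ} (hx : GoodPt S l M x) (hM : M = DI.card + DII.card)
    (hs : s = DII.card) (hr : r = DI.card) :
    recB S l (site S M x 1) *
        (winF S l M x M 2 s r * winF S l M x (M + 1) 0 (s + 1) (r + 1)) =
      potStar S (lamD S l DI DII) x *
        (winF S l M x M 1 s r * winF S l M x (M + 1) 1 (s + 1) (r + 1)) := by
  rw [hx.potStar_lamD hM, ← hs, ← hr, recB_site, etaDp_self S M x]
  have h := hx.siteData.ratio_up M s r (by omega) (by omega)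
  have ane : ∀ T, hA S l T (site S M x 0) ≠ 0 := fun T => hx.hA_ne T _
  refine gauge_cancel (dl_mul_ne_zero S) (hx.sgS_mul_ne _ _) (hx.sgS_mul_ne _ _) (ane .I) (ane .II)
    (h.trans ?_)
  rw [show M + 2 - s = M + 1 - s + 1 by omega, show M + 2 - r = M + 1 - r + 1 by omega,
    bpr_succ_div (hx.hB_ne _), bpr_succ_div (hx.hB_ne _),
    ← inv_div (apr S l .I (site S M x) 1), ← inv_div (apr S l .II (site S M x) 1),
    apr_succ_div (hx.hA_ne _), apr_succ_div (hx.hA_ne _), show M + 1 - s = r + 1 by omega,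
    show M + 1 - r = s + 1 by omega]
  simp only [winF, div_eq_mul_inv]
  ring

/-- After the removal of two seeds the coefficient of the upper neighbour becomes V, and that of the
lower neighbour becomes V*, matching the exchanged roles of the recurrence coefficients in
`cas_remove`. -/
lemma GoodPt.gauge_down_remove {M m s r : ℕ} (hx : GoodPt S l M x) (hM : M = DI.card + DII.card)
    (hm : M = m + 2) (hs : s = DII.card) (hr : r = DI.card) (hs0 : s ≠ 0) (hr0 : r ≠ 0) :
    recB S l (site S M x 2) * (winF S l M x M 1 s r * winF S l M x (m + 1) 3 s r) =
      pot S (lamD S l DI DII) x * (winF S l M x M 2 s r * winF S l M x (m + 1) 2 s r) := by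
  rw [hx.pot_lamD hM, ← hs, ← hr, recB_site, etaDm_self S M x]
  have h := hx.siteData.ratio_down_remove m s r (by omega) (by omega)
  have ane : ∀ T, hA S l T (site S M x 1) ≠ 0 := fun T => hx.hA_ne T _
  rw [show m + 4 = M + 2 by omega, show m + 5 = M + 3 by omega, ← hm] at h
  refine gauge_cancel (dl_mul_ne_zero S) (hx.sgS_mul_ne _ _) (hx.sgS_mul_ne _ _) (ane .I) (ane .II)
    (h.trans ?_)
  rw [apr_succ_div (hx.hA_ne _), apr_succ_div (hx.hA_ne _),
    ← inv_div (apr S l .I (site S M x) 2), ← inv_div (apr S l .II (site S M x) 2),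
    apr_succ_div (hx.hA_ne _), apr_succ_div (hx.hA_ne _)]
  simp only [winF, div_eq_mul_inv]
  ring

lemma GoodPt.gauge_up_remove {M m s r : ℕ} (hx : GoodPt S l M x) (hM : M = DI.card + DII.card)
    (hm : M = m + 2) (hs : s = DII.card) (hr : r = DI.card) (hs0 : s ≠ 0) (hr0 : r ≠ 0) :
    recA S l (site S M x M) * (winF S l M x M 2 s r * winF S l M x (m + 1) 1 s r) =
      potStar S (lamD S l DI DII) x * (winF S l M x M 1 s r * winF S l M x (m + 1) 2 s r) := by
  rw [hx.potStar_lamD hM, ← hs, ← hr, recA_site, etaDp_self S M x]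
  have h := hx.siteData.ratio_up_remove m s r (by omega) (by omega)
  have bne : ∀ T, hB S l T (site S M x (M + 1)) ≠ 0 := fun T => hx.hB_ne T _
  rw [show m + 4 - s = M + 1 - s + 1 by omega, show m + 4 - r = M + 1 - r + 1 by omega,
    show m + 3 - s = M + 1 - s by omega, show m + 3 - r = M + 1 - r by omega,
    show 2 * m + 4 = 2 * M by omega, show 2 * m + 5 = 2 * M + 1 by omega,
    show m + 4 = M + 1 + 1 by omega, show m + 3 = M + 1 by omega, ← hm] at h
  refine gauge_cancel (dl_mul_ne_zero S) (hx.sgS_mul_ne _ _) (hx.sgS_mul_ne _ _) (bne .I) (bne .II)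
    (h.trans ?_)
  rw [bpr_succ_div (hx.hB_ne _), bpr_succ_div (hx.hB_ne _),
    ← inv_div (bpr S l .I (site S M x) (M + 1 + 1)),
    ← inv_div (bpr S l .II (site S M x) (M + 1 + 1)),
    bpr_succ_div (hx.hB_ne _), bpr_succ_div (hx.hB_ne _), show M + 1 - s = r + 1 by omega,
    show M + 1 - r = s + 1 by omega]
  simp only [winF, div_eq_mul_inv]

/-- The constant in the remainder terms. -/
noncomputable def restConst (S : System) (m : ℕ) : ℂ :=
  kap S * runProd (dlS S) 1 (m + 2) / (dl S (I * gam S) * dl S (2 * I * gam S) * runProd (dlS S) 1 m)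

lemma rest_cancel {k d u X Y b b' R R' : ℂ} (hd : d ≠ 0) (hu : u ≠ 0)
    (hb : b ≠ 0) (hb' : b' ≠ 0) (hR : R ≠ 0) (h : X * R = Y * R' * u * b⁻¹ * b'⁻¹) :
    k * (b * b') / (d * u) * X = k * R' / (d * R) * Y := by
  field_simp at h ⊢
  linear_combination k * h

/-- In the remainder all dependence on x cancels between the coefficient and the window factors,
leaving the constant `restConst`. The same constant appears in `gauge_rest_up`, so the two halves of
the remainder have a common factor. -/
lemma GoodPt.gauge_rest_down {M m s r : ℕ} (hx : GoodPt S l M x) (hm : M = m + 2) (hs : s ≤ m)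
    (hr : r ≤ m) :
    recB S l (site S M x 2) *
        (winF S l M x (M + 1) 1 (s + 2) (r + 2) * winF S l M x m 3 s r) =
      restConst S m *
        (winF S l M x M 2 (s + 1) (r + 1) * winF S l M x (m + 1) 2 (s + 1) (r + 1)) := by
  rw [recB_site, restConst]
  have h := hx.siteData.ratio_rest_down m s r hs hr
  have ane : ∀ T, hA S l T (site S M x 1) ≠ 0 := fun T => hx.hA_ne T _
  rw [show m + 3 = M + 1 by omega, ← hm] at h
  refine (rest_cancel (dl_mul_ne_zero S) (hx.sgS_mul_ne _ _) (ane .I) (ane .II)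
    (hx.siteData.runProd_d_ne _) (h.trans ?_)).trans (by rw [← hm])
  rw [← inv_div (apr S l .I (site S M x) 2), ← inv_div (apr S l .II (site S M x) 2),
    apr_succ_div (hx.hA_ne _), apr_succ_div (hx.hA_ne _)]
  simp only [winF]

lemma GoodPt.gauge_rest_up {M m s r : ℕ} (hx : GoodPt S l M x) (hm : M = m + 2) (hs : s ≤ m)
    (hr : r ≤ m) :
    recA S l (site S M x M) *
        (winF S l M x (M + 1) 1 (s + 2) (r + 2) * winF S l M x m 2 s r) =
      restConst S m *
        (winF S l M x M 1 (s + 1) (r + 1) * winF S l M x (m + 1) 2 (s + 1) (r + 1)) := by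
  rw [recA_site, restConst]
  have h := hx.siteData.ratio_rest_up m s r hs hr
  have bne : ∀ T, hB S l T (site S M x (M + 1)) ≠ 0 := fun T => hx.hB_ne T _
  rw [show 2 * m + 4 = 2 * M by omega, show 2 * m + 5 = 2 * M + 1 by omega,
    show m + 4 = M + 1 + 1 by omega, show m + 3 = M + 1 by omega, ← hm] at h
  refine (rest_cancel (dl_mul_ne_zero S) (hx.sgS_mul_ne _ _) (bne .I) (bne .II)
    (hx.siteData.runProd_d_ne _) (h.trans ?_)).trans (by rw [← hm])
  rw [← inv_div (bpr S l .I (site S M x) (M + 1 + 1)),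
    ← inv_div (bpr S l .II (site S M x) (M + 1 + 1)),
    bpr_succ_div (hx.hB_ne _), bpr_succ_div (hx.hB_ne _)]
  simp only [winF]

end

/-! ### Casoratians of the seed functions -/

lemma comp_snoc {α β : Type*} {n : ℕ} (f : α → β) (c : Fin n → α) (a : α) :
    (fun k => f (snoc c a k)) = snoc (fun k => f (c k)) (f a) := by
  funext k
  induction k using Fin.lastCases with
  | last => simp
  | cast k => simp

/-- The constant in the Casoratian of the seed functions. -/
noncomputable def xiConst (S : System) (DI DII : Finset ℕ) : ℂ :=
  casConst S (seeds DI DII).length DII.card DI.card *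
    (I ^ ((seeds DI DII).length * ((seeds DI DII).length - 1) / 2))⁻¹

lemma xiConst_ne_zero (S : System) (DI DII : Finset ℕ) : xiConst S DI DII ≠ 0 :=
  mul_ne_zero (casConst_ne_zero _ _ _ _) (inv_ne_zero (pow_ne_zero _ I_ne_zero))

/-- The constant in the Casoratian of the seed functions and an eigenpolynomial. -/
noncomputable def pConst (S : System) (DI DII : Finset ℕ) : ℂ :=
  casConst S ((seeds DI DII).length + 1) (DII.card + 1) (DI.card + 1) *
    (I ^ (((seeds DI DII).length + 1) * (seeds DI DII).length / 2))⁻¹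

lemma pConst_ne_zero (S : System) (DI DII : Finset ℕ) : pConst S DI DII ≠ 0 :=
  mul_ne_zero (casConst_ne_zero _ _ _ _) (inv_ne_zero (pow_ne_zero _ I_ne_zero))

/-- The dressed seed functions. -/
noncomputable def dSeeds (S : System) (l : Fin 4 → ℂ) (y : ℕ → ℂ) (DI DII : Finset ℕ) :
    Fin (seeds DI DII).length → ℕ → ℂ :=
  fun k => dressed S l y (seedCols DI DII k)

lemma GoodPt.cas_dSeeds {S : System} {l : Fin 4 → ℂ} {M : ℕ} {x : ℂ} (hx : GoodPt S l M x)
    (DI DII : Finset ℕ) (p L : ℕ) (hL : L = DI.card + DII.card) (z : ℂ)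
    (hz : z = x + I * ((M : ℂ) / 2 + 1 - p - ((L : ℂ) - 1) / 2) * gam S) :
    cas p (dSeeds S l (site S M x) DI DII) =
      xiConst S DI DII * winF S l M x L p DII.card DI.card * XiC S l DI DII z := by
  have h1 := hx.cas_rawDressed p (fun k => (seedCols DI DII k).1)
    (fun k => colP S l (seedCols DI DII k)) z (by rw [hz, hL, length_seeds])
    ((I ^ ((seeds DI DII).length * ((seeds DI DII).length - 1) / 2))⁻¹ * XiC S l DI DII z) (by
      have h2 := isDenominatorPoly_Xi S l DI DII z
      rw [detXi_eq, colsDet] at h2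
      have hI : I ^ ((seeds DI DII).length * ((seeds DI DII).length - 1) / 2) ≠ 0 :=
        pow_ne_zero _ I_ne_zero
      rw [mcount_seedCols, mcount_seedCols, mul_left_comm, eq_inv_mul_iff_mul_eq₀ hI, h2, XiC,
        length_seeds])
  have e : dSeeds S l (site S M x) DI DII = fun k => rawDressed S l (site S M x)
      (seedCols DI DII k).1 (colP S l (seedCols DI DII k)) := by
    funext k; rw [dSeeds, dressed_eq_rawDressed]
  rw [e, h1, mcount_seedCols, mcount_seedCols, xiConst, hL, length_seeds]
  ring

lemma GoodPt.cas_snoc_dSeeds {S : System} {l : Fin 4 → ℂ} {M : ℕ} {x : ℂ} (hx : GoodPt S l M x)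
    (DI DII : Finset ℕ) (n p L : ℕ) (hL : L = DI.card + DII.card + 1) (z : ℂ)
    (hz : z = x + I * ((M : ℂ) / 2 + 1 - p - ((L : ℂ) - 1) / 2) * gam S) :
    cas p (snoc (dSeeds S l (site S M x) DI DII) (dressed S l (site S M x) (none, n))) =
      pConst S DI DII * winF S l M x L p (DII.card + 1) (DI.card + 1) *
        multiPC S l DI DII n z := by
  have hm := mcount_snoc_seedCols DI DII n
  have h1 := hx.cas_rawDressed p (fun k => (snoc (seedCols DI DII) (none, n) k).1)
    (fun k => colP S l (snoc (seedCols DI DII) (none, n) k)) z (by rw [hz, hL, length_seeds])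
    ((I ^ (((seeds DI DII).length + 1) * (seeds DI DII).length / 2))⁻¹ *
      multiPC S l DI DII n z) (by
      have h2 := isMultiIndexedPoly_multiP S l DI DII n z
      rw [detP_eq, colsDet] at h2
      have hI : I ^ (((seeds DI DII).length + 1) * (seeds DI DII).length / 2) ≠ 0 :=
        pow_ne_zero _ I_ne_zero
      rw [hm.1, hm.2, mul_left_comm, eq_inv_mul_iff_mul_eq₀ hI, h2, multiPC, length_seeds])
  have e : snoc (dSeeds S l (site S M x) DI DII) (dressed S l (site S M x) (none, n)) =
      fun k => rawDressed S l (site S M x)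
      (snoc (seedCols DI DII) (none, n) k).1 (colP S l (snoc (seedCols DI DII) (none, n) k)) := by
    simp only [← dressed_eq_rawDressed]
    rw [comp_snoc]; rfl
  rw [e, h1, hm.1, hm.2, pConst, hL, length_seeds]
  ring

lemma GoodPt.isSol {S : System} {l : Fin 4 → ℂ} {M : ℕ} {x : ℂ} (hx : GoodPt S l M x) (n : ℕ)
    (c : Option VType × ℕ) :
    IsSol (fun j => recA S l (site S M x j)) (fun j => recB S l (site S M x j))
      (fun j => diagC S l (site S M x j)) n (dressed S l (site S M x) c) (energy S l c.1 c.2) :=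
  dressed_isSol S l _ n (site_succ S M x) (fun T k _ => hx.hB_ne T k)
    (fun k _ => (hx.potDen_site (k + 1)).1) (fun k _ => (hx.potDen_site (k + 1)).2) c

/-! ### Reordering columns -/

/-- `u` is a rearrangement of `u'`. -/
def Rearr {α : Type*} {n n' : ℕ} (u : Fin n → α) (u' : Fin n' → α) : Prop :=
  n = n' ∧ ∃ σ : Fin n → Fin n', Function.Injective σ ∧ ∀ k, u k = u' (σ k)

lemma Rearr.map {α β : Type*} {n n' : ℕ} {u : Fin n → α} {u' : Fin n' → α} (h : Rearr u u')
    (f : α → β) : Rearr (fun k => f (u k)) (fun k => f (u' k)) :=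
  ⟨h.1, h.2.imp fun _ hσ => ⟨hσ.1, fun k => congrArg f (hσ.2 k)⟩⟩

lemma Rearr.snoc {α : Type*} {n n' : ℕ} {u : Fin n → α} {u' : Fin n' → α} (h : Rearr u u')
    (a : α) : Rearr (MultiIndexed.snoc u a) (MultiIndexed.snoc u' a) := by
  obtain ⟨hn, σ, hσ, hu⟩ := h
  refine ⟨by rw [hn], MultiIndexed.snoc (fun k => (σ k).castSucc) (Fin.last n'), ?_, ?_⟩
  · intro i j hij
    induction i using Fin.lastCases with
    | last =>
      induction j using Fin.lastCases with
      | last => rfl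
      | cast j => simp only [snoc_last, snoc_castSucc] at hij; exact absurd hij.symm (Fin.castSucc_ne_last _)
    | cast i =>
      induction j using Fin.lastCases with
      | last => simp only [snoc_last, snoc_castSucc] at hij; exact absurd hij (Fin.castSucc_ne_last _)
      | cast j =>
        simp only [snoc_castSucc] at hij
        rw [hσ (Fin.castSucc_injective _ hij)]
  · intro k
    induction k using Fin.lastCases with
    | last => simp
    | cast k => simp [hu]

lemma Rearr.of_injective {α : Type*} {n n' : ℕ} {u : Fin n → α} {u' : Fin n' → α} (hn : n = n')
    (hu : Function.Injective u) (h : ∀ k, ∃ k', u k = u' k') : Rearr u u' := by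
  choose σ hσ using h
  exact ⟨hn, σ, fun i j hij => hu (by rw [hσ i, hσ j, hij]), hσ⟩

lemma Rearr.cas {n n' : ℕ} {u : Fin n → ℕ → ℂ} {u' : Fin n' → ℕ → ℂ} (h : Rearr u u') :
    ∃ ε : ℂ, ε * ε = 1 ∧ ∀ p, MultiIndexed.cas p u = ε * MultiIndexed.cas p u' := by
  obtain ⟨hn, σ, hσ, hu⟩ := h
  exact cas_reorder hn u u' σ hσ hu

lemma norm_of_mul_self {ε : ℂ} (h : ε * ε = 1) : ‖ε‖ = 1 := by
  have := congrArg norm h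
  rw [norm_mul, norm_one] at this
  nlinarith [norm_nonneg ε]

lemma norm_le_of_unit_mul {E z w : ℂ} (hE : ‖E‖ = 1) (h : z = E * w) : ‖z‖ ≤ ‖w‖ := by
  rw [h, norm_mul, hE, one_mul]

/-! ### The difference equations at good points -/

/-- The difference operator applied to the values of a multi-indexed polynomial, with the
denominators cleared. -/
noncomputable def diffOp (S : System) (l : Fin 4 → ℂ) (DI DII : Finset ℕ) (Q : ℂ → ℂ) (x : ℂ) : ℂ :=
  pot S (lamD S l DI DII) x * XiC S l DI DII (x + I * gam S / 2) ^ 2 * Q (x - I * gam S) +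
    potStar S (lamD S l DI DII) x * XiC S l DI DII (x - I * gam S / 2) ^ 2 * Q (x + I * gam S)

/-- Passage from Casoratians to polynomial parts: by `ha` and `hb` the coefficients become
potentials once the window factors are divided out. The rescaled δ involves only the factors of the
seeds, so it remains common to all polynomials. -/
lemma divide_gauge {a b V V' W1 W2 U0 U1 U2 xc pc z1 z2 q0 q1 q2 e δ T X1 X2 Q0 Q1 Q2 : ℂ}
    (ha : a * (W1 * U2) = V * (W2 * U1)) (hb : b * (W2 * U0) = V' * (W1 * U1))
    (hX1 : X1 = xc * W1 * z1) (hX2 : X2 = xc * W2 * z2) (hQ0 : Q0 = pc * U0 * q0)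
    (hQ1 : Q1 = pc * U1 * q1) (hQ2 : Q2 = pc * U2 * q2)
    (h : a * X1 ^ 2 * Q2 + b * X2 ^ 2 * Q0 = (e * X1 * X2 - δ) * Q1 + T)
    (hxc : xc ≠ 0) (hpc : pc ≠ 0) (hW1 : W1 ≠ 0) (hW2 : W2 ≠ 0) (hU1 : U1 ≠ 0) :
    V * z1 ^ 2 * q2 + V' * z2 ^ 2 * q0 - (e * (z1 * z2) - δ / (xc ^ 2 * W1 * W2)) * q1 =
      T / (xc ^ 2 * pc * W1 * W2 * U1) := by
  subst hX1 hX2 hQ0 hQ1 hQ2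
  rw [eq_div_iff (by simp [*])]
  have hc : δ / (xc ^ 2 * W1 * W2) * (xc ^ 2 * W1 * W2) = δ := div_mul_cancel₀ _ (by simp [*])
  linear_combination h - xc ^ 2 * pc * W1 * z1 ^ 2 * q2 * ha - xc ^ 2 * pc * W2 * z2 ^ 2 * q0 * hb +
    pc * U1 * q1 * hc

lemma remove_cancel {E rA rB rc U' w2 w3 W1 W2 U1 xc xc' pc pc' X1 X2 Y2 Y3 p : ℂ}
    (g1 : rB * (U' * w3) = rc * (W2 * U1)) (g2 : rA * (U' * w2) = rc * (W1 * U1))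
    (hxc : xc ≠ 0) (hpc : pc' ≠ 0) (hW1 : W1 ≠ 0) (hW2 : W2 ≠ 0) (hU1 : U1 ≠ 0) :
    E * (pc * U' * p * (xc * W1 * X1 * (rB * (xc' * w3 * Y3)) +
        xc * W2 * X2 * (rA * (xc' * w2 * Y2)))) / (xc ^ 2 * pc' * W1 * W2 * U1) =
      E * (rc * (xc' / xc) * (pc / pc') * (p * (X1 * Y3 + X2 * Y2))) := by
  rw [div_eq_iff (by simp [*])]
  field_simp
  linear_combination E * pc * p * xc' * (W1 * X1 * Y3 * g1 + W2 * X2 * Y2 * g2)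

/-- The Schrödinger equation with the constant `δ`. -/
def SchEq (S : System) (l : Fin 4 → ℂ) (M : ℕ) (x : ℂ) (DI DII : Finset ℕ) (δ : ℂ) : Prop :=
  ∀ t e, IsSol (fun j => recA S l (site S M x j)) (fun j => recB S l (site S M x j))
      (fun j => diagC S l (site S M x j)) M t e →
    recA S l (site S M x (M + 1)) * cas 1 (dSeeds S l (site S M x) DI DII) ^ 2 *
        cas 2 (snoc (dSeeds S l (site S M x) DI DII) t) +
      recB S l (site S M x 1) * cas 2 (dSeeds S l (site S M x) DI DII) ^ 2 *
        cas 0 (snoc (dSeeds S l (site S M x) DI DII) t) =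
      (e * cas 1 (dSeeds S l (site S M x) DI DII) * cas 2 (dSeeds S l (site S M x) DI DII) - δ) *
        cas 1 (snoc (dSeeds S l (site S M x) DI DII) t)

section

variable {S : System} {l : Fin 4 → ℂ} {x : ℂ} {DI DII : Finset ℕ} {M : ℕ}

lemma GoodPt.exists_schEq (hx : GoodPt S l M x) (hM : M = DI.card + DII.card) :
    ∃ δ, SchEq S l M x DI DII δ := by
  obtain ⟨δ, hδ⟩ := cas_schrodinger (D := dSeeds S l (site S M x) DI DII)
    (fun k => hx.isSol _ (seedCols DI DII k))
  rw [← length_seeds] at hM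
  subst hM
  exact ⟨δ, hδ⟩

/-- The normalized constant in the Schrödinger equation. -/
noncomputable def normDelta (S : System) (l : Fin 4 → ℂ) (M : ℕ) (x : ℂ) (DI DII : Finset ℕ)
    (δ : ℂ) : ℂ :=
  δ / (xiConst S DI DII ^ 2 * winF S l M x M 1 DII.card DI.card * winF S l M x M 2 DII.card DI.card)

lemma GoodPt.cas_one (hx : GoodPt S l M x) (hM : M = DI.card + DII.card) :
    cas 1 (dSeeds S l (site S M x) DI DII) = xiConst S DI DII *
      winF S l M x M 1 DII.card DI.card * XiC S l DI DII (x + I * gam S / 2) :=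
  hx.cas_dSeeds DI DII 1 M hM _ (by push_cast; ring)

lemma GoodPt.cas_two (hx : GoodPt S l M x) (hM : M = DI.card + DII.card) :
    cas 2 (dSeeds S l (site S M x) DI DII) = xiConst S DI DII *
      winF S l M x M 2 DII.card DI.card * XiC S l DI DII (x - I * gam S / 2) :=
  hx.cas_dSeeds DI DII 2 M hM _ (by push_cast; ring)

lemma GoodPt.cas_snoc_zero (hx : GoodPt S l M x) (hM : M = DI.card + DII.card) (n : ℕ) :
    cas 0 (snoc (dSeeds S l (site S M x) DI DII) (dressed S l (site S M x) (none, n))) =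
      pConst S DI DII * winF S l M x (M + 1) 0 (DII.card + 1) (DI.card + 1) *
        multiPC S l DI DII n (x + I * gam S) :=
  hx.cas_snoc_dSeeds DI DII n 0 (M + 1) (by rw [hM]) _ (by push_cast; ring)

lemma GoodPt.cas_snoc_one (hx : GoodPt S l M x) (hM : M = DI.card + DII.card) (n : ℕ) :
    cas 1 (snoc (dSeeds S l (site S M x) DI DII) (dressed S l (site S M x) (none, n))) =
      pConst S DI DII * winF S l M x (M + 1) 1 (DII.card + 1) (DI.card + 1) *
        multiPC S l DI DII n x :=
  hx.cas_snoc_dSeeds DI DII n 1 (M + 1) (by rw [hM]) _ (by push_cast; ring)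

lemma GoodPt.cas_snoc_two (hx : GoodPt S l M x) (hM : M = DI.card + DII.card) (n : ℕ) :
    cas 2 (snoc (dSeeds S l (site S M x) DI DII) (dressed S l (site S M x) (none, n))) =
      pConst S DI DII * winF S l M x (M + 1) 2 (DII.card + 1) (DI.card + 1) *
        multiPC S l DI DII n (x - I * gam S) :=
  hx.cas_snoc_dSeeds DI DII n 2 (M + 1) (by rw [hM]) _ (by push_cast; ring)

lemma GoodPt.eigen_eq (hx : GoodPt S l M x) (hM : M = DI.card + DII.card) {δ : ℂ}
    (hδ : SchEq S l M x DI DII δ) (n : ℕ) :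
    diffOp S l DI DII (multiPC S l DI DII n) x -
      (energy S l none n * (XiC S l DI DII (x + I * gam S / 2) * XiC S l DI DII (x - I * gam S / 2)) -
        normDelta S l M x DI DII δ) * multiPC S l DI DII n x = 0 := by
  have h := hδ _ _ (hx.isSol M (none, n))
  have := divide_gauge (T := 0) (hx.gauge_down hM rfl rfl) (hx.gauge_up hM rfl rfl)
    (hx.cas_one hM) (hx.cas_two hM) (hx.cas_snoc_zero hM n) (hx.cas_snoc_one hM n)
    (hx.cas_snoc_two hM n) (by rw [add_zero]; exact h) (xiConst_ne_zero S DI DII)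
    (pConst_ne_zero S DI DII) (hx.winF_ne_zero _ _ _ _) (hx.winF_ne_zero _ _ _ _)
    (hx.winF_ne_zero _ _ _ _)
  rw [zero_div] at this
  exact this

/-- The exchanged polynomial satisfies the same equation with another energy, up to a term
containing P_{𝒟,n}(x). Rearranging columns brings in signs chosen separately for each point, so the
remainder is only bounded in norm; this suffices because it is used where P_{𝒟,n} tends to zero. -/
lemma GoodPt.exchange_eq (hx : GoodPt S l M x) (hM : M = DI.card + DII.card) {δ : ℂ}
    (hδ : SchEq S l M x DI DII δ) {DI' DII' : Finset ℕ} (hI : DI'.card = DI.card)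
    (hII : DII'.card = DII.card) {m : ℕ} (hm : M = m + 1) (B : Fin m → Option VType × ℕ)
    (f s : Option VType × ℕ) (hf : Rearr (snoc B f) (seedCols DI DII))
    (hs : Rearr (snoc B s) (seedCols DI' DII'))
    (h1 : XiC S l DI DII (x + I * gam S / 2) ≠ 0) (h2 : XiC S l DI DII (x - I * gam S / 2) ≠ 0)
    (n : ℕ) :
    ‖diffOp S l DI DII (multiPC S l DI' DII' n) x -
      ((energy S l s.1 s.2 + energy S l f.1 f.2 - energy S l none n) *
        (XiC S l DI DII (x + I * gam S / 2) * XiC S l DI DII (x - I * gam S / 2)) -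
        normDelta S l M x DI DII δ) * multiPC S l DI' DII' n x‖ ≤
    ‖(energy S l none n - energy S l s.1 s.2) * (xiConst S DI' DII' / xiConst S DI DII) *
        (pConst S DI DII / pConst S DI' DII')‖ *
      ‖multiPC S l DI DII n x *
        (XiC S l DI DII (x + I * gam S / 2) * XiC S l DI' DII' (x - I * gam S / 2) +
          XiC S l DI DII (x - I * gam S / 2) * XiC S l DI' DII' (x + I * gam S / 2))‖ := by
  have hM' : M = DI'.card + DII'.card := by rw [hI, hII, hM]
  set y := site S M x with hy
  set g := dressed S l y (none, n) with hg
  set F : Fin m → ℕ → ℂ := fun k => dressed S l y (B k) with hF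
  have rf : Rearr (snoc F (dressed S l y f)) (dSeeds S l y DI DII) := by
    have := hf.map (dressed S l y)
    rwa [comp_snoc] at this
  have rs : Rearr (snoc F (dressed S l y s)) (dSeeds S l y DI' DII') := by
    have := hs.map (dressed S l y)
    rwa [comp_snoc] at this
  obtain ⟨ε1, hε1, c1⟩ := rf.cas
  obtain ⟨ε2, hε2, c2⟩ := rs.cas
  obtain ⟨ε3, hε3, c3⟩ := (rf.snoc g).cas
  obtain ⟨ε4, hε4, c4⟩ := (rs.snoc g).cas
  have W1 := hx.winF_ne_zero M 1 DII.card DI.card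
  have W2 := hx.winF_ne_zero M 2 DII.card DI.card
  have U1 := hx.winF_ne_zero (M + 1) 1 (DII.card + 1) (DI.card + 1)
  have k0 := xiConst_ne_zero S DI DII
  have k1 := pConst_ne_zero S DI DII
  have k1' := pConst_ne_zero S DI' DII'
  have n1 : cas 1 (dSeeds S l y DI DII) ≠ 0 := by
    rw [hx.cas_one hM]; exact mul_ne_zero (mul_ne_zero k0 W1) h1
  have n2 : cas 2 (dSeeds S l y DI DII) ≠ 0 := by
    rw [hx.cas_two hM]; exact mul_ne_zero (mul_ne_zero k0 W2) h2
  have e0 : ∀ {ε : ℂ}, ε * ε = 1 → ε ≠ 0 := fun h h0 => by simp [h0] at h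
  -- The constant δ belongs to the standard order of the seeds. Reordering multiplies the
  -- Casoratians of the seeds by a sign that enters squared, and those with t by one common sign, so
  -- the equation with δ persists.
  have ex := cas_exchange (fun k => hx.isSol (m + 1) (B k)) (hx.isSol (m + 1) f)
    (hx.isSol (m + 1) (none, n)) (hx.isSol (m + 1) s)
    (by rw [← hy, c1]; exact mul_ne_zero (e0 hε1) n1)
    (by rw [← hy, c1]; exact mul_ne_zero (e0 hε1) n2) (δ := δ) (by
      intro t e ht
      obtain ⟨ε, hε, c⟩ := (rf.snoc t).cas
      have := hδ t e (by rw [hm]; rw [hm] at ht; exact ht)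
      rw [← hy, c1, c1, c, c, c]
      rw [← hy, show M + 1 = m + 2 by omega] at this
      linear_combination ε * this + ε * (recA S l (y (m + 2)) * cas 1 (dSeeds S l y DI DII) ^ 2 *
        cas 2 (snoc (dSeeds S l y DI DII) t) + recB S l (y 1) * cas 2 (dSeeds S l y DI DII) ^ 2 *
        cas 0 (snoc (dSeeds S l y DI DII) t) - e * cas 1 (dSeeds S l y DI DII) *
        cas 2 (dSeeds S l y DI DII) * cas 1 (snoc (dSeeds S l y DI DII) t)) * hε1)
  rw [← hy, ← hg] at ex
  rw [c1, c1, c2, c2, c3, c4, c4, c4] at ex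
  have ex' : recA S l (y (M + 1)) * cas 1 (dSeeds S l y DI DII) ^ 2 *
        cas 2 (snoc (dSeeds S l y DI' DII') g) +
      recB S l (y 1) * cas 2 (dSeeds S l y DI DII) ^ 2 * cas 0 (snoc (dSeeds S l y DI' DII') g) =
      ((energy S l s.1 s.2 + energy S l f.1 f.2 - energy S l none n) *
        cas 1 (dSeeds S l y DI DII) * cas 2 (dSeeds S l y DI DII) - δ) *
        cas 1 (snoc (dSeeds S l y DI' DII') g) +
      ε4 * ε3 * ε1 * ε2 * (cas 1 (snoc (dSeeds S l y DI DII) g) *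
        ((energy S l none n - energy S l s.1 s.2) *
        (cas 1 (dSeeds S l y DI DII) * cas 2 (dSeeds S l y DI' DII') +
          cas 2 (dSeeds S l y DI DII) * cas 1 (dSeeds S l y DI' DII')))) := by
    rw [show M + 1 = m + 2 by omega]
    set Z := recA S l (y (m + 2)) * cas 1 (dSeeds S l y DI DII) ^ 2 *
        cas 2 (snoc (dSeeds S l y DI' DII') g) +
      recB S l (y 1) * cas 2 (dSeeds S l y DI DII) ^ 2 * cas 0 (snoc (dSeeds S l y DI' DII') g) -
      (energy S l s.1 s.2 + energy S l f.1 f.2 - energy S l none n) *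
        cas 1 (dSeeds S l y DI DII) * cas 2 (dSeeds S l y DI DII) *
        cas 1 (snoc (dSeeds S l y DI' DII') g) with hZ
    linear_combination ε4 * ex - Z * ε4 ^ 2 * hε1 -
      (Z + δ * cas 1 (snoc (dSeeds S l y DI' DII') g)) * hε4
  have dv := divide_gauge (hx.gauge_down hM rfl rfl) (hx.gauge_up hM rfl rfl)
    (hx.cas_one hM) (hx.cas_two hM) (by rw [hx.cas_snoc_zero hM' n, hI, hII])
    (by rw [hx.cas_snoc_one hM' n, hI, hII])
    (by rw [hx.cas_snoc_two hM' n, hI, hII]) ex' k0 k1' W1 W2 U1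
  rw [diffOp, normDelta, dv, hx.cas_snoc_one hM, hx.cas_one hM, hx.cas_two hM, hx.cas_one hM',
    hx.cas_two hM', hI, hII, ← norm_mul]
  refine norm_le_of_unit_mul (E := ε4 * ε3 * ε1 * ε2) ?_ ?_
  · rw [norm_mul, norm_mul, norm_mul, norm_of_mul_self hε4, norm_of_mul_self hε3,
      norm_of_mul_self hε1, norm_of_mul_self hε2]
    simp only [one_mul]
  · field_simp

/-- With two columns fewer, the windows have to start at the sites 1, 2, 3 instead of 0, 1, 2 in
order to be centred at x + iγ, x, x - iγ. As in the exchange case, the remainder is bounded in norm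
because of the signs. -/
lemma GoodPt.remove_eq (hx : GoodPt S l M x) (hM : M = DI.card + DII.card) {δ : ℂ}
    (hδ : SchEq S l M x DI DII δ) {DI' DII' : Finset ℕ} (hI : DI.card = DI'.card + 1)
    (hII : DII.card = DII'.card + 1) (f h : Option VType × ℕ)
    (hf : Rearr (snoc (snoc (seedCols DI' DII') h) f) (seedCols DI DII))
    (hE : ∀ k, energy S l (seedCols DI' DII' k).1 (seedCols DI' DII' k).2 ≠ energy S l h.1 h.2)
    (n : ℕ) (hge : energy S l none n ≠ energy S l h.1 h.2)
    (h1 : XiC S l DI DII (x + I * gam S / 2) ≠ 0)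
    (h2 : XiC S l DI DII (x - I * gam S / 2) ≠ 0) :
    ‖diffOp S l DI DII (multiPC S l DI' DII' n) x -
      ((energy S l h.1 h.2 + energy S l f.1 f.2 - energy S l none n) *
        (XiC S l DI DII (x + I * gam S / 2) * XiC S l DI DII (x - I * gam S / 2)) -
        normDelta S l M x DI DII δ) * multiPC S l DI' DII' n x‖ ≤
    ‖restConst S (DI'.card + DII'.card) * (xiConst S DI' DII' / xiConst S DI DII) *
        (pConst S DI DII / pConst S DI' DII')‖ *
      ‖multiPC S l DI DII n x *
        (XiC S l DI DII (x + I * gam S / 2) * XiC S l DI' DII' (x - I * gam S / 2) +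
          XiC S l DI DII (x - I * gam S / 2) * XiC S l DI' DII' (x + I * gam S / 2))‖ := by
  set m := (seeds DI' DII').length with hmdef
  have hm' : m = DI'.card + DII'.card := length_seeds DI' DII'
  have hm : M = m + 2 := by omega
  set y := site S M x with hy
  set g := dressed S l y (none, n) with hg
  set C := dSeeds S l y DI' DII' with hC
  have rf : Rearr (snoc (snoc C (dressed S l y h)) (dressed S l y f)) (dSeeds S l y DI DII) := by
    have := hf.map (dressed S l y)
    rwa [comp_snoc, comp_snoc] at this
  obtain ⟨ε1, hε1, c1⟩ := rf.cas
  obtain ⟨ε3, hε3, c3⟩ := (rf.snoc g).cas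
  have W1 := hx.winF_ne_zero M 1 DII.card DI.card
  have W2 := hx.winF_ne_zero M 2 DII.card DI.card
  have U1 := hx.winF_ne_zero (m + 1) 2 DII.card DI.card
  have k0 := xiConst_ne_zero S DI DII
  have k1 := pConst_ne_zero S DI DII
  have k1' := pConst_ne_zero S DI' DII'
  have n1 : cas 1 (dSeeds S l y DI DII) ≠ 0 := by
    rw [hx.cas_one hM]; exact mul_ne_zero (mul_ne_zero k0 W1) h1
  have n2 : cas 2 (dSeeds S l y DI DII) ≠ 0 := by
    rw [hx.cas_two hM]; exact mul_ne_zero (mul_ne_zero k0 W2) h2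
  have e0 : ∀ {ε : ℂ}, ε * ε = 1 → ε ≠ 0 := fun h h0 => by simp [h0] at h
  obtain ⟨ε, hε, ex⟩ := cas_remove (fun k => hx.isSol (m + 2) (seedCols DI' DII' k))
    (hx.isSol (m + 2) f) (hx.isSol (m + 2) (none, n)) (hx.isSol (m + 2) h)
    (fun j _ => by
      rw [recA_site]
      exact div_ne_zero (mul_ne_zero (kap_ne_zero S) (mul_ne_zero (hx.hB_ne _ _) (hx.hB_ne _ _)))
        (mul_ne_zero (dl_mul_ne_zero S) (hx.sgS_mul_ne _ _)))
    (fun j _ => by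
      rw [recB_site]
      exact div_ne_zero (mul_ne_zero (kap_ne_zero S) (mul_ne_zero (hx.hA_ne _ _) (hx.hA_ne _ _)))
        (mul_ne_zero (dl_mul_ne_zero S) (hx.sgS_mul_ne _ _)))
    hE hge
    ((c1 1).trans_ne (mul_ne_zero (e0 hε1) n1))
    ((c1 2).trans_ne (mul_ne_zero (e0 hε1) n2)) (δ := δ) (by
      intro t e ht
      obtain ⟨ε, hε, c⟩ := (rf.snoc t).cas
      have := hδ t e (by rw [hm]; rw [hm] at ht; exact ht)
      have c' : ∀ p, cas p (snoc (snoc (snoc (fun k => dressed S l (site S M x)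
        (seedCols DI' DII' k)) (dressed S l (site S M x) h)) (dressed S l (site S M x) f)) t) =
          ε * cas p (snoc (dSeeds S l y DI DII) t) := c
      have c1' : ∀ p, cas p (snoc (snoc (fun k => dressed S l (site S M x)
        (seedCols DI' DII' k)) (dressed S l (site S M x) h)) (dressed S l (site S M x) f)) =
          ε1 * cas p (dSeeds S l y DI DII) := c1
      rw [c1', c1', c', c', c']
      rw [← hy, show M + 1 = m + 3 by omega] at this
      linear_combination ε * this + ε * (recA S l (y (m + 3)) * cas 1 (dSeeds S l y DI DII) ^ 2 *
        cas 2 (snoc (dSeeds S l y DI DII) t) + recB S l (y 1) * cas 2 (dSeeds S l y DI DII) ^ 2 *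
        cas 0 (snoc (dSeeds S l y DI DII) t) - e * cas 1 (dSeeds S l y DI DII) *
        cas 2 (dSeeds S l y DI DII) * cas 1 (snoc (dSeeds S l y DI DII) t)) * hε1)
  have ex : recB S l (y 2) * cas 1 (snoc (snoc C (dressed S l y h)) (dressed S l y f)) ^ 2 *
        cas 3 (snoc C g) + recA S l (y (m + 2)) *
        cas 2 (snoc (snoc C (dressed S l y h)) (dressed S l y f)) ^ 2 * cas 1 (snoc C g) =
      ((energy S l h.1 h.2 + energy S l f.1 f.2 - energy S l none n) *
        cas 1 (snoc (snoc C (dressed S l y h)) (dressed S l y f)) *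
        cas 2 (snoc (snoc C (dressed S l y h)) (dressed S l y f)) - δ) * cas 2 (snoc C g) +
        ε * cas 1 (snoc (snoc (snoc C (dressed S l y h)) (dressed S l y f)) g) *
          (cas 1 (snoc (snoc C (dressed S l y h)) (dressed S l y f)) *
              (recB S l (y 2) * cas 3 C) +
            cas 2 (snoc (snoc C (dressed S l y h)) (dressed S l y f)) *
              (recA S l (y (m + 2)) * cas 2 C)) := ex
  rw [c1, c1, c3] at ex
  have ex' : recB S l (y 2) * cas 1 (dSeeds S l y DI DII) ^ 2 * cas 3 (snoc C g) +
      recA S l (y M) * cas 2 (dSeeds S l y DI DII) ^ 2 * cas 1 (snoc C g) =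
      ((energy S l h.1 h.2 + energy S l f.1 f.2 - energy S l none n) *
        cas 1 (dSeeds S l y DI DII) * cas 2 (dSeeds S l y DI DII) - δ) * cas 2 (snoc C g) +
      ε * ε3 * ε1 * (cas 1 (snoc (dSeeds S l y DI DII) g) *
        (cas 1 (dSeeds S l y DI DII) * (recB S l (y 2) * cas 3 C) +
          cas 2 (dSeeds S l y DI DII) * (recA S l (y M) * cas 2 C))) := by
    rw [show M = m + 2 from hm]
    linear_combination ex - (recB S l (y 2) * cas 1 (dSeeds S l y DI DII) ^ 2 * cas 3 (snoc C g) +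
      recA S l (y (m + 2)) * cas 2 (dSeeds S l y DI DII) ^ 2 * cas 1 (snoc C g) -
      (energy S l h.1 h.2 + energy S l f.1 f.2 - energy S l none n) *
        cas 1 (dSeeds S l y DI DII) * cas 2 (dSeeds S l y DI DII) * cas 2 (snoc C g)) * hε1
  have s0 : DII.card ≠ 0 := by omega
  have r0 : DI.card ≠ 0 := by omega
  have dv := divide_gauge (hx.gauge_down_remove hM hm rfl rfl s0 r0)
    (hx.gauge_up_remove hM hm rfl rfl s0 r0) (hx.cas_one hM) (hx.cas_two hM)
    (by
      rw [hx.cas_snoc_dSeeds DI' DII' n 1 (m + 1) (by omega) (x + I * gam S)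
        (by rw [hm]; push_cast; ring), ← hI, ← hII])
    (by
      rw [hx.cas_snoc_dSeeds DI' DII' n 2 (m + 1) (by omega) x
        (by rw [hm]; push_cast; ring), ← hI, ← hII])
    (by
      rw [hx.cas_snoc_dSeeds DI' DII' n 3 (m + 1) (by omega) (x - I * gam S)
        (by rw [hm]; push_cast; ring), ← hI, ← hII]) ex' k0 k1' W1 W2 U1
  have g1 := hx.gauge_rest_down hm (by omega : DII'.card ≤ m) (by omega : DI'.card ≤ m)
  have g2 := hx.gauge_rest_up hm (by omega : DII'.card ≤ m) (by omega : DI'.card ≤ m)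
  rw [← hI, ← hII, show DII'.card + 2 = DII.card + 1 by omega,
    show DI'.card + 2 = DI.card + 1 by omega, ← hy] at g1 g2
  rw [diffOp, normDelta, dv, hx.cas_snoc_one hM, hx.cas_one hM, hx.cas_two hM, hC,
    hx.cas_dSeeds DI' DII' 3 m hm' (x - I * gam S / 2) (by rw [hm]; push_cast; ring),
    hx.cas_dSeeds DI' DII' 2 m hm' (x + I * gam S / 2) (by rw [hm]; push_cast; ring),
    ← norm_mul]
  refine norm_le_of_unit_mul (E := ε * ε3 * ε1) ?_ ?_
  · rw [norm_mul, norm_mul, norm_of_mul_self hε, norm_of_mul_self hε3, norm_of_mul_self hε1]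
    simp only [one_mul]
  · rw [← hm']
    exact remove_cancel g1 g2 k0 k1' W1 W2 U1

end

/-! ### Rearranging the columns of the seed functions -/

lemma Rearr.trans {α : Type*} {n n' n'' : ℕ} {u : Fin n → α} {u' : Fin n' → α} {u'' : Fin n'' → α}
    (h : Rearr u u') (h' : Rearr u' u'') : Rearr u u'' := by
  obtain ⟨hn, σ, hσ, hu⟩ := h
  obtain ⟨hn', σ', hσ', hu'⟩ := h'
  exact ⟨hn.trans hn', σ' ∘ σ, hσ'.comp hσ, fun k => by rw [hu, hu']; rfl⟩

lemma seedCols_injective (DI DII : Finset ℕ) : Function.Injective (seedCols DI DII) := by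
  have hn : (seeds DI DII).Nodup := by
    refine List.Nodup.append ?_ ?_ ?_
    · exact (Finset.sort_nodup _ _).map fun _ _ h => (Prod.ext_iff.1 h).2
    · exact (Finset.sort_nodup _ _).map fun _ _ h => (Prod.ext_iff.1 h).2
    · intro c h1 h2
      simp only [List.mem_map] at h1 h2
      obtain ⟨a, -, rfl⟩ := h1
      obtain ⟨b, -, hb⟩ := h2
      simp at hb
  intro i j hij
  simp only [seedCols, Prod.mk.injEq, Option.some.injEq] at hij
  exact hn.injective_get (Prod.ext hij.1 hij.2)

lemma exists_seedCols_iff (DI DII : Finset ℕ) (T : VType) (v : ℕ) :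
    (∃ k, seedCols DI DII k = (some T, v)) ↔ v ∈ (match T with | .I => DI | .II => DII) := by
  have h1 : (∃ k, seedCols DI DII k = (some T, v)) ↔ (T, v) ∈ seeds DI DII := by
    rw [List.mem_iff_get]
    simp [seedCols, Prod.ext_iff]
  rw [h1, seeds]
  cases T <;> simp

lemma seedCols_fst_ne_none (DI DII : Finset ℕ) (k : Fin (seeds DI DII).length) :
    ∃ T v, seedCols DI DII k = (some T, v) := ⟨_, _, rfl⟩

lemma snoc_injective {α : Type*} {n : ℕ} {u : Fin n → α} {a : α} (hu : Function.Injective u)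
    (ha : ∀ k, u k ≠ a) : Function.Injective (snoc u a) := by
  intro i j hij
  induction i using Fin.lastCases with
  | last =>
    induction j using Fin.lastCases with
    | last => rfl
    | cast j => simp only [snoc_last, snoc_castSucc] at hij; exact absurd hij.symm (ha j)
  | cast i =>
    induction j using Fin.lastCases with
    | last => simp only [snoc_last, snoc_castSucc] at hij; exact absurd hij (ha i)
    | cast j => simp only [snoc_castSucc] at hij; rw [hu hij]

lemma rearr_seedCols {DI DII DI' DII' : Finset ℕ} (T : VType) (v : ℕ)
    (hc : DI.card + DII.card + 1 = DI'.card + DII'.card)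
    (hv : v ∉ (match T with | .I => DI | .II => DII))
    (hv' : v ∈ (match T with | .I => DI' | .II => DII')) (hI : DI ⊆ DI') (hII : DII ⊆ DII') :
    Rearr (snoc (seedCols DI DII) (some T, v)) (seedCols DI' DII') := by
  refine Rearr.of_injective (by rw [length_seeds, length_seeds, hc])
    (snoc_injective (seedCols_injective DI DII) fun k hk =>
      hv ((exists_seedCols_iff DI DII T v).1 ⟨k, hk⟩)) fun k => ?_
  induction k using Fin.lastCases with
  | last =>
    obtain ⟨k, hk⟩ := (exists_seedCols_iff DI' DII' T v).2 hv'
    exact ⟨k, by rw [snoc_last, hk]⟩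
  | cast k =>
    obtain ⟨T', v', h⟩ := seedCols_fst_ne_none DI DII k
    have := (exists_seedCols_iff DI DII T' v').1 ⟨k, h⟩
    obtain ⟨k', hk'⟩ := (exists_seedCols_iff DI' DII' T' v').2 (by
      cases T'
      · exact hI this
      · exact hII this)
    exact ⟨k', by rw [snoc_castSucc, h, hk']⟩

lemma rearr_insert_I {DI : Finset ℕ} (DII : Finset ℕ) {v : ℕ} (hv : v ∉ DI) :
    Rearr (snoc (seedCols DI DII) (some .I, v)) (seedCols (insert v DI) DII) :=
  rearr_seedCols .I v (by rw [Finset.card_insert_of_notMem hv]; ring) hv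
    (Finset.mem_insert_self _ _) (Finset.subset_insert _ _) subset_rfl

lemma rearr_insert_II (DI : Finset ℕ) {DII : Finset ℕ} {v : ℕ} (hv : v ∉ DII) :
    Rearr (snoc (seedCols DI DII) (some .II, v)) (seedCols DI (insert v DII)) :=
  rearr_seedCols .II v (by rw [Finset.card_insert_of_notMem hv]; ring) hv
    (Finset.mem_insert_self _ _) subset_rfl (Finset.subset_insert _ _)

/-! ### Energies of the labels -/

/-- The energy attached to a label. -/
noncomputable def eLab (S : System) (l : Fin 4 → ℂ) (DI DII : Finset ℕ) (N : ℕ) :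
    Label DI DII N → ℂ
  | .inl n => energy S l none (n : ℕ)
  | .inr (.inl p) => energy S l (some .I) p.1.2 + energy S l (some .I) p.1.1 - energy S l none N
  | .inr (.inr (.inl p)) =>
      energy S l (some .II) p.1.2 + energy S l (some .II) p.1.1 - energy S l none N
  | .inr (.inr (.inr p)) =>
      energy S l (some .I) p.1.1 + energy S l (some .II) p.2.1 - energy S l none N

/-- Labels of the last three kinds correspond to unordered pairs of integers: two nonnegative ones,
two negative ones, or one of each, by `energy_I` and `energy_II`. Within a gap label the order ε < d
determines the pair, and genericity separates sums over different pairs from each other and from the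
energies of eigenpolynomials. -/
lemma Generic.eLab_injective {S : System} {l : Fin 4 → ℂ} (hl : Generic S l) (DI DII : Finset ℕ)
    (N : ℕ) : Function.Injective (eLab S l DI DII N) := by
  have key : ∀ k k' m m' : ℤ, seedE S l k + seedE S l k' = seedE S l m + seedE S l m' →
      (k = m ∧ k' = m') ∨ (k = m' ∧ k' = m) := fun k k' m m' h => by
    by_contra hc
    exact hl.seed_seed k k' m m' hc (by rw [h, sub_self])
  have key0 : ∀ (n : ℕ) (k k' : ℤ),
      energy S l none n = seedE S l k + seedE S l k' - energy S l none N → False :=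
    fun n k k' h => hl.none_seed n N k k' (by rw [h]; ring)
  rintro (n | ⟨p, hp⟩ | ⟨p, hp⟩ | ⟨d, d'⟩) (n' | ⟨p', hp'⟩ | ⟨p', hp'⟩ | ⟨e, e'⟩) h <;>
    simp only [eLab, energy_I, energy_II, sub_left_inj] at h
  · by_contra hc
    exact hl.none_ne n n' (fun h' => hc (by rw [Fin.ext h'])) (by rw [h, sub_self])
  · exact (key0 _ _ _ h).elim
  · exact (key0 _ _ _ h).elim
  · exact (key0 _ _ _ h).elim
  · exact (key0 _ _ _ h.symm).elim
  · have : p = p' := Prod.ext (by have := key _ _ _ _ h; omega) (by have := key _ _ _ _ h; omega)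
    subst this; rfl
  · have := key _ _ _ _ h; omega
  · have := key _ _ _ _ h; omega
  · exact (key0 _ _ _ h.symm).elim
  · have := key _ _ _ _ h; omega
  · have : p = p' := Prod.ext (by have := key _ _ _ _ h; omega) (by have := key _ _ _ _ h; omega)
    subst this; rfl
  · have := key _ _ _ _ h; omega
  · exact (key0 _ _ _ h.symm).elim
  · have := key _ _ _ _ h; omega
  · have := key _ _ _ _ h; omega
  · have h1 : d = e := Subtype.ext (by have := key _ _ _ _ h; omega)
    have h2 : d' = e' := Subtype.ext (by have := key _ _ _ _ h; omega)
    rw [h1, h2]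

lemma Generic.energy_ne {S : System} {l : Fin 4 → ℂ} (hl : Generic S l) {T T' : VType} {v v' : ℕ}
    (h : (T, v) ≠ (T', v')) : energy S l (some T) v ≠ energy S l (some T') v' := by
  have key : ∀ k m : ℤ, seedE S l k = seedE S l m → k = m := fun k m hkm => by
    by_contra hc
    exact hl.seed_seed k 0 m 0 (by omega) (by rw [hkm, sub_self])
  intro h'
  cases T <;> cases T' <;> simp only [energy_I, energy_II] at h' <;> have := key _ _ h'
  · exact h (by rw [show v = v' by omega])
  · omega
  · omega
  · exact h (by rw [show v = v' by omega])

lemma Generic.energy_none_ne {S : System} {l : Fin 4 → ℂ} (hl : Generic S l) (n : ℕ) (T : VType)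
    (v : ℕ) : energy S l none n ≠ energy S l (some T) v := by
  intro h
  cases T with
  | I => rw [energy_I] at h; exact hl.none_seed n n v v (by rw [h]; ring)
  | II => rw [energy_II] at h; exact hl.none_seed n n (-v - 1) (-v - 1) (by rw [h]; ring)

/-- The values of the polynomials attached to the labels. -/
noncomputable def calPC (S : System) (l : Fin 4 → ℂ) (DI DII : Finset ℕ) (N : ℕ)
    (a : Label DI DII N) (x : ℂ) : ℂ :=
  (calP S l DI DII N a).eval (eta S x)

/-- A uniform form of the three kinds of difference equations. The constant and the index set in the
remainder do not depend on x, so the bound survives the limit to a zero of P. -/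
lemma Generic.exists_label_bound {S : System} {l : Fin 4 → ℂ} (hl : Generic S l)
    (DI DII : Finset ℕ) (N : ℕ) (a : Label DI DII N) :
    ∃ (C : ℝ) (DI' DII' : Finset ℕ), ∀ x, GoodPt S l (DI.card + DII.card) x →
      XiC S l DI DII (x + I * gam S / 2) ≠ 0 → XiC S l DI DII (x - I * gam S / 2) ≠ 0 →
      ∀ δ, SchEq S l (DI.card + DII.card) x DI DII δ →
      ‖diffOp S l DI DII (calPC S l DI DII N a) x -
        (eLab S l DI DII N a *
          (XiC S l DI DII (x + I * gam S / 2) * XiC S l DI DII (x - I * gam S / 2)) -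
          normDelta S l (DI.card + DII.card) x DI DII δ) * calPC S l DI DII N a x‖ ≤
      C * ‖multiPC S l DI DII N x *
        (XiC S l DI DII (x + I * gam S / 2) * XiC S l DI' DII' (x - I * gam S / 2) +
          XiC S l DI DII (x - I * gam S / 2) * XiC S l DI' DII' (x + I * gam S / 2))‖ := by
  rcases a with n | ⟨⟨d, v⟩, hd, hv, -⟩ | ⟨⟨d, v⟩, hd, hv, -⟩ | ⟨⟨d, hd⟩, ⟨d', hd'⟩⟩
  · refine ⟨0, ∅, ∅, fun x hx _ _ δ hδ => ?_⟩
    have := hx.eigen_eq rfl hδ n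
    rw [zero_mul]
    exact (norm_eq_zero.2 this).le
  · have hv' : v ∉ DI.erase d := fun h => hv (Finset.mem_of_mem_erase h)
    have e := rearr_insert_I DII (Finset.notMem_erase d DI)
    rw [Finset.insert_erase hd] at e
    have c : (DI.erase d).card + 1 = DI.card := Finset.card_erase_add_one hd
    have c' : (insert v (DI.erase d)).card = (DI.erase d).card + 1 := Finset.card_insert_of_notMem hv'
    exact ⟨_, _, _, fun x hx h1 h2 δ hδ => hx.exchange_eq rfl hδ (by omega) rfl
      (by rw [length_seeds]; omega) _ _ _ e (rearr_insert_I DII hv') h1 h2 N⟩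
  · have hv' : v ∉ DII.erase d := fun h => hv (Finset.mem_of_mem_erase h)
    have e := rearr_insert_II DI (Finset.notMem_erase d DII)
    rw [Finset.insert_erase hd] at e
    have c : (DII.erase d).card + 1 = DII.card := Finset.card_erase_add_one hd
    have c' : (insert v (DII.erase d)).card = (DII.erase d).card + 1 := Finset.card_insert_of_notMem hv'
    exact ⟨_, _, _, fun x hx h1 h2 δ hδ => hx.exchange_eq rfl hδ rfl (by omega)
      (by rw [length_seeds]; omega) _ _ _ e (rearr_insert_II DI hv') h1 h2 N⟩
  · have e := (rearr_insert_I (DII.erase d') (Finset.notMem_erase d DI)).snoc (some .II, d')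
    rw [Finset.insert_erase hd] at e
    have e' := rearr_insert_II DI (Finset.notMem_erase d' DII)
    rw [Finset.insert_erase hd'] at e'
    exact ⟨_, _, _, fun x hx h1 h2 δ hδ => hx.remove_eq rfl hδ
      (Finset.card_erase_add_one hd).symm (Finset.card_erase_add_one hd').symm _ _ (e.trans e')
      (fun k => by
        obtain ⟨T, w, hk⟩ := seedCols_fst_ne_none (DI.erase d) (DII.erase d') k
        rw [hk]
        refine hl.energy_ne fun h => ?_
        have := (exists_seedCols_iff _ _ _ _).1 ⟨k, hk⟩
        simp only [Prod.mk.injEq] at h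
        obtain ⟨rfl, rfl⟩ := h
        exact Finset.notMem_erase _ _ this) N (hl.energy_none_ne N .I d) h1 h2⟩

/-! ### Casoratians as functions of the last column -/

/-- Laplace expansion along the last column. Only the first and last cofactors are identified, since
a column supported at one end of the window meets no others. -/
lemma cas_snoc_expand {n : ℕ} (p : ℕ) (D : Fin n → ℕ → ℂ) : ∃ w : Fin (n + 1) → ℂ,
    w (Fin.last n) = cas p D ∧ w 0 = (-1) ^ n * cas (p + 1) D ∧
      ∀ t : ℕ → ℂ, cas p (snoc D t) = ∑ i : Fin (n + 1), t (p + i) * w i := by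
  refine ⟨fun i => (-1) ^ ((i : ℕ) + n) *
    Matrix.det (Matrix.of fun (j : Fin n) (k : Fin n) => D k (p + (i.succAbove j))), ?_, ?_, ?_⟩
  · simp only [Fin.val_last, Fin.succAbove_last, Fin.val_castSucc, ← two_mul, pow_mul, neg_one_sq,
      one_pow, one_mul]
    rfl
  · simp only [Fin.val_zero, zero_add, Fin.succAbove_zero, Fin.val_succ, cas]
    congr 4
    funext j k
    rw [show p + ((j : ℕ) + 1) = p + 1 + j by ring]
  · intro t
    rw [cas, Matrix.det_succ_column _ (Fin.last n)]
    refine Finset.sum_congr rfl fun i _ => ?_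
    have : (Matrix.of fun (i k : Fin (n + 1)) => snoc D t k (p + i)).submatrix i.succAbove
        (Fin.last n).succAbove = Matrix.of fun (j : Fin n) (k : Fin n) =>
          D k (p + (i.succAbove j)) := by
      ext j k
      simp [Fin.succAbove_last]
    rw [this]
    simp only [Matrix.of_apply, snoc_last, Fin.val_last]
    ring

lemma cas_snoc_of_zero_left {n : ℕ} (p : ℕ) (D : Fin n → ℕ → ℂ) (t : ℕ → ℂ)
    (h : ∀ i < n, t (p + i) = 0) : cas p (snoc D t) = t (p + n) * cas p D := by
  obtain ⟨w, h1, -, h3⟩ := cas_snoc_expand p D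
  rw [h3, Fin.sum_univ_castSucc, h1, Finset.sum_eq_zero fun i _ => by
    rw [Fin.val_castSucc, h i i.2, zero_mul], zero_add, Fin.val_last]

lemma cas_snoc_of_zero_right {n : ℕ} (p : ℕ) (D : Fin n → ℕ → ℂ) (t : ℕ → ℂ)
    (h : ∀ i < n, t (p + 1 + i) = 0) :
    cas p (snoc D t) = (-1) ^ n * t p * cas (p + 1) D := by
  obtain ⟨w, -, h2, h3⟩ := cas_snoc_expand p D
  rw [h3, Fin.sum_univ_succ, h2, Finset.sum_eq_zero fun i _ => by
    rw [Fin.val_succ, show p + ((i : ℕ) + 1) = p + 1 + i by ring, h i i.2, zero_mul], add_zero,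
    Fin.val_zero, add_zero]
  ring

lemma rawDressed_none (S : System) (l : Fin 4 → ℂ) (y : ℕ → ℂ) (q : ℂ[X]) (k : ℕ) :
    rawDressed S l y none q k =
      gauge S l .I y k * gauge S l .II y k * q.eval (eta S (y k)) := rfl

lemma cas_snoc_add {n : ℕ} (p : ℕ) (D : Fin n → ℕ → ℂ) (t t' : ℕ → ℂ) :
    cas p (snoc D (t + t')) = cas p (snoc D t) + cas p (snoc D t') := by
  obtain ⟨w, -, -, h⟩ := cas_snoc_expand p D
  simp only [h, ← Finset.sum_add_distrib, Pi.add_apply, add_mul]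

lemma cas_snoc_smul {n : ℕ} (p : ℕ) (D : Fin n → ℕ → ℂ) (c : ℂ) (t : ℕ → ℂ) :
    cas p (snoc D (c • t)) = c * cas p (snoc D t) := by
  obtain ⟨w, -, -, h⟩ := cas_snoc_expand p D
  simp only [h, Finset.mul_sum, Pi.smul_apply, smul_eq_mul, mul_assoc]

lemma rawDressed_add (S : System) (l : Fin 4 → ℂ) (y : ℕ → ℂ) (o : Option VType) (q q' : ℂ[X]) :
    rawDressed S l y o (q + q') = rawDressed S l y o q + rawDressed S l y o q' := by
  funext k; simp [rawDressed, mul_add]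

lemma rawDressed_smul (S : System) (l : Fin 4 → ℂ) (y : ℕ → ℂ) (o : Option VType) (c : ℂ)
    (q : ℂ[X]) : rawDressed S l y o (c • q) = c • rawDressed S l y o q := by
  funext k; simp [rawDressed, mul_left_comm]

/-- `R` is the polynomial part of the Casoratian of the seed functions and the polynomial `q`. -/
def IsPart (S : System) (l : Fin 4 → ℂ) (DI DII : Finset ℕ) (q R : ℂ[X]) : Prop :=
  ∀ x, GoodPt S l (DI.card + DII.card) x →
    cas 1 (snoc (dSeeds S l (site S (DI.card + DII.card) x) DI DII)
      (rawDressed S l (site S (DI.card + DII.card) x) none q)) =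
    pConst S DI DII * winF S l (DI.card + DII.card) x (DI.card + DII.card + 1) 1 (DII.card + 1)
      (DI.card + 1) * R.eval (eta S x)

lemma isPart_baseP (S : System) (l : Fin 4 → ℂ) (DI DII : Finset ℕ) (n : ℕ) :
    IsPart S l DI DII (baseP S l n) (multiP S l DI DII n) := by
  intro x hx
  have := hx.cas_snoc_one rfl n
  rw [dressed_eq_rawDressed] at this
  exact this

/-- The polynomials whose part vanishes at `t`. -/
noncomputable def partSubmodule (S : System) (l : Fin 4 → ℂ) (DI DII : Finset ℕ) (t : ℂ) :
    Submodule ℂ ℂ[X] where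
  carrier := {q | ∃ R : ℂ[X], R.eval t = 0 ∧ IsPart S l DI DII q R}
  add_mem' := by
    rintro a b ⟨R, h1, h2⟩ ⟨R', h1', h2'⟩
    refine ⟨R + R', by rw [eval_add, h1, h1', add_zero], fun x hx => ?_⟩
    rw [rawDressed_add, cas_snoc_add, h2 x hx, h2' x hx, eval_add]
    ring
  zero_mem' := by
    refine ⟨0, eval_zero, fun x hx => ?_⟩
    have := cas_snoc_smul 1 (dSeeds S l (site S (DI.card + DII.card) x) DI DII) 0
      (rawDressed S l (site S (DI.card + DII.card) x) none 0)
    rw [← rawDressed_smul, smul_zero, zero_mul] at this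
    rw [this, eval_zero, mul_zero]
  smul_mem' := by
    rintro c a ⟨R, h1, h2⟩
    refine ⟨c • R, by rw [eval_smul, h1, smul_zero], fun x hx => ?_⟩
    rw [rawDressed_smul, cas_snoc_smul, h2 x hx, eval_smul, smul_eq_mul]
    ring

/-- For generic parameters the base polynomials have one exact degree each and span all polynomials.
If every P_{𝒟,n} vanishes at t, linearity thus makes the part of an arbitrary polynomial vanish
there. -/
lemma Generic.partSubmodule_eq_top {S : System} {l : Fin 4 → ℂ} (hl : Generic S l)
    (DI DII : Finset ℕ) (t : ℂ) (h : ∀ n, (multiP S l DI DII n).eval t = 0) :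
    partSubmodule S l DI DII t = ⊤ := by
  have hd := fun n => natDegree_baseP S l n (hl.lead n)
  let s : Polynomial.Sequence ℂ :=
    ⟨baseP S l, fun n => (degree_eq_iff_natDegree_eq (hd n).1).2 (hd n).2⟩
  refine top_le_iff.1 ((s.span fun i => ?_).symm.le.trans (Submodule.span_le.2 ?_))
  · exact (leadingCoeff_ne_zero.2 (hd i).1).isUnit
  · rintro _ ⟨n, rfl⟩
    exact ⟨_, h n, isPart_baseP S l DI DII n⟩

/-! ### Polynomials vanishing on a window -/

lemma continuous_eta (S : System) : Continuous (eta S) := by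
  cases S with
  | cH => exact continuous_id
  | W => exact continuous_pow 2
  | AW q h0 h1 => exact Complex.continuous_cos

lemma continuous_site (S : System) (M k : ℕ) : Continuous fun x => site S M x k := by
  unfold site; fun_prop

lemma continuous_hA (S : System) (l : Fin 4 → ℂ) (T : VType) : Continuous (hA S l T) := by
  have h1 : Continuous (phA S) := by
    cases S with
    | cH => exact continuous_const
    | W => exact continuous_const
    | AW q h0 h1 => unfold phA; fun_prop
  exact h1.mul (continuous_finsetProd _ fun k _ => continuous_lin S continuous_const continuous_id)

lemma continuous_hB (S : System) (l : Fin 4 → ℂ) (T : VType) : Continuous (hB S l T) := by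
  have h1 : Continuous (phB S) := by
    cases S with
    | cH => exact continuous_const
    | W => exact continuous_const
    | AW q h0 h1 => unfold phB; fun_prop
  exact h1.mul (continuous_finsetProd _ fun k _ => continuous_lin S continuous_const continuous_neg)

lemma continuous_XiC (S : System) (l : Fin 4 → ℂ) (DI DII : Finset ℕ) :
    Continuous (XiC S l DI DII) :=
  (Polynomial.continuous _).comp (continuous_eta S)

/-- The polynomial vanishing at the images of the sites `p, …, p + M - 1`. -/
noncomputable def winPoly (S : System) (M p : ℕ) (x : ℂ) : ℂ[X] :=
  ∏ j ∈ Finset.range M, (X - C (eta S (site S M x (p + j))))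

lemma eval_winPoly (S : System) (M p : ℕ) (x z : ℂ) : (winPoly S M p x).eval z =
    ∏ j ∈ Finset.range M, (z - eta S (site S M x (p + j))) := by
  simp [winPoly, eval_prod]

lemma continuous_coeff_prod {ι : Type*} (s : Finset ι) (f : ι → ℂ → ℂ)
    (hf : ∀ j, Continuous (f j)) (i : ℕ) :
    Continuous fun x => (∏ j ∈ s, (X - C (f j x))).coeff i := by
  classical
  induction s using Finset.induction_on generalizing i with
  | empty => simp only [Finset.prod_empty]; exact continuous_const
  | insert a s ha ih =>
    simp only [Finset.prod_insert ha, coeff_mul]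
    refine continuous_finsetSum _ fun k _ => Continuous.mul ?_ (ih _)
    simp only [coeff_sub, coeff_C]
    split_ifs
    · exact continuous_const.sub (hf a)
    · exact continuous_const

lemma natDegree_winPoly (S : System) (M p : ℕ) (x : ℂ) : (winPoly S M p x).natDegree < M + 1 := by
  rw [winPoly, natDegree_prod_of_monic _ _ fun _ _ => monic_X_sub_C _]
  simp

/-- The polynomial in the last column varies with x, so its part is assembled from those of the
monomials. The coefficients of `winPoly` are continuous in x and the part of each monomial vanishes
at η(x0), hence f is continuous with value zero at x0. -/
lemma exists_winPart {S : System} {l : Fin 4 → ℂ} {DI DII : Finset ℕ} {x0 : ℂ}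
    (h : partSubmodule S l DI DII (eta S x0) = ⊤) (p : ℕ) : ∃ f : ℂ → ℂ, Continuous f ∧ f x0 = 0 ∧
      ∀ x, GoodPt S l (DI.card + DII.card) x →
        cas 1 (snoc (dSeeds S l (site S (DI.card + DII.card) x) DI DII)
          (rawDressed S l (site S (DI.card + DII.card) x) none
            (winPoly S (DI.card + DII.card) p x))) =
        pConst S DI DII * winF S l (DI.card + DII.card) x (DI.card + DII.card + 1) 1
          (DII.card + 1) (DI.card + 1) * f x := by
  have hR : ∀ i : ℕ, ∃ R : ℂ[X], R.eval (eta S x0) = 0 ∧ IsPart S l DI DII (X ^ i) R := fun i => by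
    have : (X ^ i : ℂ[X]) ∈ partSubmodule S l DI DII (eta S x0) := h ▸ Submodule.mem_top
    exact this
  choose R hR0 hR1 using hR
  refine ⟨fun x => ∑ i ∈ Finset.range (DI.card + DII.card + 1),
    (winPoly S (DI.card + DII.card) p x).coeff i * (R i).eval (eta S x), ?_, ?_, fun x hx => ?_⟩
  · exact continuous_finsetSum _ fun i _ => (continuous_coeff_prod _ _ (fun j =>
      (continuous_eta S).comp (continuous_site S _ _)) i).mul
      ((Polynomial.continuous _).comp (continuous_eta S))
  · exact Finset.sum_eq_zero fun i _ => by rw [hR0, mul_zero]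
  · obtain ⟨w, -, -, hw⟩ := cas_snoc_expand 1 (dSeeds S l (site S (DI.card + DII.card) x) DI DII)
    have e : ∀ z, (winPoly S (DI.card + DII.card) p x).eval z =
        ∑ i ∈ Finset.range (DI.card + DII.card + 1),
          (winPoly S (DI.card + DII.card) p x).coeff i * z ^ i := fun z =>
      eval_eq_sum_range' (natDegree_winPoly S _ p x) z
    have hi := fun i => hR1 i x hx
    simp only [hw, rawDressed_none, eval_pow, eval_X] at hi
    rw [Finset.mul_sum]
    simp only [hw, rawDressed_none, e]
    rw [← Finset.sum_congr rfl fun i (_ : i ∈ Finset.range (DI.card + DII.card + 1)) =>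
      show (winPoly S (DI.card + DII.card) p x).coeff i * _ = _ from
        (congrArg (_ * ·) (hi i)).trans (by ring)]
    simp only [Finset.mul_sum, Finset.sum_mul]
    rw [Finset.sum_comm]
    exact Finset.sum_congr rfl fun i _ => Finset.sum_congr rfl fun j _ => by ring

/-! ### Some multi-indexed polynomial does not vanish -/

lemma prod_sub_comm {M : ℕ} (a : ℕ → ℂ) (b : ℂ) :
    ∏ j ∈ Finset.range M, (b - a j) = (-1) ^ M * ∏ j ∈ Finset.range M, (a j - b) := by
  rw [← Finset.card_range M, ← Finset.prod_const, Finset.card_range, ← Finset.prod_mul_distrib]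
  exact Finset.prod_congr rfl fun _ _ => by ring

lemma gauge_eq_div (S : System) (l : Fin 4 → ℂ) (T : VType) (y : ℕ → ℂ) (k : ℕ) :
    gauge S l T y k = apr S l T y k / bpr S l T y (k + 1) := rfl

lemma apr_mul_Ico (S : System) (l : Fin 4 → ℂ) (T : VType) (y : ℕ → ℂ) {a b : ℕ} (h : a ≤ b) :
    apr S l T y b = apr S l T y a * ∏ i ∈ Finset.Ico a b, hA S l T (y i) :=
  (Finset.prod_range_mul_prod_Ico _ h).symm

lemma bpr_mul_Ico (S : System) (l : Fin 4 → ℂ) (T : VType) (y : ℕ → ℂ) {a b : ℕ} (h : a ≤ b) :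
    bpr S l T y b = bpr S l T y a * ∏ i ∈ Finset.Ico a b, hB S l T (y i) :=
  (Finset.prod_range_mul_prod_Ico _ h).symm

section

variable {S : System} {l : Fin 4 → ℂ} {x : ℂ} {DI DII : Finset ℕ} {M s r : ℕ}

lemma left_cancel {pc v V f a1 a2 A1 A2 b1 b2 p1 p2 xc z σ : ℂ}
    (h : pc * (v * V * (a1 / b1 * p1 * (a2 / b2 * p2))) * f =
      a1 * A1 / b1 * (a2 * A2 / b2) * (σ * V) * (xc * (v * (p1 * p2)) * z))
    (hv : v ≠ 0) (hV : V ≠ 0) (ha1 : a1 ≠ 0) (ha2 : a2 ≠ 0) (hb1 : b1 ≠ 0) (hb2 : b2 ≠ 0)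
    (hp1 : p1 ≠ 0) (hp2 : p2 ≠ 0) : pc * f = σ * xc * (A1 * A2) * z := by
  field_simp at h
  linear_combination h

lemma right_cancel {pc v V f a1 a2 B1 B2 b1 b2 p1 p2 xc z σ : ℂ}
    (h : pc * (v * V * (a1 / (b1 * B1) * p1 * (a2 / (b2 * B2) * p2))) * f =
      σ * (a1 / b1 * (a2 / b2) * V) * (xc * (v * (p1 * p2)) * z))
    (hv : v ≠ 0) (hV : V ≠ 0) (ha1 : a1 ≠ 0) (ha2 : a2 ≠ 0) (hb1 : b1 ≠ 0) (hb2 : b2 ≠ 0)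
    (hB1 : B1 ≠ 0) (hB2 : B2 ≠ 0)
    (hp1 : p1 ≠ 0) (hp2 : p2 ≠ 0) : pc * f = σ * xc * (B1 * B2) * z := by
  field_simp at h
  linear_combination h

/-- The polynomial vanishes at every site of the window but the last, so the Casoratian is one entry
times the Casoratian of the seeds. After cancellation, Ξ(x + iγ/2) remains, multiplied by factors of
`hA` only. -/
lemma GoodPt.winPart_left (hx : GoodPt S l M x) (hM : M = DI.card + DII.card)
    (hs : s = DII.card) (hr : r = DI.card) {f : ℂ}
    (hf : cas 1 (snoc (dSeeds S l (site S M x) DI DII)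
          (rawDressed S l (site S M x) none (winPoly S M 1 x))) =
        pConst S DI DII * winF S l M x (M + 1) 1 (s + 1) (r + 1) * f) :
    pConst S DI DII * f = (-1) ^ M * xiConst S DI DII *
      ((∏ i ∈ Finset.Ico (s + 1) (M + 1), hA S l .I (site S M x i)) *
        ∏ i ∈ Finset.Ico (r + 1) (M + 1), hA S l .II (site S M x i)) *
      XiC S l DI DII (x + I * gam S / 2) := by
  have hlen : (seeds DI DII).length = M := by rw [length_seeds, hM]
  rw [cas_snoc_of_zero_left _ _ _ (fun i hi => by
    rw [rawDressed_none, eval_winPoly, Finset.prod_eq_zero (i := i) (Finset.mem_range.2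
      (hlen ▸ hi)) (sub_self _), mul_zero]), hx.cas_one hM, hlen, ← hs, ← hr, rawDressed_none,
    eval_winPoly, gauge_eq_div, gauge_eq_div, prod_sub_comm] at hf
  have hd := hx.siteData
  have hV := vd_ne_zero hd.diff hd.d_ne hd.σ_ne (M + 1) 1
  have hp := ph_peel' (α := apr S l .I (site S M x)) hd.β_ne M 1 s (by omega)
  have hp' := ph_peel' (α := apr S l .II (site S M x)) hd.β'_ne M 1 r (by omega)
  rw [winF, winF, winFactor, winFactor, vd_succ, hp, hp', show 1 + M + 1 = M + 2 by ring,
    show 1 + M = M + 1 by ring, show 1 + s = s + 1 by ring, show 1 + r = r + 1 by ring] at hf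
  rw [vd_succ, show 1 + M = M + 1 by ring] at hV
  rw [apr_mul_Ico S l .I (site S M x) (show s + 1 ≤ M + 1 by omega),
    apr_mul_Ico S l .II (site S M x) (show r + 1 ≤ M + 1 by omega)] at hf
  exact left_cancel hf.symm (left_ne_zero_of_mul hV) (right_ne_zero_of_mul hV) (hd.α_ne _)
    (hd.α'_ne _) (hd.β_ne _) (hd.β'_ne _) (ph_ne_zero hd.α_ne hd.β_ne _ _ _)
    (ph_ne_zero hd.α'_ne hd.β'_ne _ _ _)

/-- The mirror image: only the first site contributes, the cofactor gives Ξ(x - iγ/2), and the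
remaining factors are all of the kind `hB`. -/
lemma GoodPt.winPart_right (hx : GoodPt S l M x) (hM : M = DI.card + DII.card)
    (hs : s = DII.card) (hr : r = DI.card) {f : ℂ}
    (hf : cas 1 (snoc (dSeeds S l (site S M x) DI DII)
          (rawDressed S l (site S M x) none (winPoly S M 2 x))) =
        pConst S DI DII * winF S l M x (M + 1) 1 (s + 1) (r + 1) * f) :
    pConst S DI DII * f = (-1) ^ M * xiConst S DI DII *
      ((∏ i ∈ Finset.Ico 2 (M + 2 - s), hB S l .I (site S M x i)) *
        ∏ i ∈ Finset.Ico 2 (M + 2 - r), hB S l .II (site S M x i)) *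
      XiC S l DI DII (x - I * gam S / 2) := by
  have hlen : (seeds DI DII).length = M := by rw [length_seeds, hM]
  rw [cas_snoc_of_zero_right _ _ _ (fun i hi => by
    rw [rawDressed_none, eval_winPoly, Finset.prod_eq_zero (i := i) (Finset.mem_range.2
      (hlen ▸ hi)) (sub_self _), mul_zero]), hx.cas_two hM, hlen, ← hs, ← hr, rawDressed_none,
    eval_winPoly, gauge_eq_div, gauge_eq_div] at hf
  have hd := hx.siteData
  have hV := vd_ne_zero hd.diff hd.d_ne hd.σ_ne (M + 1) 1
  have hp := ph_peel (α := apr S l .I (site S M x)) hd.β_ne M 1 s (by omega)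
  have hp' := ph_peel (α := apr S l .II (site S M x)) hd.β'_ne M 1 r (by omega)
  rw [winF, winF, winFactor, winFactor, vd_succ', hp, hp', show 1 + M + 1 - s = M + 2 - s by omega,
    show 1 + M + 1 - r = M + 2 - r by omega] at hf
  rw [vd_succ'] at hV
  rw [bpr_mul_Ico S l .I (site S M x) (show 2 ≤ M + 2 - s by omega),
    bpr_mul_Ico S l .II (site S M x) (show 2 ≤ M + 2 - r by omega)] at hf
  exact right_cancel hf.symm (left_ne_zero_of_mul hV) (right_ne_zero_of_mul hV) (hd.α_ne _)
    (hd.α'_ne _) (hd.β_ne _) (hd.β'_ne _)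
    (Finset.prod_ne_zero_iff.2 fun _ _ => hx.hB_ne _ _)
    (Finset.prod_ne_zero_iff.2 fun _ _ => hx.hB_ne _ _) (ph_ne_zero hd.α_ne hd.β_ne _ _ _)
    (ph_ne_zero hd.α'_ne hd.β'_ne _ _ _)

end

lemma eq_of_goodPt {S : System} {l : Fin 4 → ℂ} {M : ℕ} {f g : ℂ → ℂ} (hf : Continuous f)
    (hg : Continuous g) (h : ∀ x, GoodPt S l M x → f x = g x) (x : ℂ) : f x = g x :=
  congrFun (Continuous.ext_on (dense_goodPt S l M) hf hg h) x

/-- If all P_{𝒟,n} vanished at x0, the two special columns above would force a zero of some `hA` and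
of some `hB` at sites around x0, as Ξ does not vanish at x0 ± iγ/2. Two such zeros are excluded for
generic parameters. -/
lemma Generic.exists_multiPC_ne_zero {S : System} {l : Fin 4 → ℂ} (hl : Generic S l)
    (DI DII : Finset ℕ) (x0 : ℂ) (h1 : XiC S l DI DII (x0 + I * gam S / 2) ≠ 0)
    (h2 : XiC S l DI DII (x0 - I * gam S / 2) ≠ 0) : ∃ n, multiPC S l DI DII n x0 ≠ 0 := by
  by_contra! hP
  have hX := continuous_XiC S l DI DII
  have ht := hl.partSubmodule_eq_top DI DII (eta S x0) hP
  have cA : ∀ T k, Continuous fun x => hA S l T (site S (DI.card + DII.card) x k) := fun T k =>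
    (continuous_hA S l T).comp (continuous_site S _ k)
  have cB : ∀ T k, Continuous fun x => hB S l T (site S (DI.card + DII.card) x k) := fun T k =>
    (continuous_hB S l T).comp (continuous_site S _ k)
  have hσ : (-1 : ℂ) ^ (DI.card + DII.card) ≠ 0 := pow_ne_zero _ (neg_ne_zero.2 one_ne_zero)
  have kA : ∃ T k, hA S l T (site S (DI.card + DII.card) x0 k) = 0 := by
    obtain ⟨f, hf, hf0, hf1⟩ := exists_winPart ht 1
    have := eq_of_goodPt (S := S) (l := l) (M := DI.card + DII.card)
      (f := fun x => pConst S DI DII * f x)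
      (g := fun x => (-1) ^ (DI.card + DII.card) * xiConst S DI DII *
      ((∏ i ∈ Finset.Ico (DII.card + 1) (DI.card + DII.card + 1),
          hA S l .I (site S (DI.card + DII.card) x i)) *
        ∏ i ∈ Finset.Ico (DI.card + 1) (DI.card + DII.card + 1),
          hA S l .II (site S (DI.card + DII.card) x i)) *
      XiC S l DI DII (x + I * gam S / 2)) (continuous_const.mul hf)
      ((continuous_const.mul ((continuous_finsetProd _ fun i _ => cA _ _).mul
        (continuous_finsetProd _ fun i _ => cA _ _))).mul
        (hX.comp (continuous_id.add continuous_const)))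
      (fun x hx => hx.winPart_left rfl rfl rfl (hf1 x hx)) x0
    simp only [hf0, mul_zero] at this
    have h := (mul_eq_zero.1 this.symm).resolve_right h1
    have h := (mul_eq_zero.1 h).resolve_left (mul_ne_zero hσ (xiConst_ne_zero _ _ _))
    rcases mul_eq_zero.1 h with h | h <;> obtain ⟨k, -, hk⟩ := Finset.prod_eq_zero_iff.1 h <;>
      exact ⟨_, _, hk⟩
  have kB : ∃ T k, hB S l T (site S (DI.card + DII.card) x0 k) = 0 := by
    obtain ⟨f, hf, hf0, hf1⟩ := exists_winPart ht 2
    have := eq_of_goodPt (S := S) (l := l) (M := DI.card + DII.card)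
      (f := fun x => pConst S DI DII * f x)
      (g := fun x => (-1) ^ (DI.card + DII.card) * xiConst S DI DII *
      ((∏ i ∈ Finset.Ico 2 (DI.card + DII.card + 2 - DII.card),
          hB S l .I (site S (DI.card + DII.card) x i)) *
        ∏ i ∈ Finset.Ico 2 (DI.card + DII.card + 2 - DI.card),
          hB S l .II (site S (DI.card + DII.card) x i)) *
      XiC S l DI DII (x - I * gam S / 2)) (continuous_const.mul hf)
      ((continuous_const.mul ((continuous_finsetProd _ fun i _ => cB _ _).mul
        (continuous_finsetProd _ fun i _ => cB _ _))).mul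
        (hX.comp (continuous_id.sub continuous_const)))
      (fun x hx => hx.winPart_right rfl rfl rfl (hf1 x hx)) x0
    simp only [hf0, mul_zero] at this
    have h := (mul_eq_zero.1 this.symm).resolve_right h2
    have h := (mul_eq_zero.1 h).resolve_left (mul_ne_zero hσ (xiConst_ne_zero _ _ _))
    rcases mul_eq_zero.1 h with h | h <;> obtain ⟨k, -, hk⟩ := Finset.prod_eq_zero_iff.1 h <;>
      exact ⟨_, _, hk⟩
  obtain ⟨T, k, hk⟩ := kA
  obtain ⟨T', k', hk'⟩ := kB
  refine hl.par.hB_ne_zero T T' _ _ ((k' : ℤ) - k) ?_ hk hk'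
  simp only [site]; push_cast; ring

/-! ### Continuity of the potentials -/

lemma tendsto_lin (S : System) {ι : Type*} {F : Filter ι} {s x : ι → ℂ} {s0 x0 : ℂ}
    (hs : Tendsto s F (𝓝 s0)) (hx : Tendsto x F (𝓝 x0)) :
    Tendsto (fun t => lin S (s t) (x t)) F (𝓝 (lin S s0 x0)) :=
  ((continuous_lin S continuous_fst continuous_snd).tendsto (s0, x0)).comp (hs.prodMk_nhds hx)

lemma continuous_potDen (S : System) : Continuous (potDen S) := by
  cases S <;> unfold potDen <;> fun_prop

lemma tendsto_pot (S : System) {ι : Type*} {F : Filter ι} {l : ι → Fin 4 → ℂ} {l0 : Fin 4 → ℂ}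
    {x : ι → ℂ} {x0 : ℂ} (hl : Tendsto l F (𝓝 l0)) (hx : Tendsto x F (𝓝 x0))
    (h : potDen S x0 ≠ 0) : Tendsto (fun t => pot S (l t) (x t)) F (𝓝 (pot S l0 x0)) := by
  have hk : ∀ k, Tendsto (fun t => l t k) F (𝓝 (l0 k)) := fun k =>
    ((continuous_apply k).tendsto l0).comp hl
  have hd := ((continuous_potDen S).tendsto x0).comp hx
  cases S with
  | cH => exact (tendsto_lin _ (hk 0) hx).mul (tendsto_lin _ (hk 1) hx)
  | W => exact (tendsto_finsetProd _ fun k _ => tendsto_lin _ (hk k) hx).div hd h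
  | AW q h0 h1 => exact (tendsto_finsetProd _ fun k _ => tendsto_lin _ (hk k) hx).div hd h

lemma tendsto_potStar (S : System) {ι : Type*} {F : Filter ι} {l : ι → Fin 4 → ℂ} {l0 : Fin 4 → ℂ}
    {x : ι → ℂ} {x0 : ℂ} (hl : Tendsto l F (𝓝 l0)) (hx : Tendsto x F (𝓝 x0))
    (h : potDen S (-x0) ≠ 0) :
    Tendsto (fun t => potStar S (l t) (x t)) F (𝓝 (potStar S l0 x0)) := by
  have hk : ∀ k, Tendsto (fun t => l t k) F (𝓝 (l0 k)) := fun k =>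
    ((continuous_apply k).tendsto l0).comp hl
  cases S with
  | cH => exact (tendsto_lin _ (hk 2) hx.neg).mul (tendsto_lin _ (hk 3) hx.neg)
  | W => exact tendsto_pot _ hl hx.neg h
  | AW q h0 h1 => exact tendsto_pot _ hl hx.neg h

lemma continuous_multiPC (S : System) (l : Fin 4 → ℂ) (DI DII : Finset ℕ) (n : ℕ) :
    Continuous (multiPC S l DI DII n) :=
  (Polynomial.continuous _).comp (continuous_eta S)

lemma continuous_calPC (S : System) (l : Fin 4 → ℂ) (DI DII : Finset ℕ) (N : ℕ)
    (a : Label DI DII N) : Continuous (calPC S l DI DII N a) :=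
  (Polynomial.continuous _).comp (continuous_eta S)

lemma tendsto_diffOp (S : System) (l : Fin 4 → ℂ) (DI DII : Finset ℕ) {Q : ℂ → ℂ}
    (hQ : Continuous Q) {x0 : ℂ} (h : potDen S x0 ≠ 0) (h' : potDen S (-x0) ≠ 0) :
    Tendsto (diffOp S l DI DII Q) (𝓝 x0) (𝓝 (diffOp S l DI DII Q x0)) := by
  have hX := continuous_XiC S l DI DII
  have c1 : Continuous fun x => XiC S l DI DII (x + I * gam S / 2) ^ 2 * Q (x - I * gam S) := by
    fun_prop
  have c2 : Continuous fun x => XiC S l DI DII (x - I * gam S / 2) ^ 2 * Q (x + I * gam S) := by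
    fun_prop
  have := ((tendsto_pot S (tendsto_const_nhds (x := lamD S l DI DII)) tendsto_id h).mul
    (c1.tendsto x0)).add ((tendsto_potStar S (tendsto_const_nhds (x := lamD S l DI DII))
      tendsto_id h').mul (c2.tendsto x0))
  simp only [← mul_assoc] at this
  exact this

/-! ### The difference equations at the zeros -/

/-- At a zero of a multi-indexed polynomial, the difference equations hold up to a common shift of
the energies. -/
lemma Generic.exists_root_eq {S : System} {l : Fin 4 → ℂ} (hl : Generic S l) (DI DII : Finset ℕ)
    (N : ℕ) {x0 : ℂ} (h : potDen S x0 ≠ 0) (h' : potDen S (-x0) ≠ 0)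
    (h1 : XiC S l DI DII (x0 + I * gam S / 2) ≠ 0) (h2 : XiC S l DI DII (x0 - I * gam S / 2) ≠ 0)
    (hP : multiPC S l DI DII N x0 = 0) :
    diffOp S l DI DII (multiPC S l DI DII N) x0 = 0 ∧ ∃ w : ℂ, ∀ a : Label DI DII N,
      diffOp S l DI DII (calPC S l DI DII N a) x0 = (eLab S l DI DII N a *
        (XiC S l DI DII (x0 + I * gam S / 2) * XiC S l DI DII (x0 - I * gam S / 2)) + w) *
          calPC S l DI DII N a x0 := by
  obtain ⟨n, hn⟩ := hl.exists_multiPC_ne_zero DI DII x0 h1 h2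
  set G := {x | GoodPt S l (DI.card + DII.card) x} with hG
  have : (𝓝[G] x0).NeBot := mem_closure_iff_nhdsWithin_neBot.1 (dense_goodPt S l _ x0)
  have hle : 𝓝[G] x0 ≤ 𝓝 x0 := nhdsWithin_le_nhds
  have hX := continuous_XiC S l DI DII
  have hXp : Continuous fun x => XiC S l DI DII (x + I * gam S / 2) := by fun_prop
  have hXm : Continuous fun x => XiC S l DI DII (x - I * gam S / 2) := by fun_prop
  have hδ : ∀ x, ∃ δ, GoodPt S l (DI.card + DII.card) x →
      SchEq S l (DI.card + DII.card) x DI DII δ := fun x => by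
    by_cases hx : GoodPt S l (DI.card + DII.card) x
    · obtain ⟨δ, hδ⟩ := hx.exists_schEq rfl
      exact ⟨δ, fun _ => hδ⟩
    · exact ⟨0, fun h => absurd h hx⟩
  choose δ hδ using hδ
  set nd : ℂ → ℂ := fun x => normDelta S l (DI.card + DII.card) x DI DII (δ x) with hnd
  have eig : ∀ n, ∀ᶠ x in 𝓝[G] x0, diffOp S l DI DII (multiPC S l DI DII n) x =
      (energy S l none n * (XiC S l DI DII (x + I * gam S / 2) *
        XiC S l DI DII (x - I * gam S / 2)) - nd x) * multiPC S l DI DII n x := fun n => by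
    filter_upwards [self_mem_nhdsWithin] with x hx
    exact sub_eq_zero.1 (GoodPt.eigen_eq hx rfl (hδ x hx) n)
  have tXX := ((hXp.tendsto x0).mul (hXm.tendsto x0)).mono_left hle
  have td : ∀ {Q : ℂ → ℂ}, Continuous Q →
      Tendsto (diffOp S l DI DII Q) (𝓝[G] x0) (𝓝 (diffOp S l DI DII Q x0)) := fun hQ =>
    (tendsto_diffOp S l DI DII hQ h h').mono_left hle
  have tP : ∀ n, Tendsto (multiPC S l DI DII n) (𝓝[G] x0) (𝓝 (multiPC S l DI DII n x0)) :=
    fun n => ((continuous_multiPC S l DI DII n).tendsto x0).mono_left hle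
  -- The constant of the deformed equation is recovered by dividing the equation of a P_{𝒟,n} that
  -- does not vanish at x0. It has a finite limit, although it is defined only at good points and
  -- contains window factors that may degenerate at x0.
  obtain ⟨d0, hd0⟩ : ∃ d0, Tendsto nd (𝓝[G] x0) (𝓝 d0) := by
    refine ⟨_, ((tXX.const_mul (energy S l none n)).sub
      ((td (continuous_multiPC S l DI DII n)).div (tP n) hn)).congr' ?_⟩
    filter_upwards [eig n, (tP n).eventually_ne hn] with x hx hne
    rw [Pi.div_apply, hx, mul_div_cancel_right₀ _ hne]
    ring
  refine ⟨?_, -d0, fun a => ?_⟩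
  · have := tendsto_nhds_unique ((td (continuous_multiPC S l DI DII N)).congr' (eig N))
      (((tXX.const_mul (energy S l none N)).sub hd0).mul (tP N))
    rw [this, hP, mul_zero]
  · obtain ⟨C, DI', DII', hC⟩ := hl.exists_label_bound DI DII N a
    have hX' := continuous_XiC S l DI' DII'
    have hXp' : Continuous fun x => XiC S l DI' DII' (x + I * gam S / 2) := by fun_prop
    have hXm' : Continuous fun x => XiC S l DI' DII' (x - I * gam S / 2) := by fun_prop
    have hcont := continuous_calPC S l DI DII N a
    have t1 := ((td hcont).sub (((tXX.const_mul (eLab S l DI DII N a)).sub hd0).mul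
      ((hcont.tendsto x0).mono_left hle))).norm
    have t2 := ((tP N).mul ((((hXp.tendsto x0).mul (hXm'.tendsto x0)).add
      ((hXm.tendsto x0).mul (hXp'.tendsto x0))).mono_left hle)).norm.const_mul C
    -- In the limit the bound on the right contains P(x0) = 0, so the remainder vanishes exactly.
    have := le_of_tendsto_of_tendsto t1 t2 (by
      filter_upwards [self_mem_nhdsWithin, hle ((hXp.tendsto x0).eventually_ne h1),
        hle ((hXm.tendsto x0).eventually_ne h2)] with x hx hx1 hx2
      exact hC x hx hx1 hx2 _ (hδ x hx))
    rw [hP, zero_mul, norm_zero, mul_zero] at this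
    have := norm_le_zero_iff.1 this
    linear_combination this

/-! ### Orthogonality from a symmetric kernel -/

/-- The usual argument for eigenvectors of a symmetric matrix: pairing each equation with the other
vector, the kernels cancel by symmetry and so do the terms with w, which leaves (e - e') times the
weighted sum. -/
lemma sum_eq_zero_of_symm {ι : Type*} [Fintype ι] {k : ι → ι → ℂ} (hk : ∀ i j, k i j = k j i)
    {y z F w : ι → ℂ} {e e' : ℂ} (hy : ∀ i, ∑ m, k i m * y m = (e + w i) * y i / F i)
    (hz : ∀ i, ∑ m, k i m * z m = (e' + w i) * z i / F i) (he : e ≠ e') :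
    ∑ i, 1 / F i * y i * z i = 0 := by
  have h1 : ∑ i, z i * ∑ m, k i m * y m = ∑ i, y i * ∑ m, k i m * z m := by
    simp only [Finset.mul_sum]
    rw [Finset.sum_comm]
    exact Finset.sum_congr rfl fun i _ => Finset.sum_congr rfl fun j _ => by rw [hk j i]; ring
  have h2 : (e - e') * ∑ i, 1 / F i * y i * z i = 0 := by
    have : (e - e') * ∑ i, 1 / F i * y i * z i =
        ∑ i, z i * ∑ m, k i m * y m - ∑ i, y i * ∑ m, k i m * z m := by
      rw [Finset.mul_sum, ← Finset.sum_sub_distrib]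
      exact Finset.sum_congr rfl fun i _ => by rw [hy, hz]; ring
    rw [this, h1, sub_self]
  exact (mul_eq_zero.1 h2).resolve_left (sub_ne_zero.2 he)

/-! ### Partial fractions -/

lemma eq_C_mul_nodal {ι : Type*} [Fintype ι] {P : ℂ[X]} {r : ι → ℂ} (hr : Function.Injective r)
    (hroot : ∀ i, P.eval (r i) = 0) (hcard : P.natDegree = Fintype.card ι) (hP : P ≠ 0) :
    P = C P.leadingCoeff * Lagrange.nodal Finset.univ r := by
  have hlc := leadingCoeff_ne_zero.2 hP
  have hd : (C P.leadingCoeff * Lagrange.nodal Finset.univ r).degree = P.degree := by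
    rw [degree_C_mul hlc, Lagrange.degree_nodal, degree_eq_natDegree hP, hcard, Finset.card_univ]
  refine Polynomial.eq_of_degree_le_of_eval_index_eq Finset.univ hr.injOn ?_ hd.symm ?_ ?_
  · rw [degree_eq_natDegree hP, hcard, Finset.card_univ]
  · rw [leadingCoeff_mul, leadingCoeff_C, (Lagrange.nodal_monic).leadingCoeff, mul_one]
  · intro i _
    rw [hroot, eval_mul, Lagrange.eval_nodal_at_node (Finset.mem_univ i), mul_zero]

/-- The partial fraction expansion of Q/P at the simple zeros of P, in the form of barycentric
Lagrange interpolation. -/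
lemma eval_eq_sum_div {ι : Type*} [Fintype ι] {P Q : ℂ[X]} {r : ι → ℂ}
    (hr : Function.Injective r) (hroot : ∀ i, P.eval (r i) = 0)
    (hcard : P.natDegree = Fintype.card ι) (hP : P ≠ 0) (hQ : Q.degree < Fintype.card ι) {z : ℂ}
    (hz : P.eval z ≠ 0) :
    Q.eval z = P.eval z * ∑ m, 1 / (z - r m) * (Q.eval (r m) / P.derivative.eval (r m)) := by
  classical
  have hlc := leadingCoeff_ne_zero.2 hP
  have h1 := Lagrange.eq_interpolate (s := Finset.univ) (v := r) (f := Q) hr.injOn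
    (by rwa [Finset.card_univ])
  have h2 := eq_C_mul_nodal hr hroot hcard hP
  have h3 : ∀ i ∈ Finset.univ, z ≠ r i := fun i _ h => hz (h ▸ hroot i)
  have h4 : Q.eval z = _ := (congrArg (eval z) h1).trans (Lagrange.eval_interpolate_not_at_node _ h3)
  rw [h4]
  have h5 : ∀ m, P.derivative.eval (r m) =
      P.leadingCoeff * (Lagrange.nodal Finset.univ r).derivative.eval (r m) := fun m => by
    rw [congrArg (fun p => eval (r m) (derivative p)) h2]
    simp
  have h6 : P.eval z = P.leadingCoeff * (Lagrange.nodal Finset.univ r).eval z := by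
    rw [congrArg (eval z) h2, eval_mul, eval_C]
  rw [h6, mul_assoc, mul_left_comm, Finset.mul_sum _ _ P.leadingCoeff]
  refine congrArg _ (Finset.sum_congr rfl fun m hm => ?_)
  rw [Lagrange.nodalWeight_eq_eval_derivative_nodal hm, h5]
  field_simp

/-- The product which is the inverse of the kernel. -/
lemma eta_shift_symm (S : System) (x y : ℂ) :
    (eta S (x - I * gam S) - eta S y) * (eta S (x + I * gam S) - eta S y) =
      (eta S (y - I * gam S) - eta S x) * (eta S (y + I * gam S) - eta S x) := by
  cases S with
  | cH => simp only [eta, gam]; ring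
  | W => simp only [eta, gam]; ring
  | AW q h0 h1 =>
    simp only [eta, Complex.cos_sub, Complex.cos_add]
    have e := Complex.sin_sq_add_cos_sq (I * gam (.AW q h0 h1))
    have e1 := Complex.sin_sq_add_cos_sq x
    have e2 := Complex.sin_sq_add_cos_sq y
    linear_combination (Complex.cos x ^ 2 - Complex.cos y ^ 2) * e +
      Complex.sin (I * gam (.AW q h0 h1)) ^ 2 * (e2 - e1)

/-! ### Degrees -/

lemma half_mul_pred (m : ℤ) : (m + 2) * (m + 2 - 1) / 2 = m * (m - 1) / 2 + (2 * m + 1) := by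
  rw [← Int.add_mul_ediv_right _ _ (by norm_num : (2 : ℤ) ≠ 0)]
  congr 1
  ring

/-- An exchange lowers ℓ by d - ε. A removal lowers it by d + d' + 1: with m seeds left, the
quadratic term contributes 2m + 1 and the mixed term -(2m + 2). The strict inequality is what
partial fractions require. -/
lemma degree_calP_lt (S : System) (l : Fin 4 → ℂ) (DI DII : Finset ℕ) (N : ℕ)
    (a : Label DI DII N) : ((calP S l DI DII N a).natDegree : ℤ) < ell DI DII + N := by
  rcases a with n | ⟨⟨d, v⟩, hd, hv, hlt⟩ | ⟨⟨d, v⟩, hd, hv, hlt⟩ | ⟨⟨d, hd⟩, ⟨d', hd'⟩⟩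
  · refine (natDegree_multiP_le S l DI DII n).trans_lt ?_
    have := n.2
    omega
  · refine (natDegree_multiP_le S l _ DII N).trans_lt ?_
    have hv' : v ∉ DI.erase d := fun h => hv (Finset.mem_of_mem_erase h)
    have hlt : v < d := hlt
    have c : (insert v (DI.erase d)).card = DI.card := by
      rw [Finset.card_insert_of_notMem hv', Finset.card_erase_add_one hd]
    have s : (d : ℤ) + ∑ i ∈ DI.erase d, (i : ℤ) = ∑ i ∈ DI, (i : ℤ) :=
      Finset.add_sum_erase DI (fun i => (i : ℤ)) hd
    simp only [ell]
    rw [c, Finset.sum_insert hv', ← s]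
    omega
  · refine (natDegree_multiP_le S l DI _ N).trans_lt ?_
    have hv' : v ∉ DII.erase d := fun h => hv (Finset.mem_of_mem_erase h)
    have hlt : v < d := hlt
    have c : (insert v (DII.erase d)).card = DII.card := by
      rw [Finset.card_insert_of_notMem hv', Finset.card_erase_add_one hd]
    have s : (d : ℤ) + ∑ i ∈ DII.erase d, (i : ℤ) = ∑ i ∈ DII, (i : ℤ) :=
      Finset.add_sum_erase DII (fun i => (i : ℤ)) hd
    simp only [ell]
    rw [c, Finset.sum_insert hv', ← s]
    omega
  · refine (natDegree_multiP_le S l _ _ N).trans_lt ?_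
    have c := Finset.card_erase_add_one hd
    have c' := Finset.card_erase_add_one hd'
    have s : (d : ℤ) + ∑ i ∈ DI.erase d, (i : ℤ) = ∑ i ∈ DI, (i : ℤ) :=
      Finset.add_sum_erase DI (fun i => (i : ℤ)) hd
    have s' : (d' : ℤ) + ∑ i ∈ DII.erase d', (i : ℤ) = ∑ i ∈ DII, (i : ℤ) :=
      Finset.add_sum_erase DII (fun i => (i : ℤ)) hd'
    have hh := half_mul_pred (((DI.erase d).card : ℤ) + (DII.erase d').card)
    simp only [ell]
    rw [← s, ← s', ← c, ← c']
    push_cast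
    rw [show ((DI.erase d).card : ℤ) + 1 + ((DII.erase d').card + 1) =
      (DI.erase d).card + (DII.erase d').card + 2 by ring, hh]
    have e : 2 * (((DI.erase d).card : ℤ) + 1) * ((DII.erase d').card + 1) =
        2 * ((DI.erase d).card : ℤ) * (DII.erase d').card + 2 * (DI.erase d).card +
          2 * (DII.erase d').card + 2 := by ring
    rw [e]
    omega

/-! ### Orthogonality for generic parameters -/

/-- By `hAB` the two terms of the operator carry opposite factors A p and B p', so the expansions
enter through the difference 1/(u - r) - 1/(u' - r), which is (u' - u) times the kernel. The same
relation reduces the definition of F to A p (u' - u) = F P' X. -/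
lemma kernel_eq {ι : Type*} [Fintype ι] {A B p p' u u' X w e Pp F qi Q Q' : ℂ} {r y : ι → ℂ}
    (hPp : Pp ≠ 0) (hX : X ≠ 0) (hAB : A * p + B * p' = 0)
    (hF : F = -1 / (Pp * X) * (u * A * p + u' * B * p')) (hF0 : F ≠ 0)
    (hu : ∀ m, u - r m ≠ 0) (hu' : ∀ m, u' - r m ≠ 0)
    (hQ : Q = p * ∑ m, 1 / (u - r m) * y m) (hQ' : Q' = p' * ∑ m, 1 / (u' - r m) * y m)
    (heq : A * Q + B * Q' = (e * X + w) * qi) :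
    ∑ m, 1 / ((u - r m) * (u' - r m)) * y m = (e + w / X) * (qi / Pp) / F := by
  have h1 : ∑ m, 1 / (u - r m) * y m - ∑ m, 1 / (u' - r m) * y m =
      (u' - u) * ∑ m, 1 / ((u - r m) * (u' - r m)) * y m := by
    rw [Finset.mul_sum, ← Finset.sum_sub_distrib]
    refine Finset.sum_congr rfl fun m _ => ?_
    have := hu m
    have := hu' m
    field_simp
    ring
  have h2 : A * Q + B * Q' =
      A * p * ((u' - u) * ∑ m, 1 / ((u - r m) * (u' - r m)) * y m) := by
    rw [hQ, hQ', ← h1]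
    linear_combination (∑ m, 1 / (u' - r m) * y m) * hAB
  have h3 : F * (Pp * X) = A * p * (u' - u) := by
    rw [hF]
    field_simp
    linear_combination -u' * hAB
  rw [heq] at h2
  generalize ∑ m, 1 / ((u - r m) * (u' - r m)) * y m = Z at h2 ⊢
  rw [eq_div_iff hF0]
  field_simp
  linear_combination -h2 + Z * h3

lemma Generic.sum_eq_zero {S : System} {l : Fin 4 → ℂ} (hl : Generic S l) (DI DII : Finset ℕ)
    (N : ℕ) {ι : Type*} [Fintype ι] (x : ι → ℂ) (hinj : Function.Injective fun i => eta S (x i))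
    (hroot : ∀ i, multiPC S l DI DII N (x i) = 0)
    (hcard : (multiP S l DI DII N).natDegree = Fintype.card ι)
    (hdeg : ((multiP S l DI DII N).natDegree : ℤ) = ell DI DII + N)
    (hreg : ∀ i, IsRegular S l DI DII N (x i)) (hF : ∀ i, FC S l DI DII N (x i) ≠ 0)
    {a b : Label DI DII N} (hab : a ≠ b) :
    ∑ i, 1 / FC S l DI DII N (x i) *
      (calPC S l DI DII N a (x i) / (multiP S l DI DII N).derivative.eval (eta S (x i))) *
      (calPC S l DI DII N b (x i) / (multiP S l DI DII N).derivative.eval (eta S (x i))) = 0 := by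
  have hre := fun i => hl.exists_root_eq DI DII N (hreg i).1 (hreg i).2.1 (hreg i).2.2.1
    (hreg i).2.2.2.1 (hroot i)
  choose w hw using fun i => (hre i).2
  set X : ι → ℂ := fun i =>
    XiC S l DI DII (x i + I * gam S / 2) * XiC S l DI DII (x i - I * gam S / 2) with hX
  have hX0 : ∀ i, X i ≠ 0 := fun i => mul_ne_zero (hreg i).2.2.1 (hreg i).2.2.2.1
  refine sum_eq_zero_of_symm (k := fun i m => 1 / ((eta S (x i - I * gam S) - eta S (x m)) *
    (eta S (x i + I * gam S) - eta S (x m)))) (fun i j => by rw [eta_shift_symm])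
    (w := fun i => w i / X i) (e := eLab S l DI DII N a) (e' := eLab S l DI DII N b) ?_ ?_
    (fun h => hab (hl.eLab_injective DI DII N h))
  all_goals
    intro i
    have hP0 : multiP S l DI DII N ≠ 0 := fun h => (hreg i).2.2.2.2 (by rw [h]; simp)
    obtain ⟨hd1, hd2, hx1, hx2, hd⟩ := hreg i
    have hA := (hre i).1
    have hFi : FC S l DI DII N (x i) =
        -1 / ((multiP S l DI DII N).derivative.eval (eta S (x i)) * X i) *
        (eta S (x i - I * gam S) * (pot S (lamD S l DI DII) (x i) *
            XiC S l DI DII (x i + I * gam S / 2) ^ 2) * multiPC S l DI DII N (x i - I * gam S) +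
          eta S (x i + I * gam S) * (potStar S (lamD S l DI DII) (x i) *
            XiC S l DI DII (x i - I * gam S / 2) ^ 2) * multiPC S l DI DII N (x i + I * gam S)) := by
      rw [FC, hX]
      field_simp
    -- The two terms of the equation of P at a zero are opposite. If one vanished, both would, and F
    -- with them. Hence P does not vanish at η(x_i ∓ iγ), and the expansions may be evaluated there.
    have hAP : pot S (lamD S l DI DII) (x i) * XiC S l DI DII (x i + I * gam S / 2) ^ 2 *
        multiPC S l DI DII N (x i - I * gam S) ≠ 0 := by
      intro h0
      rw [diffOp, h0, zero_add] at hA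
      refine hF i ?_
      rw [hFi, mul_assoc (eta S _), mul_assoc (eta S _), h0, hA]
      ring
    have hPm := right_ne_zero_of_mul hAP
    have hPp : multiPC S l DI DII N (x i + I * gam S) ≠ 0 := by
      intro h0
      rw [diffOp, h0, mul_zero, add_zero] at hA
      exact hAP hA
    refine kernel_eq hd (hX0 i) hA hFi (hF i)
      (fun m h => hPm (by rw [multiPC, sub_eq_zero.1 h]; exact hroot m))
      (fun m h => hPp (by rw [multiPC, sub_eq_zero.1 h]; exact hroot m))
      (eval_eq_sum_div hinj hroot hcard hP0 ?_ hPm) (eval_eq_sum_div hinj hroot hcard hP0 ?_ hPp)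
      (hw i _)
    all_goals
      have := degree_calP_lt S l DI DII N a
      have := degree_calP_lt S l DI DII N b
      refine degree_le_natDegree.trans_lt ?_
      rw [← hcard]
      exact_mod_cast (by omega)

/-! ### Convergence of polynomials and of their zeros -/

lemma tendsto_eval_of_coeff {p : ℕ → ℂ[X]} {p0 : ℂ[X]} {d : ℕ} (hd : ∀ k, (p k).natDegree ≤ d)
    (hd0 : p0.natDegree ≤ d) (hp : ∀ i, Tendsto (fun k => (p k).coeff i) atTop (𝓝 (p0.coeff i)))
    {z : ℕ → ℂ} {z0 : ℂ} (hz : Tendsto z atTop (𝓝 z0)) :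
    Tendsto (fun k => (p k).eval (z k)) atTop (𝓝 (p0.eval z0)) := by
  rw [eval_eq_sum_range' (Nat.lt_succ_of_le hd0)]
  refine (tendsto_finsetSum (Finset.range (d + 1)) fun i _ => (hp i).mul (hz.pow i)).congr fun k => ?_
  rw [eval_eq_sum_range' (Nat.lt_succ_of_le (hd k))]

/-- If all roots had distance at least ε from a, the factorization would bound |g(a)| below by
|leading coefficient| · ε^deg. -/
lemma exists_root_norm_lt {g : ℂ[X]} {a : ℂ} {ε : ℝ} (hε : 0 < ε)
    (h : ‖g.eval a‖ < ‖g.leadingCoeff‖ * ε ^ g.natDegree) : ∃ b ∈ g.roots, ‖a - b‖ < ε := by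
  have hs := IsAlgClosed.splits g
  by_contra! hc
  have h1 := Multiset.prod_map_le_prod_map₀ (fun _ => ε) (fun b => ‖a - b‖)
    (fun _ _ => hε.le) hc
  rw [Multiset.map_const', Multiset.prod_replicate, ← hs.natDegree_eq_card_roots] at h1
  have h2 : (g.roots.map fun b => ‖a - b‖).prod = ‖(g.roots.map fun b => a - b).prod‖ := by
    have := Multiset.prod_hom (g.roots.map fun b => a - b) (normHom : ℂ →*₀ ℝ)
    rw [Multiset.map_map] at this
    exact this
  rw [hs.eval_eq_prod_roots, norm_mul, ← h2] at h
  exact absurd h (not_lt.2 (mul_le_mul_of_nonneg_left h1 (norm_nonneg _)))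

lemma eventually_natDegree_eq {p : ℕ → ℂ[X]} {p0 : ℂ[X]} (hp0 : p0 ≠ 0)
    (hd : ∀ k, (p k).natDegree ≤ p0.natDegree)
    (hp : ∀ i, Tendsto (fun k => (p k).coeff i) atTop (𝓝 (p0.coeff i))) :
    ∀ᶠ k in atTop, (p k).natDegree = p0.natDegree := by
  filter_upwards [(hp p0.natDegree).eventually_ne (leadingCoeff_ne_zero.2 hp0)] with k hk
  exact le_antisymm (hd k) (le_natDegree_of_ne_zero hk)

/-- The values at a tend to zero while the leading coefficients stay away from zero, so roots come
arbitrarily close to a. The sequence takes the root nearest to a, and an irrelevant value if there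
is none. -/
lemma exists_tendsto_root {p : ℕ → ℂ[X]} {p0 : ℂ[X]} (hp0 : p0 ≠ 0)
    (hd : ∀ k, (p k).natDegree ≤ p0.natDegree)
    (hp : ∀ i, Tendsto (fun k => (p k).coeff i) atTop (𝓝 (p0.coeff i))) {a : ℂ}
    (ha : p0.eval a = 0) :
    ∃ ρ : ℕ → ℂ, Tendsto ρ atTop (𝓝 a) ∧ ∀ᶠ k in atTop, (p k).eval (ρ k) = 0 := by
  have hlc := leadingCoeff_ne_zero.2 hp0
  have key : ∀ ε : ℝ, 0 < ε → ∀ᶠ k in atTop, ∃ b ∈ (p k).roots, ‖a - b‖ < ε := fun ε hε => by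
    have h1 := (tendsto_eval_of_coeff hd le_rfl hp (tendsto_const_nhds (x := a))).norm
    rw [ha, norm_zero] at h1
    have h2 := ((hp p0.natDegree).norm).mul_const (ε ^ p0.natDegree)
    have h3 : 0 < ‖p0.coeff p0.natDegree‖ * ε ^ p0.natDegree :=
      mul_pos (norm_pos_iff.2 hlc) (pow_pos hε _)
    filter_upwards [h1.eventually_lt h2 h3, eventually_natDegree_eq hp0 hd hp] with k hk hk'
    refine exists_root_norm_lt hε ?_
    rw [leadingCoeff, hk']
    exact hk
  have hmin : ∀ k, ∃ ρ, (∃ b, b ∈ (p k).roots) →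
      ρ ∈ (p k).roots ∧ ∀ b ∈ (p k).roots, ‖a - ρ‖ ≤ ‖a - b‖ := fun k => by
    by_cases h : ∃ b, b ∈ (p k).roots
    · obtain ⟨b, hb⟩ := h
      obtain ⟨ρ, h1, h2⟩ := (p k).roots.toFinset.exists_min_image (fun b => ‖a - b‖)
        ⟨b, Multiset.mem_toFinset.2 hb⟩
      exact ⟨ρ, fun _ => ⟨Multiset.mem_toFinset.1 h1, fun b hb =>
        h2 b (Multiset.mem_toFinset.2 hb)⟩⟩
    · exact ⟨0, fun h' => absurd h' h⟩
  choose ρ hρ using hmin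
  refine ⟨ρ, Metric.tendsto_nhds.2 fun ε hε => ?_, ?_⟩
  · filter_upwards [key ε hε] with k hk
    obtain ⟨b, hb, hlt⟩ := hk
    rw [dist_comm, dist_eq_norm]
    exact ((hρ k ⟨b, hb⟩).2 b hb).trans_lt hlt
  · filter_upwards [key 1 one_pos] with k hk
    obtain ⟨b, hb, -⟩ := hk
    exact isRoot_of_mem_roots (hρ k ⟨b, hb⟩).1

/-! ### Local inverses of the sinusoidal coordinate -/

lemma eta_surjective (S : System) : Function.Surjective (eta S) := by
  cases S with
  | cH => exact Function.surjective_id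
  | W => exact fun z => IsAlgClosed.exists_pow_nat_eq z two_pos
  | AW q h0 h1 => exact Complex.cos_surjective

lemma exists_hasStrictDerivAt_eta (S : System) (x : ℂ) (h : potDen S x ≠ 0) :
    ∃ d, d ≠ 0 ∧ HasStrictDerivAt (eta S) d x := by
  cases S with
  | cH => exact ⟨1, one_ne_zero, hasStrictDerivAt_id x⟩
  | W =>
    have e : HasStrictDerivAt (fun x : ℂ => x ^ 2) (2 * x) x := by
      simpa using hasStrictDerivAt_pow 2 x
    refine ⟨2 * x, fun h0 => h ?_, e⟩
    simp only [potDen]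
    linear_combination I * (2 * I * x + 1) * h0
  | AW q h0 h1 =>
    refine ⟨-Complex.sin x, fun h0 => h ?_, Complex.hasStrictDerivAt_cos x⟩
    simp only [potDen]
    rw [neg_eq_zero, Complex.sin_eq_zero_iff] at h0
    obtain ⟨k, rfl⟩ := h0
    rw [show 2 * I * ((k : ℂ) * Real.pi) = k * (2 * Real.pi * I) by ring,
      Complex.exp_int_mul_two_pi_mul_I, sub_self, zero_mul]

/-- Critical points of η are zeros of `potDen`. At the points concerned η therefore has a local
inverse, which lifts convergence of zeros in η to convergence in x. -/
lemma exists_tendsto_eta (S : System) {x0 : ℂ} (h : potDen S x0 ≠ 0) {ρ : ℕ → ℂ}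
    (hρ : Tendsto ρ atTop (𝓝 (eta S x0))) :
    ∃ x : ℕ → ℂ, Tendsto x atTop (𝓝 x0) ∧ ∀ᶠ k in atTop, eta S (x k) = ρ k := by
  obtain ⟨d, hd, hs⟩ := exists_hasStrictDerivAt_eta S x0 h
  refine ⟨fun k => hs.localInverse _ _ _ hd (ρ k), ?_, hρ.eventually (hs.eventually_right_inverse hd)⟩
  have := (hs.hasStrictFDerivAt_equiv hd).localInverse_tendsto
  exact this.comp hρ

/-! ### Continuity in the parameters -/

lemma tendsto_lamD (S : System) (DI DII : Finset ℕ) {ls : ℕ → Fin 4 → ℂ} {l : Fin 4 → ℂ}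
    (ht : Tendsto ls atTop (𝓝 l)) :
    Tendsto (fun k => lamD S (ls k) DI DII) atTop (𝓝 (lamD S l DI DII)) := by
  refine tendsto_pi_nhds.2 fun i => ?_
  have := ((continuous_apply i).tendsto l).comp ht
  exact (this.add tendsto_const_nhds).add tendsto_const_nhds

section

variable {S : System} {DI DII : Finset ℕ} {ls : ℕ → Fin 4 → ℂ} {l : Fin 4 → ℂ}
  {x : ℕ → ℂ} {x0 : ℂ}

lemma natDegree_multiP_le_toNat (S : System) (l : Fin 4 → ℂ) (DI DII : Finset ℕ) (n : ℕ) :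
    (multiP S l DI DII n).natDegree ≤ (ell DI DII + n).toNat := by
  have := natDegree_multiP_le S l DI DII n
  omega

lemma tendsto_multiPC (ht : Tendsto ls atTop (𝓝 l)) (hx : Tendsto x atTop (𝓝 x0)) (n : ℕ) :
    Tendsto (fun k => multiPC S (ls k) DI DII n (x k)) atTop (𝓝 (multiPC S l DI DII n x0)) :=
  tendsto_eval_of_coeff (fun k => natDegree_multiP_le_toNat S (ls k) DI DII n)
    (natDegree_multiP_le_toNat S l DI DII n) (tendsto_coeff_multiP S DI DII n ht)
    (((continuous_eta S).tendsto x0).comp hx)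

lemma tendsto_derivative (ht : Tendsto ls atTop (𝓝 l)) (hx : Tendsto x atTop (𝓝 x0)) (n : ℕ) :
    Tendsto (fun k => (multiP S (ls k) DI DII n).derivative.eval (eta S (x k))) atTop
      (𝓝 ((multiP S l DI DII n).derivative.eval (eta S x0))) := by
  refine tendsto_eval_of_coeff
    (fun k => (natDegree_derivative_le _).trans ((Nat.sub_le _ _).trans
      (natDegree_multiP_le_toNat S (ls k) DI DII n)))
    ((natDegree_derivative_le _).trans ((Nat.sub_le _ _).trans
      (natDegree_multiP_le_toNat S l DI DII n))) (fun i => ?_)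
    (((continuous_eta S).tendsto x0).comp hx)
  simp only [coeff_derivative]
  exact (tendsto_coeff_multiP S DI DII n ht (i + 1)).mul_const _

lemma tendsto_XiC (ht : Tendsto ls atTop (𝓝 l)) (hx : Tendsto x atTop (𝓝 x0)) :
    Tendsto (fun k => XiC S (ls k) DI DII (x k)) atTop (𝓝 (XiC S l DI DII x0)) :=
  tendsto_eval_of_coeff (fun k => natDegree_Xi_le S (ls k) DI DII)
    (natDegree_Xi_le S l DI DII) (tendsto_coeff_Xi S DI DII ht)
    (((continuous_eta S).tendsto x0).comp hx)

lemma tendsto_calPC (ht : Tendsto ls atTop (𝓝 l)) (hx : Tendsto x atTop (𝓝 x0)) {N : ℕ}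
    (a : Label DI DII N) :
    Tendsto (fun k => calPC S (ls k) DI DII N a (x k)) atTop (𝓝 (calPC S l DI DII N a x0)) := by
  rcases a with n | p | p | p
  · exact tendsto_multiPC ht hx n
  · exact tendsto_multiPC ht hx N
  · exact tendsto_multiPC ht hx N
  · exact tendsto_multiPC ht hx N

lemma tendsto_FC (ht : Tendsto ls atTop (𝓝 l)) (hx : Tendsto x atTop (𝓝 x0)) (N : ℕ)
    (hreg : IsRegular S l DI DII N x0) :
    Tendsto (fun k => FC S (ls k) DI DII N (x k)) atTop (𝓝 (FC S l DI DII N x0)) := by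
  obtain ⟨h1, h2, h3, h4, h5⟩ := hreg
  have hl := tendsto_lamD S DI DII ht
  have e := (continuous_eta S)
  have p1 := hx.add_const (I * gam S)
  have p2 := hx.sub_const (I * gam S)
  have p3 := hx.add_const (I * gam S / 2)
  have p4 := hx.sub_const (I * gam S / 2)
  exact ((tendsto_const_nhds (x := (-1 : ℂ))).div (tendsto_derivative ht hx N) h5).mul
    ((((((e.tendsto _).comp p2).mul (tendsto_pot S hl hx h1)).mul
      ((tendsto_XiC ht p3).div (tendsto_XiC ht p4) h4)).mul (tendsto_multiPC ht p2 N)).add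
    (((((e.tendsto _).comp p1).mul (tendsto_potStar S hl hx h2)).mul
      ((tendsto_XiC ht p4).div (tendsto_XiC ht p3) h3)).mul (tendsto_multiPC ht p1 N)))

lemma eventually_isRegular (ht : Tendsto ls atTop (𝓝 l)) (hx : Tendsto x atTop (𝓝 x0)) (N : ℕ)
    (hreg : IsRegular S l DI DII N x0) : ∀ᶠ k in atTop, IsRegular S (ls k) DI DII N (x k) := by
  obtain ⟨h1, h2, h3, h4, h5⟩ := hreg
  filter_upwards [(((continuous_potDen S).tendsto _).comp hx).eventually_ne h1,
    (((continuous_potDen S).tendsto _).comp hx.neg).eventually_ne h2,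
    (tendsto_XiC ht (hx.add_const (I * gam S / 2))).eventually_ne h3,
    (tendsto_XiC ht (hx.sub_const (I * gam S / 2))).eventually_ne h4,
    (tendsto_derivative ht hx N).eventually_ne h5] with k a1 a2 a3 a4 a5
  exact ⟨a1, a2, a3, a4, a5⟩

end

/-! ### Orthogonality -/

/-- The orthogonality relations, on points over the zeros. -/
lemma sum_eq_zero {S : System} (l : Fin 4 → ℂ) (DI DII : Finset ℕ)
    (N : ℕ) {ι : Type*} [Fintype ι] (x : ι → ℂ) (hinj : Function.Injective fun i => eta S (x i))
    (hroot : ∀ i, multiPC S l DI DII N (x i) = 0)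
    (hcard : (multiP S l DI DII N).natDegree = Fintype.card ι)
    (hdeg : ((multiP S l DI DII N).natDegree : ℤ) = ell DI DII + N)
    (hreg : ∀ i, IsRegular S l DI DII N (x i)) (hF : ∀ i, FC S l DI DII N (x i) ≠ 0)
    {a b : Label DI DII N} (hab : a ≠ b) :
    ∑ i, 1 / FC S l DI DII N (x i) *
      (calPC S l DI DII N a (x i) / (multiP S l DI DII N).derivative.eval (eta S (x i))) *
      (calPC S l DI DII N b (x i) / (multiP S l DI DII N).derivative.eval (eta S (x i))) = 0 := by
  by_cases hι : IsEmpty ι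
  · simp
  obtain ⟨i0⟩ := not_isEmpty_iff.1 hι
  have hP0 : multiP S l DI DII N ≠ 0 := fun h => (hreg i0).2.2.2.2 (by rw [h]; simp)
  -- Along generic parameters tending to l, each zero of the limit is approached by zeros, which are
  -- lifted to points near x i. Eventually they stay distinct, exhaust the zeros because the degree
  -- is attained, and inherit regularity and F ≠ 0, so the generic relation applies and passes to
  -- the limit.
  obtain ⟨ls, hgen, ht⟩ := exists_seq_generic S l
  have hdk : ∀ k, (multiP S (ls k) DI DII N).natDegree ≤ (multiP S l DI DII N).natDegree :=
    fun k => by have := natDegree_multiP_le S (ls k) DI DII N; omega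
  have hc := tendsto_coeff_multiP S DI DII N ht
  choose ρ hρ hρ0 using fun i => exists_tendsto_root hP0 hdk hc (hroot i)
  choose y hy hyρ using fun i => exists_tendsto_eta S (hreg i).1 (hρ i)
  have hlim := tendsto_finsetSum Finset.univ fun i (_ : i ∈ Finset.univ) =>
    (((tendsto_const_nhds (x := (1 : ℂ))).div (tendsto_FC ht (hy i) N (hreg i)) (hF i)).mul
      ((tendsto_calPC (S := S) ht (hy i) a).div (tendsto_derivative ht (hy i) N) (hreg i).2.2.2.2)).mul
      ((tendsto_calPC (S := S) ht (hy i) b).div (tendsto_derivative ht (hy i) N) (hreg i).2.2.2.2)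
  refine tendsto_nhds_unique hlim (tendsto_const_nhds.congr' ?_)
  have hinj' : ∀ i j, i ≠ j → ∀ᶠ k in atTop, eta S (y i k) ≠ eta S (y j k) := fun i j hij => by
    have t := (((continuous_eta S).tendsto _).comp (hy i)).sub
      (((continuous_eta S).tendsto _).comp (hy j))
    filter_upwards [t.eventually_ne (sub_ne_zero.2 fun h => hij (hinj h))] with k hk
    exact sub_ne_zero.1 hk
  filter_upwards [eventually_all.2 hρ0, eventually_all.2 hyρ,
    eventually_all.2 fun i => eventually_isRegular ht (hy i) N (hreg i),
    eventually_all.2 fun i => (tendsto_FC ht (hy i) N (hreg i)).eventually_ne (hF i),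
    eventually_all.2 fun i => eventually_all.2 fun j => eventually_imp_distrib_left.2 (hinj' i j),
    eventually_natDegree_eq hP0 hdk hc] with k k1 k2 k3 k4 k5 k6
  refine ((hgen k).sum_eq_zero DI DII N (fun i => y i k) (fun i j hij => ?_) (fun i => ?_)
    (k6.trans hcard) (by rw [k6, hdeg]) k3 k4 hab).symm
  · by_contra hne
    exact k5 i j hne hij
  · rw [multiPC, k2, k1]

/-! ### Polynomials in the sinusoidal coordinate -/

/-- The odd companion of the sinusoidal coordinate. -/
noncomputable def oddPart : System → ℂ → ℂ
  | .cH, _ => 0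
  | .W, x => x
  | .AW _ _ _, x => Complex.sin x

/-- The functions generated by the sinusoidal coordinate and its odd companion. -/
noncomputable def etaAlg (S : System) : Subalgebra ℂ (ℂ → ℂ) :=
  Algebra.adjoin ℂ {eta S, oddPart S}

lemma eta_mem (S : System) : eta S ∈ etaAlg S := Algebra.subset_adjoin (Set.mem_insert _ _)

lemma oddPart_mem (S : System) : oddPart S ∈ etaAlg S :=
  Algebra.subset_adjoin (Set.mem_insert_of_mem _ rfl)

lemma const_mem (S : System) (c : ℂ) : (fun _ => c) ∈ etaAlg S := (etaAlg S).algebraMap_mem c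

lemma oddPart_sq (S : System) : ∃ p : ℂ[X], ∀ x, oddPart S x * oddPart S x = p.eval (eta S x) := by
  cases S with
  | cH => exact ⟨0, fun x => by simp [oddPart]⟩
  | W => exact ⟨X, fun x => by simp [oddPart, eta, sq]⟩
  | AW q h0 h1 =>
    refine ⟨1 - X ^ 2, fun x => ?_⟩
    simp only [oddPart, eta, eval_sub, eval_one, eval_pow, eval_X]
    linear_combination Complex.sin_sq_add_cos_sq x

/-- The square of the odd companion is a polynomial in η, so 1 and the companion generate the
algebra as a module over polynomials in η. -/
lemma exists_form {S : System} {f : ℂ → ℂ} (hf : f ∈ etaAlg S) : ∃ A B : ℂ[X],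
    ∀ x, f x = A.eval (eta S x) + oddPart S x * B.eval (eta S x) := by
  induction hf using Algebra.adjoin_induction with
  | mem f hf =>
    rcases hf with rfl | rfl
    · exact ⟨X, 0, fun x => by simp⟩
    · exact ⟨0, 1, fun x => by simp⟩
  | algebraMap c => exact ⟨C c, 0, fun x => by simp⟩
  | add f g _ _ hf hg =>
    obtain ⟨A, B, h⟩ := hf
    obtain ⟨A', B', h'⟩ := hg
    exact ⟨A + A', B + B', fun x => by simp only [Pi.add_apply, h, h', eval_add]; ring⟩
  | mul f g _ _ hf hg =>
    obtain ⟨A, B, h⟩ := hf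
    obtain ⟨A', B', h'⟩ := hg
    obtain ⟨p, hp⟩ := oddPart_sq S
    refine ⟨A * A' + p * B * B', A * B' + A' * B, fun x => ?_⟩
    simp only [Pi.mul_apply, h, h', eval_add, eval_mul]
    linear_combination B.eval (eta S x) * B'.eval (eta S x) * hp x

/-- Averaging with the reflected function removes the part with the odd companion. For cH no
symmetry is needed, as that companion is zero. -/
lemma exists_poly_of_even {S : System} {f : ℂ → ℂ} (hf : f ∈ etaAlg S)
    (he : S ≠ .cH → ∀ x, f (-x) = f x) : ∃ A : ℂ[X], ∀ x, A.eval (eta S x) = f x := by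
  obtain ⟨A, B, h⟩ := exists_form hf
  refine ⟨A, fun x => ?_⟩
  by_cases hS : S = .cH
  · subst hS; simp [h, oddPart]
  · have h1 := h x
    have h2 := h (-x)
    rw [he hS, eta_neg_comm S hS] at h2
    have h3 : oddPart S (-x) = -oddPart S x := by cases S <;> simp [oddPart]
    rw [h3] at h2
    linear_combination -(h1 + h2) / 2

lemma eta_add_mem (S : System) (c : ℂ) : (fun x => eta S (x + c)) ∈ etaAlg S := by
  cases S with
  | cH => exact add_mem (eta_mem .cH) (const_mem .cH c)
  | W =>
    have : (fun x => eta .W (x + c)) = (oddPart .W + fun _ => c) ^ 2 := by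
      funext x; simp [eta, oddPart]
    rw [this]
    exact pow_mem (add_mem (oddPart_mem .W) (const_mem .W c)) 2
  | AW q h0 h1 =>
    have : (fun x => eta (.AW q h0 h1) (x + c)) =
        eta (.AW q h0 h1) * (fun _ => Complex.cos c) - oddPart (.AW q h0 h1) * fun _ => Complex.sin c := by
      funext x; simp [eta, oddPart, Complex.cos_add]
    rw [this]
    exact sub_mem (mul_mem (eta_mem _) (const_mem _ _)) (mul_mem (oddPart_mem _) (const_mem _ _))

lemma eval_mem {S : System} (p : ℂ[X]) {f : ℂ → ℂ} (hf : f ∈ etaAlg S) :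
    (fun x => p.eval (f x)) ∈ etaAlg S := by
  have : (fun x => p.eval (f x)) =
      ∑ i ∈ Finset.range (p.natDegree + 1), (fun _ => p.coeff i) * f ^ i := by
    funext x; simp [eval_eq_sum_range]
  rw [this]
  exact sum_mem fun i _ => mul_mem (const_mem S _) (pow_mem hf i)

lemma exp_mem (q : ℝ) (h0 : 0 < q) (h1 : q < 1) :
    (fun x => exp (I * x)) ∈ etaAlg (.AW q h0 h1) ∧
      (fun x => exp (-(I * x))) ∈ etaAlg (.AW q h0 h1) := by
  have e1 : (fun x => exp (I * x)) =
      eta (.AW q h0 h1) + oddPart (.AW q h0 h1) * fun _ => I := by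
    funext x; simp only [Pi.add_apply, Pi.mul_apply, eta, oddPart]
    rw [mul_comm I x, exp_mul_I]
  have e2 : (fun x => exp (-(I * x))) =
      eta (.AW q h0 h1) - oddPart (.AW q h0 h1) * fun _ => I := by
    funext x; simp only [Pi.sub_apply, Pi.mul_apply, eta, oddPart]
    rw [show -(I * x) = -x * I by ring, exp_mul_I, Complex.cos_neg, Complex.sin_neg]
    ring
  rw [e1, e2]
  exact ⟨add_mem (eta_mem _) (mul_mem (oddPart_mem _) (const_mem _ _)),
    sub_mem (eta_mem _) (mul_mem (oddPart_mem _) (const_mem _ _))⟩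

lemma lin_mem (S : System) (s : ℂ) :
    (fun x => lin S s x) ∈ etaAlg S ∧ (fun x => lin S s (-x)) ∈ etaAlg S := by
  cases S with
  | cH =>
    have e : (fun x => lin .cH s (-x)) = (fun _ => s) - (fun _ => I) * eta .cH := by
      funext x; simp only [lin, eta, Pi.sub_apply, Pi.mul_apply]; ring
    rw [e]
    exact ⟨add_mem (const_mem _ _) (mul_mem (const_mem _ I) (eta_mem _)),
      sub_mem (const_mem _ _) (mul_mem (const_mem _ I) (eta_mem _))⟩
  | W =>
    have e : (fun x => lin .W s (-x)) = (fun _ => s) - (fun _ => I) * oddPart .W := by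
      funext x; simp only [lin, oddPart, Pi.sub_apply, Pi.mul_apply]; ring
    rw [e]
    exact ⟨add_mem (const_mem _ _) (mul_mem (const_mem _ I) (oddPart_mem _)),
      sub_mem (const_mem _ _) (mul_mem (const_mem _ I) (oddPart_mem _))⟩
  | AW q h0 h1 =>
    have := exp_mem q h0 h1
    refine ⟨sub_mem (const_mem _ _) (mul_mem (const_mem _ _) this.1), ?_⟩
    have e : (fun x => lin (.AW q h0 h1) s (-x)) =
        (fun _ => 1) - (fun _ => (q : ℂ) ^ s) * fun x => exp (-(I * x)) := by
      funext x; simp [lin]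
    rw [e]
    exact sub_mem (const_mem _ _) (mul_mem (const_mem _ _) this.2)

lemma potDen_mem (S : System) :
    (fun x => potDen S x) ∈ etaAlg S ∧ (fun x => potDen S (-x)) ∈ etaAlg S := by
  cases S with
  | cH => exact ⟨const_mem _ 1, const_mem _ 1⟩
  | W =>
    have e1 : (fun x => potDen .W x) = (fun _ => 2 * I) * oddPart .W *
        ((fun _ => 2 * I) * oddPart .W + fun _ => 1) := by
      funext x; simp [potDen, oddPart]
    have e2 : (fun x => potDen .W (-x)) = (fun _ => -(2 * I)) * oddPart .W *
        ((fun _ => -(2 * I)) * oddPart .W + fun _ => 1) := by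
      funext x; simp [potDen, oddPart]
    have h : ∀ c, (fun _ => c) * oddPart .W * ((fun _ => c) * oddPart .W + fun _ => 1) ∈
        etaAlg .W := fun c => by
      have := mul_mem (const_mem .W c) (oddPart_mem .W)
      exact mul_mem this (add_mem this (const_mem _ 1))
    exact ⟨e1 ▸ h _, e2 ▸ h _⟩
  | AW q h0 h1 =>
    have h := exp_mem q h0 h1
    have key : ∀ f ∈ etaAlg (.AW q h0 h1), ((fun _ => 1) - f ^ 2) *
        ((fun _ => 1) - (fun _ => (q : ℂ)) * f ^ 2) ∈ etaAlg (.AW q h0 h1) := fun f hf =>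
      mul_mem (sub_mem (const_mem _ _) (pow_mem hf 2))
        (sub_mem (const_mem _ _) (mul_mem (const_mem _ _) (pow_mem hf 2)))
    have e1 : ∀ x, exp (2 * I * x) = exp (I * x) ^ 2 := fun x => by
      rw [← exp_nat_mul]; congr 1; push_cast; ring
    have e2 : ∀ x, exp (2 * I * -x) = exp (-(I * x)) ^ 2 := fun x => by
      rw [← exp_nat_mul]; congr 1; push_cast; ring
    constructor
    · convert key _ h.1 using 1
      funext x; simp [potDen, e1]
    · convert key _ h.2 using 1
      funext x; simp only [potDen, e2]; simp

/-- The numerator of the potential. -/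
noncomputable def potNum : System → (Fin 4 → ℂ) → ℂ → ℂ
  | .cH, l, x => lin .cH (l 0) x * lin .cH (l 1) x
  | S, l, x => ∏ k, lin S (l k) x

/-- The numerator of the second potential. -/
noncomputable def potStarNum : System → (Fin 4 → ℂ) → ℂ → ℂ
  | .cH, l, x => lin .cH (l 2) (-x) * lin .cH (l 3) (-x)
  | S, l, x => ∏ k, lin S (l k) (-x)

lemma pot_eq_div (S : System) (l : Fin 4 → ℂ) (x : ℂ) :
    pot S l x = potNum S l x / potDen S x := by
  cases S <;> simp [pot, potNum, potDen]

lemma potStar_eq_div (S : System) (l : Fin 4 → ℂ) (x : ℂ) :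
    potStar S l x = potStarNum S l x / potDen S (-x) := by
  cases S <;> simp [potStar, pot, potStarNum, potDen]

lemma potNum_mem (S : System) (l : Fin 4 → ℂ) :
    potNum S l ∈ etaAlg S ∧ potStarNum S l ∈ etaAlg S := by
  have h1 : ∀ S, (fun x => ∏ k, lin S (l k) x) ∈ etaAlg S := fun S => by
    have e : (fun x => ∏ k, lin S (l k) x) = ∏ k, fun x => lin S (l k) x := by
      funext x; simp
    rw [e]
    exact prod_mem fun k _ => (lin_mem S (l k)).1
  have h2 : ∀ S, (fun x => ∏ k, lin S (l k) (-x)) ∈ etaAlg S := fun S => by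
    have e : (fun x => ∏ k, lin S (l k) (-x)) = ∏ k, fun x => lin S (l k) (-x) := by
      funext x; simp
    rw [e]
    exact prod_mem fun k _ => (lin_mem S (l k)).2
  cases S with
  | cH => exact ⟨mul_mem (lin_mem _ _).1 (lin_mem _ _).1, mul_mem (lin_mem _ _).2 (lin_mem _ _).2⟩
  | W => exact ⟨h1 _, h2 _⟩
  | AW q h0 h1' => exact ⟨h1 _, h2 _⟩

lemma potNum_neg (S : System) (hS : S ≠ .cH) (l : Fin 4 → ℂ) (x : ℂ) :
    potNum S l (-x) = potStarNum S l x ∧ potStarNum S l (-x) = potNum S l x := by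
  cases S with
  | cH => exact absurd rfl hS
  | W => simp [potNum, potStarNum]
  | AW q h0 h1 => simp [potNum, potStarNum]

/-! ### The rational function -/

lemma comp_eta_add_mem (S : System) (p : ℂ[X]) (c : ℂ) :
    (fun x => p.eval (eta S (x + c))) ∈ etaAlg S := eval_mem p (eta_add_mem S c)

/-- Reflection interchanges the numerators of V and V*, the two denominators and the shifts ±iγ, so
for W and AW it swaps the two summands. -/
lemma exists_numerator (S : System) (l : Fin 4 → ℂ) (Ξ P : ℂ[X]) : ∃ A : ℂ[X], ∀ x,
    A.eval (eta S x) =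
      eta S (x - I * gam S) * potNum S l x * potDen S (-x) *
        Ξ.eval (eta S (x + I * gam S / 2)) ^ 2 * P.eval (eta S (x - I * gam S)) +
      eta S (x + I * gam S) * potStarNum S l x * potDen S x *
        Ξ.eval (eta S (x - I * gam S / 2)) ^ 2 * P.eval (eta S (x + I * gam S)) := by
  refine exists_poly_of_even ?_ fun hS x => ?_
  · have hp := potNum_mem S l
    have hd := potDen_mem S
    exact add_mem
      (mul_mem (mul_mem (mul_mem (mul_mem (eta_add_mem S (-(I * gam S))) hp.1) hd.2)
        (pow_mem (comp_eta_add_mem S Ξ (I * gam S / 2)) 2)) (comp_eta_add_mem S P (-(I * gam S))))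
      (mul_mem (mul_mem (mul_mem (mul_mem (eta_add_mem S (I * gam S)) hp.2) hd.1)
        (pow_mem (comp_eta_add_mem S Ξ (-(I * gam S / 2))) 2)) (comp_eta_add_mem S P (I * gam S)))
  · have e : ∀ c, eta S (-x + c) = eta S (x - c) := fun c => by
      rw [← eta_neg_comm S hS]; congr 1; ring
    have e' : ∀ c, eta S (-x - c) = eta S (x + c) := fun c => by
      rw [← eta_neg_comm S hS]; congr 1; ring
    rw [e, e, e', e', (potNum_neg S hS l x).1, (potNum_neg S hS l x).2, neg_neg]
    ring

lemma exists_denominator (S : System) (Ξ : ℂ[X]) : ∃ A : ℂ[X], ∀ x,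
    A.eval (eta S x) = potDen S x * potDen S (-x) * (Ξ.eval (eta S (x + I * gam S / 2)) *
      Ξ.eval (eta S (x - I * gam S / 2))) := by
  refine exists_poly_of_even ?_ fun hS x => ?_
  · have hd := potDen_mem S
    exact mul_mem (mul_mem hd.1 hd.2) (mul_mem (comp_eta_add_mem S Ξ (I * gam S / 2))
      (comp_eta_add_mem S Ξ (-(I * gam S / 2))))
  · have e : ∀ c, eta S (-x + c) = eta S (x - c) := fun c => by
      rw [← eta_neg_comm S hS]; congr 1; ring
    have e' : ∀ c, eta S (-x - c) = eta S (x + c) := fun c => by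
      rw [← eta_neg_comm S hS]; congr 1; ring
    rw [e, e', neg_neg]
    ring

lemma ratFunc_eval_div (p q : ℂ[X]) (t : ℂ) (hq : q.eval t ≠ 0) :
    (algebraMap ℂ[X] (RatFunc ℂ) p / algebraMap ℂ[X] (RatFunc ℂ) q).denom.eval t ≠ 0 ∧
      (algebraMap ℂ[X] (RatFunc ℂ) p / algebraMap ℂ[X] (RatFunc ℂ) q).eval (RingHom.id ℂ) t =
        p.eval t / q.eval t := by
  have hq0 : q ≠ 0 := fun h => hq (by rw [h, eval_zero])
  set F := algebraMap ℂ[X] (RatFunc ℂ) p / algebraMap ℂ[X] (RatFunc ℂ) q with hF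
  have h1 : F.denom.eval t ≠ 0 := fun h => hq (by
    obtain ⟨c, hc⟩ := RatFunc.denom_div_dvd p q
    rw [hc, eval_mul, ← hF, h, zero_mul])
  refine ⟨h1, ?_⟩
  have h2 : F.num * q = p * F.denom := (RatFunc.num_mul_eq_mul_denom_iff hq0).2 hF
  have h3 := congrArg (eval t) h2
  rw [eval_mul, eval_mul] at h3
  rw [RatFunc.eval, eval₂_id, eval₂_id, div_eq_div_iff h1 hq, h3]

/-- Over the common denominator, the numerator and the denominator of F̌ are both polynomials in η.
The denominator in lowest terms divides the one written down, so there are no poles at regular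
points. -/
lemma exists_ratFunc (S : System) (l : Fin 4 → ℂ) (DI DII : Finset ℕ) (N : ℕ) :
    ∃ F : RatFunc ℂ, ∀ x : ℂ, IsRegular S l DI DII N x →
      F.denom.eval (eta S x) ≠ 0 ∧
        F.eval (RingHom.id ℂ) (eta S x) = FC S l DI DII N x := by
  obtain ⟨A, hA⟩ := exists_numerator S (lamD S l DI DII) (Xi S l DI DII) (multiP S l DI DII N)
  obtain ⟨B, hB⟩ := exists_denominator S (Xi S l DI DII)
  refine ⟨algebraMap ℂ[X] (RatFunc ℂ) (-A) /
    algebraMap ℂ[X] (RatFunc ℂ) ((multiP S l DI DII N).derivative * B), fun x hx => ?_⟩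
  obtain ⟨h1, h2, h3, h4, h5⟩ := hx
  have hq : ((multiP S l DI DII N).derivative * B).eval (eta S x) ≠ 0 := by
    rw [eval_mul, hB]
    exact mul_ne_zero h5 (mul_ne_zero (mul_ne_zero h1 h2) (mul_ne_zero h3 h4))
  obtain ⟨e1, e2⟩ := ratFunc_eval_div (-A) _ _ hq
  refine ⟨e1, e2.trans ?_⟩
  rw [eval_mul, eval_neg, hA, hB, FC, pot_eq_div, potStar_eq_div]
  simp only [XiC, multiPC] at h3 h4 ⊢
  field_simp

end MultiIndexed

/-! ### The theorem -/

open MultiIndexed in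
theorem mainTheorem1 (S : MultiIndexed.System) (l : Fin 4 → ℂ) (DI DII : Finset ℕ) (N : ℕ) :
    -- the objects exist: the Casoratians have polynomial parts, of the expected degrees
    MultiIndexed.IsDenominatorPoly S l DI DII (MultiIndexed.Xi S l DI DII) ∧
    (∀ (EI EII : Finset ℕ) (n : ℕ),
      MultiIndexed.IsMultiIndexedPoly S l EI EII n (MultiIndexed.multiP S l EI EII n) ∧
      ((MultiIndexed.multiP S l EI EII n).natDegree : ℤ) ≤ MultiIndexed.ell EI EII + n) ∧
    -- the number of the polynomials `𝒫_a`
    (Nat.card (MultiIndexed.Label DI DII N) : ℤ) = MultiIndexed.ell DI DII + N ∧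
    -- the discrete orthogonality relations
    (((MultiIndexed.multiP S l DI DII N).natDegree : ℤ) = MultiIndexed.ell DI DII + N →
      (MultiIndexed.multiP S l DI DII N).roots.Nodup →
      (∀ x : ℂ, MultiIndexed.multiPC S l DI DII N x = 0 →
        MultiIndexed.IsRegular S l DI DII N x ∧ MultiIndexed.FC S l DI DII N x ≠ 0) →
      ∃ F : RatFunc ℂ,
        (∀ x : ℂ, MultiIndexed.IsRegular S l DI DII N x →
          F.denom.eval (MultiIndexed.eta S x) ≠ 0 ∧
          F.eval (RingHom.id ℂ) (MultiIndexed.eta S x) = MultiIndexed.FC S l DI DII N x) ∧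
        ∃ k : MultiIndexed.Label DI DII N → ℂ,
          ∀ a b : MultiIndexed.Label DI DII N,
            ∑ t ∈ (MultiIndexed.multiP S l DI DII N).roots.toFinset,
              1 / F.eval (RingHom.id ℂ) t *
                ((MultiIndexed.calP S l DI DII N a).eval t /
                  (MultiIndexed.multiP S l DI DII N).derivative.eval t) *
                ((MultiIndexed.calP S l DI DII N b).eval t /
                  (MultiIndexed.multiP S l DI DII N).derivative.eval t) =
              if a = b then k a else 0) := by
  refine ⟨isDenominatorPoly_Xi S l DI DII, fun EI EII n =>
    ⟨isMultiIndexedPoly_multiP S l EI EII n, natDegree_multiP_le S l EI EII n⟩,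
    card_label DI DII N, fun hdeg hnodup hx => ?_⟩
  obtain ⟨F, hF⟩ := exists_ratFunc S l DI DII N
  refine ⟨F, hF, fun a => ∑ t ∈ (multiP S l DI DII N).roots.toFinset,
    1 / F.eval (RingHom.id ℂ) t *
      ((calP S l DI DII N a).eval t / (multiP S l DI DII N).derivative.eval t) *
      ((calP S l DI DII N a).eval t / (multiP S l DI DII N).derivative.eval t), fun a b => ?_⟩
  -- Each k a is defined as the diagonal sum, so only a ≠ b has content. The sum over zeros is then
  -- lifted to one over chosen preimages under η.
  split_ifs with hab
  · rw [hab]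
  choose y hy using eta_surjective S
  have hroot : ∀ t : (multiP S l DI DII N).roots.toFinset, multiPC S l DI DII N (y t) = 0 :=
    fun t => by
      rw [multiPC, hy]
      exact Polynomial.isRoot_of_mem_roots (Multiset.mem_toFinset.1 t.2)
  have h := sum_eq_zero l DI DII N (fun t : (multiP S l DI DII N).roots.toFinset => y t)
    (fun s t hst => by
      simp only [hy] at hst
      exact Subtype.ext hst) hroot
    (by
      rw [Fintype.card_coe, Multiset.toFinset_card_of_nodup hnodup]
      exact (IsAlgClosed.splits _).natDegree_eq_card_roots)
    hdeg (fun t => (hx _ (hroot t)).1) (fun t => (hx _ (hroot t)).2) hab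
  rw [← Finset.sum_coe_sort]
  refine Eq.trans (Finset.sum_congr rfl fun t _ => ?_) h
  rw [← (hF _ (hx _ (hroot t)).1).2, calPC, calPC, hy]
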